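/- **Conventions.** Manifolds are smooth, finite-dimensional, connected and without boundary. Let $(M^m,g)$ be a compact and $(N^n,h)$ an arbitrary Riemannian manifold, $v_g$ the Riemannian measure of $M$, and $R(X,Y)Z=[\nabla_X,\nabla_Y]Z-\nabla_{[X,Y]}Z$, $(\nabla R)(X,Y,Z,V)=(\nabla_XR)(Y,Z)V$, $\langle\operatorname{Ric}(X),Y\rangle=\operatorname{Tr}\{Z\mapsto R(Z,X)Y\}$, $\operatorname{Scal}=\operatorname{Tr}\operatorname{Ric}$ (the last two on $M$). Traces are taken with respect to $g$. For a smooth map $\phi:M\to N$, $\nabla^\phi$ is the pull-back to $\phi^{-1}TN$ of the Levi-Civita connection of $N$, $\tau(\phi)=\operatorname{Tr}\nabla^\phi d\phi$ is the tension field, $(\nabla^\phi)^2W=\nabla^\phi\nabla^\phi W-\nabla^\phi_{\nabla}W$ and $\Delta^\phi=-\operatorname{Tr}(\nabla^\phi)^2$. The conformal-bienergy is $$E_2^c(\phi)=\frac12\int_M\Big(|\tau(\phi)|^2+\frac23\operatorname{Scal}|d\phi|^2-2\operatorname{Tr}\langle d\phi(\operatorname{Ric}(\cdot)),d\phi(\cdot)\rangle\Big)\,v_g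 ,$$ and a smooth map is *c-biharmonic* if it is a critical point of $E_2^c$ with respect to all smooth variations. For smooth sections $W$ of $\phi^{-1}TN$ put $$J(W)=\Delta^\phi W+\operatorname{Tr}R^N(d\phi(\cdot),W)d\phi(\cdot),$$ $$\begin{aligned}J_2(W)={}&J(J(W))-R^N(\tau(\phi),W)\tau(\phi)-\operatorname{Tr}(\nabla^NR^N)(\tau(\phi),d\phi(\cdot),W,d\phi(\cdot))\\&+\operatorname{Tr}\big\{(\nabla^NR^N)(d\phi(\cdot),\tau(\phi),d\phi(\cdot),W)+2R^N(W,d\phi(\cdot))\nabla^\phi_{(\cdot)}\tau(\phi)+2R^N(\tau(\phi),d\phi(\cdot))\nabla^\phi_{(\cdot)}W\big\},\end{aligned}$$ $$\begin{aligned}J_2^c(W)={}&J_2(W)-2\operatorname{Tr}R^N(d\phi(\operatorname{Ric}(\cdot)),W)d\phi(\cdot)+\frac23\operatorname{Scal}J(W)\\&+2\operatorname{Tr}\big((\nabla^\phi)^2W\big)(\operatorname{Ric}(\cdot),\cdot)+\frac13\nabla^\phi_{\nabla\operatorname{Scal}}W .\end{aligned}$$ **Theorem (Hessian of $E_2^c$).**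 Let $\phi:(M^m,g)\to(N^n,h)$ be a c-biharmonic map with $M$ compact. Let $\{\phi_{s,t}\}_{(s,t)\in\mathbb R^2}$, $\phi_{0,0}=\phi$, be a two-parameter smooth variation of $\phi$, that is, $(s,t,p)\mapsto\phi_{s,t}(p)$ is a smooth map $\mathbb R\times\mathbb R\times M\to N$, with variational vector fields $V=\frac{d}{ds}\big|_{s=0}\phi_{s,0}$ and $W=\frac{d}{dt}\big|_{t=0}\phi_{0,t}$. Then $(s,t)\mapsto E_2^c(\phi_{s,t})$ is twice continuously differentiable, and $$\begin{aligned}\operatorname{Hess}_{E_2^c}(\phi)(V,W)&=\frac{\partial^2}{\partial s\,\partial t}\Big|_{(s,t)=(0,0)}E_2^c(\phi_{s,t})=\int_M\langle J_2^c(W),V\rangle\,v_g\\&=\int_M\Big(\langle J_2(W)-2\operatorname{Tr}R^N(d\phi(\operatorname{Ric}(\cdot)),W)d\phi(\cdot),V\rangle+\frac23\operatorname{Scal}\langle\operatorname{Tr}R^N(d\phi(\cdot),W)d\phi(\cdot),V\rangle\\&\qquad\quad+\frac23\operatorname{Scal}\langle\nabla^\phi W,\nabla^\phi V\rangle-2\operatorname{Tr}\langle\nabla^\phi_{(\cdot)}W,\nabla^\phi_{\operatorname{Ric}(\cdot)}V\rangle\Big)\,v_g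 .\end{aligned}$$ The last two integrals are defined and equal for all smooth sections $V,W$ of $\phi^{-1}TN$, and they are symmetric in $V$ and $W$. Thus $J_2^c$ is $L^2$-selfadjoint on smooth sections: $\int_M\langle J_2^c(W),V\rangle\,v_g=\int_M\langle W,J_2^c(V)\rangle\,v_g$. Moreover $J_2^c$ is a linear elliptic differential operator of order at most four (of order exactly four if $m,n\ge1$) on smooth sections of $\phi^{-1}TN$, with leading term $(\Delta^\phi)^2$: the difference $J_2^c-(\Delta^\phi)^2$ is a differential operator of order at most three. -/

import Mathlib

open Bundle Manifold MeasureTheory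
open scoped ContDiff Manifold

noncomputable section

namespace CBiharmonic

/-! ### Coordinate fields, metrics, traces -/

/-- The model space of an `m`-dimensional manifold. -/
abbrev Euc (m : ℕ) : Type := EuclideanSpace ℝ (Fin m)

/-- Smooth Riemannian metrics on a smooth `m`-dimensional manifold without boundary. -/
abbrev Metric (m : ℕ) (M : Type*) [TopologicalSpace M] [ChartedSpace (Euc m) M]
    [IsManifold (𝓡 m) ∞ M] : Type _ :=
  ContMDiffRiemannianMetric (𝓡 m) ∞ (Euc m) (fun x : M => TangentSpace (𝓡 m) x)

section Geometry

variable {m n : ℕ}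
  {M : Type*} [TopologicalSpace M] [ChartedSpace (Euc m) M] [IsManifold (𝓡 m) ∞ M]
  {N : Type*} [TopologicalSpace N] [ChartedSpace (Euc n) N] [IsManifold (𝓡 n) ∞ N]

/-- The `i`-th coordinate vector at `p` of the preferred chart at `p`. -/
def basisVec (p : M) (i : Fin m) : TangentSpace (𝓡 m) p :=
  (EuclideanSpace.single i 1 : Euc m)

/-- The `i`-th component of a tangent vector in the basis `basisVec p`. -/
def coord {p : M} (v : TangentSpace (𝓡 m) p) (i : Fin m) : ℝ :=
  let v' : Euc m := v
  v' i

/-- The vector field which has the constant components of `v` in the preferred chart at `p₀`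
(and which vanishes outside the domain of this chart). Its value at `p₀` is `v`. -/
def coordField (p₀ : M) (v : TangentSpace (𝓡 m) p₀) (p : M) : TangentSpace (𝓡 m) p :=
  (trivializationAt (Euc m) (TangentSpace (𝓡 m) : M → Type _) p₀).symmL ℝ p v

/-- The matrix `(g_ij)` at `p`, in the preferred chart at `p₀`. -/
def gram (g : Metric m M) (p₀ p : M) : Matrix (Fin m) (Fin m) ℝ :=
  Matrix.of fun i j =>
    g.inner p (coordField p₀ (basisVec p₀ i) p) (coordField p₀ (basisVec p₀ j) p)

/-- The inverse matrix `(g^ij)` at `p`, in the preferred chart at `p`. -/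
def gramInv (g : Metric m M) (p : M) : Matrix (Fin m) (Fin m) ℝ :=
  (gram g p p)⁻¹

/-- The trace `∑ g^ij B(∂_i, ∂_j)` of a bilinear map on `T_pM` with respect to the metric. -/
def trace {A : Type*} [AddCommMonoid A] [Module ℝ A] (g : Metric m M) (p : M)
    (B : TangentSpace (𝓡 m) p → TangentSpace (𝓡 m) p → A) : A :=
  ∑ i, ∑ j, gramInv g p i j • B (basisVec p i) (basisVec p j)

/-- The differential of a map. -/
def dmap (φ : M → N) (p : M) (v : TangentSpace (𝓡 m) p) : TangentSpace (𝓡 n) (φ p) :=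
  mfderiv (𝓡 m) (𝓡 n) φ p v

/-- The derivative of a real function in the direction of a tangent vector. -/
def dfun (f : M → ℝ) (p : M) (v : TangentSpace (𝓡 m) p) : ℝ :=
  mfderiv (𝓡 m) 𝓘(ℝ, ℝ) f p v

/-! ### Levi-Civita connection, curvature -/

/-- The Christoffel symbol `Γ^k_ij` of the Levi-Civita connection at `y`, in the preferred chart
at `y`. -/
def christoffel (h : Metric n N) (y : N) (k i j : Fin n) : ℝ :=
  (1 / 2) * ∑ l, gramInv h y k l *
    (dfun (fun y' => gram h y y' j l) y (basisVec y i)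
      + dfun (fun y' => gram h y y' i l) y (basisVec y j)
      - dfun (fun y' => gram h y y' i j) y (basisVec y l))

/-- The vector `Γ(u, w)` with components `Γ^k_ij u^i w^j`. -/
def christoffelMap (h : Metric n N) (y : N) (u w : TangentSpace (𝓡 n) y) :
    TangentSpace (𝓡 n) y :=
  ∑ k, (∑ i, ∑ j, christoffel h y k i j * coord u i * coord w j) • basisVec y k

/-- The derivative along `v` of the components of a section `W` of `φ⁻¹TN`, these being taken in
the preferred chart at `φ p`. -/
def componentDeriv (φ : M → N) (W : ∀ q : M, TangentSpace (𝓡 n) (φ q)) (p : M)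
    (v : TangentSpace (𝓡 m) p) : TangentSpace (𝓡 n) (φ p) :=
  let w : M → Euc n := fun q =>
    (trivializationAt (Euc n) (TangentSpace (𝓡 n) : N → Type _) (φ p) ⟨φ q, W q⟩).2
  (mfderiv (𝓡 m) 𝓘(ℝ, Euc n) w p v : Euc n)

/-- `∇^φ_v W`: the pull-back to `φ⁻¹TN` of the Levi-Civita connection of `h`. -/
def covAlong (h : Metric n N) (φ : M → N) (W : ∀ q : M, TangentSpace (𝓡 n) (φ q)) (p : M)
    (v : TangentSpace (𝓡 m) p) : TangentSpace (𝓡 n) (φ p) :=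
  componentDeriv φ W p v + christoffelMap h (φ p) (dmap φ p v) (W p)

/-- `∇_v X`: the Levi-Civita connection on vector fields. -/
def leviCivita (g : Metric m M) (X : ∀ q : M, TangentSpace (𝓡 m) q) (p : M)
    (v : TangentSpace (𝓡 m) p) : TangentSpace (𝓡 m) p :=
  covAlong g (id : M → M) X p v

/-- The curvature tensor `R(u, v)w = ∇_u ∇_V Z - ∇_v ∇_U Z - ∇_[U,V] Z`, where `U`, `V`, `Z` are
the coordinate fields which extend `u`, `v`, `w`. -/
def curv (g : Metric m M) (p : M) (u v w : TangentSpace (𝓡 m) p) : TangentSpace (𝓡 m) p :=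
  leviCivita g (fun q => leviCivita g (coordField p w) q (coordField p v q)) p u
    - leviCivita g (fun q => leviCivita g (coordField p w) q (coordField p u q)) p v
    - leviCivita g (coordField p w) p
        (VectorField.mlieBracket (𝓡 m) (coordField p u) (coordField p v) p)

/-- `(∇R)(x, u, v, w) = (∇_x R)(u, v)w`. -/
def covCurv (g : Metric m M) (p : M) (x u v w : TangentSpace (𝓡 m) p) : TangentSpace (𝓡 m) p :=
  leviCivita g (fun q => curv g q (coordField p u q) (coordField p v q) (coordField p w q)) p x
    - curv g p (leviCivita g (coordField p u) p x) v w
    - curv g p u (leviCivita g (coordField p v) p x) w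
    - curv g p u v (leviCivita g (coordField p w) p x)

/-- `Ric(u, v)`, the trace of the endomorphism `z ↦ R(z, u)v`. -/
def ricciForm (g : Metric m M) (p : M) (u v : TangentSpace (𝓡 m) p) : ℝ :=
  ∑ k, coord (curv g p (basisVec p k) u v) k

/-- The Ricci endomorphism, `⟨Ric(u), v⟩ = Ric(u, v)`. -/
def ricci (g : Metric m M) (p : M) (u : TangentSpace (𝓡 m) p) : TangentSpace (𝓡 m) p :=
  trace g p fun a b => ricciForm g p u a • b

/-- The scalar curvature. -/
def scal (g : Metric m M) (p : M) : ℝ :=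
  trace g p (ricciForm g p)

/-- The gradient of a function. -/
def grad (g : Metric m M) (f : M → ℝ) (p : M) : TangentSpace (𝓡 m) p :=
  trace g p fun a b => dfun f p a • b

/-! ### Operators along a map -/

/-- The second covariant derivative `((∇^φ)² W)(u, v) = ∇^φ_u ∇^φ_V W - ∇^φ_{∇_u V} W`, where `V`
is the coordinate field which extends `v`. -/
def cov2Along (g : Metric m M) (h : Metric n N) (φ : M → N)
    (W : ∀ q : M, TangentSpace (𝓡 n) (φ q)) (p : M) (u v : TangentSpace (𝓡 m) p) :
    TangentSpace (𝓡 n) (φ p) :=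
  covAlong h φ (fun q => covAlong h φ W q (coordField p v q)) p u
    - covAlong h φ W p (leviCivita g (coordField p v) p u)

/-- The rough Laplacian `Δ^φ W = - Tr (∇^φ)² W`. -/
def roughLaplacian (g : Metric m M) (h : Metric n N) (φ : M → N)
    (W : ∀ q : M, TangentSpace (𝓡 n) (φ q)) (p : M) : TangentSpace (𝓡 n) (φ p) :=
  - trace g p (cov2Along g h φ W p)

/-- `(∇^φ dφ)(u, v) = ∇^φ_u (dφ(V)) - dφ(∇_u V)`. -/
def hessMap (g : Metric m M) (h : Metric n N) (φ : M → N) (p : M)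
    (u v : TangentSpace (𝓡 m) p) : TangentSpace (𝓡 n) (φ p) :=
  covAlong h φ (fun q => dmap φ q (coordField p v q)) p u
    - dmap φ p (leviCivita g (coordField p v) p u)

/-- The tension field `τ(φ) = Tr ∇^φ dφ`. -/
def tension (g : Metric m M) (h : Metric n N) (φ : M → N) (p : M) : TangentSpace (𝓡 n) (φ p) :=
  trace g p (hessMap g h φ p)

/-- `Tr R^N(dφ(·), W)dφ(·)`. -/
def trCurv (g : Metric m M) (h : Metric n N) (φ : M → N)
    (W : ∀ q : M, TangentSpace (𝓡 n) (φ q)) (p : M) : TangentSpace (𝓡 n) (φ p) :=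
  trace g p fun a b => curv h (φ p) (dmap φ p a) (W p) (dmap φ p b)

/-- `Tr R^N(dφ(Ric(·)), W)dφ(·)`. -/
def trCurvRic (g : Metric m M) (h : Metric n N) (φ : M → N)
    (W : ∀ q : M, TangentSpace (𝓡 n) (φ q)) (p : M) : TangentSpace (𝓡 n) (φ p) :=
  trace g p fun a b => curv h (φ p) (dmap φ p (ricci g p a)) (W p) (dmap φ p b)

/-- `J(W) = Δ^φ W + Tr R^N(dφ(·), W)dφ(·)`. -/
def jacobi (g : Metric m M) (h : Metric n N) (φ : M → N)
    (W : ∀ q : M, TangentSpace (𝓡 n) (φ q)) (p : M) : TangentSpace (𝓡 n) (φ p) :=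
  roughLaplacian g h φ W p + trCurv g h φ W p

/-- The operator `J₂` of the bienergy. -/
def jacobi2 (g : Metric m M) (h : Metric n N) (φ : M → N)
    (W : ∀ q : M, TangentSpace (𝓡 n) (φ q)) (p : M) : TangentSpace (𝓡 n) (φ p) :=
  jacobi g h φ (jacobi g h φ W) p
    - curv h (φ p) (tension g h φ p) (W p) (tension g h φ p)
    - trace g p (fun a b =>
        covCurv h (φ p) (tension g h φ p) (dmap φ p a) (W p) (dmap φ p b))
    + trace g p (fun a b =>
        covCurv h (φ p) (dmap φ p a) (tension g h φ p) (dmap φ p b) (W p)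
        + (2 : ℝ) • curv h (φ p) (W p) (dmap φ p a) (covAlong h φ (tension g h φ) p b)
        + (2 : ℝ) • curv h (φ p) (tension g h φ p) (dmap φ p a) (covAlong h φ W p b))

/-- The operator `J₂ᶜ` of the conformal-bienergy. -/
def jacobi2c (g : Metric m M) (h : Metric n N) (φ : M → N)
    (W : ∀ q : M, TangentSpace (𝓡 n) (φ q)) (p : M) : TangentSpace (𝓡 n) (φ p) :=
  jacobi2 g h φ W p - (2 : ℝ) • trCurvRic g h φ W p
    + ((2 / 3 : ℝ) * scal g p) • jacobi g h φ W p
    + (2 : ℝ) • trace g p (fun a b => cov2Along g h φ W p (ricci g p a) b)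
    + (1 / 3 : ℝ) • covAlong h φ W p (grad g (scal g) p)

/-- The integrand of the second variation formula:
`⟨J₂(W) - 2 Tr R^N(dφ(Ric(·)), W)dφ(·), V⟩ + (2/3) Scal ⟨Tr R^N(dφ(·), W)dφ(·), V⟩
+ (2/3) Scal ⟨∇^φ W, ∇^φ V⟩ - 2 Tr ⟨∇^φ_(·) W, ∇^φ_Ric(·) V⟩`. -/
def hessIntegrand (g : Metric m M) (h : Metric n N) (φ : M → N)
    (V W : ∀ q : M, TangentSpace (𝓡 n) (φ q)) (p : M) : ℝ :=
  h.inner (φ p) (jacobi2 g h φ W p - (2 : ℝ) • trCurvRic g h φ W p) (V p)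
    + (2 / 3) * scal g p * h.inner (φ p) (trCurv g h φ W p) (V p)
    + (2 / 3) * scal g p *
        trace g p (fun a b => h.inner (φ p) (covAlong h φ W p a) (covAlong h φ V p b))
    - 2 * trace g p
        (fun a b => h.inner (φ p) (covAlong h φ W p a) (covAlong h φ V p (ricci g p b)))

/-! ### Smooth sections, differential operators -/

/-- `W` is a smooth section of `φ⁻¹TN`. -/
def IsSmoothSection (m : ℕ) {M : Type*} [TopologicalSpace M] [ChartedSpace (Euc m) M]
    [IsManifold (𝓡 m) ∞ M] (φ : M → N) (W : ∀ p : M, TangentSpace (𝓡 n) (φ p)) : Prop :=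
  ContMDiff (𝓡 m) (𝓡 n).tangent ∞ (fun p => (⟨φ p, W p⟩ : TangentBundle (𝓡 n) N))

/-- `P` maps smooth sections of `φ⁻¹TN` linearly to smooth sections. -/
structure IsLinearOnSections (m : ℕ) {M : Type*} [TopologicalSpace M]
    [ChartedSpace (Euc m) M] [IsManifold (𝓡 m) ∞ M] (φ : M → N)
    (P : (∀ p : M, TangentSpace (𝓡 n) (φ p)) → ∀ p : M, TangentSpace (𝓡 n) (φ p)) : Prop where
  smooth : ∀ W, IsSmoothSection m φ W → IsSmoothSection m φ (P W)
  add : ∀ V W, IsSmoothSection m φ V → IsSmoothSection m φ W →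
    P (fun p => V p + W p) = fun p => P V p + P W p
  smul : ∀ (c : ℝ) (W), IsSmoothSection m φ W → P (fun p => c • W p) = fun p => c • P W p

/-- `P` is a linear differential operator of order at most `k` on smooth sections of `φ⁻¹TN`:
its iterated commutators with the multiplications by `k + 1` smooth functions vanish. -/
def IsDiffOp (m : ℕ) {M : Type*} [TopologicalSpace M] [ChartedSpace (Euc m) M]
    [IsManifold (𝓡 m) ∞ M] (φ : M → N) : ℕ →
    ((∀ p : M, TangentSpace (𝓡 n) (φ p)) → ∀ p : M, TangentSpace (𝓡 n) (φ p)) → Prop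
  | 0, P => IsLinearOnSections m φ P ∧
      ∀ f : M → ℝ, ContMDiff (𝓡 m) 𝓘(ℝ, ℝ) ∞ f → ∀ W, IsSmoothSection m φ W →
        P (fun p => f p • W p) = fun p => f p • P W p
  | k + 1, P => IsLinearOnSections m φ P ∧
      ∀ f : M → ℝ, ContMDiff (𝓡 m) 𝓘(ℝ, ℝ) ∞ f →
        IsDiffOp m φ k (fun W p => P (fun q => f q • W q) p - f p • P W p)

/-- `P`, of order at most `k`, is elliptic: its principal symbol `σ` at every nonzero covector `ξ`
is invertible. Here `σ(ξ)(W p) = P(f ^ k W)(p) / k!` if `f p = 0` and `df_p = ξ`. -/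
def IsElliptic (m : ℕ) {M : Type*} [TopologicalSpace M] [ChartedSpace (Euc m) M]
    [IsManifold (𝓡 m) ∞ M] (φ : M → N) (k : ℕ)
    (P : (∀ p : M, TangentSpace (𝓡 n) (φ p)) → ∀ p : M, TangentSpace (𝓡 n) (φ p)) : Prop :=
  ∀ (p : M) (ξ : TangentSpace (𝓡 m) p →ₗ[ℝ] ℝ), ξ ≠ 0 →
    ∃ σ : TangentSpace (𝓡 n) (φ p) ≃ₗ[ℝ] TangentSpace (𝓡 n) (φ p),
      ∀ f : M → ℝ, ContMDiff (𝓡 m) 𝓘(ℝ, ℝ) ∞ f → f p = 0 → (∀ v, dfun f p v = ξ v) →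
        ∀ W, IsSmoothSection m φ W →
          P (fun q => f q ^ k • W q) p = (k.factorial : ℝ) • σ (W p)

/-- A smooth two-parameter variation `Φ(s, t, p) = φ_{s,t}(p)` of `φ`, with variational vector
fields `V = dΦ(∂_s)` and `W = dΦ(∂_t)` at `(s, t) = (0, 0)`. -/
structure IsVariation (m : ℕ) {M : Type*} [TopologicalSpace M] [ChartedSpace (Euc m) M]
    [IsManifold (𝓡 m) ∞ M] (φ : M → N) (Φ : ℝ × ℝ × M → N)
    (V W : ∀ p : M, TangentSpace (𝓡 n) (φ p)) : Prop where
  smooth : ContMDiff (𝓘(ℝ, ℝ).prod (𝓘(ℝ, ℝ).prod (𝓡 m))) (𝓡 n) ∞ Φ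
  base : ∀ p, Φ (0, 0, p) = φ p
  fieldV : ∀ p, (⟨Φ (0, 0, p), mfderiv 𝓘(ℝ, ℝ) (𝓡 n) (fun s : ℝ => Φ (s, 0, p)) 0 (1 : ℝ)⟩ :
    TangentBundle (𝓡 n) N) = ⟨φ p, V p⟩
  fieldW : ∀ p, (⟨Φ (0, 0, p), mfderiv 𝓘(ℝ, ℝ) (𝓡 n) (fun t : ℝ => Φ (0, t, p)) 0 (1 : ℝ)⟩ :
    TangentBundle (𝓡 n) N) = ⟨φ p, W p⟩

/-! ### Riemannian volume, conformal-bienergy -/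

/-- A smooth partition of unity subordinate to the domains of the preferred charts. -/
def chartPartition (m : ℕ) (M : Type*) [TopologicalSpace M] [ChartedSpace (Euc m) M]
    [IsManifold (𝓡 m) ∞ M] [T2Space M] [SigmaCompactSpace M] :
    SmoothPartitionOfUnity M (𝓡 m) M :=
  Classical.choose (SmoothPartitionOfUnity.exists_isSubordinate_chartAt_source (𝓡 m) M)

/-- The Riemannian volume measure `v_g`, that is `√(det g_ij) dx` in every chart, glued by a
partition of unity. -/
def vol [T2Space M] [SigmaCompactSpace M] [MeasurableSpace M] (g : Metric m M) : Measure M :=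
  Measure.sum fun c : M =>
    Measure.map (extChartAt (𝓡 m) c).symm
      (((volume : Measure (Euc m)).restrict (extChartAt (𝓡 m) c).target).withDensity fun x =>
        ENNReal.ofReal (chartPartition m M c ((extChartAt (𝓡 m) c).symm x) *
          Real.sqrt (gram g c ((extChartAt (𝓡 m) c).symm x)).det))

/-- The conformal-bienergy
`E₂ᶜ(φ) = 1/2 ∫ |τ(φ)|² + (2/3) Scal |dφ|² - 2 Tr ⟨dφ(Ric(·)), dφ(·)⟩ v_g`. -/
def energy2c [T2Space M] [SigmaCompactSpace M] [MeasurableSpace M]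
    (g : Metric m M) (h : Metric n N) (φ : M → N) : ℝ :=
  (1 / 2) * ∫ p, (h.inner (φ p) (tension g h φ p) (tension g h φ p)
    + (2 / 3) * scal g p * trace g p (fun a b => h.inner (φ p) (dmap φ p a) (dmap φ p b))
    - 2 * trace g p (fun a b => h.inner (φ p) (dmap φ p (ricci g p a)) (dmap φ p b))) ∂(vol g)

/-- Conformal-biharmonic maps: the smooth critical points of the conformal-bienergy. -/
structure IsCBiharmonic [T2Space M] [SigmaCompactSpace M] [MeasurableSpace M]
    (g : Metric m M) (h : Metric n N) (φ : M → N) : Prop where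
  smooth : ContMDiff (𝓡 m) (𝓡 n) ∞ φ
  critical : ∀ Φ : ℝ × M → N, ContMDiff (𝓘(ℝ, ℝ).prod (𝓡 m)) (𝓡 n) ∞ Φ →
    (∀ p, Φ (0, p) = φ p) → HasDerivAt (fun s : ℝ => energy2c g h (fun p => Φ (s, p))) 0 0

end Geometry

end CBiharmonic

end

/-! ### Connections on open sets of a normed space: pull-back derivative, curvature, Bianchi
identities. -/

noncomputable section

set_option linter.unusedSectionVars false
set_option synthInstance.maxHeartbeats 200000

namespace CBiharmonic

/-! ### Covariant differentiation in Euclidean domains -/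

section Flat

/-! The whole argument is calculus on open sets of Euclidean spaces. In a chart a connection is a
smooth family `Γ` of bilinear maps, and a section `w` along a map `u` is differentiated by `cd`. The
symmetries of the curvature `RC` and of its derivative `NR` are proved once in this setting. A
metric determines its torsion-free compatible connection, so a transition map carries one
Christoffel map to the other (`gamma_transform`). Hence every operator defined pointwise through
preferred charts has the expected expression in every pair of charts of `M` and `N`
(`tc_covAlong_of`, `tc_second`, `sloc_jacobi2c`, `hessIntegrand_eq`).

Variation. A variation is regarded as one map on parameters times `M`. The metric coefficients of
`M` do not depend on the parameters, so a parameter is just one more direction of differentiation.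
Commuting it past the operators gives `∇_X τ = -J(X)` (`cd_ten`), and the commutator of `∇_X` with
`J` is an explicit curvature expression (`cd_jac`). Consequently the derivative of the energy
density is twice a linear expression in the velocity, and the derivative of that expression is
`sec(V, W)` plus the same expression evaluated on the covariant acceleration (`fderiv_dens`,
`fderiv_lin`). Compactness allows differentiation under the integral. The acceleration term
integrates to zero because `φ` is critical: a partition of unity splits any smooth section into
pieces carried by charts of `N`, and each piece is the velocity of an explicit variation
(`integral_linG_eq_zero`).

Integration by parts. The integrand `sec` contains `⟨J W, J V⟩` and curvature terms paired with `τ`.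
It differs from `hessI` by the divergence of the one-form `⟨∇JW, V⟩ - ⟨∇V, JW⟩ + 2⟨R(du, W)τ, V⟩`
(`sec_sub_hessI`). In turn `hessI - ⟨J₂ᶜ W, V⟩` is the divergence of `(2/3) Scal · Y - 2 Ric(Y)`,
where `Y` is dual to `⟨∇W, V⟩`. By the contracted Bianchi identity `div Ric = (1/2) d Scal`, so the
coefficient `1/3` in `J₂ᶜ` arises as `1 - 2/3` (`integral_jacobi2c`). The divergence theorem removes
both terms.

Symmetry. The integrand `sec` is symmetric in `V` and `W` at every point, by the two Bianchi
identities (`sec_symm`). Hence the integrals are symmetric and `J₂ᶜ` is selfadjoint; criticality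
plays no part in this.

Order and ellipticity. The order of an operator is measured by iterated commutators with
multiplications by functions. The commutator is a derivation for composition, so orders add
(`HasOrder.comp`), and `∇_Z` has commutator `df(Z)`. The difference `J₂ᶜ - Δ²` even has order two.
Applied to `f ^ 4 • W` at a zero of `f`, the square of the Laplacian gives `24 |df|⁴ W`, whence
ellipticity, and order exactly four in positive dimensions. -/

instance {F : Type*} [NormedAddCommGroup F] [NormedSpace ℝ F] :
    NormedAddCommGroup (F →L[ℝ] F →L[ℝ] F) := inferInstance

instance {F : Type*} [NormedAddCommGroup F] [NormedSpace ℝ F] :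
    NormedSpace ℝ (F →L[ℝ] F →L[ℝ] F) := inferInstance

instance instNormedAddCommGroupTrilinear {F : Type*} [NormedAddCommGroup F] [NormedSpace ℝ F] :
    NormedAddCommGroup (F →L[ℝ] F →L[ℝ] F →L[ℝ] F) :=
  ContinuousLinearMap.toNormedAddCommGroup

instance instNormedSpaceTrilinear {F : Type*} [NormedAddCommGroup F] [NormedSpace ℝ F] :
    NormedSpace ℝ (F →L[ℝ] F →L[ℝ] F →L[ℝ] F) :=
  ContinuousLinearMap.toNormedSpace

instance instAddCommGroupTrilinear {F : Type*} [NormedAddCommGroup F] [NormedSpace ℝ F] :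
    AddCommGroup (F →L[ℝ] F →L[ℝ] F →L[ℝ] F) :=
  ContinuousLinearMap.addCommGroup

variable {E F A : Type*} [NormedAddCommGroup E] [NormedSpace ℝ E]
  [NormedAddCommGroup F] [NormedSpace ℝ F] [NormedAddCommGroup A] [NormedSpace ℝ A]

theorem diffAt_of_smooth {f : E → F} {U : Set E} (hU : IsOpen U) (hf : ContDiffOn ℝ ∞ f U) {z : E}
    (hz : z ∈ U) : DifferentiableAt ℝ f z :=
  (hf.differentiableOn (by simp)).differentiableAt (hU.mem_nhds hz)

theorem smooth_fderiv {f : E → F} {U : Set E} (hU : IsOpen U) (hf : ContDiffOn ℝ ∞ f U) :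
    ContDiffOn ℝ ∞ (fderiv ℝ f) U :=
  hf.fderiv_of_isOpen hU (by simp)

theorem smooth_fderiv_apply {f : E → F} {U : Set E} (hU : IsOpen U) (hf : ContDiffOn ℝ ∞ f U)
    (v : E) : ContDiffOn ℝ ∞ (fun z => fderiv ℝ f z v) U :=
  (smooth_fderiv hU hf).clm_apply contDiffOn_const

theorem fderiv_congr_on {f g : E → F} {U : Set E} (hU : IsOpen U) (h : ∀ z ∈ U, f z = g z) {z : E}
    (hz : z ∈ U) : fderiv ℝ f z = fderiv ℝ g z :=
  Filter.EventuallyEq.fderiv_eq (Filter.eventually_of_mem (hU.mem_nhds hz) h)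

theorem fderiv_fderiv_apply {f : E → F} {U : Set E} (hU : IsOpen U) (hf : ContDiffOn ℝ ∞ f U)
    {z : E} (hz : z ∈ U) (a b : E) :
    fderiv ℝ (fun y => fderiv ℝ f y b) z a = fderiv ℝ (fderiv ℝ f) z a b := by
  rw [fderiv_clm_apply (diffAt_of_smooth hU (smooth_fderiv hU hf) hz) (by fun_prop)]
  simp

theorem fderiv_fderiv_comm {f : E → F} {U : Set E} (hU : IsOpen U) (hf : ContDiffOn ℝ ∞ f U)
    {z : E} (hz : z ∈ U) (a b : E) :
    fderiv ℝ (fun y => fderiv ℝ f y b) z a = fderiv ℝ (fun y => fderiv ℝ f y a) z b := by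
  rw [fderiv_fderiv_apply hU hf hz, fderiv_fderiv_apply hU hf hz]
  exact ((hf.contDiffAt (hU.mem_nhds hz)).isSymmSndFDerivAt (by simpa using ENat.LEInfty.out)) a b

theorem fderiv_apply₁ {U : Set E} (hU : IsOpen U) {B : E → F →L[ℝ] A}
    {w : E → F} (hB : ContDiffOn ℝ ∞ B U) (hw : ContDiffOn ℝ ∞ w U) {z : E} (hz : z ∈ U) (a : E) :
    fderiv ℝ (fun z => B z (w z)) z a = fderiv ℝ B z a (w z) + B z (fderiv ℝ w z a) := by
  rw [fderiv_clm_apply (diffAt_of_smooth hU hB hz) (diffAt_of_smooth hU hw hz)]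
  simp [add_comm]

theorem fderiv_apply₂ {F' : Type*} [NormedAddCommGroup F'] [NormedSpace ℝ F'] {U : Set E}
    (hU : IsOpen U) {B : E → F →L[ℝ] F' →L[ℝ] A}
    {w : E → F} {v : E → F'} (hB : ContDiffOn ℝ ∞ B U) (hw : ContDiffOn ℝ ∞ w U)
    (hv : ContDiffOn ℝ ∞ v U) {z : E} (hz : z ∈ U) (a : E) :
    fderiv ℝ (fun z => B z (w z) (v z)) z a =
      fderiv ℝ B z a (w z) (v z) + B z (fderiv ℝ w z a) (v z) + B z (w z) (fderiv ℝ v z a) := by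
  rw [fderiv_apply₁ hU (hB.clm_apply hw) hv hz, fderiv_apply₁ hU hB hw hz]
  simp

theorem fderiv_comp_on {U : Set E} (hU : IsOpen U) {Ω : Set F} (hΩ : IsOpen Ω) {B : F → A}
    {u : E → F} (hB : ContDiffOn ℝ ∞ B Ω) (hu : ContDiffOn ℝ ∞ u U) (hm : ∀ z ∈ U, u z ∈ Ω)
    {z : E} (hz : z ∈ U) (a : E) :
    fderiv ℝ (fun z => B (u z)) z a = fderiv ℝ B (u z) (fderiv ℝ u z a) := by
  have := fderiv_comp z (diffAt_of_smooth hΩ hB (hm z hz)) (diffAt_of_smooth hU hu hz)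
  rw [Function.comp_def] at this
  rw [this]; rfl

/-- The covariant derivative, in the direction `v`, of a section `w` along the map `u`, for the
connection with Christoffel map `Γ`. -/
def cd (Γ : F → F →L[ℝ] F →L[ℝ] F) (u w : E → F) (v z : E) : F :=
  fderiv ℝ w z v + Γ (u z) (fderiv ℝ u z v) (w z)

variable {U : Set E} {Ω : Set F} {Γ : F → F →L[ℝ] F →L[ℝ] F} {u w w' : E → F}

theorem cd_congr (hU : IsOpen U) (h : ∀ z ∈ U, w z = w' z) {z : E} (hz : z ∈ U) (v : E) :
    cd Γ u w v z = cd Γ u w' v z := by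
  rw [cd, cd, fderiv_congr_on hU h hz, h z hz]

theorem cd_congr_map {u' : E → F} (hU : IsOpen U) (hu : ∀ z ∈ U, u z = u' z)
    (h : ∀ z ∈ U, w z = w' z) {z : E} (hz : z ∈ U) (v : E) :
    cd Γ u w v z = cd Γ u' w' v z := by
  rw [cd, cd, fderiv_congr_on hU h hz, h z hz, fderiv_congr_on hU hu hz, hu z hz]

theorem cd_smooth (hU : IsOpen U) (hΓ : ContDiffOn ℝ ∞ Γ Ω) (hu : ContDiffOn ℝ ∞ u U)
    (hm : ∀ z ∈ U, u z ∈ Ω) (hw : ContDiffOn ℝ ∞ w U) (v : E) :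
    ContDiffOn ℝ ∞ (cd Γ u w v) U :=
  (smooth_fderiv_apply hU hw v).add
    (((hΓ.comp hu hm).clm_apply (smooth_fderiv_apply hU hu v)).clm_apply hw)

theorem cd_dir_add (a b z : E) : cd Γ u w (a + b) z = cd Γ u w a z + cd Γ u w b z := by
  simp only [cd, map_add, add_apply]; abel

theorem cd_dir_smul (c : ℝ) (a z : E) : cd Γ u w (c • a) z = c • cd Γ u w a z := by
  simp only [cd, map_smul, smul_apply, smul_add]

theorem cd_dir_sum {ι : Type*} (s : Finset ι) (a : ι → E) (z : E) :
    cd Γ u w (∑ i ∈ s, a i) z = ∑ i ∈ s, cd Γ u w (a i) z := by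
  simp only [cd, map_sum, sum_apply, Finset.sum_add_distrib]

theorem cd_add (hU : IsOpen U) (hw : ContDiffOn ℝ ∞ w U) (hw' : ContDiffOn ℝ ∞ w' U) {z : E}
    (hz : z ∈ U) (v : E) :
    cd Γ u (fun z => w z + w' z) v z = cd Γ u w v z + cd Γ u w' v z := by
  simp only [cd]
  rw [fderiv_fun_add (diffAt_of_smooth hU hw hz) (diffAt_of_smooth hU hw' hz)]
  simp only [add_apply, map_add]; abel

theorem cd_smul (hU : IsOpen U) {f : E → ℝ} (hf : ContDiffOn ℝ ∞ f U) (hw : ContDiffOn ℝ ∞ w U)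
    {z : E} (hz : z ∈ U) (v : E) :
    cd Γ u (fun z => f z • w z) v z = fderiv ℝ f z v • w z + f z • cd Γ u w v z := by
  simp only [cd]
  rw [fderiv_fun_smul (diffAt_of_smooth hU hf hz) (diffAt_of_smooth hU hw hz)]
  simp only [add_apply, smul_apply,
    ContinuousLinearMap.smulRight_apply, map_smul, smul_add]
  abel

theorem cd_zero (v z : E) : cd Γ u (fun _ => 0) v z = 0 := by
  simp [cd]

theorem cd_neg (v z : E) : cd Γ u (fun z => - w z) v z = - cd Γ u w v z := by
  simp only [cd, fderiv_fun_neg, neg_apply, map_neg, neg_add]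

theorem cd_const_smul (hU : IsOpen U) (c : ℝ) (hw : ContDiffOn ℝ ∞ w U) {z : E} (hz : z ∈ U)
    (v : E) : cd Γ u (fun z => c • w z) v z = c • cd Γ u w v z := by
  rw [cd_smul hU contDiffOn_const hw hz]; simp

theorem cd_sub (hU : IsOpen U) (hw : ContDiffOn ℝ ∞ w U) (hw' : ContDiffOn ℝ ∞ w' U) {z : E}
    (hz : z ∈ U) (v : E) :
    cd Γ u (fun z => w z - w' z) v z = cd Γ u w v z - cd Γ u w' v z := by
  simp only [sub_eq_add_neg]
  rw [cd_add hU hw hw'.neg hz, cd_neg]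

theorem cd_sum {ι : Type*} (s : Finset ι) {w : ι → E → F} (hU : IsOpen U)
    (hw : ∀ i ∈ s, ContDiffOn ℝ ∞ (w i) U) {z : E} (hz : z ∈ U) (v : E) :
    cd Γ u (fun z => ∑ i ∈ s, w i z) v z = ∑ i ∈ s, cd Γ u (w i) v z := by
  classical
  simp only [cd]
  rw [fderiv_fun_sum fun i hi => diffAt_of_smooth hU (hw i hi) hz]
  simp only [sum_apply, map_sum, Finset.sum_add_distrib]

/-- The torsion-free property. -/
theorem cd_fderiv_comm (hU : IsOpen U) (hu : ContDiffOn ℝ ∞ u U)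
    {z : E} (hz : z ∈ U) (hs : ∀ a b, Γ (u z) a b = Γ (u z) b a) (a b : E) :
    cd Γ u (fun z => fderiv ℝ u z b) a z = cd Γ u (fun z => fderiv ℝ u z a) b z := by
  rw [cd, cd, fderiv_fderiv_comm hU hu hz, hs]

/-- The covariant derivative of the metric `H` vanishes on `Ω`. -/
def Compat (Ω : Set F) (H : F → F →L[ℝ] F →L[ℝ] ℝ) (Γ : F → F →L[ℝ] F →L[ℝ] F) : Prop :=
  ∀ y ∈ Ω, ∀ a b c, fderiv ℝ H y a b c = H y (Γ y a b) c + H y b (Γ y a c)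

/-- Compatibility says that the derivative of `H` along `u` is exactly what the two `Γ`-corrections
contribute, so the Leibniz rule may be written with covariant derivatives. -/
theorem fderiv_metric (hU : IsOpen U) (hΩ : IsOpen Ω) {H : F → F →L[ℝ] F →L[ℝ] ℝ}
    (hH : ContDiffOn ℝ ∞ H Ω) (hc : Compat Ω H Γ) (hu : ContDiffOn ℝ ∞ u U)
    (hm : ∀ z ∈ U, u z ∈ Ω) (hw : ContDiffOn ℝ ∞ w U) (hw' : ContDiffOn ℝ ∞ w' U)
    {z : E} (hz : z ∈ U) (a : E) :
    fderiv ℝ (fun z => H (u z) (w z) (w' z)) z a =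
      H (u z) (cd Γ u w a z) (w' z) + H (u z) (w z) (cd Γ u w' a z) := by
  rw [fderiv_apply₂ hU (B := fun z => H (u z)) (hH.comp hu hm) hw hw' hz,
    fderiv_comp_on hU hΩ hH hu hm hz, hc _ (hm z hz)]
  simp only [cd, map_add, add_apply]
  ring

/-- The curvature tensor of the connection with Christoffel map `Γ`. -/
def RC (Γ : F → F →L[ℝ] F →L[ℝ] F) (y : F) : F →L[ℝ] F →L[ℝ] F →L[ℝ] F :=
  fderiv ℝ Γ y - (fderiv ℝ Γ y).flip
    + (ContinuousLinearMap.compL ℝ F F F).bilinearComp (Γ y) (Γ y)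
    - ((ContinuousLinearMap.compL ℝ F F F).bilinearComp (Γ y) (Γ y)).flip

theorem RC_apply (y a b c : F) : RC Γ y a b c =
    fderiv ℝ Γ y a b c - fderiv ℝ Γ y b a c + Γ y a (Γ y b c) - Γ y b (Γ y a c) := by
  simp [RC]

theorem RC_antisymm (y a b c : F) : RC Γ y a b c = - RC Γ y b a c := by
  simp only [RC_apply]; abel

theorem RC_smooth [FiniteDimensional ℝ F] (hΩ : IsOpen Ω) (hΓ : ContDiffOn ℝ ∞ Γ Ω) :
    ContDiffOn ℝ ∞ (RC Γ) Ω := by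
  rw [contDiffOn_clm_apply]; intro a
  rw [contDiffOn_clm_apply]; intro b
  rw [contDiffOn_clm_apply]; intro c
  simp only [RC_apply]
  have h1 := smooth_fderiv hΩ hΓ
  have hc : ∀ x : F, ContDiffOn ℝ ∞ (fun _ : F => x) Ω := fun x => contDiffOn_const
  exact (((((h1.clm_apply (hc a)).clm_apply (hc b)).clm_apply (hc c)).sub
    (((h1.clm_apply (hc b)).clm_apply (hc a)).clm_apply (hc c))).add
    ((hΓ.clm_apply (hc a)).clm_apply ((hΓ.clm_apply (hc b)).clm_apply (hc c)))).sub
    ((hΓ.clm_apply (hc b)).clm_apply ((hΓ.clm_apply (hc a)).clm_apply (hc c)))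

theorem cd_cd (hU : IsOpen U) (hΩ : IsOpen Ω) (hΓ : ContDiffOn ℝ ∞ Γ Ω)
    (hu : ContDiffOn ℝ ∞ u U) (hm : ∀ z ∈ U, u z ∈ Ω) (hw : ContDiffOn ℝ ∞ w U)
    {z : E} (hz : z ∈ U) (a b : E) :
    cd Γ u (cd Γ u w b) a z = fderiv ℝ (fun y => fderiv ℝ w y b) z a
      + (fderiv ℝ Γ (u z) (fderiv ℝ u z a) (fderiv ℝ u z b) (w z)
      + Γ (u z) (fderiv ℝ (fun y => fderiv ℝ u y b) z a) (w z)
      + Γ (u z) (fderiv ℝ u z b) (fderiv ℝ w z a))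
      + Γ (u z) (fderiv ℝ u z a) (fderiv ℝ w z b + Γ (u z) (fderiv ℝ u z b) (w z)) := by
  have h1 : fderiv ℝ (cd Γ u w b) z = fderiv ℝ (fun y => fderiv ℝ w y b) z +
      fderiv ℝ (fun y => Γ (u y) (fderiv ℝ u y b) (w y)) z :=
    fderiv_fun_add (diffAt_of_smooth hU (smooth_fderiv_apply hU hw b) hz)
      (diffAt_of_smooth hU (((hΓ.comp hu hm).clm_apply (smooth_fderiv_apply hU hu b)).clm_apply hw)
        hz)
  have h2 := fderiv_apply₂ hU (B := fun z => Γ (u z)) (hΓ.comp hu hm)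
    (smooth_fderiv_apply hU hu b) hw hz a
  rw [fderiv_comp_on hU hΩ hΓ hu hm hz] at h2
  rw [cd, h1, add_apply, h2]; rfl

/-- Ricci identity for a pull-back connection. The directions are constant, so there is no bracket
term; the second derivatives of `w` and `u` cancel by symmetry, and what is left is the formula for
the curvature. Symmetry of `Γ` does not enter. -/
theorem cd_comm (hU : IsOpen U) (hΩ : IsOpen Ω) (hΓ : ContDiffOn ℝ ∞ Γ Ω)
    (hu : ContDiffOn ℝ ∞ u U) (hm : ∀ z ∈ U, u z ∈ Ω) (hw : ContDiffOn ℝ ∞ w U)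
    {z : E} (hz : z ∈ U) (a b : E) :
    cd Γ u (cd Γ u w b) a z = cd Γ u (cd Γ u w a) b z
      + RC Γ (u z) (fderiv ℝ u z a) (fderiv ℝ u z b) (w z) := by
  rw [cd_cd hU hΩ hΓ hu hm hw hz, cd_cd hU hΩ hΓ hu hm hw hz, fderiv_fderiv_comm hU hw hz a b,
    fderiv_fderiv_comm hU hu hz a b, RC_apply]
  simp only [map_add]
  abel

/-- The covariant derivative `(∇_x R)(a, b)c` of the curvature tensor. -/
def NR (Γ : F → F →L[ℝ] F →L[ℝ] F) (y x a b c : F) : F :=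
  fderiv ℝ (RC Γ) y x a b c + Γ y x (RC Γ y a b c) - RC Γ y (Γ y x a) b c
    - RC Γ y a (Γ y x b) c - RC Γ y a b (Γ y x c)

/-- Leibniz rule: the `Γ`-corrections inside `NR` are those which turn the derivatives of `X`, `Y`,
`Z` into covariant ones. -/
theorem cd_RC [FiniteDimensional ℝ F] (hU : IsOpen U) (hΩ : IsOpen Ω) (hΓ : ContDiffOn ℝ ∞ Γ Ω)
    (hu : ContDiffOn ℝ ∞ u U) (hm : ∀ z ∈ U, u z ∈ Ω) {X Y Z : E → F}
    (hX : ContDiffOn ℝ ∞ X U) (hY : ContDiffOn ℝ ∞ Y U) (hZ : ContDiffOn ℝ ∞ Z U)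
    {z : E} (hz : z ∈ U) (a : E) :
    cd Γ u (fun z => RC Γ (u z) (X z) (Y z) (Z z)) a z =
      NR Γ (u z) (fderiv ℝ u z a) (X z) (Y z) (Z z) + RC Γ (u z) (cd Γ u X a z) (Y z) (Z z)
      + RC Γ (u z) (X z) (cd Γ u Y a z) (Z z) + RC Γ (u z) (X z) (Y z) (cd Γ u Z a z) := by
  have h1 := (RC_smooth hΩ hΓ).comp hu hm
  have h2 := fderiv_apply₂ hU (B := fun z => RC Γ (u z) (X z)) (h1.clm_apply hX) hY hZ hz a
  have h3 := fderiv_apply₁ hU (B := fun z => RC Γ (u z)) h1 hX hz a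
  rw [h3, fderiv_comp_on hU hΩ (RC_smooth hΩ hΓ) hu hm hz] at h2
  rw [cd, h2, NR]
  simp only [cd, map_add, add_apply]
  abel

theorem RC_bianchi (hΩ : IsOpen Ω) (hΓ : ContDiffOn ℝ ∞ Γ Ω)
    (hs : ∀ y ∈ Ω, ∀ a b, Γ y a b = Γ y b a) {y : F} (hy : y ∈ Ω) (a b c : F) :
    RC Γ y a b c + RC Γ y b c a + RC Γ y c a b = 0 := by
  -- Symmetry of `Γ` holds on an open set, hence passes to its derivative.
  have key : ∀ x a b, fderiv ℝ Γ y x a b = fderiv ℝ Γ y x b a := by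
    intro x a b
    have h1 : ∀ a b, fderiv ℝ Γ y x a b = fderiv ℝ (fun y => Γ y a b) y x := by
      intro a b
      have := fderiv_apply₂ hΩ hΓ (contDiffOn_const (c := a)) (contDiffOn_const (c := b)) hy x
      simpa using this.symm
    rw [h1, h1, fderiv_congr_on hΩ (fun y hy => hs y hy a b) hy]
  simp only [RC_apply]
  rw [key a b c, key b c a, key c a b, hs y hy b c, hs y hy c a, hs y hy a b]
  abel

/-- The second derivatives of the function `H(c, d)`, with `c` and `d` constant fields, commute.
Expanded by compatibility, their commutator is `⟨R(a,b)c, d⟩ + ⟨c, R(a,b)d⟩`. -/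
theorem RC_skew (hΩ : IsOpen Ω) (hΓ : ContDiffOn ℝ ∞ Γ Ω) {H : F → F →L[ℝ] F →L[ℝ] ℝ}
    (hH : ContDiffOn ℝ ∞ H Ω) (hc : Compat Ω H Γ) {y : F} (hy : y ∈ Ω) (a b c d : F) :
    H y (RC Γ y a b c) d = - H y c (RC Γ y a b d) := by
  have hid : ContDiffOn ℝ ∞ (fun y : F => y) Ω := contDiffOn_id
  have hm : ∀ z ∈ Ω, (fun y : F => y) z ∈ Ω := fun z hz => hz
  have hk : ∀ x : F, ContDiffOn ℝ ∞ (fun _ : F => x) Ω := fun x => contDiffOn_const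
  have h1 : ∀ a b : F, fderiv ℝ (fun z => fderiv ℝ (fun z => H z c d) z b) y a =
      H y (cd Γ (fun y => y) (cd Γ (fun y => y) (fun _ => c) b) a y) d
      + H y (cd Γ (fun y => y) (fun _ => c) b y) (cd Γ (fun y => y) (fun _ => d) a y)
      + (H y (cd Γ (fun y => y) (fun _ => c) a y) (cd Γ (fun y => y) (fun _ => d) b y)
      + H y c (cd Γ (fun y => y) (cd Γ (fun y => y) (fun _ => d) b) a y)) := by
    intro a b
    rw [fderiv_congr_on hΩ
      (fun z hz => fderiv_metric hΩ hΩ hH hc hid hm (hk c) (hk d) hz b) hy]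
    have hcd := fun x => cd_smooth hΩ hΓ hid hm (hk x) b
    rw [fderiv_fun_add (diffAt_of_smooth hΩ ((hH.clm_apply (hcd c)).clm_apply (hk d)) hy)
      (diffAt_of_smooth hΩ ((hH.clm_apply (hk c)).clm_apply (hcd d)) hy),
      add_apply, fderiv_metric hΩ hΩ hH hc hid hm (hcd c) (hk d) hy,
      fderiv_metric hΩ hΩ hH hc hid hm (hk c) (hcd d) hy]
  have h2 := fderiv_fderiv_comm hΩ ((hH.clm_apply (hk c)).clm_apply (hk d)) hy a b
  rw [h1, h1, cd_comm hΩ hΩ hΓ hid hm (hk c) hy a b, cd_comm hΩ hΩ hΓ hid hm (hk d) hy a b] at h2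
  simp only [fderiv_fun_id, ContinuousLinearMap.id_apply, map_add, add_apply] at h2
  linarith

/-- The symmetry `⟨R(a,b)c,d⟩ = ⟨R(c,d)a,b⟩` of an algebraic curvature tensor. -/
theorem pair_symm_of {Q : F → F → F → F → ℝ} (h1 : ∀ a b c d, Q a b c d = - Q b a c d)
    (h2 : ∀ a b c d, Q a b c d = - Q a b d c)
    (h3 : ∀ a b c d, Q a b c d + Q b c a d + Q c a b d = 0) (a b c d : F) :
    Q a b c d = Q c d a b := by
  -- The octahedron argument: the four Bianchi identities, one for each entry kept in the last slot,
  -- are combined linearly, and the skew symmetries leave only the two desired terms.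
  linarith [h3 a b c d, h3 b c d a, h3 c d a b, h3 d a b c, h1 a b c d, h1 b c a d, h1 c a b d,
    h1 b d c a, h1 c d b a, h1 d b c a, h1 a c d b, h1 d a c b, h1 a b d c, h1 b d a c, h1 d a b c,
    h2 a b c d, h2 b c a d, h2 c a b d, h2 c d a b, h2 b d c a, h2 d a c b, h2 a c d b, h2 c d b a,
    h2 d b c a, h2 a b d c, h2 b d a c, h2 d a b c, h2 a c b d, h2 a d b c, h2 d b a c]

theorem RC_pair (hΩ : IsOpen Ω) (hΓ : ContDiffOn ℝ ∞ Γ Ω)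
    (hs : ∀ y ∈ Ω, ∀ a b, Γ y a b = Γ y b a) {H : F → F →L[ℝ] F →L[ℝ] ℝ}
    (hH : ContDiffOn ℝ ∞ H Ω) (hHs : ∀ y ∈ Ω, ∀ a b, H y a b = H y b a) (hc : Compat Ω H Γ)
    {y : F} (hy : y ∈ Ω) (a b c d : F) :
    H y (RC Γ y a b c) d = H y (RC Γ y c d a) b := by
  refine pair_symm_of (Q := fun a b c d => H y (RC Γ y a b c) d) ?_ ?_ ?_ a b c d
  · intro a b c d
    rw [RC_antisymm]; simp
  · intro a b c d
    rw [RC_skew hΩ hΓ hH hc hy, hHs y hy]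
  · intro a b c d
    rw [← add_apply, ← map_add, ← add_apply, ← map_add,
      RC_bianchi hΩ hΓ hs hy]
    simp

section CovariantDerivativeOfCurvature

variable [FiniteDimensional ℝ F]

/-- Along the identity map with constant arguments, `NR` is an honest covariant derivative of a
vector field; identities of `RC` valid on `Ω` can therefore be differentiated. -/
theorem NR_eq_cd (hΩ : IsOpen Ω) (hΓ : ContDiffOn ℝ ∞ Γ Ω) {y : F} (hy : y ∈ Ω) (x a b c : F) :
    NR Γ y x a b c = cd Γ (fun y => y) (fun y => RC Γ y a b c) x y - RC Γ y (Γ y x a) b c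
      - RC Γ y a (Γ y x b) c - RC Γ y a b (Γ y x c) := by
  have hk : ∀ x : F, ContDiffOn ℝ ∞ (fun _ : F => x) Ω := fun x => contDiffOn_const
  rw [cd_RC (u := fun y => y) hΩ hΩ hΓ contDiffOn_id (fun z hz => hz) (hk a) (hk b) (hk c) hy]
  simp only [cd, fderiv_fun_id, ContinuousLinearMap.id_apply, fderiv_fun_const, Pi.zero_apply, zero_apply, zero_add]
  abel

/-- No smoothness is needed: exchanging two arguments is a continuous linear equivalence and so
commutes with `fderiv` unconditionally. -/
theorem NR_antisymm (y x a b c : F) : NR Γ y x a b c = - NR Γ y x b a c := by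
  have h : fderiv ℝ (RC Γ) y x a b c = - fderiv ℝ (RC Γ) y x b a c := by
    have h1 : RC Γ = fun y => - (RC Γ y).flip := by
      ext y a b c
      simpa using RC_antisymm y a b c
    have h2 : fderiv ℝ (RC Γ) y = fderiv ℝ (fun y => - (RC Γ y).flip) y := by rw [← h1]
    have h3 : fderiv ℝ (fun y => - (RC Γ y).flip) y x = - (fderiv ℝ (RC Γ) y x).flip := by
      rw [fderiv_fun_neg]
      have := (ContinuousLinearMap.flipₗᵢ ℝ F F (F →L[ℝ] F)).toContinuousLinearEquiv.comp_fderiv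
        (f := RC Γ) (x := y)
      rw [Function.comp_def] at this
      rw [neg_apply]
      congr 1
      exact congrArg (fun T => T x) this
    have h4 := congrArg (fun T => T x a b c) h2
    simp only [h3] at h4
    simpa using h4
  simp only [NR]
  rw [h, RC_antisymm y a b c, RC_antisymm y (Γ y x a) b c, RC_antisymm y a (Γ y x b) c,
    RC_antisymm y a b (Γ y x c)]
  simp only [map_neg]
  abel

theorem NR_bianchi (hΩ : IsOpen Ω) (hΓ : ContDiffOn ℝ ∞ Γ Ω)
    (hs : ∀ y ∈ Ω, ∀ a b, Γ y a b = Γ y b a) {y : F} (hy : y ∈ Ω) (x a b c : F) :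
    NR Γ y x a b c + NR Γ y x b c a + NR Γ y x c a b = 0 := by
  have hk : ∀ x : F, ContDiffOn ℝ ∞ (fun _ : F => x) Ω := fun x => contDiffOn_const
  have hR : ∀ a b c, ContDiffOn ℝ ∞ (fun y => RC Γ y a b c) Ω := fun a b c =>
    (((RC_smooth hΩ hΓ).clm_apply (hk a)).clm_apply (hk b)).clm_apply (hk c)
  have h1 : cd Γ (fun y => y) (fun y => RC Γ y a b c) x y
      + cd Γ (fun y => y) (fun y => RC Γ y b c a) x y
      + cd Γ (fun y => y) (fun y => RC Γ y c a b) x y = 0 := by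
    rw [← cd_add hΩ (hR a b c) (hR b c a) hy, ← cd_add hΩ ((hR a b c).add (hR b c a)) (hR c a b) hy,
      cd_congr hΩ (fun z hz => RC_bianchi hΩ hΓ hs hz a b c) hy, cd_zero]
  have h2 := RC_bianchi hΩ hΓ hs hy (Γ y x a) b c
  have h3 := RC_bianchi hΩ hΓ hs hy a (Γ y x b) c
  have h4 := RC_bianchi hΩ hΓ hs hy a b (Γ y x c)
  simp only [NR_eq_cd hΩ hΓ hy]
  linear_combination (norm := module) h1 - h2 - h3 - h4

/-- The covariant derivative of `RC_skew`; the corrections in each slot cancel by `RC_skew` itself.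
-/
theorem NR_skew (hΩ : IsOpen Ω) (hΓ : ContDiffOn ℝ ∞ Γ Ω) {H : F → F →L[ℝ] F →L[ℝ] ℝ}
    (hH : ContDiffOn ℝ ∞ H Ω) (hc : Compat Ω H Γ) {y : F} (hy : y ∈ Ω) (x a b c d : F) :
    H y (NR Γ y x a b c) d = - H y c (NR Γ y x a b d) := by
  have hk : ∀ x : F, ContDiffOn ℝ ∞ (fun _ : F => x) Ω := fun x => contDiffOn_const
  have hid : ContDiffOn ℝ ∞ (fun y : F => y) Ω := contDiffOn_id
  have hm : ∀ z ∈ Ω, (fun y : F => y) z ∈ Ω := fun z hz => hz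
  have hR : ∀ a b c, ContDiffOn ℝ ∞ (fun y => RC Γ y a b c) Ω := fun a b c =>
    (((RC_smooth hΩ hΓ).clm_apply (hk a)).clm_apply (hk b)).clm_apply (hk c)
  have h0 : fderiv ℝ (fun y => H y (RC Γ y a b c) d + H y c (RC Γ y a b d)) y x = 0 := by
    rw [fderiv_congr_on (g := fun _ => 0) hΩ (fun z hz => by rw [RC_skew hΩ hΓ hH hc hz]; ring) hy]
    simp
  rw [fderiv_fun_add (diffAt_of_smooth hΩ ((hH.clm_apply (hR a b c)).clm_apply (hk d)) hy)
      (diffAt_of_smooth hΩ ((hH.clm_apply (hk c)).clm_apply (hR a b d)) hy),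
      add_apply, fderiv_metric hΩ hΩ hH hc hid hm (hR a b c) (hk d) hy,
      fderiv_metric hΩ hΩ hH hc hid hm (hk c) (hR a b d) hy] at h0
  have h1 := RC_skew hΩ hΓ hH hc hy (Γ y x a) b c d
  have h2 := RC_skew hΩ hΓ hH hc hy a (Γ y x b) c d
  have h3 := RC_skew hΩ hΓ hH hc hy a b (Γ y x c) d
  have h4 := RC_skew hΩ hΓ hH hc hy a b c (Γ y x d)
  have hcd : ∀ c, cd Γ (fun y => y) (fun _ => c) x y = Γ y x c := fun c => by simp [cd]
  simp only [hcd] at h0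
  simp only [NR_eq_cd hΩ hΓ hy, map_sub, sub_apply]
  linarith

theorem NR_pair (hΩ : IsOpen Ω) (hΓ : ContDiffOn ℝ ∞ Γ Ω)
    (hs : ∀ y ∈ Ω, ∀ a b, Γ y a b = Γ y b a) {H : F → F →L[ℝ] F →L[ℝ] ℝ}
    (hH : ContDiffOn ℝ ∞ H Ω) (hHs : ∀ y ∈ Ω, ∀ a b, H y a b = H y b a) (hc : Compat Ω H Γ)
    {y : F} (hy : y ∈ Ω) (x a b c d : F) :
    H y (NR Γ y x a b c) d = H y (NR Γ y x c d a) b := by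
  refine pair_symm_of (Q := fun a b c d => H y (NR Γ y x a b c) d) ?_ ?_ ?_ a b c d
  · intro a b c d
    rw [NR_antisymm]; simp
  · intro a b c d
    rw [NR_skew hΩ hΓ hH hc hy, hHs y hy]
  · intro a b c d
    rw [← add_apply, ← map_add, ← add_apply, ← map_add,
      NR_bianchi hΩ hΓ hs hy]
    simp

/-- The second Bianchi identity. -/
theorem NR_bianchi₂ (hΩ : IsOpen Ω) (hΓ : ContDiffOn ℝ ∞ Γ Ω)
    (hs : ∀ y ∈ Ω, ∀ a b, Γ y a b = Γ y b a) {y : F} (hy : y ∈ Ω) (a b c w : F) :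
    NR Γ y a b c w + NR Γ y b c a w + NR Γ y c a b w = 0 := by
  have hk : ∀ x : F, ContDiffOn ℝ ∞ (fun _ : F => x) Ω := fun x => contDiffOn_const
  have hid : ContDiffOn ℝ ∞ (fun y : F => y) Ω := contDiffOn_id
  have hm : ∀ z ∈ Ω, (fun y : F => y) z ∈ Ω := fun z hz => hz
  set D : F → (F → F) → F → F := fun v w y => cd Γ (fun y => y) w v y with hD
  have hs1 : ∀ v w, ContDiffOn ℝ ∞ w Ω → ContDiffOn ℝ ∞ (D v w) Ω := fun v w hw =>
    cd_smooth hΩ hΓ hid hm hw v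
  have hcomm : ∀ a b w, ContDiffOn ℝ ∞ w Ω → ∀ z ∈ Ω,
      RC Γ z a b (w z) = D a (D b w) z - D b (D a w) z := by
    intro a b w hw z hz
    have := cd_comm hΩ hΩ hΓ hid hm hw hz a b
    simp only [fderiv_fun_id, ContinuousLinearMap.id_apply] at this
    simp only [hD]
    change _ = cd Γ (fun y => y) (cd Γ (fun y => y) w b) a z
      - cd Γ (fun y => y) (cd Γ (fun y => y) w a) b z
    rw [this]; abel
  -- The Jacobi identity for `D`: in the cyclic sum the triple derivatives cancel in pairs, and the
  -- terms with `Γ y a b` cancel because `Γ` is symmetric and `RC` is antisymmetric.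
  have h1 : ∀ a b c, NR Γ y a b c w = D a (D b (D c fun _ => w)) y - D a (D c (D b fun _ => w)) y
      - RC Γ y (Γ y a b) c w - RC Γ y b (Γ y a c) w
      - (D b (D c (D a fun _ => w)) y - D c (D b (D a fun _ => w)) y) := by
    intro a b c
    rw [NR_eq_cd hΩ hΓ hy, cd_congr hΩ (fun z hz => hcomm b c (fun _ => w) (hk w) z hz) hy,
      cd_sub hΩ (hs1 _ _ (hs1 _ _ (hk w))) (hs1 _ _ (hs1 _ _ (hk w))) hy,
      ← hcomm b c _ (hs1 a _ (hk w)) y hy]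
    simp [hD, cd]
  rw [h1, h1, h1, hs y hy b a, hs y hy c a, hs y hy c b, RC_antisymm y b (Γ y a c) w,
    RC_antisymm y c (Γ y a b) w, RC_antisymm y a (Γ y b c) w]
  abel

end CovariantDerivativeOfCurvature

end Flat

end CBiharmonic

end

/-! ### Uniqueness and existence of the Levi-Civita connection; behaviour under local isometries. -/

noncomputable section

set_option linter.unusedSectionVars false
set_option synthInstance.maxHeartbeats 200000

namespace CBiharmonic

/-! ### The Levi-Civita connection of a metric on a Euclidean domain -/

section Transform

variable {E F F' : Type*} [NormedAddCommGroup E] [NormedSpace ℝ E]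
  [NormedAddCommGroup F] [NormedSpace ℝ F] [NormedAddCommGroup F'] [NormedSpace ℝ F']
  {U : Set E} {Ω : Set F} {Ω' : Set F'} {Γ : F → F →L[ℝ] F →L[ℝ] F}
  {Γ' : F' → F' →L[ℝ] F' →L[ℝ] F'} {κ : F' → F}

/-- Uniqueness of the Levi-Civita connection. The difference `T` of the two sides is symmetric in
its two arguments, and `⟨T(a,b), dκ(c)⟩` is skew in `b`, `c` because both connections are metric;
such a trilinear form vanishes. -/
theorem gamma_transform (hΩ' : IsOpen Ω') (hΩ : IsOpen Ω)
    (hs : ∀ y ∈ Ω, ∀ a b, Γ y a b = Γ y b a) (hs' : ∀ y ∈ Ω', ∀ a b, Γ' y a b = Γ' y b a)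
    {H : F → F →L[ℝ] F →L[ℝ] ℝ} {H' : F' → F' →L[ℝ] F' →L[ℝ] ℝ}
    (hH : ContDiffOn ℝ ∞ H Ω) (hHs : ∀ y ∈ Ω, ∀ a b, H y a b = H y b a)
    (hpos : ∀ y ∈ Ω, ∀ a, a ≠ 0 → 0 < H y a a) (hc : Compat Ω H Γ)
    (hH' : ContDiffOn ℝ ∞ H' Ω') (hc' : Compat Ω' H' Γ')
    (hκ : ContDiffOn ℝ ∞ κ Ω') (hm : ∀ y ∈ Ω', κ y ∈ Ω)
    (hsurj : ∀ y ∈ Ω', Function.Surjective (fderiv ℝ κ y))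
    (hHH : ∀ y ∈ Ω', ∀ a b, H' y a b = H (κ y) (fderiv ℝ κ y a) (fderiv ℝ κ y b))
    {y : F'} (hy : y ∈ Ω') (a b : F') :
    cd Γ κ (fun y => fderiv ℝ κ y b) a y = fderiv ℝ κ y (Γ' y a b) := by
  set T : F' → F' → F := fun a b =>
    cd Γ κ (fun y => fderiv ℝ κ y b) a y - fderiv ℝ κ y (Γ' y a b) with hT
  have hsymm : ∀ a b, T a b = T b a := by
    intro a b
    simp only [hT]
    rw [cd_fderiv_comm hΩ' hκ hy (hs _ (hm y hy)), hs' y hy a b]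
  have hskew : ∀ a b c, H (κ y) (T a b) (fderiv ℝ κ y c) + H (κ y) (fderiv ℝ κ y b) (T a c) = 0 := by
    intro a b c
    have h1 := fderiv_metric hΩ' hΩ hH hc hκ hm (smooth_fderiv_apply hΩ' hκ b)
      (smooth_fderiv_apply hΩ' hκ c) hy a
    rw [← fderiv_congr_on hΩ' (fun z hz => hHH z hz b c) hy] at h1
    have h2 := fderiv_apply₂ hΩ' hH' (contDiffOn_const (c := b)) (contDiffOn_const (c := c)) hy a
    rw [h1, hc' y hy, hHH y hy, hHH y hy] at h2
    simp only [fderiv_fun_const, Pi.zero_apply, zero_apply, map_zero, add_zero] at h2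
    simp only [hT, map_sub, sub_apply]
    linarith
  -- Symmetric in the first pair and skew in the last pair: three alternations return the form to
  -- its negative.
  have hzero : ∀ a b c, H (κ y) (T a b) (fderiv ℝ κ y c) = 0 := by
    intro a b c
    have e := hHs (κ y) (hm y hy)
    have h1 := hskew a b c
    have h2 := hskew c a b
    have h3 := hskew b c a
    rw [e _ (T a c)] at h1
    rw [e _ (T c b)] at h2
    rw [e _ (T b a)] at h3
    rw [hsymm c a] at h2
    rw [hsymm c b] at h2
    rw [hsymm b a] at h3
    linarith
  -- Surjectivity of the differential allows `T a b` to be tested against itself.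
  obtain ⟨c, hcc⟩ := hsurj y hy (T a b)
  have h0 := hzero a b c
  rw [hcc] at h0
  by_contra hne
  have := hpos _ (hm y hy) (T a b) (sub_ne_zero.mpr hne)
  linarith

variable (hΩ' : IsOpen Ω') (hκ : ContDiffOn ℝ ∞ κ Ω')
  (hΓκ : ∀ y ∈ Ω', ∀ a b, cd Γ κ (fun y => fderiv ℝ κ y b) a y = fderiv ℝ κ y (Γ' y a b))

include hΩ' hκ hΓκ in
-- Chain rule: the second derivative of `κ` produced by differentiating `dκ(w)` is what the
-- transformation law of `Γ` absorbs.
theorem cd_transform (hU : IsOpen U) {u : E → F'} {w : E → F'} (hu : ContDiffOn ℝ ∞ u U)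
    (hm : ∀ z ∈ U, u z ∈ Ω') (hw : ContDiffOn ℝ ∞ w U) {z : E} (hz : z ∈ U) (v : E) :
    cd Γ (fun z => κ (u z)) (fun z => fderiv ℝ κ (u z) (w z)) v z
      = fderiv ℝ κ (u z) (cd Γ' u w v z) := by
  have h1 := fderiv_apply₁ hU (B := fun z => fderiv ℝ κ (u z)) ((smooth_fderiv hΩ' hκ).comp hu hm)
    hw hz v
  rw [fderiv_comp_on hU hΩ' (smooth_fderiv hΩ' hκ) hu hm hz,
    ← fderiv_fderiv_apply hΩ' hκ (hm z hz)] at h1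
  have h2 := hΓκ _ (hm z hz) (fderiv ℝ u z v) (w z)
  simp only [cd, map_add] at h2 ⊢
  rw [h1, fderiv_comp_on hU hΩ' hκ hu hm hz, ← h2]
  abel

include hΩ' hκ hΓκ in
-- Curvature is the commutator of covariant derivatives, and these correspond under `κ`. The two
-- Ricci identities are compared for a constant field and its image.
theorem RC_transform (hΩ : IsOpen Ω) (hΓ : ContDiffOn ℝ ∞ Γ Ω) (hΓ' : ContDiffOn ℝ ∞ Γ' Ω')
    (hm : ∀ y ∈ Ω', κ y ∈ Ω) {y : F'} (hy : y ∈ Ω') (a b c : F') :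
    RC Γ (κ y) (fderiv ℝ κ y a) (fderiv ℝ κ y b) (fderiv ℝ κ y c)
      = fderiv ℝ κ y (RC Γ' y a b c) := by
  have hid : ContDiffOn ℝ ∞ (fun y : F' => y) Ω' := contDiffOn_id
  have hm' : ∀ z ∈ Ω', (fun y : F' => y) z ∈ Ω' := fun z hz => hz
  have hk : ∀ x : F', ContDiffOn ℝ ∞ (fun _ : F' => x) Ω' := fun x => contDiffOn_const
  have h1 : ∀ a b, cd Γ κ (cd Γ κ (fun y => fderiv ℝ κ y c) b) a y =
      fderiv ℝ κ y (cd Γ' (fun y => y) (cd Γ' (fun y => y) (fun _ => c) b) a y) := by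
    intro a b
    rw [← cd_transform hΩ' hκ hΓκ hΩ' hid hm' (cd_smooth hΩ' hΓ' hid hm' (hk c) b) hy]
    exact cd_congr hΩ' (fun z hz => cd_transform hΩ' hκ hΓκ hΩ' hid hm' (hk c) hz b) hy a
  have h2 := cd_comm hΩ' hΩ hΓ hκ hm (smooth_fderiv_apply hΩ' hκ c) hy a b
  have h3 := cd_comm hΩ' hΩ' hΓ' hid hm' (hk c) hy a b
  rw [h1, h1, h3, map_add] at h2
  simpa using (add_left_cancel h2).symm

include hΩ' hκ hΓκ in
theorem NR_transform [FiniteDimensional ℝ F] [FiniteDimensional ℝ F'] (hΩ : IsOpen Ω)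
    (hΓ : ContDiffOn ℝ ∞ Γ Ω) (hΓ' : ContDiffOn ℝ ∞ Γ' Ω')
    (hm : ∀ y ∈ Ω', κ y ∈ Ω) {y : F'} (hy : y ∈ Ω') (x a b c : F') :
    NR Γ (κ y) (fderiv ℝ κ y x) (fderiv ℝ κ y a) (fderiv ℝ κ y b) (fderiv ℝ κ y c)
      = fderiv ℝ κ y (NR Γ' y x a b c) := by
  have hid : ContDiffOn ℝ ∞ (fun y : F' => y) Ω' := contDiffOn_id
  have hm' : ∀ z ∈ Ω', (fun y : F' => y) z ∈ Ω' := fun z hz => hz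
  have hk : ∀ x : F', ContDiffOn ℝ ∞ (fun _ : F' => x) Ω' := fun x => contDiffOn_const
  have hκ' := fun a => smooth_fderiv_apply hΩ' hκ a
  have hR : ContDiffOn ℝ ∞ (fun y => RC Γ' y a b c) Ω' :=
    (((RC_smooth hΩ' hΓ').clm_apply (hk a)).clm_apply (hk b)).clm_apply (hk c)
  have h1 := cd_RC hΩ' hΩ hΓ hκ hm (hκ' a) (hκ' b) (hκ' c) hy x
  rw [cd_congr hΩ' (fun z hz => RC_transform hΩ' hκ hΓκ hΩ hΓ hΓ' hm hz a b c) hy,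
    cd_transform hΩ' hκ hΓκ hΩ' hid hm' hR hy, hΓκ y hy, hΓκ y hy, hΓκ y hy,
    RC_transform hΩ' hκ hΓκ hΩ hΓ hΓ' hm hy, RC_transform hΩ' hκ hΓκ hΩ hΓ hΓ' hm hy,
    RC_transform hΩ' hκ hΓκ hΩ hΓ hΓ' hm hy] at h1
  rw [NR_eq_cd hΩ' hΓ' hy, map_sub, map_sub, map_sub, h1]
  abel

end Transform

section Metric

variable {n : ℕ}

/-- The standard basis vectors. -/
abbrev ev (i : Fin n) : Euc n := EuclideanSpace.single i 1

theorem sum_ev (a : Euc n) : a = ∑ i, a i • ev i := by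
  ext j
  simp [Finset.sum_apply, Pi.single_apply]

theorem linear_ext {A : Type*} [AddCommGroup A] [Module ℝ A] {f g : Euc n → A}
    (hf : IsLinearMap ℝ f) (hg : IsLinearMap ℝ g) (h : ∀ i, f (ev i) = g (ev i)) (x : Euc n) :
    f x = g x := by
  have h1 : ∀ f : Euc n → A, IsLinearMap ℝ f → f x = ∑ i, x i • f (ev i) := by
    intro f hf
    have := map_sum (hf.mk' f) (fun i => x i • ev i) Finset.univ
    rw [← sum_ev] at this
    simpa [hf.map_smul] using this
  rw [h1 f hf, h1 g hg]
  simp [h]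

/-- The coordinate functions. -/
def pr (i : Fin n) : Euc n →L[ℝ] ℝ := EuclideanSpace.proj i

@[simp] theorem pr_apply (i : Fin n) (a : Euc n) : pr i a = a i := rfl

/-- The matrix of the metric `H`. -/
def gramL (H : Euc n → Euc n →L[ℝ] Euc n →L[ℝ] ℝ) (y : Euc n) : Matrix (Fin n) (Fin n) ℝ :=
  Matrix.of fun i j => H y (ev i) (ev j)

/-- The Christoffel symbols of the metric `H`. -/
def chrL (H : Euc n → Euc n →L[ℝ] Euc n →L[ℝ] ℝ) (y : Euc n) (k i j : Fin n) : ℝ :=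
  (1 / 2) * ∑ l, (gramL H y)⁻¹ k l *
    (fderiv ℝ (fun y' => gramL H y' j l) y (ev i) + fderiv ℝ (fun y' => gramL H y' i l) y (ev j)
      - fderiv ℝ (fun y' => gramL H y' i j) y (ev l))

/-- The Christoffel map of the metric `H`. -/
def gammaL (H : Euc n → Euc n →L[ℝ] Euc n →L[ℝ] ℝ) (y : Euc n) : Euc n →L[ℝ] Euc n →L[ℝ] Euc n :=
  ∑ k, ∑ i, ∑ j, chrL H y k i j • ContinuousLinearMap.smulRight (pr i)
    (ContinuousLinearMap.smulRight (pr j) (ev k))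

theorem gammaL_apply (H : Euc n → Euc n →L[ℝ] Euc n →L[ℝ] ℝ) (y a b : Euc n) :
    gammaL H y a b = ∑ k, (∑ i, ∑ j, chrL H y k i j * a i * b j) • ev k := by
  simp only [gammaL, sum_apply, smul_apply, ContinuousLinearMap.smulRight_apply,
    pr_apply, Finset.sum_smul, smul_smul]

theorem gammaL_ev (H : Euc n → Euc n →L[ℝ] Euc n →L[ℝ] ℝ) (y : Euc n) (i j : Fin n) :
    gammaL H y (ev i) (ev j) = ∑ k, chrL H y k i j • ev k := by
  rw [gammaL_apply]
  refine Finset.sum_congr rfl fun k _ => ?_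
  congr 1
  rw [Finset.sum_eq_single i, Finset.sum_eq_single j]
  · simp
  · intro l _ hl; simp [hl]
  · simp
  · intro l _ hl; simp [hl]
  · simp

/-- `H` is a smooth Riemannian metric on `Ω`. -/
structure IsMetricOn (Ω : Set (Euc n)) (H : Euc n → Euc n →L[ℝ] Euc n →L[ℝ] ℝ) : Prop where
  smooth : ContDiffOn ℝ ∞ H Ω
  symm : ∀ y ∈ Ω, ∀ a b, H y a b = H y b a
  pos : ∀ y ∈ Ω, ∀ a, a ≠ 0 → 0 < H y a a

/-- A determinant is a polynomial in the entries; with Cramer's rule this also gives smoothness of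
the inverse matrix. -/
theorem smooth_det {E : Type*} [NormedAddCommGroup E] [NormedSpace ℝ E] {U : Set E}
    {A : E → Matrix (Fin n) (Fin n) ℝ} (hA : ∀ i j, ContDiffOn ℝ ∞ (fun y => A y i j) U) :
    ContDiffOn ℝ ∞ (fun y => (A y).det) U := by
  simp only [Matrix.det_apply']
  exact ContDiffOn.sum fun σ _ => contDiffOn_const.mul (contDiffOn_prod fun i _ => hA _ _)

theorem smooth_inv {E : Type*} [NormedAddCommGroup E] [NormedSpace ℝ E] {U : Set E}
    {A : E → Matrix (Fin n) (Fin n) ℝ} (hA : ∀ i j, ContDiffOn ℝ ∞ (fun y => A y i j) U)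
    (h0 : ∀ y ∈ U, (A y).det ≠ 0) (i j : Fin n) :
    ContDiffOn ℝ ∞ (fun y => (A y)⁻¹ i j) U := by
  simp only [Matrix.inv_def, Ring.inverse_eq_inv', Matrix.smul_apply, smul_eq_mul,
    Matrix.adjugate_apply]
  refine ((smooth_det hA).inv h0).mul (smooth_det fun k l => ?_)
  by_cases hk : k = j
  · subst hk; simp only [Matrix.updateRow_self]; exact contDiffOn_const
  · simp only [Matrix.updateRow_ne hk]; exact hA k l

variable {Ω : Set (Euc n)} {H : Euc n → Euc n →L[ℝ] Euc n →L[ℝ] ℝ}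

theorem gramL_posDef (hH : IsMetricOn Ω H) {y : Euc n} (hy : y ∈ Ω) : (gramL H y).PosDef := by
  refine Matrix.PosDef.of_dotProduct_mulVec_pos ?_ ?_
  · ext i j
    simp [gramL, hH.symm y hy (ev j) (ev i)]
  · intro x hx
    have h1 : (WithLp.toLp 2 x : Euc n) = ∑ i, x i • ev i := sum_ev _
    have h2 : star x ⬝ᵥ (gramL H y).mulVec x = H y (WithLp.toLp 2 x) (WithLp.toLp 2 x) := by
      rw [h1]
      simp only [map_sum, map_smul, sum_apply, smul_apply, dotProduct, Matrix.mulVec, gramL,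
        Matrix.of_apply, smul_eq_mul, Finset.mul_sum]
      rw [Finset.sum_comm]
      refine Finset.sum_congr rfl fun i _ => Finset.sum_congr rfl fun j _ => ?_
      simp; ring
    rw [h2]
    exact hH.pos y hy _ (by simpa using hx)

theorem gramL_det_pos (hH : IsMetricOn Ω H) {y : Euc n} (hy : y ∈ Ω) : 0 < (gramL H y).det :=
  (gramL_posDef hH hy).det_pos

theorem gramL_smooth (hH : IsMetricOn Ω H) (i j : Fin n) :
    ContDiffOn ℝ ∞ (fun y => gramL H y i j) Ω :=
  (hH.smooth.clm_apply contDiffOn_const).clm_apply contDiffOn_const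

theorem gramL_inv_smooth (hH : IsMetricOn Ω H) (i j : Fin n) :
    ContDiffOn ℝ ∞ (fun y => (gramL H y)⁻¹ i j) Ω :=
  smooth_inv (gramL_smooth hH) (fun _ hy => (gramL_det_pos hH hy).ne') i j

theorem gramL_symm (hH : IsMetricOn Ω H) {y : Euc n} (hy : y ∈ Ω) (i j : Fin n) :
    gramL H y i j = gramL H y j i := hH.symm y hy _ _

theorem gramL_inv_symm (hH : IsMetricOn Ω H) {y : Euc n} (hy : y ∈ Ω) (i j : Fin n) :
    (gramL H y)⁻¹ i j = (gramL H y)⁻¹ j i := by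
  have h : (gramL H y).transpose = gramL H y := by
    ext i j; exact gramL_symm hH hy j i
  have := Matrix.transpose_nonsing_inv (gramL H y)
  rw [h] at this
  conv_lhs => rw [← this]
  rfl

theorem gramL_inv_mul (hH : IsMetricOn Ω H) {y : Euc n} (hy : y ∈ Ω) (i j : Fin n) :
    ∑ k, (gramL H y)⁻¹ i k * gramL H y k j = if i = j then 1 else 0 := by
  have := Matrix.nonsing_inv_mul (gramL H y) (isUnit_iff_ne_zero.mpr (gramL_det_pos hH hy).ne')
  have h2 := congrFun (congrFun this i) j
  rwa [Matrix.mul_apply, Matrix.one_apply] at h2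

theorem gammaL_smooth (hΩ : IsOpen Ω) (hH : IsMetricOn Ω H) : ContDiffOn ℝ ∞ (gammaL H) Ω := by
  have hg := fun i j k => smooth_fderiv_apply hΩ (gramL_smooth hH i j) (ev k)
  have hc : ∀ k i j, ContDiffOn ℝ ∞ (fun y => chrL H y k i j) Ω := fun k i j =>
    contDiffOn_const.mul (ContDiffOn.sum fun l _ => (gramL_inv_smooth hH k l).mul
      (((hg _ _ _).add (hg _ _ _)).sub (hg _ _ _)))
  exact ContDiffOn.sum fun k _ => ContDiffOn.sum fun i _ => ContDiffOn.sum fun j _ =>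
    (hc k i j).smul
      (contDiffOn_const (c := ContinuousLinearMap.smulRight (pr i)
        (ContinuousLinearMap.smulRight (pr j) (ev k))))

theorem chrL_smooth (hΩ : IsOpen Ω) (hH : IsMetricOn Ω H) (k i j : Fin n) :
    ContDiffOn ℝ ∞ (fun y => chrL H y k i j) Ω := by
  have hg := fun i j k => smooth_fderiv_apply hΩ (gramL_smooth hH i j) (ev k)
  exact contDiffOn_const.mul (ContDiffOn.sum fun l _ => (gramL_inv_smooth hH k l).mul
      (((hg _ _ _).add (hg _ _ _)).sub (hg _ _ _)))

theorem chrL_symm (hΩ : IsOpen Ω) (hH : IsMetricOn Ω H) {y : Euc n} (hy : y ∈ Ω) (k i j : Fin n) :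
    chrL H y k i j = chrL H y k j i := by
  simp only [chrL]
  congr 1
  refine Finset.sum_congr rfl fun l _ => ?_
  rw [fderiv_congr_on hΩ (fun z hz => gramL_symm hH hz i j) hy]
  ring

theorem gammaL_symm (hΩ : IsOpen Ω) (hH : IsMetricOn Ω H) :
    ∀ y ∈ Ω, ∀ a b, gammaL H y a b = gammaL H y b a := by
  intro y hy a b
  rw [gammaL_apply, gammaL_apply]
  refine Finset.sum_congr rfl fun k _ => ?_
  congr 1
  rw [Finset.sum_comm]
  refine Finset.sum_congr rfl fun i _ => Finset.sum_congr rfl fun j _ => ?_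
  rw [chrL_symm hΩ hH hy]; ring

/-- The Koszul formula. Both sides are linear in each vector, so basis vectors suffice, and there
the inverse Gram matrix in the Christoffel symbols cancels against the metric. -/
theorem gammaL_koszul (hΩ : IsOpen Ω) (hH : IsMetricOn Ω H) {y : Euc n} (hy : y ∈ Ω)
    (a b c : Euc n) : H y (gammaL H y a b) c =
      (1 / 2) * (fderiv ℝ H y a b c + fderiv ℝ H y b a c - fderiv ℝ H y c a b) := by
  refine linear_ext (f := fun a => H y (gammaL H y a b) c) (g := fun a =>
    (1 / 2) * (fderiv ℝ H y a b c + fderiv ℝ H y b a c - fderiv ℝ H y c a b))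
    ⟨fun x z => by simp, fun r x => by simp⟩
    ⟨fun x z => by simp; ring, fun r x => by simp; ring⟩ (fun i => ?_) a
  refine linear_ext (f := fun b => H y (gammaL H y (ev i) b) c) (g := fun b =>
    (1 / 2) * (fderiv ℝ H y (ev i) b c + fderiv ℝ H y b (ev i) c - fderiv ℝ H y c (ev i) b))
    ⟨fun x z => by simp, fun r x => by simp⟩
    ⟨fun x z => by simp; ring, fun r x => by simp; ring⟩ (fun j => ?_) b
  refine linear_ext (f := fun c => H y (gammaL H y (ev i) (ev j)) c) (g := fun c =>
    (1 / 2) * (fderiv ℝ H y (ev i) (ev j) c + fderiv ℝ H y (ev j) (ev i) c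
      - fderiv ℝ H y c (ev i) (ev j)))
    ⟨fun x z => by simp, fun r x => by simp⟩
    ⟨fun x z => by simp; ring, fun r x => by simp; ring⟩ (fun l => ?_) c
  have hd : ∀ i j k, fderiv ℝ (fun y' => gramL H y' i j) y (ev k)
      = fderiv ℝ H y (ev k) (ev i) (ev j) := by
    intro i j k
    have := fderiv_apply₂ hΩ hH.smooth (contDiffOn_const (c := ev i))
      (contDiffOn_const (c := ev j)) hy (ev k)
    simpa [gramL] using this
  simp only [gammaL_ev, map_sum, map_smul, sum_apply, smul_apply, chrL, hd, smul_eq_mul]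
  have h1 : ∀ k, H y (ev k) (ev l) = gramL H y k l := fun k => rfl
  simp only [h1, mul_assoc, ← Finset.mul_sum, Finset.sum_mul]
  congr 1
  rw [Finset.sum_comm]
  have h2 : ∀ k p, (gramL H y)⁻¹ k p * ((fderiv ℝ H y (ev i) (ev j) (ev p)
      + fderiv ℝ H y (ev j) (ev i) (ev p) - fderiv ℝ H y (ev p) (ev i) (ev j)) * gramL H y k l)
      = (fderiv ℝ H y (ev i) (ev j) (ev p)
      + fderiv ℝ H y (ev j) (ev i) (ev p) - fderiv ℝ H y (ev p) (ev i) (ev j)) *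
        ((gramL H y)⁻¹ p k * gramL H y k l) := by
    intro k p
    rw [gramL_inv_symm hH hy k p]; ring
  simp only [h2, ← Finset.mul_sum, gramL_inv_mul hH hy]
  simp

/-- Adding two instances of the Koszul formula leaves only the derivative of `H` in the direction
`a`. -/
theorem gammaL_compat (hΩ : IsOpen Ω) (hH : IsMetricOn Ω H) : Compat Ω H (gammaL H) := by
  have hsd : ∀ y ∈ Ω, ∀ x a b, fderiv ℝ H y x a b = fderiv ℝ H y x b a := by
    intro y hy x a b
    have h1 : ∀ a b, fderiv ℝ H y x a b = fderiv ℝ (fun y => H y a b) y x := by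
      intro a b
      have := fderiv_apply₂ hΩ hH.smooth (contDiffOn_const (c := a)) (contDiffOn_const (c := b)) hy x
      simpa using this.symm
    rw [h1, h1, fderiv_congr_on hΩ (fun z hz => hH.symm z hz a b) hy]
  intro y hy a b c
  rw [hH.symm y hy b, gammaL_koszul hΩ hH hy, gammaL_koszul hΩ hH hy, hsd y hy b a c,
    hsd y hy a c b]
  ring

end Metric

end CBiharmonic

end

/-! ### Charts, transition maps, tangent components, and the metric in an arbitrary chart. -/

noncomputable section

set_option linter.unusedSectionVars false
set_option synthInstance.maxHeartbeats 200000

namespace CBiharmonic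

/-! ### Coordinates -/

section Coordinates

variable {n : ℕ} {N : Type*} [TopologicalSpace N] [ChartedSpace (Euc n) N]

/-- The preferred chart at `d`, as a map to the model space. -/
abbrev xt (n : ℕ) {N : Type*} [TopologicalSpace N] [ChartedSpace (Euc n) N] (d : N) :
    PartialEquiv N (Euc n) := extChartAt (𝓡 n) d

theorem xt_source_open (d : N) : IsOpen (xt n d).source := isOpen_extChartAt_source d

theorem xt_target_open (d : N) : IsOpen (xt n d).target := isOpen_extChartAt_target d

theorem xt_cont (d : N) : ContinuousOn (xt n d) (xt n d).source := continuousOn_extChartAt d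

theorem xt_symm_cont (d : N) : ContinuousOn (xt n d).symm (xt n d).target :=
  continuousOn_extChartAt_symm d

theorem mem_chart_of_xt {d q : N} (hq : q ∈ (xt n d).source) : q ∈ (chartAt (Euc n) d).source := by
  rwa [← extChartAt_source (𝓡 n)]

/-- The transition from the chart at `d'` to the chart at `d`. -/
def kap (n : ℕ) {N : Type*} [TopologicalSpace N] [ChartedSpace (Euc n) N] (d d' : N) :
    Euc n → Euc n := fun y => xt n d ((xt n d').symm y)

/-- The domain of the transition map. -/
def kapDom (n : ℕ) {N : Type*} [TopologicalSpace N] [ChartedSpace (Euc n) N] (d d' : N) :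
    Set (Euc n) := (xt n d').target ∩ (xt n d').symm ⁻¹' (xt n d).source

theorem kapDom_open (d d' : N) : IsOpen (kapDom n d d') :=
  (xt_symm_cont d').isOpen_inter_preimage (xt_target_open d') (xt_source_open d)

theorem kap_maps {d d' : N} {y : Euc n} (hy : y ∈ kapDom n d d') :
    kap n d d' y ∈ kapDom n d' d := by
  refine ⟨(xt n d).map_source hy.2, ?_⟩
  simp only [Set.mem_preimage, kap, (xt n d).left_inv hy.2]
  exact (xt n d').map_target hy.1

theorem kap_kap {d d' : N} {y : Euc n} (hy : y ∈ kapDom n d d') :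
    kap n d' d (kap n d d' y) = y := by
  simp only [kap, (xt n d).left_inv hy.2, (xt n d').right_inv hy.1]

theorem mem_kapDom {d d' q : N} (h : q ∈ (xt n d).source) (h' : q ∈ (xt n d').source) :
    xt n d' q ∈ kapDom n d d' :=
  ⟨(xt n d').map_source h', by rwa [Set.mem_preimage, (xt n d').left_inv h']⟩

theorem kap_xt {d d' q : N} (h' : q ∈ (xt n d').source) :
    kap n d d' (xt n d' q) = xt n d q := by
  simp only [kap, (xt n d').left_inv h']

variable [IsManifold (𝓡 n) ∞ N]

theorem kap_smooth (d d' : N) : ContDiffOn ℝ ∞ (kap n d d') (kapDom n d d') := by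
  have h1 : ContMDiffOn 𝓘(ℝ, Euc n) 𝓘(ℝ, Euc n) ∞ (kap n d d') (kapDom n d d') := by
    refine ContMDiffOn.comp (t := (chartAt (Euc n) d).source)
      (contMDiffOn_extChartAt (I := 𝓡 n) (n := ∞) (x := d))
      ((contMDiffOn_extChartAt_symm (I := 𝓡 n) (n := ∞) d').mono Set.inter_subset_left) ?_
    intro y hy
    exact mem_chart_of_xt hy.2
  exact h1.contDiffOn

/-- The components of a tangent vector in the chart at `d`. -/
def tc (d q : N) : TangentSpace (𝓡 n) q →L[ℝ] Euc n :=
  (trivializationAt (Euc n) (TangentSpace (𝓡 n) : N → Type _) d).continuousLinearMapAt ℝ q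

/-- The tangent vector with given components in the chart at `d`. -/
def fm (d q : N) : Euc n →L[ℝ] TangentSpace (𝓡 n) q :=
  (trivializationAt (Euc n) (TangentSpace (𝓡 n) : N → Type _) d).symmL ℝ q

theorem mem_base {d q : N} (hq : q ∈ (xt n d).source) :
    q ∈ (trivializationAt (Euc n) (TangentSpace (𝓡 n) : N → Type _) d).baseSet := by
  rw [TangentBundle.trivializationAt_baseSet]; exact mem_chart_of_xt hq

theorem tc_fm {d q : N} (hq : q ∈ (xt n d).source) (v : Euc n) : tc d q (fm d q v) = v :=
  Trivialization.continuousLinearMapAt_symmL _ (mem_base hq) v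

theorem fm_tc {d q : N} (hq : q ∈ (xt n d).source) (v : TangentSpace (𝓡 n) q) :
    fm d q (tc d q v) = v :=
  Trivialization.symmL_continuousLinearMapAt _ (mem_base hq) v

theorem tc_inj {d q : N} (hq : q ∈ (xt n d).source) {v w : TangentSpace (𝓡 n) q}
    (h : tc d q v = tc d q w) : v = w := by
  rw [← fm_tc hq v, h, fm_tc hq]

theorem mem_xt (q : N) : q ∈ (xt n q).source := mem_extChartAt_source q

theorem tc_eq_mfderiv {d q : N} (hq : q ∈ (xt n d).source) :
    tc d q = mfderiv (𝓡 n) 𝓘(ℝ, Euc n) (xt n d) q :=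
  TangentBundle.continuousLinearMapAt_trivializationAt (mem_chart_of_xt hq)

theorem tc_basisVec (q : N) (i : Fin n) : tc q q (basisVec q i) = ev i := by
  rw [tc_eq_mfderiv (mem_xt q), mfderiv_extChartAt_self]; rfl

theorem basisVec_eq (q : N) (i : Fin n) : basisVec q i = fm q q (ev i) :=
  tc_inj (mem_xt q) (by rw [tc_basisVec, tc_fm (mem_xt q)])

theorem coord_eq {q : N} (v : TangentSpace (𝓡 n) q) (i : Fin n) : coord v i = tc q q v i := by
  rw [tc_eq_mfderiv (mem_xt q), mfderiv_extChartAt_self]; rfl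

theorem triv_snd {d q : N} (hq : q ∈ (xt n d).source) (v : TangentSpace (𝓡 n) q) :
    (trivializationAt (Euc n) (TangentSpace (𝓡 n) : N → Type _) d ⟨q, v⟩).2 = tc d q v := by
  rw [tc, Trivialization.continuousLinearMapAt_apply, Trivialization.linearMapAt_apply,
    if_pos (mem_base hq)]

theorem coordField_eq (d : N) (v : TangentSpace (𝓡 n) d) (q : N) :
    coordField d v q = fm d q (tc d d v) := by
  rw [tc_eq_mfderiv (mem_xt d), mfderiv_extChartAt_self]; rfl

theorem coordField_self (d : N) (v : TangentSpace (𝓡 n) d) : coordField d v d = v := by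
  rw [coordField_eq, fm_tc (mem_xt d)]

/-- Only the chart expression of `f` near the point must be smooth. This covers functions such as
Gram entries, which are controlled only inside one chart. -/
theorem mfderiv_xt {V : Type*} [NormedAddCommGroup V] [NormedSpace ℝ V] {f : N → V} {c q : N}
    (hq : q ∈ (xt n c).source) (hf : ContDiffAt ℝ ∞ (fun x => f ((xt n c).symm x)) (xt n c q))
    (v : TangentSpace (𝓡 n) q) :
    (mfderiv (𝓡 n) 𝓘(ℝ, V) f q v : V) =
      fderiv ℝ (fun x => f ((xt n c).symm x)) (xt n c q) (tc c q v) := by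
  have h1 : f =ᶠ[nhds q] (fun x => f ((xt n c).symm x)) ∘ (xt n c) := by
    filter_upwards [(xt_source_open c).mem_nhds hq] with p hp
    rw [Function.comp_apply, (xt n c).left_inv hp]
  have h2 : MDifferentiableAt 𝓘(ℝ, Euc n) 𝓘(ℝ, V) (fun x => f ((xt n c).symm x)) (xt n c q) :=
    (hf.differentiableAt (by simp)).mdifferentiableAt
  have h3 : MDifferentiableAt (𝓡 n) 𝓘(ℝ, Euc n) (xt n c) q :=
    mdifferentiableAt_extChartAt (mem_chart_of_xt hq)
  rw [h1.mfderiv_eq, mfderiv_comp q h2 h3, mfderiv_eq_fderiv, tc_eq_mfderiv hq]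
  rfl

/-- Trivialisations of the tangent bundle are differentials of charts, so components transform by
the differential of the transition map. -/
theorem tc_kap {d d' q : N} (h : q ∈ (xt n d).source) (h' : q ∈ (xt n d').source)
    (v : TangentSpace (𝓡 n) q) :
    tc d q v = fderiv ℝ (kap n d d') (xt n d' q) (tc d' q v) := by
  rw [tc_eq_mfderiv h]
  exact mfderiv_xt h' ((kap_smooth d d').contDiffAt
    ((kapDom_open d d').mem_nhds (mem_kapDom h h'))) v

theorem fderiv_kap_surjective {d d' : N} {y : Euc n} (hy : y ∈ kapDom n d d') :
    Function.Surjective (fderiv ℝ (kap n d d') y) := by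
  intro v
  set q := (xt n d').symm y
  have h' : q ∈ (xt n d').source := (xt n d').map_target hy.1
  refine ⟨tc d' q (fm d q v), ?_⟩
  have := tc_kap hy.2 h' (fm d q v)
  rw [(xt n d').right_inv hy.1] at this
  rw [← this, tc_fm hy.2]

/-! ### The metric in coordinates -/

/-- The metric `h`, in the chart at `d`. -/
def metL (h : Metric n N) (d : N) (y : Euc n) : Euc n →L[ℝ] Euc n →L[ℝ] ℝ :=
  (ContinuousLinearMap.precomp ℝ (fm d ((xt n d).symm y))).comp
    ((h.inner ((xt n d).symm y)).comp (fm d ((xt n d).symm y)))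

theorem metL_apply (h : Metric n N) (d : N) (y a b : Euc n) :
    metL h d y a b = h.inner ((xt n d).symm y) (fm d ((xt n d).symm y) a)
      (fm d ((xt n d).symm y) b) := rfl

theorem inner_eq (h : Metric n N) {d q : N} (hq : q ∈ (xt n d).source)
    (v w : TangentSpace (𝓡 n) q) :
    h.inner q v w = metL h d (xt n d q) (tc d q v) (tc d q w) := by
  rw [metL_apply, (xt n d).left_inv hq, fm_tc hq, fm_tc hq]

theorem fm_smooth (d : N) (a : Euc n) :
    ContMDiffOn (𝓡 n) (𝓡 n).tangent ∞
      (fun q => (⟨q, fm d q a⟩ : TangentBundle (𝓡 n) N)) (xt n d).source := by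
  have hb : (xt n d).source ⊆
      (trivializationAt (Euc n) (TangentSpace (𝓡 n) : N → Type _) d).baseSet :=
    fun q hq => mem_base hq
  refine (Trivialization.contMDiffOn_section_iff (IB := 𝓡 n) (n := ∞)
    (s := fun q : N => fm d q a)
    (trivializationAt (Euc n) (TangentSpace (𝓡 n) : N → Type _) d) (xt_source_open d) hb).mpr ?_
  refine contMDiffOn_const (c := a) |>.congr fun q hq => ?_
  rw [triv_snd hq, tc_fm hq]

theorem metL_metric (h : Metric n N) (d : N) : IsMetricOn (xt n d).target (metL h d) where
  smooth := by
    rw [contDiffOn_clm_apply]; intro a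
    rw [contDiffOn_clm_apply]; intro b
    -- The bundle metric is evaluated on the smooth frame fields of the chart; matrix entries
    -- suffice in finite dimension.
    have h1 : ContMDiffOn (𝓡 n) ((𝓡 n).prod 𝓘(ℝ, ℝ)) ∞
        (fun q => TotalSpace.mk' ℝ (E := Bundle.Trivial N ℝ) q
          (h.inner q (fm d q a) (fm d q b))) (xt n d).source :=
      ContMDiffOn.clm_bundle_apply₂ (F₁ := Euc n) (F₂ := Euc n)
        h.contMDiff.contMDiffOn (fm_smooth d a) (fm_smooth d b)
    have h2 : ContMDiffOn (𝓡 n) 𝓘(ℝ, ℝ) ∞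
        (fun q => h.inner q (fm d q a) (fm d q b)) (xt n d).source := by
      intro q hq
      have := h1 q hq
      rw [contMDiffWithinAt_totalSpace] at this
      exact this.2
    have h3 := h2.comp (contMDiffOn_extChartAt_symm (I := 𝓡 n) (n := ∞) d)
      (fun y hy => (xt n d).map_target hy)
    exact h3.contDiffOn
  symm y _ a b := h.symm _ _ _
  pos y hy a ha := by
    refine h.pos _ _ fun h0 => ha ?_
    have h1 : fm d ((xt n d).symm y) a = 0 := h0
    rw [← tc_fm ((xt n d).map_target hy) a, h1, map_zero]

/-- The Christoffel map of `h` in the chart at `d`. -/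
abbrev gam (h : Metric n N) (d : N) : Euc n → Euc n →L[ℝ] Euc n →L[ℝ] Euc n := gammaL (metL h d)

theorem gam_smooth (h : Metric n N) (d : N) : ContDiffOn ℝ ∞ (gam h d) (xt n d).target :=
  gammaL_smooth (xt_target_open d) (metL_metric h d)

theorem gam_symm (h : Metric n N) (d : N) :
    ∀ y ∈ (xt n d).target, ∀ a b, gam h d y a b = gam h d y b a :=
  gammaL_symm (xt_target_open d) (metL_metric h d)

theorem gam_compat (h : Metric n N) (d : N) : Compat (xt n d).target (metL h d) (gam h d) :=
  gammaL_compat (xt_target_open d) (metL_metric h d)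

theorem kapDom_subset (d d' : N) : kapDom n d d' ⊆ (xt n d').target := Set.inter_subset_left

theorem metL_kap (h : Metric n N) {d d' : N} {y : Euc n} (hy : y ∈ kapDom n d d') (a b : Euc n) :
    metL h d' y a b = metL h d (kap n d d' y) (fderiv ℝ (kap n d d') y a)
      (fderiv ℝ (kap n d d') y b) := by
  have h' : (xt n d').symm y ∈ (xt n d').source := (xt n d').map_target hy.1
  have h1 := fun v => tc_kap (n := n) hy.2 h' v
  rw [(xt n d').right_inv hy.1] at h1
  rw [metL_apply, inner_eq h hy.2, h1, h1, tc_fm h', tc_fm h']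
  rfl

/-- Transition maps are isometries between the coordinate expressions of one metric, so the
uniqueness of the Levi-Civita connection gives the transformation law of Christoffel symbols without
computing them. -/
theorem gam_kap (h : Metric n N) (d d' : N) : ∀ y ∈ kapDom n d d', ∀ a b,
    cd (gam h d) (kap n d d') (fun y => fderiv ℝ (kap n d d') y b) a y
      = fderiv ℝ (kap n d d') y (gam h d' y a b) := by
  intro y hy a b
  have hsub := kapDom_subset (n := n) d d'
  have hm := metL_metric h d
  exact gamma_transform (kapDom_open d d') (xt_target_open d) (gam_symm h d)
    (fun y hy => gam_symm h d' y (hsub hy)) hm.smooth hm.symm hm.pos (gam_compat h d)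
    ((metL_metric h d').smooth.mono hsub) (fun y hy => gam_compat h d' y (hsub hy))
    (kap_smooth d d') (fun y hy => (kap_maps hy).1) (fun y hy => fderiv_kap_surjective hy)
    (fun y hy => metL_kap h hy) hy a b

theorem gram_eq (h : Metric n N) {d q : N} (hq : q ∈ (xt n d).source) :
    gram h d q = gramL (metL h d) (xt n d q) := by
  ext i j
  simp only [gram, gramL, Matrix.of_apply]
  rw [metL_apply, (xt n d).left_inv hq, coordField_eq, coordField_eq, tc_basisVec, tc_basisVec]

theorem dfun_gram (h : Metric n N) (y : N) (j l i : Fin n) :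
    dfun (fun y' => gram h y y' j l) y (basisVec y i) =
      fderiv ℝ (fun y' => gramL (metL h y) y' j l) (xt n y y) (ev i) := by
  have hty := (xt n y).map_source (mem_xt y)
  have hopen := xt_target_open (n := n) y
  have h1 : ∀ x ∈ (xt n y).target,
      gram h y ((xt n y).symm x) j l = gramL (metL h y) x j l := by
    intro x hx
    rw [gram_eq h ((xt n y).map_target hx), (xt n y).right_inv hx]
  have h2 : ContDiffAt ℝ ∞ (fun x => gram h y ((xt n y).symm x) j l) (xt n y y) :=
    ((gramL_smooth (metL_metric h y) j l).congr h1).contDiffAt (hopen.mem_nhds hty)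
  rw [dfun]
  have h3 := mfderiv_xt (f := fun y' => gram h y y' j l) (mem_xt y) h2 (basisVec y i)
  rw [fderiv_congr_on hopen h1 hty, tc_basisVec] at h3
  exact h3

theorem gramInv_self (h : Metric n N) (q : N) : gramInv h q = (gramL (metL h q) (xt n q q))⁻¹ := by
  rw [gramInv, gram_eq h (mem_xt q)]

theorem christoffel_eq (h : Metric n N) (y : N) (k i j : Fin n) :
    christoffel h y k i j = chrL (metL h y) (xt n y y) k i j := by
  simp only [christoffel, chrL, gramInv_self, dfun_gram]

theorem christoffelMap_eq (h : Metric n N) (y : N) (u w : TangentSpace (𝓡 n) y) :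
    tc y y (christoffelMap h y u w) = gam h y (xt n y y) (tc y y u) (tc y y w) := by
  rw [gammaL_apply]
  simp only [christoffelMap, christoffel_eq, map_sum, map_smul, tc_basisVec, coord_eq]

end Coordinates

end CBiharmonic

end

/-! ### Maps and sections in two charts; chart independence of the pull-back connection. -/

noncomputable section

set_option linter.unusedSectionVars false
set_option synthInstance.maxHeartbeats 200000

namespace CBiharmonic

section Maps

variable {m n : ℕ}
  {M : Type*} [TopologicalSpace M] [ChartedSpace (Euc m) M] [IsManifold (𝓡 m) ∞ M]
  {N : Type*} [TopologicalSpace N] [ChartedSpace (Euc n) N] [IsManifold (𝓡 n) ∞ N]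

/-! ### Maps and sections in coordinates -/

/-- The map `φ` in the charts at `c` and `d`. -/
def mloc (m n : ℕ) {M : Type*} [TopologicalSpace M] [ChartedSpace (Euc m) M]
    {N : Type*} [TopologicalSpace N] [ChartedSpace (Euc n) N] (c : M) (d : N) (φ : M → N) (x : Euc m) : Euc n := xt n d (φ ((xt m c).symm x))

/-- The domain of the expression of `φ` in the charts at `c` and `d`. -/
def dom (m n : ℕ) {M : Type*} [TopologicalSpace M] [ChartedSpace (Euc m) M]
    {N : Type*} [TopologicalSpace N] [ChartedSpace (Euc n) N] (c : M) (d : N) (φ : M → N) : Set (Euc m) :=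
  (xt m c).target ∩ (xt m c).symm ⁻¹' (φ ⁻¹' (xt n d).source)

/-- The components of a section of `φ⁻¹TN` in the charts at `c` and `d`. -/
def sloc (m : ℕ) {M : Type*} [TopologicalSpace M] [ChartedSpace (Euc m) M] (c : M) (d : N) (φ : M → N) (W : ∀ q : M, TangentSpace (𝓡 n) (φ q)) (x : Euc m) : Euc n :=
  tc d (φ ((xt m c).symm x)) (W ((xt m c).symm x))

variable {φ : M → N} {c : M} {d : N}

theorem dom_open (hφ : Continuous φ) : IsOpen (dom m n c d φ) :=
  (xt_symm_cont c).isOpen_inter_preimage (xt_target_open c) ((xt_source_open d).preimage hφ)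

theorem dom_subset : dom m n c d φ ⊆ (xt m c).target := Set.inter_subset_left

theorem mem_dom {q : M} (hq : q ∈ (xt m c).source) (hd : φ q ∈ (xt n d).source) :
    xt m c q ∈ dom m n c d φ :=
  ⟨(xt m c).map_source hq, by simpa only [Set.mem_preimage, (xt m c).left_inv hq] using hd⟩

theorem mloc_maps {x : Euc m} (hx : x ∈ dom m n c d φ) : mloc m n c d φ x ∈ (xt n d).target :=
  (xt n d).map_source hx.2

theorem mloc_xt {q : M} (hq : q ∈ (xt m c).source) : mloc m n c d φ (xt m c q) = xt n d (φ q) := by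
  rw [mloc, (xt m c).left_inv hq]

theorem sloc_xt {q : M} (hq : q ∈ (xt m c).source) (W : ∀ q : M, TangentSpace (𝓡 n) (φ q)) :
    sloc m c d φ W (xt m c q) = tc d (φ q) (W q) := by
  rw [sloc, (xt m c).left_inv hq]

theorem mloc_smooth (hφ : ContMDiff (𝓡 m) (𝓡 n) ∞ φ) :
    ContDiffOn ℝ ∞ (mloc m n c d φ) (dom m n c d φ) := by
  have h1 : ContMDiffOn 𝓘(ℝ, Euc m) 𝓘(ℝ, Euc n) ∞ (mloc m n c d φ) (dom m n c d φ) := by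
    refine ContMDiffOn.comp (t := (chartAt (Euc n) d).source)
      (contMDiffOn_extChartAt (I := 𝓡 n) (n := ∞) (x := d))
      (hφ.comp_contMDiffOn
      ((contMDiffOn_extChartAt_symm (I := 𝓡 m) (n := ∞) c).mono Set.inter_subset_left)) ?_
    intro y hy
    exact mem_chart_of_xt hy.2
  exact h1.contDiffOn

theorem sloc_smooth {W : ∀ q : M, TangentSpace (𝓡 n) (φ q)}
    (hW : IsSmoothSection m φ W) : ContDiffOn ℝ ∞ (sloc m c d φ W) (dom m n c d φ) := by
  have h1 : ContMDiffOn 𝓘(ℝ, Euc m) 𝓘(ℝ, Euc n) ∞ (sloc m c d φ W) (dom m n c d φ) := by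
    have h2 : ContMDiffOn 𝓘(ℝ, Euc m) (𝓡 n).tangent ∞
        (fun x => (⟨φ ((xt m c).symm x), W ((xt m c).symm x)⟩ : TangentBundle (𝓡 n) N))
        (dom m n c d φ) :=
      hW.comp_contMDiffOn
        ((contMDiffOn_extChartAt_symm (I := 𝓡 m) (n := ∞) c).mono Set.inter_subset_left)
    have h3 := (Trivialization.contMDiffOn_iff (IM := 𝓘(ℝ, Euc m)) (IB := 𝓡 n) (n := ∞)
      (e := trivializationAt (Euc n) (TangentSpace (𝓡 n) : N → Type _) d)
      (f := fun x => (⟨φ ((xt m c).symm x), W ((xt m c).symm x)⟩ : TangentBundle (𝓡 n) N))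
      (s := dom m n c d φ) (fun x hx => by
        rw [Trivialization.mem_source]; exact mem_base hx.2)).mp h2
    exact h3.2.congr fun x hx => (triv_snd hx.2 _).symm
  exact h1.contDiffOn

theorem isSmoothSection_of_sloc (hφ : ContMDiff (𝓡 m) (𝓡 n) ∞ φ)
    {W : ∀ q : M, TangentSpace (𝓡 n) (φ q)}
    (hW : ∀ c d, ContDiffOn ℝ ∞ (sloc m c d φ W) (dom m n c d φ)) : IsSmoothSection m φ W := by
  intro q
  refine (Trivialization.contMDiffAt_iff (IM := 𝓡 m) (IB := 𝓡 n) (n := ∞)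
      (e := trivializationAt (Euc n) (TangentSpace (𝓡 n) : N → Type _) (φ q))
      (f := fun p => (⟨φ p, W p⟩ : TangentBundle (𝓡 n) N)) (by
        rw [Trivialization.mem_source]; exact mem_base (mem_xt _))).mpr ⟨hφ q, ?_⟩
  have h1 : ContMDiffAt 𝓘(ℝ, Euc m) 𝓘(ℝ, Euc n) ∞ (sloc m q (φ q) φ W) (xt m q q) :=
    ((hW q (φ q)).contDiffAt ((dom_open hφ.continuous).mem_nhds
      (mem_dom (mem_xt q) (mem_xt _)))).contMDiffAt
  have h2 := h1.comp q (contMDiffAt_extChartAt (I := 𝓡 m) (n := ∞) (x := q))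
  refine h2.congr_of_eventuallyEq ?_
  filter_upwards [(xt_source_open (n := m) q).mem_nhds (mem_xt q),
    hφ.continuous.continuousAt.preimage_mem_nhds ((xt_source_open (n := n) (φ q)).mem_nhds (mem_xt _))]
    with p hp hp'
  rw [Function.comp_apply, sloc_xt hp, triv_snd hp']

theorem tc_dmap (hφ : ContMDiff (𝓡 m) (𝓡 n) ∞ φ) {q : M} (hq : q ∈ (xt m c).source)
    (hd : φ q ∈ (xt n d).source) (v : TangentSpace (𝓡 m) q) :
    tc d (φ q) (dmap φ q v) = fderiv ℝ (mloc m n c d φ) (xt m c q) (tc c q v) := by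
  have h1 := mfderiv_xt (f := fun p => xt n d (φ p)) hq ((mloc_smooth hφ).contDiffAt
    ((dom_open hφ.continuous).mem_nhds (mem_dom hq hd))) v
  have h2 := mfderiv_comp q (I := 𝓡 m) (I' := 𝓡 n) (I'' := 𝓘(ℝ, Euc n)) (g := xt n d) (f := φ)
    (mdifferentiableAt_extChartAt (mem_chart_of_xt hd)) (hφ.mdifferentiableAt (by simp))
  have h3 : mfderiv (𝓡 m) 𝓘(ℝ, Euc n) (fun p => xt n d (φ p)) q v =
      mfderiv (𝓡 n) 𝓘(ℝ, Euc n) (xt n d) (φ q) (mfderiv (𝓡 m) (𝓡 n) φ q v) := by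
    exact congrArg (fun T => T v) h2
  rw [tc_eq_mfderiv hd]
  exact h3.symm.trans h1

theorem sloc_kap {d d' : N} {W : ∀ q : M, TangentSpace (𝓡 n) (φ q)} {x : Euc m}
    (hx : x ∈ dom m n c d φ) (hx' : x ∈ dom m n c d' φ) :
    sloc m c d φ W x = fderiv ℝ (kap n d d') (mloc m n c d' φ x) (sloc m c d' φ W x) :=
  tc_kap hx.2 hx'.2 _

theorem mloc_kap {d d' : N} {x : Euc m} (hx' : x ∈ dom m n c d' φ) :
    mloc m n c d φ x = kap n d d' (mloc m n c d' φ x) :=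
  (kap_xt hx'.2).symm

theorem sloc_smooth_kap (hφ : ContMDiff (𝓡 m) (𝓡 n) ∞ φ) {d d' : N} {S : Set (Euc m)}
    (hS : S ⊆ dom m n c d' φ) {W : ∀ q : M, TangentSpace (𝓡 n) (φ q)}
    (hW : ContDiffOn ℝ ∞ (sloc m c d' φ W) S) :
    ContDiffOn ℝ ∞ (sloc m c d φ W) (dom m n c d φ ∩ S) := by
  have h1 : ContDiffOn ℝ ∞ (fun x => fderiv ℝ (kap n d d') (mloc m n c d' φ x) (sloc m c d' φ W x))
      (dom m n c d φ ∩ S) := by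
    refine ContDiffOn.clm_apply ?_ (hW.mono Set.inter_subset_right)
    refine (smooth_fderiv (kapDom_open d d') (kap_smooth d d')).comp
      ((mloc_smooth hφ).mono fun x hx => hS hx.2) fun x hx => mem_kapDom hx.1.2 (hS hx.2).2
  exact h1.congr fun x hx => sloc_kap hx.1 (hS hx.2)

/-- The definition uses the preferred chart at `φ q`; `cd_transform` carries it to any other chart.
Smoothness is asked only on an open set `S`, since coordinate fields are smooth only inside the
domain of their own chart. -/
theorem tc_covAlong_of (h : Metric n N) (hφ : ContMDiff (𝓡 m) (𝓡 n) ∞ φ)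
    {W : ∀ q : M, TangentSpace (𝓡 n) (φ q)}
    {S : Set (Euc m)} (hSo : IsOpen S) (hS : S ⊆ dom m n c d φ)
    (hW : ContDiffOn ℝ ∞ (sloc m c d φ W) S) {q : M} (hqS : xt m c q ∈ S) (hq : q ∈ (xt m c).source)
    (hd : φ q ∈ (xt n d).source) (v : TangentSpace (𝓡 m) q) :
    tc d (φ q) (covAlong h φ W q v) =
      cd (gam h d) (mloc m n c d φ) (sloc m c d φ W) (tc c q v) (xt m c q) := by
  set d' := φ q with hd'
  set U := dom m n c d' φ ∩ S with hU
  have hUo : IsOpen U := (dom_open hφ.continuous).inter hSo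
  have hqU : xt m c q ∈ U := ⟨mem_dom hq (mem_xt _), hqS⟩
  have hW' : ContDiffOn ℝ ∞ (sloc m c d' φ W) U := sloc_smooth_kap hφ hS hW
  -- In the preferred chart at `φ q` the definition is literally the local formula.
  have h1 : tc d' (φ q) (covAlong h φ W q v) =
      cd (gam h d') (mloc m n c d' φ) (sloc m c d' φ W) (tc c q v) (xt m c q) := by
    have h0 : tc d' (φ q) (componentDeriv φ W q v) =
      fderiv ℝ (sloc m c d' φ W) (xt m c q) (tc c q v) := by
      have hnb := hUo.mem_nhds hqU
      have h0 : (fun p => (trivializationAt (Euc n) (TangentSpace (𝓡 n) : N → Type _) (φ q)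
          ⟨φ p, W p⟩).2) =ᶠ[nhds q] fun p => tc (n := n) (φ q) (φ p) (W p) := by
        filter_upwards [hφ.continuous.continuousAt.preimage_mem_nhds
          ((xt_source_open (n := n) (φ q)).mem_nhds (mem_xt _))] with p hp'
        rw [triv_snd hp']
      have h1 := mfderiv_xt (f := fun p => tc (n := n) (φ q) (φ p) (W p)) hq (hW'.contDiffAt hnb) v
      rw [← h0.mfderiv_eq] at h1
      rw [tc_eq_mfderiv (mem_xt (φ q)), mfderiv_extChartAt_self]
      exact h1
    rw [covAlong, map_add, h0, christoffelMap_eq, cd, mloc_xt hq, sloc_xt hq,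
      tc_dmap hφ hq (mem_xt _)]
  have h2 := cd_transform (Γ := gam h d) (Γ' := gam h d') (kapDom_open d d') (kap_smooth d d')
    (gam_kap h d d') hUo
    (u := mloc m n c d' φ) (w := sloc m c d' φ W) ((mloc_smooth hφ).mono Set.inter_subset_left)
    (fun x hx => mem_kapDom (hS hx.2).2 hx.1.2) hW' hqU (tc c q v)
  rw [tc_kap hd (mem_xt (φ q)), h1, ← mloc_xt hq, ← h2]
  exact cd_congr_map hUo (fun x hx => (mloc_kap hx.1).symm)
    (fun x hx => (sloc_kap (hS hx.2) hx.1).symm) hqU _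

theorem tc_covAlong (h : Metric n N) (hφ : ContMDiff (𝓡 m) (𝓡 n) ∞ φ)
    {W : ∀ q : M, TangentSpace (𝓡 n) (φ q)}
    (hW : ContDiffOn ℝ ∞ (sloc m c d φ W) (dom m n c d φ)) {q : M} (hq : q ∈ (xt m c).source)
    (hd : φ q ∈ (xt n d).source) (v : TangentSpace (𝓡 m) q) :
    tc d (φ q) (covAlong h φ W q v) =
      cd (gam h d) (mloc m n c d φ) (sloc m c d φ W) (tc c q v) (xt m c q) :=
  tc_covAlong_of h hφ (dom_open hφ.continuous) subset_rfl hW (mem_dom hq hd) hq hd v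

theorem dom_id (c : M) : dom m m c c (id : M → M) = (xt m c).target := by
  ext x
  exact ⟨fun h => h.1, fun h => ⟨h, (xt m c).map_target h⟩⟩

theorem mloc_id {c : M} {x : Euc m} (hx : x ∈ (xt m c).target) : mloc m m c c (id : M → M) x = x :=
  (xt m c).right_inv hx

/-- The components of a vector field in the chart at `c`. -/
abbrev vloc (c : M) (X : ∀ q : M, TangentSpace (𝓡 m) q) : Euc m → Euc m := sloc m c c (id : M → M) X

/-- A vector field is a section along the identity map, whose expression in one chart is the
identity. -/
theorem tc_leviCivita (g : Metric m M) {X : ∀ q : M, TangentSpace (𝓡 m) q}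
    (hX : ContDiffOn ℝ ∞ (vloc c X) (xt m c).target) {q : M} (hq : q ∈ (xt m c).source)
    (v : TangentSpace (𝓡 m) q) :
    tc c q (leviCivita g X q v) =
      cd (gam g c) (fun x => x) (vloc c X) (tc c q v) (xt m c q) := by
  have h1 := tc_covAlong (c := c) (d := c) g (φ := (id : M → M)) contMDiff_id (W := X)
    (by rwa [dom_id]) hq hq v
  rw [cd_congr_map (xt_target_open c) (fun x hx => mloc_id hx) (fun x _ => rfl)
    ((xt m c).map_source hq)] at h1
  exact h1

end Maps

end CBiharmonic

end

/-! ### Traces, curvature, Ricci and scalar curvature in an arbitrary chart. -/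

noncomputable section

set_option linter.unusedSectionVars false
set_option synthInstance.maxHeartbeats 200000

namespace CBiharmonic

section Tensors

variable {m : ℕ} {M : Type*} [TopologicalSpace M] [ChartedSpace (Euc m) M] [IsManifold (𝓡 m) ∞ M]

/-! ### Traces in coordinates -/

/-- A map of two variables which is linear in each of them. -/
structure IsBilin {A : Type*} [AddCommGroup A] [Module ℝ A] (b : Euc m → Euc m → A) : Prop where
  left : ∀ y, IsLinearMap ℝ fun x => b x y
  right : ∀ x, IsLinearMap ℝ fun y => b x y

theorem IsBilin.expand {A : Type*} [AddCommGroup A] [Module ℝ A] {b : Euc m → Euc m → A}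
    (hb : IsBilin b) (x y : Euc m) : b x y = ∑ i, ∑ j, (x i * y j) • b (ev i) (ev j) := by
  have h1 : b x y = ∑ i, x i • b (ev i) y := by
    have := map_sum ((hb.left y).mk' _) (fun i => x i • ev i) Finset.univ
    rw [← sum_ev] at this
    simpa [(hb.left y).map_smul] using this
  have h2 : ∀ z, b z y = ∑ j, y j • b z (ev j) := by
    intro z
    have := map_sum ((hb.right z).mk' _) (fun i => y i • ev i) Finset.univ
    rw [← sum_ev] at this
    simpa [(hb.right z).map_smul] using this
  rw [h1]
  refine Finset.sum_congr rfl fun i _ => ?_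
  rw [h2, Finset.smul_sum]
  simp only [smul_smul]

/-- Independence of the basis: if `P` has the new basis as columns, the Gram matrix becomes `Pᵀ G
P`, hence `P G'⁻¹ Pᵀ = G⁻¹`. -/
theorem trace_change {A : Type*} [AddCommGroup A] [Module ℝ A] {b : Euc m → Euc m → A}
    (hb : IsBilin b) {G G' : Matrix (Fin m) (Fin m) ℝ} {f : Fin m → Euc m} (hG : G'.det ≠ 0)
    (hf : ∀ i j, G' i j = ∑ k, ∑ l, f i k * f j l * G k l) :
    ∑ i, ∑ j, G'⁻¹ i j • b (f i) (f j) = ∑ i, ∑ j, G⁻¹ i j • b (ev i) (ev j) := by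
  set P : Matrix (Fin m) (Fin m) ℝ := Matrix.of fun k i => f i k with hP
  have h1 : G' = P.transpose * G * P := by
    ext i j
    rw [hf]
    simp only [Matrix.mul_apply, Finset.sum_mul, Matrix.transpose_apply, hP, Matrix.of_apply]
    rw [Finset.sum_comm]
    refine Finset.sum_congr rfl fun k _ => Finset.sum_congr rfl fun l _ => ?_
    ring
  -- The `f i` are not assumed to be a basis; this follows from `det G' ≠ 0`.
  have hPd : IsUnit P.det := by
    rw [isUnit_iff_ne_zero]
    intro h0
    apply hG
    rw [h1, Matrix.det_mul, h0, mul_zero]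
  have h2 : P * G'⁻¹ * P.transpose = G⁻¹ := by
    have hPt : IsUnit P.transpose.det := by rwa [Matrix.det_transpose]
    rw [h1, Matrix.mul_inv_rev, Matrix.mul_inv_rev, ← Matrix.mul_assoc, Matrix.mul_nonsing_inv _ hPd,
      Matrix.one_mul, Matrix.mul_assoc, Matrix.nonsing_inv_mul _ hPt, Matrix.mul_one]
  have h3 : ∀ k l, G⁻¹ k l = ∑ i, ∑ j, G'⁻¹ i j * (f i k * f j l) := by
    intro k l
    rw [← h2]
    simp only [Matrix.mul_apply, Finset.sum_mul, Matrix.transpose_apply, hP, Matrix.of_apply]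
    rw [Finset.sum_comm]
    refine Finset.sum_congr rfl fun k _ => Finset.sum_congr rfl fun l _ => ?_
    ring
  simp only [h3, Finset.sum_smul, hb.expand (f _) (f _), Finset.smul_sum, smul_smul]
  conv_lhs => enter [2, i]; rw [Finset.sum_comm]
  rw [Finset.sum_comm]
  refine Finset.sum_congr rfl fun k _ => ?_
  conv_lhs => enter [2, i]; rw [Finset.sum_comm]
  rw [Finset.sum_comm]

variable {c : M}

/-- The coefficients `g^ij` in the chart at `c`. -/
def gInv (g : Metric m M) (c : M) (i j : Fin m) (x : Euc m) : ℝ := (gramL (metL g c) x)⁻¹ i j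

theorem gInv_smooth (g : Metric m M) (c : M) (i j : Fin m) :
    ContDiffOn ℝ ∞ (gInv g c i j) (xt m c).target :=
  gramL_inv_smooth (metL_metric g c) i j

theorem gInv_symm (g : Metric m M) {x : Euc m} (hx : x ∈ (xt m c).target) (i j : Fin m) :
    gInv g c i j x = gInv g c j i x := gramL_inv_symm (metL_metric g c) hx i j

/-- The linear map `ℓ` lets one statement serve scalar traces (the identity) and vector-valued
traces (components in a chart). -/
theorem trace_eq (g : Metric m M) {A A' : Type*} [AddCommGroup A] [Module ℝ A]
    [AddCommGroup A'] [Module ℝ A'] (ℓ : A →ₗ[ℝ] A') {q : M} (hq : q ∈ (xt m c).source)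
    {B : TangentSpace (𝓡 m) q → TangentSpace (𝓡 m) q → A} {b : Euc m → Euc m → A'}
    (hb : IsBilin b) (hB : ∀ u v, ℓ (B u v) = b (tc c q u) (tc c q v)) :
    ℓ (trace g q B) = ∑ i, ∑ j, gInv g c i j (xt m c q) • b (ev i) (ev j) := by
  have h1 : ℓ (trace g q B) = ∑ i, ∑ j, (gram g q q)⁻¹ i j •
      b (tc c q (basisVec q i)) (tc c q (basisVec q j)) := by
    simp only [trace, map_sum, map_smul, hB, gramInv]
  have hx := (xt m c).map_source hq
  rw [h1]
  refine trace_change hb ?_ ?_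
  · rw [gram_eq g (mem_xt q)]
    exact (gramL_det_pos (metL_metric g q) ((xt m q).map_source (mem_xt q))).ne'
  · intro i j
    have h2 : IsBilin fun a b => metL g c (xt m c q) a b :=
      ⟨fun y => ⟨by simp, by simp⟩, fun y => ⟨by simp, by simp⟩⟩
    have h3 := h2.expand (tc c q (basisVec q i)) (tc c q (basisVec q j))
    rw [← inner_eq g hq] at h3
    simp only [smul_eq_mul] at h3
    simp only [gramL, Matrix.of_apply]
    rw [← h3]
    change gram g q q i j = _
    rw [gram_eq g (mem_xt q), gramL, Matrix.of_apply, metL_apply,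
      (xt m q).left_inv (mem_xt q), ← basisVec_eq, ← basisVec_eq]

/-! ### Curvature in coordinates -/

theorem vloc_coordField {q : M} (w : TangentSpace (𝓡 m) q) {x : Euc m}
    (hx : x ∈ (xt m q).target) : vloc q (coordField q w) x = tc q q w := by
  rw [vloc, sloc, coordField_eq]
  exact tc_fm ((xt m q).map_target hx) _

theorem vloc_coordField_smooth {q : M} (w : TangentSpace (𝓡 m) q) :
    ContDiffOn ℝ ∞ (vloc q (coordField q w)) (xt m q).target :=
  contDiffOn_const.congr fun _ hx => vloc_coordField w hx

theorem lieBracketWithin_const_on {E : Type*} [NormedAddCommGroup E] [NormedSpace ℝ E]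
    {V W : E → E} {a b : E} {U s : Set E} (hs : s = Set.univ) (hU : IsOpen U)
    (hV : ∀ x ∈ U, V x = a) (hW : ∀ x ∈ U, W x = b) {x : E} (hx : x ∈ U) :
    VectorField.lieBracketWithin ℝ V W s x = 0 := by
  rw [VectorField.lieBracketWithin, hs, fderivWithin_univ, fderivWithin_univ,
    fderiv_congr_on hU hV hx, fderiv_congr_on hU hW hx]
  simp

theorem tc_coordField {q : M} (w : TangentSpace (𝓡 m) q) {p : M} (hp : p ∈ (xt m q).source) :
    tc q p (coordField q w p) = tc q q w := by
  rw [coordField_eq, tc_fm hp]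

/-- In the chart at `q` both fields are constant. Hence the bracket term in the definition of `curv`
contributes nothing. -/
theorem mlieBracket_coordField (q : M) (u v : TangentSpace (𝓡 m) q) :
    VectorField.mlieBracket (𝓡 m) (coordField q u) (coordField q v) q = 0 := by
  have hr : Set.range (𝓡 m) = Set.univ := (𝓡 m).range_eq_univ
  have key : ∀ u : TangentSpace (𝓡 m) q, ∀ x ∈ (xt m q).target,
      VectorField.mpullbackWithin 𝓘(ℝ, Euc m) (𝓡 m) (xt m q).symm (coordField q u)
        (Set.range (𝓡 m)) x = tc q q u := by
    intro u x hx
    have hs := (xt m q).map_target hx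
    have h1 : fm q ((xt m q).symm x) = mfderivWithin 𝓘(ℝ, Euc m) (𝓡 m) (xt m q).symm
        (Set.range (𝓡 m)) x := by
      have := TangentBundle.symmL_trivializationAt (I := 𝓡 m) (mem_chart_of_xt hs)
      rw [(xt m q).right_inv hx] at this
      exact this
    rw [VectorField.mpullbackWithin_apply, coordField_eq, h1]
    exact (isInvertible_mfderivWithin_extChartAt_symm hx).inverse_apply_self (tc q q u)
  rw [VectorField.mlieBracket, VectorField.mlieBracketWithin_apply]
  refine (congrArg (mfderiv (𝓡 m) 𝓘(ℝ, Euc m) (xt m q) q).inverse ?_).trans (map_zero _)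
  exact lieBracketWithin_const_on (by rw [hr]; simp) (xt_target_open q) (key u) (key v)
    ((xt m q).map_source (mem_xt q))

theorem leviCivita_zero (g : Metric m M) {X : ∀ q : M, TangentSpace (𝓡 m) q} {q : M}
    (hX : ContDiffOn ℝ ∞ (vloc q X) (xt m q).target) : leviCivita g X q 0 = 0 := by
  apply tc_inj (mem_xt q)
  rw [tc_leviCivita g hX (mem_xt q), map_zero]
  simp [cd]

theorem vloc_leviCivita_coordField (g : Metric m M) {q : M} (v w : TangentSpace (𝓡 m) q)
    {x : Euc m} (hx : x ∈ (xt m q).target) :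
    vloc q (fun p => leviCivita g (coordField q w) p (coordField q v p)) x =
      cd (gam g q) (fun x => x) (fun _ => tc q q w) (tc q q v) x := by
  have hs := (xt m q).map_target hx
  have h1 := tc_leviCivita g (vloc_coordField_smooth w) hs
    (coordField q v ((xt m q).symm x))
  rw [(xt m q).right_inv hx, tc_coordField _ hs] at h1
  rw [← cd_congr (xt_target_open q) (fun x hx => vloc_coordField w hx) hx, ← h1]
  rfl

/-- The extensions are constant in the preferred chart, so the definition is the commutator of two
covariant derivatives along the identity, which `cd_comm` evaluates. -/
theorem tc_curv_self (g : Metric m M) (q : M) (u v w : TangentSpace (𝓡 m) q) :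
    tc q q (curv g q u v w) = RC (gam g q) (xt m q q) (tc q q u) (tc q q v) (tc q q w) := by
  have ho := xt_target_open (n := m) q
  have hx := (xt m q).map_source (mem_xt q)
  have hid : ContDiffOn ℝ ∞ (fun x : Euc m => x) (xt m q).target := contDiffOn_id
  have hm : ∀ z ∈ (xt m q).target, (fun x : Euc m => x) z ∈ (xt m q).target := fun z hz => hz
  have hsm := fun a => cd_smooth ho (gam_smooth g q) hid hm (contDiffOn_const (c := tc q q w)) a
  have h1 : ∀ u v, tc q q (leviCivita g (fun p => leviCivita g (coordField q w) p
      (coordField q v p)) q u) =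
      cd (gam g q) (fun x => x) (cd (gam g q) (fun x => x) (fun _ => tc q q w) (tc q q v))
        (tc q q u) (xt m q q) := by
    intro u v
    rw [tc_leviCivita g ((hsm _).congr fun x hx => vloc_leviCivita_coordField g v w hx)
      (mem_xt q)]
    exact cd_congr ho (fun x hx => vloc_leviCivita_coordField g v w hx) hx _
  rw [curv, mlieBracket_coordField, leviCivita_zero g (vloc_coordField_smooth w), sub_zero, map_sub,
    h1, h1, cd_comm ho ho (gam_smooth g q) hid hm contDiffOn_const hx]
  simp

theorem tc_curv (g : Metric m M) {q : M} (hq : q ∈ (xt m c).source)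
    (u v w : TangentSpace (𝓡 m) q) :
    tc c q (curv g q u v w) = RC (gam g c) (xt m c q) (tc c q u) (tc c q v) (tc c q w) := by
  have hsub := kapDom_subset (n := m) c q
  rw [tc_kap hq (mem_xt q), tc_curv_self, tc_kap hq (mem_xt q) u, tc_kap hq (mem_xt q) v,
    tc_kap hq (mem_xt q) w, ← kap_xt (d := c) (mem_xt q)]
  exact (RC_transform (kapDom_open c q) (kap_smooth c q) (gam_kap g c q) (xt_target_open c)
    (gam_smooth g c) ((gam_smooth g q).mono hsub) (fun y hy => (kap_maps hy).1)
    (mem_kapDom hq (mem_xt q)) _ _ _).symm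

theorem vloc_curv_coordField (g : Metric m M) {q : M} (u v w : TangentSpace (𝓡 m) q)
    {x : Euc m} (hx : x ∈ (xt m q).target) :
    vloc q (fun p => curv g p (coordField q u p) (coordField q v p) (coordField q w p)) x =
      RC (gam g q) x (tc q q u) (tc q q v) (tc q q w) := by
  have hs := (xt m q).map_target hx
  have h1 := tc_curv g hs (coordField q u ((xt m q).symm x)) (coordField q v ((xt m q).symm x))
    (coordField q w ((xt m q).symm x))
  rw [(xt m q).right_inv hx, tc_coordField _ hs, tc_coordField _ hs, tc_coordField _ hs] at h1
  rw [← h1]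
  rfl

theorem tc_covCurv_self (g : Metric m M) (q : M) (x u v w : TangentSpace (𝓡 m) q) :
    tc q q (covCurv g q x u v w) =
      NR (gam g q) (xt m q q) (tc q q x) (tc q q u) (tc q q v) (tc q q w) := by
  have ho := xt_target_open (n := m) q
  have hx := (xt m q).map_source (mem_xt q)
  have hk : ∀ a : Euc m, ContDiffOn ℝ ∞ (fun _ : Euc m => a) (xt m q).target :=
    fun a => contDiffOn_const
  have h1 : ∀ w, tc q q (leviCivita g (coordField q w) q x) =
      gam g q (xt m q q) (tc q q x) (tc q q w) := by
    intro w
    rw [tc_leviCivita g (vloc_coordField_smooth w) (mem_xt q),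
      cd_congr ho (fun x hx => vloc_coordField w hx) hx]
    simp [cd]
  have h2 : ContDiffOn ℝ ∞ (vloc q fun p => curv g p (coordField q u p) (coordField q v p)
      (coordField q w p)) (xt m q).target :=
    ((((RC_smooth ho (gam_smooth g q)).clm_apply (hk (tc q q u))).clm_apply
      (hk (tc q q v))).clm_apply (hk (tc q q w))).congr
      fun x hx => vloc_curv_coordField g u v w hx
  rw [covCurv, map_sub, map_sub, map_sub, tc_leviCivita g h2 (mem_xt q),
    cd_congr ho (fun x hx => vloc_curv_coordField g u v w hx) hx,
    tc_curv_self, tc_curv_self, tc_curv_self, h1, h1, h1, NR_eq_cd ho (gam_smooth g q) hx]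

theorem tc_covCurv (g : Metric m M) {q : M} (hq : q ∈ (xt m c).source)
    (x u v w : TangentSpace (𝓡 m) q) :
    tc c q (covCurv g q x u v w) =
      NR (gam g c) (xt m c q) (tc c q x) (tc c q u) (tc c q v) (tc c q w) := by
  have hsub := kapDom_subset (n := m) c q
  rw [tc_kap hq (mem_xt q), tc_covCurv_self, tc_kap hq (mem_xt q) x, tc_kap hq (mem_xt q) u,
    tc_kap hq (mem_xt q) v, tc_kap hq (mem_xt q) w, ← kap_xt (d := c) (mem_xt q)]
  exact (NR_transform (kapDom_open c q) (kap_smooth c q) (gam_kap g c q) (xt_target_open c)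
    (gam_smooth g c) ((gam_smooth g q).mono hsub) (fun y hy => (kap_maps hy).1)
    (mem_kapDom hq (mem_xt q)) _ _ _ _).symm

/-! ### Ricci curvature in coordinates -/

/-- The Ricci form of the connection with Christoffel map `Γ`. -/
def ricL (Γ : Euc m → Euc m →L[ℝ] Euc m →L[ℝ] Euc m) (x a b : Euc m) : ℝ :=
  ∑ k, RC Γ x (ev k) a b k

/-- Conjugate endomorphisms have the same trace. This makes the Ricci form and the divergence, which
are defined through coordinates, independent of the chart. -/
theorem trace_conj {T T' : Euc m → Euc m} (hT : IsLinearMap ℝ T) (hT' : IsLinearMap ℝ T')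
    {L : Euc m →ₗ[ℝ] Euc m} (hL : Function.Surjective L) (h : ∀ a, T (L a) = L (T' a)) :
    ∑ k, T (ev k) k = ∑ k, T' (ev k) k := by
  have h1 : ∀ T : Euc m → Euc m, ∀ hT : IsLinearMap ℝ T,
      ∑ k, T (ev k) k = LinearMap.trace ℝ (Euc m) (hT.mk' T) := by
    intro T hT
    rw [LinearMap.trace_eq_matrix_trace ℝ (EuclideanSpace.basisFun (Fin m) ℝ).toBasis, Matrix.trace]
    refine Finset.sum_congr rfl fun k _ => ?_
    simp [LinearMap.toMatrix_apply]
  -- Equal finite dimensions turn surjectivity into bijectivity.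
  have hinj : Function.Injective L := LinearMap.injective_iff_surjective.mpr hL
  let e := LinearEquiv.ofBijective L ⟨hinj, hL⟩
  rw [h1 T hT, h1 T' hT', ← LinearMap.trace_conj' (hT'.mk' T') e]
  congr 1
  ext1 a
  obtain ⟨b, rfl⟩ := hL a
  have : e.symm (L b) = b := e.symm_apply_apply b
  simp [LinearEquiv.conj_apply, this, h]
  rfl

theorem ricciForm_eq (g : Metric m M) {q : M} (hq : q ∈ (xt m c).source)
    (u v : TangentSpace (𝓡 m) q) :
    ricciForm g q u v = ricL (gam g c) (xt m c q) (tc c q u) (tc c q v) := by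
  have h1 : ricciForm g q u v = ricL (gam g q) (xt m q q) (tc q q u) (tc q q v) := by
    simp only [ricciForm, ricL, coord_eq, tc_curv_self, tc_basisVec]
  rw [h1]
  have hk := mem_kapDom hq (mem_xt q)
  refine (trace_conj (L := (fderiv ℝ (kap m c q) (xt m q q)).toLinearMap)
    (T := fun z => RC (gam g c) (xt m c q) z (tc c q u) (tc c q v))
    (T' := fun z => RC (gam g q) (xt m q q) z (tc q q u) (tc q q v))
    ⟨by simp, by simp⟩ ⟨by simp, by simp⟩ (fderiv_kap_surjective hk) ?_).symm
  intro a
  have h2 := tc_curv g hq (fm q q a) u v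
  rw [tc_kap hq (mem_xt q), tc_curv_self, tc_kap hq (mem_xt q) (fm q q a), tc_fm (mem_xt q)] at h2
  exact h2.symm

theorem ricL_bilin (Γ : Euc m → Euc m →L[ℝ] Euc m →L[ℝ] Euc m) (x : Euc m) :
    IsBilin (ricL Γ x) :=
  ⟨fun y => ⟨fun a b => by simp [ricL, Finset.sum_add_distrib], fun r a => by
      simp [ricL, Finset.mul_sum]⟩,
    fun y => ⟨fun a b => by simp [ricL, Finset.sum_add_distrib], fun r a => by
      simp [ricL, Finset.mul_sum]⟩⟩

/-- The Ricci endomorphism in the chart at `c`. -/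
def ricE (g : Metric m M) (c : M) (x a : Euc m) : Euc m :=
  ∑ i, ∑ j, gInv g c i j x • ricL (gam g c) x a (ev i) • ev j

/-- The scalar curvature in the chart at `c`. -/
def scalL (g : Metric m M) (c : M) (x : Euc m) : ℝ :=
  ∑ i, ∑ j, gInv g c i j x * ricL (gam g c) x (ev i) (ev j)

theorem tc_ricci (g : Metric m M) {q : M} (hq : q ∈ (xt m c).source) (u : TangentSpace (𝓡 m) q) :
    tc c q (ricci g q u) = ricE g c (xt m c q) (tc c q u) := by
  refine trace_eq g (tc c q).toLinearMap hq
    (b := fun a b => ricL (gam g c) (xt m c q) (tc c q u) a • b) ?_ ?_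
  · have h := ricL_bilin (gam g c) (xt m c q)
    refine ⟨fun y => ⟨fun a b => ?_, fun r a => ?_⟩, fun y => ⟨by simp, fun r a => ?_⟩⟩
    · rw [(h.right _).map_add, add_smul]
    · rw [(h.right _).map_smul, smul_assoc]
    · rw [smul_comm]
  · intro a b
    simp [ricciForm_eq g hq]

theorem scal_eq (g : Metric m M) {q : M} (hq : q ∈ (xt m c).source) :
    scal g q = scalL g c (xt m c q) :=
  trace_eq g LinearMap.id hq (ricL_bilin (gam g c) (xt m c q))
    (fun u v => ricciForm_eq g hq u v)

theorem ricL_smooth {Ω : Set (Euc m)} (hΩ : IsOpen Ω) {Γ : Euc m → Euc m →L[ℝ] Euc m →L[ℝ] Euc m}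
    (hΓ : ContDiffOn ℝ ∞ Γ Ω) (a b : Euc m) : ContDiffOn ℝ ∞ (fun x => ricL Γ x a b) Ω := by
  refine ContDiffOn.sum fun k _ => ?_
  have h1 : ContDiffOn ℝ ∞ (fun x => RC Γ x (ev k) a b) Ω :=
    (((RC_smooth hΩ hΓ).clm_apply contDiffOn_const).clm_apply contDiffOn_const).clm_apply
      contDiffOn_const
  exact (pr k).contDiff.comp_contDiffOn h1

theorem scalL_smooth (g : Metric m M) (c : M) : ContDiffOn ℝ ∞ (scalL g c) (xt m c).target :=
  ContDiffOn.sum fun i _ => ContDiffOn.sum fun j _ =>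
    (gInv_smooth g c i j).mul (ricL_smooth (xt_target_open c) (gam_smooth g c) _ _)

/-- The gradient in the chart at `c`. -/
def gradL (g : Metric m M) (c : M) (f : Euc m → ℝ) (x : Euc m) : Euc m :=
  ∑ i, ∑ j, gInv g c i j x • fderiv ℝ f x (ev i) • ev j

theorem dfun_eq {f : M → ℝ} {q : M} (hq : q ∈ (xt m c).source)
    (hf : ContDiffAt ℝ ∞ (fun x => f ((xt m c).symm x)) (xt m c q)) (v : TangentSpace (𝓡 m) q) :
    dfun f q v = fderiv ℝ (fun x => f ((xt m c).symm x)) (xt m c q) (tc c q v) :=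
  mfderiv_xt hq hf v

theorem tc_grad (g : Metric m M) {f : M → ℝ} {q : M} (hq : q ∈ (xt m c).source)
    (hf : ContDiffAt ℝ ∞ (fun x => f ((xt m c).symm x)) (xt m c q)) :
    tc c q (grad g f q) = gradL g c (fun x => f ((xt m c).symm x)) (xt m c q) := by
  refine trace_eq g (tc c q).toLinearMap hq
    (b := fun a b => fderiv ℝ (fun x => f ((xt m c).symm x)) (xt m c q) a • b) ?_ ?_
  · exact ⟨fun y => ⟨fun a b => by rw [map_add, add_smul], fun r a => by rw [map_smul, smul_assoc]⟩,
      fun y => ⟨by simp, fun r a => by rw [smul_comm]⟩⟩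
  · intro a b
    simp [dfun_eq hq hf]

end Tensors

end CBiharmonic

end

/-! ### One-forms and their duals, divergence, and the divergence of the Ricci tensor. -/

noncomputable section

set_option linter.unusedSectionVars false
set_option synthInstance.maxHeartbeats 200000

namespace CBiharmonic

section MetricIdentities

variable {m : ℕ} {M : Type*} [TopologicalSpace M] [ChartedSpace (Euc m) M] [IsManifold (𝓡 m) ∞ M]
  {c : M} {x : Euc m}

/-! ### Sharp, divergence and the contracted Bianchi identity -/

/-- The components of `Tr B(Ric(·), ·)`. -/
def ricP (g : Metric m M) (c : M) (k j : Fin m) (x : Euc m) : ℝ :=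
  ∑ i, gInv g c i j x * ricE g c x (ev i) k

/-- The Christoffel symbols of `g` in the chart at `c`. -/
def chr (g : Metric m M) (c : M) (k i j : Fin m) (x : Euc m) : ℝ := chrL (metL g c) x k i j

theorem chr_smooth (g : Metric m M) (c : M) (k i j : Fin m) :
    ContDiffOn ℝ ∞ (chr g c k i j) (xt m c).target :=
  chrL_smooth (xt_target_open c) (metL_metric g c) k i j

theorem gam_ev (g : Metric m M) (c : M) (x : Euc m) (i j : Fin m) :
    gam g c x (ev i) (ev j) = ∑ k, chr g c k i j x • ev k := gammaL_ev _ _ _ _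

theorem metric_ext (g : Metric m M) (hx : x ∈ (xt m c).target) {v w : Euc m}
    (h : ∀ l, metL g c x v (ev l) = metL g c x w (ev l)) : v = w := by
  by_contra hne
  have h1 := (metL_metric g c).pos x hx (v - w) (sub_ne_zero.mpr hne)
  have h2 : ∀ a, metL g c x (v - w) a = 0 := by
    refine linear_ext (f := fun a => metL g c x (v - w) a) (g := fun _ => (0 : ℝ))
      ⟨fun a b => map_add _ _ _, fun r a => map_smul _ _ _⟩ ⟨by simp, by simp⟩ fun l => ?_
    rw [map_sub, sub_apply, h, sub_self]
  rw [h2] at h1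
  exact lt_irrefl _ h1

theorem gInv_mul (g : Metric m M) (hx : x ∈ (xt m c).target) (i j : Fin m) :
    ∑ k, gInv g c i k x * metL g c x (ev k) (ev j) = if i = j then 1 else 0 :=
  gramL_inv_mul (metL_metric g c) hx i j

theorem component_eq (g : Metric m M) (hx : x ∈ (xt m c).target) (v : Euc m) (k : Fin m) :
    v k = ∑ l, gInv g c k l x * metL g c x v (ev l) := by
  refine linear_ext (f := fun v : Euc m => v k)
    (g := fun v => ∑ l, gInv g c k l x * metL g c x v (ev l)) ⟨by simp, by simp⟩
    ⟨fun a b => by simp [mul_add, Finset.sum_add_distrib],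
      fun r a => by simp [Finset.mul_sum, mul_left_comm]⟩ (fun i => ?_) v
  have h1 : ∀ l, gInv g c k l x * metL g c x (ev i) (ev l) =
      gInv g c k l x * metL g c x (ev l) (ev i) := fun l => by
    rw [(metL_metric g c).symm x hx]
  simp only [h1, gInv_mul g hx]
  simp

/-- The vector field dual to a `1`-form with components `θ`. -/
def sharp (g : Metric m M) (c : M) (θ : Fin m → Euc m → ℝ) (x : Euc m) : Euc m :=
  ∑ i, ∑ j, gInv g c i j x • θ i x • ev j

theorem metL_sum_gInv (g : Metric m M) (hx : x ∈ (xt m c).target) (θ : Fin m → ℝ) (l : Fin m) :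
    metL g c x (∑ i, ∑ j, gInv g c i j x • θ i • ev j) (ev l) = θ l := by
  simp only [map_sum, map_smul, sum_apply, smul_apply, smul_eq_mul]
  have h1 : ∀ i, ∑ j, gInv g c i j x * (θ i * metL g c x (ev j) (ev l)) =
      θ i * if i = l then 1 else 0 := by
    intro i
    rw [← gInv_mul g hx, Finset.mul_sum]
    exact Finset.sum_congr rfl fun j _ => by ring
  simp [h1]

theorem metL_sharp (g : Metric m M) (hx : x ∈ (xt m c).target) (θ : Fin m → Euc m → ℝ)
    (w : Euc m) : metL g c x (sharp g c θ x) w = ∑ l, w l * θ l x := by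
  refine linear_ext (f := fun w => metL g c x (sharp g c θ x) w) (g := fun w => ∑ l, w l * θ l x)
    ⟨by simp, by simp⟩ ⟨fun a b => by simp [add_mul, Finset.sum_add_distrib],
      fun r a => by simp [Finset.mul_sum, mul_assoc]⟩ (fun l => ?_) w
  rw [sharp, metL_sum_gInv g hx fun i => θ i x]
  simp

theorem sharp_smooth (g : Metric m M) {θ : Fin m → Euc m → ℝ} {U : Set (Euc m)}
    (hU : U ⊆ (xt m c).target) (hθ : ∀ i, ContDiffOn ℝ ∞ (θ i) U) :
    ContDiffOn ℝ ∞ (sharp g c θ) U :=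
  ContDiffOn.sum fun i _ => ContDiffOn.sum fun j _ =>
    ((gInv_smooth g c i j).mono hU).smul ((hθ i).smul contDiffOn_const)

/-- The components `(∇_k θ)_j` of the covariant derivative of a `1`-form. -/
def nabla (g : Metric m M) (c : M) (θ : Fin m → Euc m → ℝ) (v : Euc m) (j : Fin m) (x : Euc m) :
    ℝ := fderiv ℝ (θ j) x v - ∑ l, gam g c x v (ev j) l * θ l x

theorem nabla_ev (g : Metric m M) (c : M) (θ : Fin m → Euc m → ℝ) (k j : Fin m) (x : Euc m) :
    nabla g c θ (ev k) j x = fderiv ℝ (θ j) x (ev k) - ∑ l, chr g c l k j x * θ l x := by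
  rw [nabla, gam_ev]
  congr 1
  refine Finset.sum_congr rfl fun l _ => ?_
  rw [← sum_ev (WithLp.toLp 2 fun l => chr g c l k j x)]

/-- The metric is parallel, so raising an index commutes with covariant differentiation; tested by
pairing with the constant fields `ev l`. -/
theorem cd_sharp (g : Metric m M) {U : Set (Euc m)} (hUo : IsOpen U) (hU : U ⊆ (xt m c).target)
    {θ : Fin m → Euc m → ℝ} (hθ : ∀ i, ContDiffOn ℝ ∞ (θ i) U) (hx : x ∈ U) (v : Euc m) :
    cd (gam g c) (fun x => x) (sharp g c θ) v x =
      ∑ i, ∑ j, gInv g c i j x • nabla g c θ v i x • ev j := by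
  refine metric_ext g (hU hx) fun l => ?_
  rw [metL_sum_gInv g (hU hx) fun i => nabla g c θ v i x]
  have h1 := fderiv_metric hUo (xt_target_open c) (metL_metric g c).smooth (gam_compat g c)
    (contDiffOn_id (s := U)) (fun z hz => hU hz) (sharp_smooth g hU hθ)
    (contDiffOn_const (c := ev l)) hx v
  rw [fderiv_congr_on (g := θ l) hUo (fun z hz => by
    simp only [id_eq]; rw [metL_sharp g (hU hz)]; simp) hx] at h1
  simp only [id_eq] at h1
  rw [metL_sharp g (hU hx)] at h1
  rw [nabla, h1]
  simp [cd]

/-- The divergence of a vector field, in the chart at `c`. -/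
def divL (g : Metric m M) (c : M) (Z : Euc m → Euc m) (x : Euc m) : ℝ :=
  ∑ k, cd (gam g c) (fun x => x) Z (ev k) x k

theorem divL_sharp (g : Metric m M) {U : Set (Euc m)} (hUo : IsOpen U)
    (hU : U ⊆ (xt m c).target) {θ : Fin m → Euc m → ℝ} (hθ : ∀ i, ContDiffOn ℝ ∞ (θ i) U)
    (hx : x ∈ U) :
    divL g c (sharp g c θ) x = ∑ i, ∑ j, gInv g c i j x * nabla g c θ (ev i) j x := by
  have h1 : ∀ k (f : Fin m → ℝ), (∑ i, ∑ j, gInv g c i j x • f i • ev j : Euc m) k =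
      ∑ i, gInv g c i k x * f i := by
    intro k f
    simp [Pi.single_apply]
  simp only [divL, cd_sharp g hUo hU hθ hx, h1]
  refine Finset.sum_congr rfl fun i _ => Finset.sum_congr rfl fun j _ => ?_
  rw [gInv_symm g (hU hx)]

theorem ricL_eq (g : Metric m M) (hx : x ∈ (xt m c).target) (a b : Euc m) :
    ricL (gam g c) x a b =
      ∑ k, ∑ l, gInv g c k l x * metL g c x (RC (gam g c) x (ev k) a b) (ev l) := by
  simp only [ricL]
  exact Finset.sum_congr rfl fun k _ => component_eq g hx _ _

/-- Pair symmetry of the curvature, together with the symmetry of the inverse metric over which it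
is contracted. -/
theorem ricL_symm (g : Metric m M) (hx : x ∈ (xt m c).target) (a b : Euc m) :
    ricL (gam g c) x a b = ricL (gam g c) x b a := by
  rw [ricL_eq g hx, ricL_eq g hx, Finset.sum_comm]
  refine Finset.sum_congr rfl fun k _ => Finset.sum_congr rfl fun l _ => ?_
  rw [gInv_symm g hx, RC_pair (xt_target_open c) (gam_smooth g c) (gam_symm g c)
    (metL_metric g c).smooth (metL_metric g c).symm (gam_compat g c) hx,
    RC_antisymm, map_neg, neg_apply,
    RC_skew (xt_target_open c) (gam_smooth g c)
    (metL_metric g c).smooth (gam_compat g c) hx, neg_neg, (metL_metric g c).symm x hx]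

theorem metL_ricE (g : Metric m M) (hx : x ∈ (xt m c).target) (a w : Euc m) :
    metL g c x (ricE g c x a) w = ricL (gam g c) x a w := by
  refine linear_ext (f := fun w => metL g c x (ricE g c x a) w)
    (g := fun w => ricL (gam g c) x a w)
    ⟨by simp, by simp⟩ ((ricL_bilin (gam g c) x).right a) (fun l => ?_) w
  exact metL_sum_gInv g hx _ l

theorem ricE_linear (g : Metric m M) (x : Euc m) : IsLinearMap ℝ (ricE g c x) := by
  have h := fun y => (ricL_bilin (gam g c) x).left y
  refine ⟨fun a b => ?_, fun r a => ?_⟩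
  · simp only [ricE, (h _).map_add, add_smul, smul_add, Finset.sum_add_distrib]
  · simp only [ricE, (h _).map_smul, Finset.smul_sum, smul_assoc]
    refine Finset.sum_congr rfl fun i _ => Finset.sum_congr rfl fun j _ => smul_comm _ _ _

theorem ricE_smooth (g : Metric m M) (c : M) (a : Euc m) :
    ContDiffOn ℝ ∞ (fun x => ricE g c x a) (xt m c).target :=
  ContDiffOn.sum fun i _ => ContDiffOn.sum fun j _ => (gInv_smooth g c i j).smul
    ((ricL_smooth (xt_target_open c) (gam_smooth g c) a _).smul contDiffOn_const)

theorem ricP_smooth (g : Metric m M) (c : M) (i j : Fin m) :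
    ContDiffOn ℝ ∞ (ricP g c i j) (xt m c).target :=
  ContDiffOn.sum fun k _ => (gInv_smooth g c _ _).mul
    ((pr i).contDiff.comp_contDiffOn (ricE_smooth g c (ev k)))

theorem ricP_eq (g : Metric m M) (k j : Fin m) :
    ricP g c k j x = ∑ i, ∑ p, gInv g c i j x * (gInv g c p k x * ricL (gam g c) x (ev i) (ev p)) := by
  have h1 : ∀ a, ricE g c x a k = ∑ i, gInv g c i k x * ricL (gam g c) x a (ev i) := by
    intro a
    simp [ricE, Pi.single_apply]
  simp only [ricP, h1, Finset.mul_sum]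

theorem ricP_symm (g : Metric m M) (hx : x ∈ (xt m c).target) (k j : Fin m) :
    ricP g c k j x = ricP g c j k x := by
  rw [ricP_eq, ricP_eq, Finset.sum_comm]
  refine Finset.sum_congr rfl fun i _ => Finset.sum_congr rfl fun p _ => ?_
  rw [ricL_symm g hx]; ring

/-- The covariant derivative of the Ricci form. -/
def nRic (g : Metric m M) (c : M) (x v a b : Euc m) : ℝ :=
  ∑ k, NR (gam g c) x v (ev k) a b k

theorem nRic_eq (g : Metric m M) (hx : x ∈ (xt m c).target) (v a b : Euc m) :
    nRic g c x v a b =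
      ∑ k, ∑ l, gInv g c k l x * metL g c x (NR (gam g c) x v (ev k) a b) (ev l) :=
  Finset.sum_congr rfl fun _ _ => component_eq g hx _ _

/-- Trace of a product is independent of the order. This is what makes covariant differentiation
commute with contraction: the connection acts on an endomorphism by a commutator, which is
traceless. -/
theorem trace_comm_apply {S T : Euc m → Euc m} (hS : IsLinearMap ℝ S) (hT : IsLinearMap ℝ T) :
    ∑ k, S (T (ev k)) k = ∑ k, T (S (ev k)) k := by
  have h1 : ∀ S : Euc m → Euc m, IsLinearMap ℝ S → ∀ v : Euc m, S v = ∑ i, v i • S (ev i) := by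
    intro S hS v
    have := map_sum (hS.mk' _) (fun i => v i • ev i) Finset.univ
    rw [← sum_ev] at this
    simpa [hS.map_smul] using this
  have h2 : ∀ k, S (T (ev k)) k = ∑ i, T (ev k) i * S (ev i) k := fun k => by
    rw [h1 S hS]; simp
  have h3 : ∀ k, T (S (ev k)) k = ∑ i, S (ev k) i * T (ev i) k := fun k => by
    rw [h1 T hT]; simp
  simp only [h2, h3]
  rw [Finset.sum_comm]
  exact Finset.sum_congr rfl fun k _ => Finset.sum_congr rfl fun l _ => mul_comm _ _

/-- The connection terms at the contracted index form the commutator of `Γ_v` with `z ↦ R(z, a)b`,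
whose trace is zero; those at the two free slots remain. -/
theorem fderiv_ricL (g : Metric m M) (hx : x ∈ (xt m c).target) (v a b : Euc m) :
    fderiv ℝ (fun x => ricL (gam g c) x a b) x v = nRic g c x v a b
      + ricL (gam g c) x (gam g c x v a) b + ricL (gam g c) x a (gam g c x v b) := by
  have ho := xt_target_open (n := m) c
  have hR : ∀ k, ContDiffOn ℝ ∞ (fun x => RC (gam g c) x (ev k) a b) (xt m c).target := fun k =>
    (((RC_smooth ho (gam_smooth g c)).clm_apply contDiffOn_const).clm_apply contDiffOn_const).clm_apply
      contDiffOn_const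
  have h1 : fderiv ℝ (fun x => ricL (gam g c) x a b) x v =
      ∑ k, (fderiv ℝ (fun x => RC (gam g c) x (ev k) a b) x v) k := by
    have h0 : (fun x => ricL (gam g c) x a b) =
        fun x => ∑ k, (pr k ∘ fun x => RC (gam g c) x (ev k) a b) x := rfl
    rw [h0, fderiv_fun_sum fun k _ =>
      ((pr k).differentiableAt.comp x (diffAt_of_smooth ho (hR k) hx)), sum_apply]
    refine Finset.sum_congr rfl fun k _ => ?_
    have := fderiv_comp x (pr k).differentiableAt (diffAt_of_smooth ho (hR k) hx)
    have h2 := congrArg (fun T => T v) this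
    simp only [ContinuousLinearMap.comp_apply, ContinuousLinearMap.fderiv, pr_apply] at h2
    exact h2
  have h2 := trace_comm_apply (S := fun z => gam g c x v z) (T := fun z => RC (gam g c) x z a b)
    ⟨by simp, by simp⟩ ⟨by simp, by simp⟩
  rw [h1]
  simp only [nRic, ricL, NR_eq_cd ho (gam_smooth g c) hx, cd]
  simp only [fderiv_fun_id, ContinuousLinearMap.id_apply, PiLp.sub_apply, PiLp.add_apply,
    Finset.sum_sub_distrib, Finset.sum_add_distrib]
  rw [h2]; ring

theorem ricE_apply (g : Metric m M) (a : Euc m) (k : Fin m) :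
    ricE g c x a k = ∑ i, gInv g c i k x * ricL (gam g c) x a (ev i) := by
  simp [ricE, Pi.single_apply]

theorem cd_ricE (g : Metric m M) (hx : x ∈ (xt m c).target) (v a : Euc m) :
    cd (gam g c) (fun x => x) (fun x => ricE g c x a) v x =
      ricE g c x (gam g c x v a) + ∑ i, ∑ j, gInv g c i j x • nRic g c x v a (ev i) • ev j := by
  have ho := xt_target_open (n := m) c
  refine metric_ext g hx fun l => ?_
  rw [map_add, add_apply, metL_sum_gInv g hx fun i => nRic g c x v a (ev i), metL_ricE g hx]
  have h1 := fderiv_metric ho ho (metL_metric g c).smooth (gam_compat g c)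
    (contDiffOn_id (s := (xt m c).target)) (fun z hz => hz) (ricE_smooth g c a)
    (contDiffOn_const (c := ev l)) hx v
  simp only [id_eq] at h1
  rw [fderiv_congr_on ho (fun z hz => metL_ricE g hz a (ev l)) hx, fderiv_ricL g hx] at h1
  rw [metL_ricE g hx] at h1
  have h2 : cd (gam g c) id (fun _ => ev l) v x = gam g c x v (ev l) := by simp [cd]
  rw [h2] at h1
  change _ = metL g c x (cd (gam g c) (fun x => x) (fun x => ricE g c x a) v x) (ev l) + _ at h1
  linarith

/-- Scalar curvature is the trace of the Ricci endomorphism, so the derivative of the inverse metric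
never has to be computed: `cd_ricE` supplies the derivative, and the commutator with `Γ_v` is
traceless. -/
theorem fderiv_scalL (g : Metric m M) (hx : x ∈ (xt m c).target) (v : Euc m) :
    fderiv ℝ (scalL g c) x v = ∑ i, ∑ j, gInv g c i j x * nRic g c x v (ev i) (ev j) := by
  have ho := xt_target_open (n := m) c
  have hs : ∀ x ∈ (xt m c).target,
      scalL g c x = ∑ k, (pr k ∘ fun x => ricE g c x (ev k)) x := by
    intro x hx
    simp only [Function.comp_apply, pr_apply, ricE_apply, scalL]
    refine Finset.sum_congr rfl fun i _ => Finset.sum_congr rfl fun j _ => ?_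
    rw [gInv_symm g hx]
  have h1 : ∀ k, fderiv ℝ (pr k ∘ fun x => ricE g c x (ev k)) x v =
      (fderiv ℝ (fun x => ricE g c x (ev k)) x v) k := by
    intro k
    have := fderiv_comp x (pr k).differentiableAt (diffAt_of_smooth ho (ricE_smooth g c (ev k)) hx)
    have h2 := congrArg (fun T => T v) this
    simp only [ContinuousLinearMap.comp_apply, ContinuousLinearMap.fderiv, pr_apply] at h2
    exact h2
  have h2 : ∀ k, fderiv ℝ (fun x => ricE g c x (ev k)) x v =
      ricE g c x (gam g c x v (ev k))
      + (∑ i, ∑ j, gInv g c i j x • nRic g c x v (ev k) (ev i) • ev j)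
      - gam g c x v (ricE g c x (ev k)) := by
    intro k
    rw [← cd_ricE g hx, cd]
    simp
  have h3 : ∀ k (f : Fin m → ℝ), (∑ i, ∑ j, gInv g c i j x • f i • ev j : Euc m) k =
      ∑ i, gInv g c i k x * f i := by
    intro k f
    simp [Pi.single_apply]
  have h4 := trace_comm_apply (S := fun z => gam g c x v z) (T := fun z => ricE g c x z)
    ⟨by simp, by simp⟩ (ricE_linear g x)
  rw [fderiv_congr_on ho hs hx, fderiv_fun_sum fun k _ =>
      ((pr k).differentiableAt.comp x (diffAt_of_smooth ho (ricE_smooth g c (ev k)) hx)), sum_apply]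
  simp only [h1, h2, PiLp.sub_apply, PiLp.add_apply, h3,
    Finset.sum_sub_distrib, Finset.sum_add_distrib]
  rw [h4]
  simp only [add_sub_cancel_left]
  refine Finset.sum_congr rfl fun i _ => Finset.sum_congr rfl fun j _ => ?_
  rw [gInv_symm g hx]

/-- The contracted second Bianchi identity. -/
theorem contracted_bianchi (g : Metric m M) (hx : x ∈ (xt m c).target) (y : Euc m) :
    ∑ k, ∑ l, gInv g c k l x * nRic g c x (ev k) y (ev l) =
      (1 / 2) * fderiv ℝ (scalL g c) x y := by
  have ho := xt_target_open (n := m) c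
  set Q : Euc m → Euc m → Euc m → Euc m → Euc m → ℝ := fun v p a b q =>
    metL g c x (NR (gam g c) x v p a b) q with hQ
  have e1 : ∀ v p a b q, Q v p a b q = - Q v p a q b := fun v p a b q => by
    simp only [hQ]
    rw [NR_skew ho (gam_smooth g c) (metL_metric g c).smooth (gam_compat g c) hx,
      (metL_metric g c).symm x hx]
  have e2 : ∀ v p a b q, Q v p a b q = - Q v a p b q := fun v p a b q => by
    simp only [hQ]
    rw [NR_antisymm, map_neg, neg_apply]
  have e3 : ∀ v p a b q, Q v p a b q + Q p a v b q + Q a v p b q = 0 := fun v p a b q => by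
    simp only [hQ]
    rw [← add_apply, ← map_add, ← add_apply, ← map_add,
      NR_bianchi₂ ho (gam_smooth g c) (gam_symm g c) hx, map_zero, zero_apply]
  have h1 : fderiv ℝ (scalL g c) x y = ∑ i, ∑ j, ∑ k, ∑ l,
      gInv g c i j x * (gInv g c k l x * Q y (ev k) (ev i) (ev j) (ev l)) := by
    simp only [fderiv_scalL g hx, nRic_eq g hx, Finset.mul_sum, hQ]
  have h2 : ∑ k, ∑ l, gInv g c k l x * nRic g c x (ev k) y (ev l) = ∑ i, ∑ j, ∑ k, ∑ l,
      gInv g c i j x * (gInv g c k l x * Q (ev i) (ev k) y (ev j) (ev l)) := by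
    simp only [nRic_eq g hx, Finset.mul_sum, hQ]
  -- The same sum with the two pairs of contracted indices exchanged.
  have h3 : ∑ k, ∑ l, gInv g c k l x * nRic g c x (ev k) y (ev l) = ∑ i, ∑ j, ∑ k, ∑ l,
      gInv g c i j x * (gInv g c k l x * Q (ev k) (ev i) y (ev l) (ev j)) := by
    rw [h2]
    have hsw : ∀ f : Fin m → Fin m → Fin m → Fin m → ℝ,
        ∑ i, ∑ j, ∑ k, ∑ l, f i j k l = ∑ i, ∑ j, ∑ k, ∑ l, f k l i j := by
      intro f
      have e : ∀ F : Fin m → Fin m → Fin m → Fin m → ℝ,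
          ∑ i, ∑ j, ∑ k, ∑ l, F i j k l = ∑ p : Fin m × Fin m, ∑ q : Fin m × Fin m,
            F p.1 p.2 q.1 q.2 := fun F => by
        rw [Fintype.sum_prod_type]
        refine Finset.sum_congr rfl fun i _ => Finset.sum_congr rfl fun j _ => ?_
        rw [Fintype.sum_prod_type]
      rw [e, e, Finset.sum_comm]
    rw [hsw]
    refine Finset.sum_congr rfl fun i _ => Finset.sum_congr rfl fun j _ =>
      Finset.sum_congr rfl fun k _ => Finset.sum_congr rfl fun l _ => by ring
  -- The second Bianchi identity contracted twice: two of its three terms give the same contraction,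
  -- which is the source of the factor one half.
  have h4 : fderiv ℝ (scalL g c) x y
      - ∑ k, ∑ l, gInv g c k l x * nRic g c x (ev k) y (ev l)
      - ∑ k, ∑ l, gInv g c k l x * nRic g c x (ev k) y (ev l) = 0 := by
    nth_rewrite 1 [h3]
    rw [h1, h2]
    simp only [← Finset.sum_sub_distrib]
    refine Finset.sum_eq_zero fun i _ => Finset.sum_eq_zero fun j _ =>
      Finset.sum_eq_zero fun k _ => Finset.sum_eq_zero fun l _ => ?_
    have a1 := e3 y (ev k) (ev i) (ev j) (ev l)
    have a2 := e1 (ev k) (ev i) y (ev j) (ev l)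
    have a3 := e2 (ev i) y (ev k) (ev j) (ev l)
    have : Q y (ev k) (ev i) (ev j) (ev l) = Q (ev k) (ev i) y (ev l) (ev j)
      + Q (ev i) (ev k) y (ev j) (ev l) := by linarith
    rw [this]; ring
  linarith

/-- The divergence of the image of `θ` under the Ricci endomorphism. -/
theorem divL_ricE_sharp (g : Metric m M) {U : Set (Euc m)} (hUo : IsOpen U)
    (hU : U ⊆ (xt m c).target) {θ : Fin m → Euc m → ℝ} (hθ : ∀ i, ContDiffOn ℝ ∞ (θ i) U)
    (hx : x ∈ U) :
    divL g c (fun x => ricE g c x (sharp g c θ x)) x =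
      ∑ i, ∑ j, ricP g c i j x * nabla g c θ (ev i) j x
      + (1 / 2) * fderiv ℝ (scalL g c) x (sharp g c θ x) := by
  have hxt := hU hx
  have hexp : ∀ x (y : Euc m), ricE g c x y = ∑ l, y l • ricE g c x (ev l) := by
    intro x y
    have := map_sum ((ricE_linear g (c := c) x).mk' _) (fun i => y i • ev i) Finset.univ
    rw [← sum_ev] at this
    simpa [(ricE_linear g (c := c) x).map_smul] using this
  have hYs : ∀ l, ContDiffOn ℝ ∞ (fun x => sharp g c θ x l) U := fun l =>
    (pr l).contDiff.comp_contDiffOn (sharp_smooth g hU hθ)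
  have hYd : ∀ l v, fderiv ℝ (fun x => sharp g c θ x l) x v = (fderiv ℝ (sharp g c θ) x v) l := by
    intro l v
    have := fderiv_comp x (pr l).differentiableAt (diffAt_of_smooth hUo (sharp_smooth g hU hθ) hx)
    have h2 := congrArg (fun T => T v) this
    simp only [ContinuousLinearMap.comp_apply, ContinuousLinearMap.fderiv, pr_apply] at h2
    exact h2
  have hnl : ∀ v, IsLinearMap ℝ fun a : Euc m =>
      ∑ i, ∑ j, gInv g c i j x • nRic g c x v a (ev i) • ev j := by
    have hl : ∀ v b, IsLinearMap ℝ fun a => nRic g c x v a b := by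
      intro v b
      refine ⟨fun a b => ?_, fun r a => ?_⟩
      · simp only [nRic, NR, map_add, add_apply, ← Finset.sum_add_distrib]
        exact Finset.sum_congr rfl fun k _ => by
          simp only [PiLp.sub_apply, PiLp.add_apply]; ring
      · simp only [nRic, NR, map_smul, smul_apply, smul_eq_mul, Finset.mul_sum]
        exact Finset.sum_congr rfl fun k _ => by
          simp only [PiLp.sub_apply, PiLp.add_apply, PiLp.smul_apply, smul_eq_mul]; ring
    intro v
    refine ⟨fun a b => ?_, fun r a => ?_⟩
    · simp only [(hl _ _).map_add, add_smul, smul_add, Finset.sum_add_distrib]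
    · simp only [(hl _ _).map_smul, Finset.smul_sum, smul_assoc]
      refine Finset.sum_congr rfl fun i _ => Finset.sum_congr rfl fun j _ => smul_comm _ _ _
  -- The Leibniz rule for `Ric(Y)`, obtained by expanding `Y` in the coordinate frame, so that only
  -- `Ric` on constant fields has to be differentiated.
  have h1 : ∀ v, cd (gam g c) (fun x => x) (fun x => ricE g c x (sharp g c θ x)) v x =
      ricE g c x (cd (gam g c) (fun x => x) (sharp g c θ) v x)
      + ∑ i, ∑ j, gInv g c i j x • nRic g c x v (sharp g c θ x) (ev i) • ev j := by
    intro v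
    rw [cd_congr hUo (fun z _ => hexp z (sharp g c θ z)) hx,
      cd_sum (w := fun l x => sharp g c θ x l • ricE g c x (ev l)) _ hUo (fun l _ =>
      (hYs l).smul ((ricE_smooth g c (ev l)).mono hU)) hx]
    have h2 : ∀ l, cd (gam g c) (fun x => x) (fun x => sharp g c θ x l • ricE g c x (ev l)) v x =
        ricE g c x ((fderiv ℝ (sharp g c θ) x v) l • ev l)
        + ricE g c x (gam g c x v (sharp g c θ x l • ev l))
        + (∑ i, ∑ j, gInv g c i j x • nRic g c x v (sharp g c θ x l • ev l) (ev i) • ev j) := by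
      intro l
      rw [cd_smul hUo (hYs l) ((ricE_smooth g c (ev l)).mono hU) hx, cd_ricE g hxt, hYd,
        (hnl v).map_smul, (ricE_linear g x).map_smul, map_smul, (ricE_linear g x).map_smul,
        smul_add, add_assoc]
    simp only [h2, Finset.sum_add_distrib]
    have hs : ∀ (L : Euc m → Euc m), IsLinearMap ℝ L → ∀ y : Euc m,
        ∑ l, L (y l • ev l) = L y := by
      intro L hL y
      have := map_sum (hL.mk' _) (fun i => y i • ev i) Finset.univ
      rw [← sum_ev] at this
      exact this.symm
    rw [hs _ (ricE_linear g x), hs _ (hnl v), hs (fun a => ricE g c x (gam g c x v a))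
      ⟨fun a b => by rw [map_add, (ricE_linear g x).map_add],
        fun r a => by rw [map_smul, (ricE_linear g x).map_smul]⟩,
      ← (ricE_linear g x).map_add, cd]
    simp
  have h3 : ∀ k (f : Fin m → ℝ), (∑ i, ∑ j, gInv g c i j x • f i • ev j : Euc m) k =
      ∑ i, gInv g c i k x * f i := by
    intro k f
    simp [Pi.single_apply]
  rw [divL]
  simp only [h1, PiLp.add_apply, Finset.sum_add_distrib, h3]
  congr 1
  · refine Finset.sum_congr rfl fun k _ => ?_
    rw [cd_sharp g hUo hU hθ hx, hexp]
    simp only [h3, ricP, WithLp.ofLp_sum, Finset.sum_apply, PiLp.smul_apply, smul_eq_mul,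
      Finset.sum_mul]
    rw [Finset.sum_comm]
    refine Finset.sum_congr rfl fun i _ => Finset.sum_congr rfl fun j _ => ?_
    rw [gInv_symm g hxt i j]; ring
  · rw [← contracted_bianchi g hxt]
    refine Finset.sum_congr rfl fun k _ => Finset.sum_congr rfl fun j _ => ?_
    rw [gInv_symm g hxt]

end MetricIdentities

end CBiharmonic

end

/-! ### Abstract local data on the source; first and second variation of the energy density. -/

noncomputable section

set_option linter.unusedSectionVars false
set_option synthInstance.maxHeartbeats 200000

namespace CBiharmonic

/-! ### Double sums -/

section Tr2

variable {m : ℕ} {E X Y : Type*} [AddCommGroup X] [Module ℝ X] [AddCommGroup Y] [Module ℝ Y]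

/-- The contraction `∑ A^ij f_ij`, with coefficients at `z`. -/
def tr2 (A : Fin m → Fin m → E → ℝ) (z : E) (f : Fin m → Fin m → X) : X :=
  ∑ i, ∑ j, A i j z • f i j

variable {A : Fin m → Fin m → E → ℝ} {z : E} {f f' : Fin m → Fin m → X}

theorem tr2_congr (h : ∀ i j, f i j = f' i j) : tr2 A z f = tr2 A z f' := by simp only [tr2, h]

theorem tr2_add : tr2 A z (fun i j => f i j + f' i j) = tr2 A z f + tr2 A z f' := by
  simp only [tr2, smul_add, Finset.sum_add_distrib]

theorem tr2_sub : tr2 A z (fun i j => f i j - f' i j) = tr2 A z f - tr2 A z f' := by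
  simp only [tr2, smul_sub, Finset.sum_sub_distrib]

theorem tr2_neg : tr2 A z (fun i j => - f i j) = - tr2 A z f := by
  simp only [tr2, smul_neg, Finset.sum_neg_distrib]

theorem tr2_smul (r : ℝ) : tr2 A z (fun i j => r • f i j) = r • tr2 A z f := by
  simp only [tr2, Finset.smul_sum, smul_comm r]

theorem tr2_mul (r : ℝ) {f : Fin m → Fin m → ℝ} :
    tr2 A z (fun i j => r * f i j) = r * tr2 A z f := tr2_smul (X := ℝ) r

theorem tr2_map (L : X →ₗ[ℝ] Y) : L (tr2 A z f) = tr2 A z fun i j => L (f i j) := by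
  simp only [tr2, map_sum, map_smul]

theorem tr2_swap (hA : ∀ i j, A i j z = A j i z) : tr2 A z (fun i j => f j i) = tr2 A z f := by
  rw [tr2, Finset.sum_comm]
  simp only [tr2]
  exact Finset.sum_congr rfl fun i _ => Finset.sum_congr rfl fun j _ => by rw [hA]

end Tr2

/-! ### Differential operators along a map, in local coordinates -/

variable {m : ℕ} {E F : Type*} [NormedAddCommGroup E] [NormedSpace ℝ E]
  [NormedAddCommGroup F] [NormedSpace ℝ F]

/-- Local coefficients of the operators on the source: directions `e`, inverse metric `GI`,
Christoffel symbols `C`, Ricci coefficients `P`, scalar curvature `S`. -/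
structure Loc (m : ℕ) (E : Type*) where
  e : Fin m → E
  GI : Fin m → Fin m → E → ℝ
  C : Fin m → Fin m → Fin m → E → ℝ
  P : Fin m → Fin m → E → ℝ
  S : E → ℝ

namespace Loc

variable (K : Loc m E) (H : F → F →L[ℝ] F →L[ℝ] ℝ) (Γ : F → F →L[ℝ] F →L[ℝ] F) (u : E → F)

/-- The partial derivative of `u` in the `i`-th direction. -/
def par (i : Fin m) (z : E) : F := fderiv ℝ u z (K.e i)

/-- The covariant derivative in the `i`-th direction. -/
def cov (i : Fin m) (w : E → F) (z : E) : F := cd Γ u w (K.e i) z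

/-- The second covariant derivative. -/
def cov2 (i j : Fin m) (w : E → F) (z : E) : F :=
  K.cov Γ u i (K.cov Γ u j w) z - ∑ k, K.C k i j z • K.cov Γ u k w z

/-- The trace of the second covariant derivative. -/
def lap (w : E → F) (z : E) : F := tr2 K.GI z fun i j => K.cov2 Γ u i j w z

/-- The second fundamental form of the map. -/
def hess (i j : Fin m) (z : E) : F :=
  K.cov Γ u i (K.par u j) z - ∑ k, K.C k i j z • K.par u k z

/-- The tension field. -/
def ten (z : E) : F := tr2 K.GI z fun i j => K.hess Γ u i j z

/-- `∑ A^ij R(∂_i u, w)∂_j u`. -/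
def trc (A : Fin m → Fin m → E → ℝ) (w : E → F) (z : E) : F :=
  tr2 A z fun i j => RC Γ (u z) (K.par u i z) (w z) (K.par u j z)

/-- The Jacobi operator. -/
def jac (w : E → F) (z : E) : F := - K.lap Γ u w z + K.trc Γ u K.GI w z

/-- The operator `J₂`. -/
def jac2 (w : E → F) (z : E) : F :=
  K.jac Γ u (K.jac Γ u w) z - RC Γ (u z) (K.ten Γ u z) (w z) (K.ten Γ u z)
    - tr2 K.GI z (fun i j => NR Γ (u z) (K.ten Γ u z) (K.par u i z) (w z) (K.par u j z))
    + tr2 K.GI z (fun i j =>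
        NR Γ (u z) (K.par u i z) (K.ten Γ u z) (K.par u j z) (w z)
        + (2 : ℝ) • RC Γ (u z) (w z) (K.par u i z) (K.cov Γ u j (K.ten Γ u) z)
        + (2 : ℝ) • RC Γ (u z) (K.ten Γ u z) (K.par u i z) (K.cov Γ u j w z))

/-- The operator `J₂ᶜ`. -/
def jac2c (w : E → F) (z : E) : F :=
  K.jac2 Γ u w z - (2 : ℝ) • K.trc Γ u K.P w z + ((2 / 3 : ℝ) * K.S z) • K.jac Γ u w z
    + (2 : ℝ) • tr2 K.P z (fun i j => K.cov2 Γ u i j w z)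
    + (1 / 3 : ℝ) • tr2 K.GI z (fun i j => fderiv ℝ K.S z (K.e i) • K.cov Γ u j w z)

/-- The integrand of the second variation formula. -/
def hessI (v w : E → F) (z : E) : ℝ :=
  H (u z) (K.jac2 Γ u w z - (2 : ℝ) • K.trc Γ u K.P w z) (v z)
    + (2 / 3) * K.S z * H (u z) (K.trc Γ u K.GI w z) (v z)
    + (2 / 3) * K.S z * tr2 K.GI z (fun i j => H (u z) (K.cov Γ u i w z) (K.cov Γ u j v z))
    - 2 * tr2 K.P z (fun i j => H (u z) (K.cov Γ u i w z) (K.cov Γ u j v z))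

/-- The divergence of a `1`-form. -/
def div (θ : Fin m → E → ℝ) (z : E) : ℝ :=
  tr2 K.GI z fun i j => fderiv ℝ (θ j) z (K.e i) - ∑ k, K.C k i j z * θ k z

/-- The integrand of the conformal-bienergy. -/
def dens (z : E) : ℝ :=
  H (u z) (K.ten Γ u z) (K.ten Γ u z)
    + (2 / 3) * K.S z * tr2 K.GI z (fun i j => H (u z) (K.par u i z) (K.par u j z))
    - 2 * tr2 K.P z (fun i j => H (u z) (K.par u i z) (K.par u j z))

/-- The integrand of the first variation. -/
def lin (w : E → F) (z : E) : ℝ :=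
  - H (u z) (K.jac Γ u w z) (K.ten Γ u z)
    + (2 / 3) * K.S z * tr2 K.GI z (fun i j => H (u z) (K.cov Γ u i w z) (K.par u j z))
    - 2 * tr2 K.P z (fun i j => H (u z) (K.cov Γ u i w z) (K.par u j z))

/-- The commutator of the Jacobi operator with a variation in the direction `v`. -/
def comm (v w : E → F) (z : E) : F :=
  tr2 K.GI z (fun i j => NR Γ (u z) (K.par u i z) (v z) (K.par u j z) (w z)
      + RC Γ (u z) (K.cov Γ u i v z) (K.par u j z) (w z)
      + (2 : ℝ) • RC Γ (u z) (v z) (K.par u i z) (K.cov Γ u j w z)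
      + NR Γ (u z) (v z) (w z) (K.par u i z) (K.par u j z)
      + RC Γ (u z) (w z) (K.cov Γ u i v z) (K.par u j z)
      + RC Γ (u z) (w z) (K.par u i z) (K.cov Γ u j v z))
    + RC Γ (u z) (v z) (K.ten Γ u z) (w z)

/-- The integrand of the second variation, before integration by parts. -/
def sec (v w : E → F) (z : E) : ℝ :=
  H (u z) (K.jac Γ u w z) (K.jac Γ u v z) + H (u z) (K.comm Γ u v w z) (K.ten Γ u z)
    + (2 / 3) * K.S z * tr2 K.GI z (fun i j => H (u z) (K.cov Γ u i w z) (K.cov Γ u j v z)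
        + H (u z) (RC Γ (u z) (v z) (K.par u i z) (w z)) (K.par u j z))
    - 2 * tr2 K.P z (fun i j => H (u z) (K.cov Γ u i w z) (K.cov Γ u j v z)
        + H (u z) (RC Γ (u z) (v z) (K.par u i z) (w z)) (K.par u j z))

end Loc

/-- The standing assumptions on the local data. -/
structure Setup (K : Loc m E) (U : Set E) (Ω : Set F) (H : F → F →L[ℝ] F →L[ℝ] ℝ)
    (Γ : F → F →L[ℝ] F →L[ℝ] F) (u : E → F) : Prop where
  hU : IsOpen U
  hΩ : IsOpen Ω
  hΓ : ContDiffOn ℝ ∞ Γ Ω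
  hs : ∀ y ∈ Ω, ∀ a b, Γ y a b = Γ y b a
  hH : ContDiffOn ℝ ∞ H Ω
  hHs : ∀ y ∈ Ω, ∀ a b, H y a b = H y b a
  hc : Compat Ω H Γ
  hu : ContDiffOn ℝ ∞ u U
  hm : ∀ z ∈ U, u z ∈ Ω
  hGI : ∀ i j, ContDiffOn ℝ ∞ (K.GI i j) U
  hGIs : ∀ z ∈ U, ∀ i j, K.GI i j z = K.GI j i z
  hC : ∀ k i j, ContDiffOn ℝ ∞ (K.C k i j) U
  hP : ∀ i j, ContDiffOn ℝ ∞ (K.P i j) U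
  hPs : ∀ z ∈ U, ∀ i j, K.P i j z = K.P j i z
  hS : ContDiffOn ℝ ∞ K.S U

namespace Setup

variable [FiniteDimensional ℝ F] {K : Loc m E} {U : Set E} {Ω : Set F}
  {H : F → F →L[ℝ] F →L[ℝ] ℝ}
  {Γ : F → F →L[ℝ] F →L[ℝ] F} {u v w : E → F}

theorem par_smooth (h : Setup K U Ω H Γ u) (i : Fin m) : ContDiffOn ℝ ∞ (K.par u i) U :=
  smooth_fderiv_apply h.hU h.hu _

theorem cov_smooth (h : Setup K U Ω H Γ u) (hw : ContDiffOn ℝ ∞ w U) (i : Fin m) :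
    ContDiffOn ℝ ∞ (K.cov Γ u i w) U := cd_smooth h.hU h.hΓ h.hu h.hm hw _

theorem tr2_smooth {A : Fin m → Fin m → E → ℝ} {X : Type*} [NormedAddCommGroup X]
    [NormedSpace ℝ X] {f : Fin m → Fin m → E → X}
    (hA : ∀ i j, ContDiffOn ℝ ∞ (A i j) U) (hf : ∀ i j, ContDiffOn ℝ ∞ (f i j) U) :
    ContDiffOn ℝ ∞ (fun z => tr2 A z fun i j => f i j z) U :=
  ContDiffOn.sum fun i _ => ContDiffOn.sum fun j _ => (hA i j).smul (hf i j)

theorem cov2_smooth (h : Setup K U Ω H Γ u) (hw : ContDiffOn ℝ ∞ w U) (i j : Fin m) :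
    ContDiffOn ℝ ∞ (K.cov2 Γ u i j w) U :=
  (h.cov_smooth (h.cov_smooth hw j) i).sub
    (ContDiffOn.sum fun k _ => (h.hC k i j).smul (h.cov_smooth hw k))

theorem lap_smooth (h : Setup K U Ω H Γ u) (hw : ContDiffOn ℝ ∞ w U) :
    ContDiffOn ℝ ∞ (K.lap Γ u w) U := tr2_smooth h.hGI fun i j => h.cov2_smooth hw i j

theorem hess_smooth (h : Setup K U Ω H Γ u) (i j : Fin m) :
    ContDiffOn ℝ ∞ (K.hess Γ u i j) U :=
  (h.cov_smooth (h.par_smooth j) i).sub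
    (ContDiffOn.sum fun k _ => (h.hC k i j).smul (h.par_smooth k))

theorem ten_smooth (h : Setup K U Ω H Γ u) : ContDiffOn ℝ ∞ (K.ten Γ u) U :=
  tr2_smooth h.hGI fun i j => h.hess_smooth i j

theorem RC_smooth (h : Setup K U Ω H Γ u) {a b c : E → F} (ha : ContDiffOn ℝ ∞ a U)
    (hb : ContDiffOn ℝ ∞ b U) (hc : ContDiffOn ℝ ∞ c U) :
    ContDiffOn ℝ ∞ (fun z => RC Γ (u z) (a z) (b z) (c z)) U :=
  ((((CBiharmonic.RC_smooth h.hΩ h.hΓ).comp h.hu h.hm).clm_apply ha).clm_apply hb).clm_apply hc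

theorem NR_smooth (h : Setup K U Ω H Γ u) {x a b c : E → F} (hx : ContDiffOn ℝ ∞ x U)
    (ha : ContDiffOn ℝ ∞ a U)
    (hb : ContDiffOn ℝ ∞ b U) (hc : ContDiffOn ℝ ∞ c U) :
    ContDiffOn ℝ ∞ (fun z => NR Γ (u z) (x z) (a z) (b z) (c z)) U := by
  have h1 : ContDiffOn ℝ ∞ (fun z => fderiv ℝ (RC Γ) (u z)) U :=
    (smooth_fderiv h.hΩ (CBiharmonic.RC_smooth h.hΩ h.hΓ)).comp h.hu h.hm
  have h2 : ContDiffOn ℝ ∞ (fun z => Γ (u z)) U := h.hΓ.comp h.hu h.hm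
  have h3 : ∀ {y : E → F}, ContDiffOn ℝ ∞ y U → ContDiffOn ℝ ∞ (fun z => Γ (u z) (x z) (y z)) U :=
    fun hy => (h2.clm_apply hx).clm_apply hy
  exact (((((((h1.clm_apply hx).clm_apply ha).clm_apply hb).clm_apply hc).add
    (h3 (h.RC_smooth ha hb hc))).sub (h.RC_smooth (h3 ha) hb hc)).sub
    (h.RC_smooth ha (h3 hb) hc)).sub (h.RC_smooth ha hb (h3 hc))

theorem trc_smooth (h : Setup K U Ω H Γ u) {A : Fin m → Fin m → E → ℝ}
    (hA : ∀ i j, ContDiffOn ℝ ∞ (A i j) U) (hw : ContDiffOn ℝ ∞ w U) :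
    ContDiffOn ℝ ∞ (K.trc Γ u A w) U :=
  tr2_smooth hA fun i j => h.RC_smooth (h.par_smooth i) hw (h.par_smooth j)

theorem jac_smooth (h : Setup K U Ω H Γ u) (hw : ContDiffOn ℝ ∞ w U) :
    ContDiffOn ℝ ∞ (K.jac Γ u w) U := (h.lap_smooth hw).neg.add (h.trc_smooth h.hGI hw)

theorem jac2_smooth (h : Setup K U Ω H Γ u) (hw : ContDiffOn ℝ ∞ w U) :
    ContDiffOn ℝ ∞ (K.jac2 Γ u w) U :=
  (((h.jac_smooth (h.jac_smooth hw)).sub (h.RC_smooth h.ten_smooth hw h.ten_smooth)).sub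
    (tr2_smooth h.hGI fun i j => h.NR_smooth h.ten_smooth (h.par_smooth i) hw (h.par_smooth j))).add
    (tr2_smooth h.hGI fun i j =>
      ((h.NR_smooth (h.par_smooth i) h.ten_smooth (h.par_smooth j) hw).add
        ((h.RC_smooth hw (h.par_smooth i) (h.cov_smooth h.ten_smooth j)).const_smul (2 : ℝ))).add
        ((h.RC_smooth h.ten_smooth (h.par_smooth i) (h.cov_smooth hw j)).const_smul (2 : ℝ)))

theorem jac2c_smooth (h : Setup K U Ω H Γ u) (hw : ContDiffOn ℝ ∞ w U) :
    ContDiffOn ℝ ∞ (K.jac2c Γ u w) U :=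
  ((((h.jac2_smooth hw).sub ((h.trc_smooth h.hP hw).const_smul (2 : ℝ))).add
    ((contDiffOn_const.mul h.hS).smul (h.jac_smooth hw))).add
    ((tr2_smooth h.hP fun i j => h.cov2_smooth hw i j).const_smul (2 : ℝ))).add
    ((tr2_smooth h.hGI fun i j =>
      (smooth_fderiv_apply h.hU h.hS (K.e i)).smul (h.cov_smooth hw j)).const_smul (1 / 3 : ℝ))

theorem H_smooth (h : Setup K U Ω H Γ u) (hv : ContDiffOn ℝ ∞ v U) (hw : ContDiffOn ℝ ∞ w U) :
    ContDiffOn ℝ ∞ (fun z => H (u z) (v z) (w z)) U :=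
  ((h.hH.comp h.hu h.hm).clm_apply hv).clm_apply hw

theorem hessI_smooth (h : Setup K U Ω H Γ u) (hv : ContDiffOn ℝ ∞ v U)
    (hw : ContDiffOn ℝ ∞ w U) : ContDiffOn ℝ ∞ (K.hessI H Γ u v w) U :=
  (((h.H_smooth ((h.jac2_smooth hw).sub ((h.trc_smooth h.hP hw).const_smul (2 : ℝ))) hv).add
    ((contDiffOn_const.mul h.hS).mul (h.H_smooth (h.trc_smooth h.hGI hw) hv))).add
    ((contDiffOn_const.mul h.hS).mul (tr2_smooth h.hGI fun i j =>
      h.H_smooth (h.cov_smooth hw i) (h.cov_smooth hv j)))).sub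
    (contDiffOn_const.mul (tr2_smooth h.hP fun i j =>
      h.H_smooth (h.cov_smooth hw i) (h.cov_smooth hv j)))

theorem dens_smooth (h : Setup K U Ω H Γ u) : ContDiffOn ℝ ∞ (K.dens H Γ u) U :=
  ((h.H_smooth h.ten_smooth h.ten_smooth).add
    ((contDiffOn_const.mul h.hS).mul (tr2_smooth h.hGI fun i j =>
      h.H_smooth (h.par_smooth i) (h.par_smooth j)))).sub
    (contDiffOn_const.mul (tr2_smooth h.hP fun i j =>
      h.H_smooth (h.par_smooth i) (h.par_smooth j)))

theorem lin_smooth (h : Setup K U Ω H Γ u) (hw : ContDiffOn ℝ ∞ w U) :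
    ContDiffOn ℝ ∞ (K.lin H Γ u w) U :=
  (((h.H_smooth (h.jac_smooth hw) h.ten_smooth).neg).add
    ((contDiffOn_const.mul h.hS).mul (tr2_smooth h.hGI fun i j =>
      h.H_smooth (h.cov_smooth hw i) (h.par_smooth j)))).sub
    (contDiffOn_const.mul (tr2_smooth h.hP fun i j =>
      h.H_smooth (h.cov_smooth hw i) (h.par_smooth j)))

/-! ### Variations -/

/-- Meant for a parameter direction `a`, in which the coefficients of the source metric are
constant; the trace then commutes with the derivative. -/
theorem cd_tr2 (h : Setup K U Ω H Γ u) {A : Fin m → Fin m → E → ℝ} {f : Fin m → Fin m → E → F}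
    (hA : ∀ i j, ContDiffOn ℝ ∞ (A i j) U) (hf : ∀ i j, ContDiffOn ℝ ∞ (f i j) U)
    {z a : E} (hz : z ∈ U) (hd : ∀ i j, fderiv ℝ (A i j) z a = 0) :
    cd Γ u (fun z => tr2 A z fun i j => f i j z) a z =
      tr2 A z fun i j => cd Γ u (f i j) a z := by
  simp only [tr2]
  rw [cd_sum (w := fun i z => ∑ j, A i j z • f i j z) _ h.hU
    (fun i _ => ContDiffOn.sum fun j _ => (hA i j).smul (hf i j)) hz]
  refine Finset.sum_congr rfl fun i _ => ?_
  rw [cd_sum (w := fun j z => A i j z • f i j z) _ h.hU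
    (fun j _ => (hA i j).smul (hf i j)) hz]
  refine Finset.sum_congr rfl fun j _ => ?_
  rw [cd_smul h.hU (hA i j) (hf i j) hz, hd, zero_smul, zero_add]

theorem fderiv_tr2 (h : Setup K U Ω H Γ u) {A : Fin m → Fin m → E → ℝ} {f : Fin m → Fin m → E → ℝ}
    (hA : ∀ i j, ContDiffOn ℝ ∞ (A i j) U) (hf : ∀ i j, ContDiffOn ℝ ∞ (f i j) U)
    {z a : E} (hz : z ∈ U) (hd : ∀ i j, fderiv ℝ (A i j) z a = 0) :
    fderiv ℝ (fun z => tr2 A z fun i j => f i j z) z a =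
      tr2 A z fun i j => fderiv ℝ (f i j) z a := by
  simp only [tr2, smul_eq_mul]
  rw [fderiv_fun_sum (A := fun i z => ∑ j, A i j z * f i j z)
    (fun i _ => diffAt_of_smooth h.hU (ContDiffOn.sum fun j _ => (hA i j).mul (hf i j)) hz),
    sum_apply]
  refine Finset.sum_congr rfl fun i _ => ?_
  rw [fderiv_fun_sum (A := fun j z => A i j z * f i j z)
    (fun j _ => diffAt_of_smooth h.hU ((hA i j).mul (hf i j)) hz), sum_apply]
  refine Finset.sum_congr rfl fun j _ => ?_
  rw [fderiv_fun_mul (diffAt_of_smooth h.hU (hA i j) hz) (diffAt_of_smooth h.hU (hf i j) hz)]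
  simp [hd]

/-- The coefficients of `K` do not depend on the direction `a`. -/
structure Indep (K : Loc m E) (U : Set E) (a : E) : Prop where
  GI : ∀ i j, ∀ z ∈ U, fderiv ℝ (K.GI i j) z a = 0
  C : ∀ k i j, ∀ z ∈ U, fderiv ℝ (K.C k i j) z a = 0
  P : ∀ i j, ∀ z ∈ U, fderiv ℝ (K.P i j) z a = 0
  S : ∀ z ∈ U, fderiv ℝ K.S z a = 0

theorem cd_sumC (h : Setup K U Ω H Γ u) {a : E} (ha : Indep K U a) {f : Fin m → E → F}
    (hf : ∀ k, ContDiffOn ℝ ∞ (f k) U) {z : E} (hz : z ∈ U) (i j : Fin m) :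
    cd Γ u (fun z => ∑ k, K.C k i j z • f k z) a z = ∑ k, K.C k i j z • cd Γ u (f k) a z := by
  rw [cd_sum (w := fun k z => K.C k i j z • f k z) _ h.hU
    (fun k _ => (h.hC k i j).smul (hf k)) hz]
  refine Finset.sum_congr rfl fun k _ => ?_
  rw [cd_smul h.hU (h.hC k i j) (hf k) hz, ha.C k i j z hz, zero_smul, zero_add]

/-- With `cd_par` this is the only mechanism of the variation: each exchange of a parameter
derivative with a space derivative costs one curvature term. -/
theorem cd_cov (h : Setup K U Ω H Γ u) (hw : ContDiffOn ℝ ∞ w U) {z : E} (hz : z ∈ U) (b : E)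
    (i : Fin m) : cd Γ u (K.cov Γ u i w) b z =
      K.cov Γ u i (cd Γ u w b) z + RC Γ (u z) (fderiv ℝ u z b) (K.par u i z) (w z) :=
  cd_comm h.hU h.hΩ h.hΓ h.hu h.hm hw hz _ _

theorem cd_par (h : Setup K U Ω H Γ u) {z : E} (hz : z ∈ U) (a : E) (i : Fin m) :
    cd Γ u (K.par u i) a z = K.cov Γ u i (fun z => fderiv ℝ u z a) z :=
  cd_fderiv_comm h.hU h.hu hz (h.hs _ (h.hm z hz)) _ _

theorem cd_smooth (h : Setup K U Ω H Γ u) (hw : ContDiffOn ℝ ∞ w U) (a : E) :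
    ContDiffOn ℝ ∞ (cd Γ u w a) U := CBiharmonic.cd_smooth h.hU h.hΓ h.hu h.hm hw _

/-- The variation of the tension field. -/
theorem cd_ten (h : Setup K U Ω H Γ u) {a : E} (ha : Indep K U a) {z : E} (hz : z ∈ U) :
    cd Γ u (K.ten Γ u) a z = - K.jac Γ u (fun z => fderiv ℝ u z a) z := by
  have hX : ContDiffOn ℝ ∞ (fun z => fderiv ℝ u z a) U := smooth_fderiv_apply h.hU h.hu a
  -- Torsion-freeness turns the derivative of `∂_j u` into `∇_j` of the variation field; the
  -- exchange with `∇_i` gives the curvature term.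
  have h1 : ∀ i j, cd Γ u (K.hess Γ u i j) a z =
      K.cov2 Γ u i j (fun z => fderiv ℝ u z a) z
        - RC Γ (u z) (K.par u i z) (fderiv ℝ u z a) (K.par u j z) := by
    intro i j
    have e1 : cd Γ u (K.hess Γ u i j) a z = cd Γ u (K.cov Γ u i (K.par u j)) a z
        - cd Γ u (fun z => ∑ k, K.C k i j z • K.par u k z) a z :=
      cd_sub h.hU (h.cov_smooth (h.par_smooth j) i)
        (ContDiffOn.sum fun k _ => (h.hC k i j).smul (h.par_smooth k)) hz a
    have e2 : K.cov Γ u i (cd Γ u (K.par u j) a) z =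
        K.cov Γ u i (K.cov Γ u j fun z => fderiv ℝ u z a) z :=
      cd_congr h.hU (fun y hy => h.cd_par hy a j) hz _
    rw [e1, h.cd_cov (h.par_smooth j) hz, e2, h.cd_sumC ha h.par_smooth hz, RC_antisymm (u z)
      (fderiv ℝ u z a)]
    simp only [h.cd_par hz, Loc.cov2]
    abel
  have h2 : cd Γ u (K.ten Γ u) a z = _ := h.cd_tr2 h.hGI h.hess_smooth hz
    (fun i j => ha.GI i j z hz)
  rw [h2, tr2_congr h1, tr2_sub, Loc.jac, Loc.lap, Loc.trc]
  abel

/-- The variation of the Jacobi operator. -/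
theorem cd_jac (h : Setup K U Ω H Γ u) {b : E} (hb : Indep K U b) (hw : ContDiffOn ℝ ∞ w U)
    {z : E} (hz : z ∈ U) :
    cd Γ u (K.jac Γ u w) b z = K.jac Γ u (cd Γ u w b) z
      - K.comm Γ u (fun z => fderiv ℝ u z b) w z := by
  set X : E → F := fun z => fderiv ℝ u z b with hXdef
  have hX : ContDiffOn ℝ ∞ X U := smooth_fderiv_apply h.hU h.hu b
  -- The parameter derivative passes two covariant derivatives. The inner curvature term is then
  -- differentiated by `∇_i`, which yields the `NR` term, and the Christoffel terms complete `∇_i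
  -- ∂_j u` to the second fundamental form.
  have h1 : ∀ i j, cd Γ u (K.cov2 Γ u i j w) b z = K.cov2 Γ u i j (cd Γ u w b) z
      + (NR Γ (u z) (K.par u i z) (X z) (K.par u j z) (w z)
      + RC Γ (u z) (K.cov Γ u i X z) (K.par u j z) (w z)
      + RC Γ (u z) (X z) (K.par u j z) (K.cov Γ u i w z)
      + RC Γ (u z) (X z) (K.par u i z) (K.cov Γ u j w z)
      + RC Γ (u z) (X z) (K.hess Γ u i j z) (w z)) := by
    intro i j
    have e1 : cd Γ u (K.cov2 Γ u i j w) b z = cd Γ u (K.cov Γ u i (K.cov Γ u j w)) b z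
        - cd Γ u (fun z => ∑ k, K.C k i j z • K.cov Γ u k w z) b z :=
      cd_sub h.hU (h.cov_smooth (h.cov_smooth hw j) i)
        (ContDiffOn.sum fun k _ => (h.hC k i j).smul (h.cov_smooth hw k)) hz b
    have e2 : K.cov Γ u i (cd Γ u (K.cov Γ u j w) b) z =
        K.cov Γ u i (fun z => K.cov Γ u j (cd Γ u w b) z
          + RC Γ (u z) (X z) (K.par u j z) (w z)) z :=
      cd_congr h.hU (fun y hy => h.cd_cov hw hy b j) hz _
    have e3 : K.cov Γ u i (fun z => K.cov Γ u j (cd Γ u w b) z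
          + RC Γ (u z) (X z) (K.par u j z) (w z)) z =
        K.cov Γ u i (K.cov Γ u j (cd Γ u w b)) z
          + K.cov Γ u i (fun z => RC Γ (u z) (X z) (K.par u j z) (w z)) z :=
      cd_add h.hU (h.cov_smooth (h.cd_smooth hw b) j) (h.RC_smooth hX (h.par_smooth j) hw) hz _
    have e4 : K.cov Γ u i (fun z => RC Γ (u z) (X z) (K.par u j z) (w z)) z =
        NR Γ (u z) (K.par u i z) (X z) (K.par u j z) (w z)
        + RC Γ (u z) (K.cov Γ u i X z) (K.par u j z) (w z)
        + RC Γ (u z) (X z) (K.cov Γ u i (K.par u j) z) (w z)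
        + RC Γ (u z) (X z) (K.par u j z) (K.cov Γ u i w z) :=
      cd_RC h.hU h.hΩ h.hΓ h.hu h.hm hX (h.par_smooth j) hw hz _
    rw [e1, h.cd_cov (h.cov_smooth hw j) hz, e2, e3, e4,
      h.cd_sumC hb (fun k => h.cov_smooth hw k) hz]
    simp only [h.cd_cov hw hz, Loc.cov2, Loc.hess, map_sub, sub_apply, map_sum, map_smul,
      sum_apply, smul_apply, smul_add, Finset.sum_add_distrib]
    abel
  have h2 : cd Γ u (K.lap Γ u w) b z = _ := h.cd_tr2 h.hGI (fun i j => h.cov2_smooth hw i j) hz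
    (fun i j => hb.GI i j z hz)
  have h3 : cd Γ u (K.trc Γ u K.GI w) b z = _ :=
    h.cd_tr2 h.hGI (fun i j => h.RC_smooth (h.par_smooth i) hw (h.par_smooth j)) hz
    (fun i j => hb.GI i j z hz)
  have h4 : ∀ i j, cd Γ u (fun z => RC Γ (u z) (K.par u i z) (w z) (K.par u j z)) b z =
      NR Γ (u z) (X z) (K.par u i z) (w z) (K.par u j z)
      + RC Γ (u z) (K.cov Γ u i X z) (w z) (K.par u j z)
      + RC Γ (u z) (K.par u i z) (cd Γ u w b z) (K.par u j z)
      + RC Γ (u z) (K.par u i z) (w z) (K.cov Γ u j X z) := by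
    intro i j
    rw [cd_RC h.hU h.hΩ h.hΓ h.hu h.hm (h.par_smooth i) hw (h.par_smooth j) hz, h.cd_par hz,
      h.cd_par hz]
  have h5 : cd Γ u (K.jac Γ u w) b z = - cd Γ u (K.lap Γ u w) b z
      + cd Γ u (K.trc Γ u K.GI w) b z := by
    rw [← cd_neg]
    exact cd_add h.hU (h.lap_smooth hw).neg (h.trc_smooth h.hGI hw) hz b
  have h6 : RC Γ (u z) (X z) (K.ten Γ u z) (w z) =
      tr2 K.GI z fun i j => RC Γ (u z) (X z) (K.hess Γ u i j z) (w z) :=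
    tr2_map (((RC Γ (u z) (X z)).flip (w z)).toLinearMap)
  -- Under the symmetric trace the two mixed terms coincide; this produces the coefficient `2` in
  -- `comm`.
  have h7 : tr2 K.GI z (fun i j => RC Γ (u z) (X z) (K.par u j z) (K.cov Γ u i w z)) =
      tr2 K.GI z (fun i j => RC Γ (u z) (X z) (K.par u i z) (K.cov Γ u j w z)) :=
    tr2_swap (f := fun i j => RC Γ (u z) (X z) (K.par u i z) (K.cov Γ u j w z)) (h.hGIs z hz)
  have h8 : ∀ i j, NR Γ (u z) (X z) (K.par u i z) (w z) (K.par u j z) =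
      - NR Γ (u z) (X z) (w z) (K.par u i z) (K.par u j z) := fun i j => NR_antisymm _ _ _ _ _
  have h9 : ∀ a i, RC Γ (u z) a (w z) (K.par u i z) = - RC Γ (u z) (w z) a (K.par u i z) :=
    fun a i => RC_antisymm _ _ _ _
  have h10 : ∀ i j, RC Γ (u z) (K.par u i z) (w z) (K.cov Γ u j X z) =
      - RC Γ (u z) (w z) (K.par u i z) (K.cov Γ u j X z) := fun i j => RC_antisymm _ _ _ _
  rw [h5, h2, h3, tr2_congr h1, tr2_congr h4, Loc.comm, h6]
  simp only [h8, h9 (K.cov Γ u _ X z), h10, tr2_add, tr2_neg, h7, tr2_smul, Loc.jac, Loc.lap,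
    Loc.trc]
  module

theorem fderiv_H (h : Setup K U Ω H Γ u) (hv : ContDiffOn ℝ ∞ v U) (hw : ContDiffOn ℝ ∞ w U)
    {z : E} (hz : z ∈ U) (a : E) :
    fderiv ℝ (fun z => H (u z) (v z) (w z)) z a =
      H (u z) (cd Γ u v a z) (w z) + H (u z) (v z) (cd Γ u w a z) :=
  fderiv_metric h.hU h.hΩ h.hH h.hc h.hu h.hm hv hw hz a

theorem fderiv_S_mul (h : Setup K U Ω H Γ u) {a : E} (ha : Indep K U a) {f : E → ℝ}
    (hf : ContDiffOn ℝ ∞ f U) {z : E} (hz : z ∈ U) :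
    fderiv ℝ (fun z => (2 / 3) * K.S z * f z) z a = (2 / 3) * K.S z * fderiv ℝ f z a := by
  rw [fderiv_fun_mul ((diffAt_of_smooth h.hU h.hS hz).const_mul _) (diffAt_of_smooth h.hU hf hz),
    fderiv_const_mul (diffAt_of_smooth h.hU h.hS hz)]
  simp [ha.S z hz]

/-- The first variation of the integrand. -/
theorem fderiv_dens (h : Setup K U Ω H Γ u) {a : E} (ha : Indep K U a) {z : E} (hz : z ∈ U) :
    fderiv ℝ (K.dens H Γ u) z a = 2 * K.lin H Γ u (fun z => fderiv ℝ u z a) z := by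
  set X : E → F := fun z => fderiv ℝ u z a with hXdef
  have hy := h.hm z hz
  have hpp : ∀ i j, ContDiffOn ℝ ∞ (fun z => H (u z) (K.par u i z) (K.par u j z)) U := fun i j =>
    h.H_smooth (h.par_smooth i) (h.par_smooth j)
  have t1 : ∀ A : Fin m → Fin m → E → ℝ, (∀ i j, ContDiffOn ℝ ∞ (A i j) U) →
      (∀ i j, fderiv ℝ (A i j) z a = 0) → (∀ i j, A i j z = A j i z) →
      fderiv ℝ (fun z => tr2 A z fun i j => H (u z) (K.par u i z) (K.par u j z)) z a =
        2 * tr2 A z fun i j => H (u z) (K.cov Γ u i X z) (K.par u j z) := by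
    intro A hA hd hs
    rw [h.fderiv_tr2 hA hpp hz hd]
    have e1 : ∀ i j, fderiv ℝ (fun z => H (u z) (K.par u i z) (K.par u j z)) z a =
        H (u z) (K.cov Γ u i X z) (K.par u j z) + H (u z) (K.cov Γ u j X z) (K.par u i z) := by
      intro i j
      rw [h.fderiv_H (h.par_smooth i) (h.par_smooth j) hz, h.cd_par hz, h.cd_par hz,
        h.hHs _ hy (K.par u i z)]
    rw [tr2_congr e1, tr2_add,
      tr2_swap (f := fun i j => H (u z) (K.cov Γ u i X z) (K.par u j z)) hs]
    ring
  have d1 := diffAt_of_smooth h.hU (h.H_smooth h.ten_smooth h.ten_smooth) hz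
  have s2 := tr2_smooth h.hGI hpp
  have s3 := tr2_smooth h.hP hpp
  have d2 := diffAt_of_smooth h.hU ((contDiffOn_const (c := (2 / 3 : ℝ)).mul h.hS).mul s2) hz
  have d3 := diffAt_of_smooth h.hU s3 hz
  have e : fderiv ℝ (K.dens H Γ u) z a = fderiv ℝ (fun z => H (u z) (K.ten Γ u z) (K.ten Γ u z)
      + (2 / 3) * K.S z * tr2 K.GI z (fun i j => H (u z) (K.par u i z) (K.par u j z))
      - 2 * tr2 K.P z (fun i j => H (u z) (K.par u i z) (K.par u j z))) z a := rfl
  rw [e, fderiv_fun_sub (d1.fun_add d2) (d3.const_mul 2), fderiv_fun_add d1 d2, fderiv_const_mul d3]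
  simp only [sub_apply, add_apply, smul_apply, smul_eq_mul]
  rw [h.fderiv_H h.ten_smooth h.ten_smooth hz, h.fderiv_S_mul ha s2 hz,
    t1 _ h.hGI (fun i j => ha.GI i j z hz) (h.hGIs z hz),
    t1 _ h.hP (fun i j => ha.P i j z hz) (h.hPs z hz), h.cd_ten ha hz,
    h.hHs _ hy (K.ten Γ u z), Loc.lin]
  simp only [map_neg, neg_apply]
  ring

/-- The second variation of the integrand. -/
theorem fderiv_lin (h : Setup K U Ω H Γ u) {b : E} (hb : Indep K U b) (hw : ContDiffOn ℝ ∞ w U)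
    {z : E} (hz : z ∈ U) :
    fderiv ℝ (K.lin H Γ u w) z b = K.sec H Γ u (fun z => fderiv ℝ u z b) w z
      + K.lin H Γ u (cd Γ u w b) z := by
  set X : E → F := fun z => fderiv ℝ u z b with hXdef
  have hy := h.hm z hz
  have hpp : ∀ i j, ContDiffOn ℝ ∞ (fun z => H (u z) (K.cov Γ u i w z) (K.par u j z)) U :=
    fun i j => h.H_smooth (h.cov_smooth hw i) (h.par_smooth j)
  have t1 : ∀ A : Fin m → Fin m → E → ℝ, (∀ i j, ContDiffOn ℝ ∞ (A i j) U) →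
      (∀ i j, fderiv ℝ (A i j) z b = 0) →
      fderiv ℝ (fun z => tr2 A z fun i j => H (u z) (K.cov Γ u i w z) (K.par u j z)) z b =
        tr2 A z (fun i j => H (u z) (K.cov Γ u i w z) (K.cov Γ u j X z)
          + H (u z) (RC Γ (u z) (X z) (K.par u i z) (w z)) (K.par u j z))
        + tr2 A z fun i j => H (u z) (K.cov Γ u i (cd Γ u w b) z) (K.par u j z) := by
    intro A hA hd
    rw [h.fderiv_tr2 hA hpp hz hd, ← tr2_add]
    refine tr2_congr fun i j => ?_
    rw [h.fderiv_H (h.cov_smooth hw i) (h.par_smooth j) hz, h.cd_par hz, h.cd_cov hw hz, map_add,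
      add_apply]
    ring
  have d1 := diffAt_of_smooth h.hU (h.H_smooth (h.jac_smooth hw) h.ten_smooth) hz
  have s2 := tr2_smooth h.hGI hpp
  have s3 := tr2_smooth h.hP hpp
  have d2 := diffAt_of_smooth h.hU ((contDiffOn_const (c := (2 / 3 : ℝ)).mul h.hS).mul s2) hz
  have d3 := diffAt_of_smooth h.hU s3 hz
  have e : fderiv ℝ (K.lin H Γ u w) z b = fderiv ℝ (fun z =>
      - H (u z) (K.jac Γ u w z) (K.ten Γ u z)
      + (2 / 3) * K.S z * tr2 K.GI z (fun i j => H (u z) (K.cov Γ u i w z) (K.par u j z))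
      - 2 * tr2 K.P z (fun i j => H (u z) (K.cov Γ u i w z) (K.par u j z))) z b := rfl
  rw [e, fderiv_fun_sub (d1.fun_neg.fun_add d2) (d3.const_mul 2), fderiv_fun_add d1.fun_neg d2,
    fderiv_const_mul d3, fderiv_fun_neg]
  simp only [sub_apply, add_apply, smul_apply, smul_eq_mul, neg_apply]
  rw [h.fderiv_H (h.jac_smooth hw) h.ten_smooth hz, h.fderiv_S_mul hb s2 hz,
    t1 _ h.hGI (fun i j => hb.GI i j z hz),
    t1 _ h.hP (fun i j => hb.P i j z hz), h.cd_ten hb hz, h.cd_jac hb hw hz, Loc.lin, Loc.sec]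
  simp only [map_neg, map_sub, sub_apply]
  ring

end Setup

end CBiharmonic

end

/-! ### Pointwise symmetry of the second variation, and its reduction modulo divergences. -/

noncomputable section

set_option linter.unusedSectionVars false
set_option synthInstance.maxHeartbeats 200000

namespace CBiharmonic

variable {m : ℕ} {E F : Type*} [NormedAddCommGroup E] [NormedSpace ℝ E]
  [NormedAddCommGroup F] [NormedSpace ℝ F]

namespace Setup

variable [FiniteDimensional ℝ F] {K : Loc m E} {U : Set E} {Ω : Set F}
  {H : F → F →L[ℝ] F →L[ℝ] ℝ}
  {Γ : F → F →L[ℝ] F →L[ℝ] F} {u v w : E → F}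

/-! ### Algebraic identities of the curvature along the map -/

section Algebra

variable (h : Setup K U Ω H Γ u) {z : E} (hz : z ∈ U)

include h hz

theorem R_pair (a b c d : F) : H (u z) (RC Γ (u z) a b c) d = H (u z) (RC Γ (u z) c d a) b :=
  RC_pair h.hΩ h.hΓ h.hs h.hH h.hHs h.hc (h.hm z hz) a b c d

theorem R_skew (a b c d : F) : H (u z) (RC Γ (u z) a b c) d = - H (u z) (RC Γ (u z) a b d) c := by
  rw [RC_skew h.hΩ h.hΓ h.hH h.hc (h.hm z hz), h.hHs _ (h.hm z hz)]

theorem R_anti (a b c d : F) : H (u z) (RC Γ (u z) a b c) d = - H (u z) (RC Γ (u z) b a c) d := by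
  rw [RC_antisymm, map_neg, neg_apply]

theorem R_bianchi (a b c d : F) : H (u z) (RC Γ (u z) a b c) d + H (u z) (RC Γ (u z) b c a) d
    + H (u z) (RC Γ (u z) c a b) d = 0 := by
  rw [← add_apply, ← map_add, ← add_apply, ← map_add, RC_bianchi h.hΩ h.hΓ h.hs (h.hm z hz),
    map_zero, zero_apply]

theorem N_pair (x a b c d : F) :
    H (u z) (NR Γ (u z) x a b c) d = H (u z) (NR Γ (u z) x c d a) b :=
  NR_pair h.hΩ h.hΓ h.hs h.hH h.hHs h.hc (h.hm z hz) x a b c d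

theorem N_skew (x a b c d : F) :
    H (u z) (NR Γ (u z) x a b c) d = - H (u z) (NR Γ (u z) x a b d) c := by
  rw [NR_skew h.hΩ h.hΓ h.hH h.hc (h.hm z hz), h.hHs _ (h.hm z hz)]

theorem N_anti (x a b c d : F) :
    H (u z) (NR Γ (u z) x a b c) d = - H (u z) (NR Γ (u z) x b a c) d := by
  rw [NR_antisymm, map_neg, neg_apply]

theorem N_bianchi (x a b c d : F) : H (u z) (NR Γ (u z) x a b c) d
    + H (u z) (NR Γ (u z) x b c a) d + H (u z) (NR Γ (u z) x c a b) d = 0 := by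
  rw [← add_apply, ← map_add, ← add_apply, ← map_add, NR_bianchi h.hΩ h.hΓ h.hs (h.hm z hz),
    map_zero, zero_apply]

theorem N_bianchi₂ (a b c w d : F) : H (u z) (NR Γ (u z) a b c w) d
    + H (u z) (NR Γ (u z) b c a w) d + H (u z) (NR Γ (u z) c a b w) d = 0 := by
  rw [← add_apply, ← map_add, ← add_apply, ← map_add, NR_bianchi₂ h.hΩ h.hΓ h.hs (h.hm z hz),
    map_zero, zero_apply]

end Algebra

/-- Pairing of a contraction. -/
theorem H_tr2 (H : F → F →L[ℝ] F →L[ℝ] ℝ) (y : F) {A : Fin m → Fin m → E → ℝ} {z : E}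
    (f : Fin m → Fin m → F) (b : F) : H y (tr2 A z f) b = tr2 A z fun i j => H y (f i j) b :=
  tr2_map ((H y).flip b).toLinearMap

/-- The second variation is symmetric. -/
theorem sec_symm (h : Setup K U Ω H Γ u) {z : E} (hz : z ∈ U) :
    K.sec H Γ u v w z = K.sec H Γ u w v z := by
  have hy := h.hm z hz
  -- The terms without the tension field are symmetric by the pair symmetry of the curvature, for
  -- any symmetric contraction; used for the metric and for Ricci.
  have s1 : ∀ A : Fin m → Fin m → E → ℝ, (∀ i j, A i j z = A j i z) →
      (tr2 A z fun i j => H (u z) (K.cov Γ u i w z) (K.cov Γ u j v z)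
        + H (u z) (RC Γ (u z) (v z) (K.par u i z) (w z)) (K.par u j z)) =
      tr2 A z fun i j => H (u z) (K.cov Γ u i v z) (K.cov Γ u j w z)
        + H (u z) (RC Γ (u z) (w z) (K.par u i z) (v z)) (K.par u j z) := by
    intro A hA
    rw [← tr2_swap hA]
    refine tr2_congr fun i j => ?_
    rw [h.hHs _ hy, h.R_pair hz]
  set q : F → F → F → F → ℝ := fun a b c d => H (u z) (RC Γ (u z) a b c) d with hq
  set τ := K.ten Γ u z with hτ
  set e : Fin m → F := fun i => K.par u i z with he
  have sw : ∀ a b : F, tr2 K.GI z (fun i j => q a (K.cov Γ u i v z) (K.par u j z) b) =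
      tr2 K.GI z (fun i j => q a (K.cov Γ u j v z) (K.par u i z) b) := fun a b =>
    tr2_swap (f := fun i j => q a (K.cov Γ u j v z) (K.par u i z) b) (h.hGIs z hz)
  have s2 : H (u z) (K.comm Γ u v w z) τ = H (u z) (K.comm Γ u w v z) τ := by
    have e1 : ∀ v w : E → F, H (u z) (K.comm Γ u v w z) τ =
        tr2 K.GI z (fun i j => H (u z) (NR Γ (u z) (e i) (v z) (e j) (w z)
            + NR Γ (u z) (v z) (w z) (e i) (e j)) τ)
        + tr2 K.GI z (fun i j => q (K.cov Γ u i v z) (e j) (w z) τ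
            + q (w z) (K.cov Γ u i v z) (e j) τ + q (w z) (e j) (K.cov Γ u i v z) τ)
        + 2 * tr2 K.GI z (fun i j => q (v z) (e j) (K.cov Γ u i w z) τ)
        + q (v z) τ (w z) τ := by
      intro v w
      have sw1 := tr2_swap (f := fun i j => q (w z) (e j) (K.cov Γ u i v z) τ) (h.hGIs z hz)
      have sw2 := tr2_swap (f := fun i j => q (v z) (e j) (K.cov Γ u i w z) τ) (h.hGIs z hz)
      simp only [tr2_add, ← sw1, ← sw2, ← tr2_mul]
      rw [Loc.comm, map_add, add_apply, H_tr2]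
      simp only [map_add, add_apply, map_smul, smul_apply, tr2_add, smul_eq_mul, hq, he]
      ring
    rw [e1, e1]
    -- Exchanging `v` and `w` changes the first summand by a first Bianchi identity for `∇_{e i} R`,
    -- and the second by a second Bianchi identity in `e i`, `w`, `v`; the changes are opposite.
    have e2 : (tr2 K.GI z fun i j => H (u z) (NR Γ (u z) (e i) (v z) (e j) (w z)
            + NR Γ (u z) (v z) (w z) (e i) (e j)) τ) =
        tr2 K.GI z fun i j => H (u z) (NR Γ (u z) (e i) (w z) (e j) (v z)
            + NR Γ (u z) (w z) (v z) (e i) (e j)) τ := by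
      refine tr2_congr fun i j => ?_
      simp only [map_add, add_apply]
      linarith [h.N_bianchi hz (e i) (v z) (e j) (w z) τ, h.N_anti hz (e i) (e j) (w z) (v z) τ,
        h.N_bianchi₂ hz (e i) (w z) (v z) (e j) τ, h.N_anti hz (v z) (e i) (w z) (e j) τ]
    -- The first Bianchi identity collapses the three terms in `∇v` to twice one of them, of the
    -- same shape as the term in `∇w`.
    have e3 : ∀ v w : E → F, (tr2 K.GI z fun i j => q (K.cov Γ u i v z) (e j) (w z) τ
            + q (w z) (K.cov Γ u i v z) (e j) τ + q (w z) (e j) (K.cov Γ u i v z) τ) =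
        2 * tr2 K.GI z (fun i j => q (w z) (e j) (K.cov Γ u i v z) τ) := by
      intro v w
      rw [← tr2_mul]
      refine tr2_congr fun i j => ?_
      linarith [h.R_bianchi hz (K.cov Γ u i v z) (e j) (w z) τ,
        h.R_anti hz (e j) (w z) (K.cov Γ u i v z) τ]
    have e4 : q (v z) τ (w z) τ = q (w z) τ (v z) τ := h.R_pair hz _ _ _ _
    rw [e2, e3, e3, e4]; ring
  rw [Loc.sec, Loc.sec, s1 _ (h.hGIs z hz), s1 _ (h.hPs z hz), s2, h.hHs _ hy]

/-- The divergence of `⟨∇W, V⟩`. -/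
theorem div_cov (h : Setup K U Ω H Γ u) (hv : ContDiffOn ℝ ∞ v U) (hw : ContDiffOn ℝ ∞ w U)
    {z : E} (hz : z ∈ U) (A : Fin m → Fin m → E → ℝ) (hA : ∀ i j, A i j z = A j i z) :
    (tr2 A z fun i j => fderiv ℝ (fun z => H (u z) (K.cov Γ u j w z) (v z)) z (K.e i)
      - ∑ k, K.C k i j z * H (u z) (K.cov Γ u k w z) (v z)) =
    H (u z) (tr2 A z fun i j => K.cov2 Γ u i j w z) (v z)
      + tr2 A z fun i j => H (u z) (K.cov Γ u i w z) (K.cov Γ u j v z) := by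
  rw [H_tr2, ← tr2_swap (f := fun i j => H (u z) (K.cov Γ u i w z) (K.cov Γ u j v z)) hA, ← tr2_add]
  refine tr2_congr fun i j => ?_
  rw [h.fderiv_H (h.cov_smooth hw j) hv hz, Loc.cov2]
  simp only [map_sub, sub_apply, map_sum, sum_apply, map_smul, smul_apply, smul_eq_mul, Loc.cov]
  ring

theorem div_add (h : Setup K U Ω H Γ u) {θ θ' : Fin m → E → ℝ}
    (hθ : ∀ i, ContDiffOn ℝ ∞ (θ i) U) (hθ' : ∀ i, ContDiffOn ℝ ∞ (θ' i) U) {z : E} (hz : z ∈ U) :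
    K.div (fun i z => θ i z + θ' i z) z = K.div θ z + K.div θ' z := by
  rw [Loc.div, Loc.div, Loc.div, ← tr2_add]
  refine tr2_congr fun i j => ?_
  rw [fderiv_fun_add (diffAt_of_smooth h.hU (hθ j) hz) (diffAt_of_smooth h.hU (hθ' j) hz)]
  simp only [add_apply, mul_add, Finset.sum_add_distrib]
  ring

theorem div_const_mul (h : Setup K U Ω H Γ u) (r : ℝ) {θ : Fin m → E → ℝ}
    (hθ : ∀ i, ContDiffOn ℝ ∞ (θ i) U) {z : E} (hz : z ∈ U) :
    K.div (fun i z => r * θ i z) z = r * K.div θ z := by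
  rw [Loc.div, Loc.div, ← tr2_mul]
  refine tr2_congr fun i j => ?_
  rw [fderiv_const_mul (diffAt_of_smooth h.hU (hθ j) hz)]
  simp only [smul_apply, smul_eq_mul, mul_sub, Finset.mul_sum, mul_left_comm]

/-- The one-form whose divergence is the difference of the two second variation integrands. -/
def form (K : Loc m E) (H : F → F →L[ℝ] F →L[ℝ] ℝ) (Γ : F → F →L[ℝ] F →L[ℝ] F) (u v w : E → F)
    (j : Fin m) (z : E) : ℝ :=
  H (u z) (K.cov Γ u j (K.jac Γ u w) z) (v z) + (-1) * H (u z) (K.cov Γ u j v z) (K.jac Γ u w z)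
    + 2 * H (u z) (RC Γ (u z) (K.par u j z) (w z) (K.ten Γ u z)) (v z)

theorem form_smooth (h : Setup K U Ω H Γ u) (hv : ContDiffOn ℝ ∞ v U) (hw : ContDiffOn ℝ ∞ w U)
    (j : Fin m) : ContDiffOn ℝ ∞ (form K H Γ u v w j) U :=
  ((h.H_smooth (h.cov_smooth (h.jac_smooth hw) j) hv).add (contDiffOn_const.mul
    (h.H_smooth (h.cov_smooth hv j) (h.jac_smooth hw)))).add (contDiffOn_const.mul
    (h.H_smooth (h.RC_smooth (h.par_smooth j) hw h.ten_smooth) hv))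

/-- The divergence of `⟨R(du, W)τ, V⟩`. -/
theorem div_curv (h : Setup K U Ω H Γ u) (hv : ContDiffOn ℝ ∞ v U) (hw : ContDiffOn ℝ ∞ w U)
    {z : E} (hz : z ∈ U) :
    K.div (fun j z => H (u z) (RC Γ (u z) (K.par u j z) (w z) (K.ten Γ u z)) (v z)) z =
      tr2 K.GI z (fun i j =>
        H (u z) (NR Γ (u z) (K.par u i z) (K.par u j z) (w z) (K.ten Γ u z)) (v z)
        + H (u z) (RC Γ (u z) (K.par u j z) (K.cov Γ u i w z) (K.ten Γ u z)) (v z)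
        + H (u z) (RC Γ (u z) (K.par u j z) (w z) (K.cov Γ u i (K.ten Γ u) z)) (v z)
        + H (u z) (RC Γ (u z) (K.par u j z) (w z) (K.ten Γ u z)) (K.cov Γ u i v z))
      + H (u z) (RC Γ (u z) (K.ten Γ u z) (w z) (K.ten Γ u z)) (v z) := by
  have e1 : H (u z) (RC Γ (u z) (K.ten Γ u z) (w z) (K.ten Γ u z)) (v z) = tr2 K.GI z
      fun i j => H (u z) (RC Γ (u z) (K.hess Γ u i j z) (w z) (K.ten Γ u z)) (v z) := by
    have : RC Γ (u z) (K.ten Γ u z) (w z) (K.ten Γ u z) = tr2 K.GI z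
        fun i j => RC Γ (u z) (K.hess Γ u i j z) (w z) (K.ten Γ u z) :=
      tr2_map ((((RC Γ (u z)).flip (w z)).flip (K.ten Γ u z)).toLinearMap)
    rw [this, H_tr2]
  rw [e1, ← tr2_add, Loc.div]
  refine tr2_congr fun i j => ?_
  have e2 := cd_RC h.hU h.hΩ h.hΓ h.hu h.hm (h.par_smooth j) hw h.ten_smooth hz (K.e i)
  rw [h.fderiv_H (h.RC_smooth (h.par_smooth j) hw h.ten_smooth) hv hz, e2, Loc.hess]
  simp only [map_sub, sub_apply, map_sum, sum_apply, map_smul, smul_apply, smul_eq_mul, Loc.cov,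
    map_add, add_apply, Loc.par]
  ring

/-- The two second variation integrands differ by a divergence. -/
theorem sec_sub_hessI (h : Setup K U Ω H Γ u) (hv : ContDiffOn ℝ ∞ v U) (hw : ContDiffOn ℝ ∞ w U)
    {z : E} (hz : z ∈ U) :
    K.sec H Γ u v w z - K.hessI H Γ u v w z = K.div (form K H Γ u v w) z := by
  have hy := h.hm z hz
  have hGs := h.hGIs z hz
  set U' := K.jac Γ u w with hU'
  have hU's : ContDiffOn ℝ ∞ U' U := h.jac_smooth hw
  have d1 : K.div (fun j z => H (u z) (K.cov Γ u j U' z) (v z)) z =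
      H (u z) (K.lap Γ u U' z) (v z)
        + tr2 K.GI z fun i j => H (u z) (K.cov Γ u i U' z) (K.cov Γ u j v z) :=
    h.div_cov hv hU's hz _ hGs
  have d2 : K.div (fun j z => H (u z) (K.cov Γ u j v z) (U' z)) z =
      H (u z) (K.lap Γ u v z) (U' z)
        + tr2 K.GI z fun i j => H (u z) (K.cov Γ u i v z) (K.cov Γ u j U' z) :=
    h.div_cov hU's hv hz _ hGs
  have d12 : (tr2 K.GI z fun i j => H (u z) (K.cov Γ u i v z) (K.cov Γ u j U' z)) =
      tr2 K.GI z fun i j => H (u z) (K.cov Γ u i U' z) (K.cov Γ u j v z) := by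
    rw [← tr2_swap hGs]
    exact tr2_congr fun i j => h.hHs _ hy _ _
  -- Green's identity: the products of first derivatives in `d1` and `d2` cancel.
  have hdiv : K.div (form K H Γ u v w) z = H (u z) (K.lap Γ u U' z) (v z)
      - H (u z) (K.lap Γ u v z) (U' z)
      + 2 * K.div (fun j z => H (u z) (RC Γ (u z) (K.par u j z) (w z) (K.ten Γ u z)) (v z)) z := by
    have a1 : ∀ j, ContDiffOn ℝ ∞ (fun z => H (u z) (K.cov Γ u j U' z) (v z)) U := fun j =>
      h.H_smooth (h.cov_smooth hU's j) hv
    have a2 : ∀ j, ContDiffOn ℝ ∞ (fun z => H (u z) (K.cov Γ u j v z) (U' z)) U := fun j =>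
      h.H_smooth (h.cov_smooth hv j) hU's
    have a3 : ∀ j, ContDiffOn ℝ ∞ (fun z =>
        H (u z) (RC Γ (u z) (K.par u j z) (w z) (K.ten Γ u z)) (v z)) U := fun j =>
      h.H_smooth (h.RC_smooth (h.par_smooth j) hw h.ten_smooth) hv
    have b1 := h.div_add (fun j => (a1 j).add (contDiffOn_const (c := (-1 : ℝ)).mul (a2 j)))
      (fun j => contDiffOn_const (c := (2 : ℝ)).mul (a3 j)) hz
    have b2 := h.div_add a1 (fun j => contDiffOn_const (c := (-1 : ℝ)).mul (a2 j)) hz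
    have b3 := h.div_const_mul (-1) a2 hz
    have b4 := h.div_const_mul 2 a3 hz
    have b0 : K.div (form K H Γ u v w) z = _ := b1
    rw [b0, b2, b3, b4, d1, d2, d12]
    ring
  rw [hdiv, h.div_curv hv hw hz]
  set τ := K.ten Γ u with hτ
  set q : F → F → F → F → ℝ := fun a b c d => H (u z) (RC Γ (u z) a b c) d with hq
  set N : F → F → F → F → F → ℝ := fun x a b c d => H (u z) (NR Γ (u z) x a b c) d with hN
  set e : Fin m → F := fun i => K.par u i z with he
  -- curvature terms of the Jacobi operators
  have c1 : H (u z) (U' z) (K.trc Γ u K.GI v z) = H (u z) (K.trc Γ u K.GI U' z) (v z) := by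
    rw [h.hHs _ hy, Loc.trc, Loc.trc, H_tr2, H_tr2, ← tr2_swap hGs]
    refine tr2_congr fun i j => ?_
    rw [h.R_pair hz, h.R_skew hz, h.R_anti hz, neg_neg, h.R_pair hz, h.R_anti hz, h.R_skew hz,
      neg_neg, h.R_pair hz]
  have c2 : ∀ A : Fin m → Fin m → E → ℝ, (∀ i j, A i j z = A j i z) →
      H (u z) (K.trc Γ u A w z) (v z) =
        tr2 A z fun i j => H (u z) (RC Γ (u z) (v z) (e i) (w z)) (e j) := by
    intro A hA
    rw [Loc.trc, H_tr2, ← tr2_swap hA]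
    refine tr2_congr fun i j => ?_
    rw [h.R_pair hz, h.R_skew hz, h.R_anti hz, neg_neg]
  have c3 : H (u z) (K.comm Γ u v w z) (τ z) =
      tr2 K.GI z (fun i j => N (e i) (v z) (e j) (w z) (τ z) + N (v z) (w z) (e i) (e j) (τ z)
        + 2 * q (v z) (e i) (K.cov Γ u j w z) (τ z)
        + (q (K.cov Γ u i v z) (e j) (w z) (τ z) + q (w z) (K.cov Γ u i v z) (e j) (τ z)
          + q (w z) (e j) (K.cov Γ u i v z) (τ z)))
      + q (v z) (τ z) (w z) (τ z) := by
    have sw1 := tr2_swap (f := fun i j => q (w z) (e j) (K.cov Γ u i v z) (τ z)) hGs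
    simp only [tr2_add, ← sw1]
    rw [Loc.comm, map_add, add_apply, H_tr2]
    simp only [map_add, add_apply, map_smul, smul_apply, tr2_add, smul_eq_mul, hq, he, hN]
    ring
  have c4 : H (u z) (K.jac2 Γ u w z) (v z) = H (u z) (K.jac Γ u U' z) (v z)
      - q (τ z) (w z) (τ z) (v z) - tr2 K.GI z (fun i j => N (τ z) (e i) (w z) (e j) (v z))
      + tr2 K.GI z (fun i j => N (e i) (τ z) (e j) (w z) (v z)
        + 2 * q (w z) (e j) (K.cov Γ u i τ z) (v z)
        + 2 * q (τ z) (e i) (K.cov Γ u j w z) (v z)) := by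
    have sw1 := tr2_swap (f := fun i j => 2 * q (w z) (e j) (K.cov Γ u i τ z) (v z)) hGs
    simp only [tr2_add, ← sw1]
    rw [Loc.jac2, map_add, add_apply, map_sub, map_sub, sub_apply, sub_apply, H_tr2, H_tr2]
    simp only [map_add, add_apply, map_smul, smul_apply, tr2_add, smul_eq_mul, hq, he, hN, hU']
    rfl
  -- What is left after the second order terms are removed: the curvature terms differ exactly by
  -- twice the trace occurring in the divergence of `⟨R(du, W)τ, V⟩`.
  have c5 : (tr2 K.GI z fun i j => N (e i) (v z) (e j) (w z) (τ z)
        + N (v z) (w z) (e i) (e j) (τ z)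
        + 2 * q (v z) (e i) (K.cov Γ u j w z) (τ z)
        + (q (K.cov Γ u i v z) (e j) (w z) (τ z) + q (w z) (K.cov Γ u i v z) (e j) (τ z)
          + q (w z) (e j) (K.cov Γ u i v z) (τ z)))
      + tr2 K.GI z (fun i j => N (τ z) (e i) (w z) (e j) (v z))
      - tr2 K.GI z (fun i j => N (e i) (τ z) (e j) (w z) (v z)
        + 2 * q (w z) (e j) (K.cov Γ u i τ z) (v z)
        + 2 * q (τ z) (e i) (K.cov Γ u j w z) (v z)) =
      2 * tr2 K.GI z (fun i j => N (e i) (e j) (w z) (τ z) (v z)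
        + q (e j) (K.cov Γ u i w z) (τ z) (v z)
        + q (e j) (w z) (K.cov Γ u i τ z) (v z)
        + q (e j) (w z) (τ z) (K.cov Γ u i v z)) := by
    have swN : (tr2 K.GI z fun i j => N (v z) (w z) (e i) (e j) (τ z)
        + N (τ z) (e i) (w z) (e j) (v z)) =
        tr2 K.GI z fun i j => N (v z) (w z) (e j) (e i) (τ z) + N (τ z) (e j) (w z) (e i) (v z) :=
      (tr2_swap (f := fun i j => N (v z) (w z) (e i) (e j) (τ z)
        + N (τ z) (e i) (w z) (e j) (v z)) hGs).symm
    have swW : (tr2 K.GI z fun i j => q (v z) (e i) (K.cov Γ u j w z) (τ z)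
        - q (τ z) (e i) (K.cov Γ u j w z) (v z)) =
        tr2 K.GI z fun i j => q (v z) (e j) (K.cov Γ u i w z) (τ z)
        - q (τ z) (e j) (K.cov Γ u i w z) (v z) :=
      (tr2_swap (f := fun i j => q (v z) (e i) (K.cov Γ u j w z) (τ z)
        - q (τ z) (e i) (K.cov Γ u j w z) (v z)) hGs).symm
    -- With indices exchanged where needed, the identity holds term by term. It splits by the
    -- differentiated object: `k1` and `k2` treat the curvature, `k3` the field `w`, `k4` the field
    -- `v`, `k5` the tension field.
    have key : ∀ i j, (N (e i) (v z) (e j) (w z) (τ z) - N (e i) (τ z) (e j) (w z) (v z))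
        + (N (v z) (w z) (e j) (e i) (τ z) + N (τ z) (e j) (w z) (e i) (v z))
        + 2 * (q (v z) (e j) (K.cov Γ u i w z) (τ z) - q (τ z) (e j) (K.cov Γ u i w z) (v z))
        + (q (K.cov Γ u i v z) (e j) (w z) (τ z) + q (w z) (K.cov Γ u i v z) (e j) (τ z)
          + q (w z) (e j) (K.cov Γ u i v z) (τ z))
        - 2 * q (w z) (e j) (K.cov Γ u i τ z) (v z) =
        2 * (N (e i) (e j) (w z) (τ z) (v z)
        + q (e j) (K.cov Γ u i w z) (τ z) (v z)
        + q (e j) (w z) (K.cov Γ u i τ z) (v z)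
        + q (e j) (w z) (τ z) (K.cov Γ u i v z)) := by
      intro i j
      have k1 : N (e i) (v z) (e j) (w z) (τ z) - N (e i) (τ z) (e j) (w z) (v z) =
          N (e i) (e j) (w z) (τ z) (v z) := by
        linarith [h.N_pair hz (e i) (v z) (e j) (w z) (τ z),
          h.N_skew hz (e i) (w z) (τ z) (v z) (e j),
          h.N_bianchi hz (e i) (τ z) (e j) (w z) (v z)]
      -- The second Bianchi identity moves the differentiation from `v` and `τ` to `e i`. Together
      -- with `k1` this gives two copies of the derivative of the curvature.
      have k2 : N (v z) (w z) (e j) (e i) (τ z) + N (τ z) (e j) (w z) (e i) (v z) =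
          N (e i) (e j) (w z) (τ z) (v z) := by
        linarith [h.N_pair hz (v z) (w z) (e j) (e i) (τ z),
          h.N_skew hz (v z) (e i) (τ z) (w z) (e j), h.N_anti hz (v z) (e i) (τ z) (e j) (w z),
          h.N_pair hz (τ z) (e j) (w z) (e i) (v z),
          h.N_skew hz (τ z) (e i) (v z) (e j) (w z),
          h.N_bianchi₂ hz (v z) (τ z) (e i) (e j) (w z),
          h.N_pair hz (e i) (v z) (τ z) (e j) (w z), h.N_skew hz (e i) (e j) (w z) (v z) (τ z)]
      have k3 : q (v z) (e j) (K.cov Γ u i w z) (τ z) - q (τ z) (e j) (K.cov Γ u i w z) (v z) =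
          q (e j) (K.cov Γ u i w z) (τ z) (v z) := by
        linarith [h.R_pair hz (v z) (e j) (K.cov Γ u i w z) (τ z),
          h.R_skew hz (K.cov Γ u i w z) (τ z) (v z) (e j),
          h.R_bianchi hz (τ z) (e j) (K.cov Γ u i w z) (v z)]
      have k4 : q (K.cov Γ u i v z) (e j) (w z) (τ z) + q (w z) (K.cov Γ u i v z) (e j) (τ z)
          + q (w z) (e j) (K.cov Γ u i v z) (τ z) =
          2 * q (e j) (w z) (τ z) (K.cov Γ u i v z) := by
        linarith [h.R_bianchi hz (K.cov Γ u i v z) (e j) (w z) (τ z),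
          h.R_anti hz (e j) (w z) (K.cov Γ u i v z) (τ z),
          h.R_skew hz (e j) (w z) (K.cov Γ u i v z) (τ z)]
      have k5 := h.R_anti hz (w z) (e j) (K.cov Γ u i τ z) (v z)
      simp only [hq, hN] at k1 k2 k3 k4 k5 ⊢
      linarith
    rw [← tr2_mul, ← tr2_congr key]
    simp only [tr2_add, tr2_sub, tr2_mul] at swN swW ⊢
    linarith
  have c6 : q (v z) (τ z) (w z) (τ z) = q (τ z) (w z) (τ z) (v z) := by
    linarith [h.R_pair hz (v z) (τ z) (w z) (τ z), h.R_skew hz (w z) (τ z) (v z) (τ z),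
      h.R_anti hz (w z) (τ z) (τ z) (v z)]
  have c7 : H (u z) (U' z) (K.jac Γ u v z) = - H (u z) (K.lap Γ u v z) (U' z)
      + H (u z) (K.trc Γ u K.GI U' z) (v z) := by
    rw [← c1, Loc.jac, map_add, map_neg, h.hHs _ hy (K.lap Γ u v z)]
  have c8 : H (u z) (K.jac Γ u U' z) (v z) = - H (u z) (K.lap Γ u U' z) (v z)
      + H (u z) (K.trc Γ u K.GI U' z) (v z) := by
    rw [Loc.jac, map_add, map_neg, add_apply, neg_apply]
  have c9 := c2 _ hGs
  have c10 := c2 _ (h.hPs z hz)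
  rw [Loc.sec, Loc.hessI, map_sub, sub_apply, map_smul, smul_apply, smul_eq_mul, c4, c3, c8, c9,
    c10, c6]
  change _ + _ + _ - _ - _ = _
  rw [c7]
  simp only [tr2_add] at c5 ⊢
  simp only [hq, hN, he] at c5 ⊢
  linarith

end Setup

end CBiharmonic

end

/-! ### From the operators on manifolds to their local expressions in any pair of charts. -/

noncomputable section

set_option linter.unusedSectionVars false
set_option synthInstance.maxHeartbeats 200000

namespace CBiharmonic

section Dictionary

variable {m n : ℕ}
  {M : Type*} [TopologicalSpace M] [ChartedSpace (Euc m) M] [IsManifold (𝓡 m) ∞ M]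
  {N : Type*} [TopologicalSpace N] [ChartedSpace (Euc n) N] [IsManifold (𝓡 n) ∞ N]

/-! ### The operators along a map in charts -/

/-- The coefficients of the operators in the chart at `c`. -/
def chartLoc (g : Metric m M) (c : M) : Loc m (Euc m) where
  e := ev
  GI := gInv g c
  C := chr g c
  P := ricP g c
  S := scalL g c

variable {φ : M → N} {c : M} {d : N} (g : Metric m M) (h : Metric n N)

theorem setup (hφ : ContMDiff (𝓡 m) (𝓡 n) ∞ φ) (c : M) (d : N) :
    Setup (chartLoc g c) (dom m n c d φ) (xt n d).target (metL h d) (gam h d)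
      (mloc m n c d φ) where
  hU := dom_open hφ.continuous
  hΩ := xt_target_open d
  hΓ := gam_smooth h d
  hs := gam_symm h d
  hH := (metL_metric h d).smooth
  hHs := (metL_metric h d).symm
  hc := gam_compat h d
  hu := mloc_smooth hφ
  hm := fun _ hx => mloc_maps hx
  hGI := fun i j => (gInv_smooth g c i j).mono dom_subset
  hGIs := fun _ hx i j => gInv_symm g (dom_subset hx) i j
  hC := fun k i j => (chr_smooth g c k i j).mono dom_subset
  hP := fun i j => (ricP_smooth g c i j).mono dom_subset
  hPs := fun _ hx i j => ricP_symm g (dom_subset hx) i j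
  hS := (scalL_smooth g c).mono dom_subset

theorem linear_expand {A : Type*} [AddCommGroup A] [Module ℝ A] {L : Euc m → A}
    (hL : IsLinearMap ℝ L) (x : Euc m) : L x = ∑ k, x k • L (ev k) := by
  have := map_sum (hL.mk' _) (fun i => x i • ev i) Finset.univ
  rw [← sum_ev] at this
  simpa [hL.map_smul] using this

/-- A trace with `Ric` inserted is again a contraction, with the symmetric coefficients `ricP` in
place of the inverse metric; both kinds of trace then obey the same lemmas. -/
theorem trace_ric_left {A A' : Type*} [AddCommGroup A] [Module ℝ A]
    [AddCommGroup A'] [Module ℝ A'] (ℓ : A →ₗ[ℝ] A') {q : M} (hq : q ∈ (xt m c).source)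
    {B : TangentSpace (𝓡 m) q → TangentSpace (𝓡 m) q → A} {b : Euc m → Euc m → A'}
    (hb : IsBilin b) (hB : ∀ u v, ℓ (B u v) = b (tc c q u) (tc c q v)) :
    ℓ (trace g q fun u v => B (ricci g q u) v) =
      tr2 (ricP g c) (xt m c q) fun i j => b (ev i) (ev j) := by
  rw [trace_eq g ℓ hq (b := fun u v => b (ricE g c (xt m c q) u) v)
    ⟨fun y => ⟨fun a b => by rw [(ricE_linear g _).map_add, (hb.left y).map_add],
      fun r a => by rw [(ricE_linear g _).map_smul, (hb.left y).map_smul]⟩,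
      fun y => hb.right _⟩ (fun u v => by rw [hB, tc_ricci g hq])]
  simp only [linear_expand (hb.left _) (ricE g c _ _), Finset.smul_sum, tr2, ricP, Finset.sum_smul]
  have : ∀ f : Fin m → Fin m → Fin m → A',
      ∑ i, ∑ j, ∑ k, f i j k = ∑ k, ∑ j, ∑ i, f i j k := by
    intro f
    calc _ = ∑ i, ∑ k, ∑ j, f i j k := Finset.sum_congr rfl fun i _ => Finset.sum_comm
      _ = ∑ k, ∑ i, ∑ j, f i j k := Finset.sum_comm
      _ = _ := Finset.sum_congr rfl fun i _ => Finset.sum_comm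
  rw [this]
  refine Finset.sum_congr rfl fun k _ => Finset.sum_congr rfl fun j _ =>
    Finset.sum_congr rfl fun i _ => ?_
  rw [smul_smul]

theorem trace_swap {A : Type*} [AddCommGroup A] [Module ℝ A] (q : M)
    (B : TangentSpace (𝓡 m) q → TangentSpace (𝓡 m) q → A) :
    trace g q B = trace g q fun u v => B v u := by
  have hs : ∀ i j, gramInv g q i j = gramInv g q j i := fun i j => by
    rw [gramInv_self]
    exact gInv_symm g ((xt m q).map_source (mem_xt q)) i j
  rw [trace, Finset.sum_comm, trace]
  exact Finset.sum_congr rfl fun i _ => Finset.sum_congr rfl fun j _ => by rw [hs]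

theorem trace_ric_right {A A' : Type*} [AddCommGroup A] [Module ℝ A]
    [AddCommGroup A'] [Module ℝ A'] (ℓ : A →ₗ[ℝ] A') {q : M} (hq : q ∈ (xt m c).source)
    {B : TangentSpace (𝓡 m) q → TangentSpace (𝓡 m) q → A} {b : Euc m → Euc m → A'}
    (hb : IsBilin b) (hB : ∀ u v, ℓ (B u v) = b (tc c q u) (tc c q v)) :
    ℓ (trace g q fun u v => B u (ricci g q v)) =
      tr2 (ricP g c) (xt m c q) fun i j => b (ev i) (ev j) := by
  rw [trace_swap g q]
  rw [trace_ric_left g ℓ hq (B := fun u v => B v u) (b := fun u v => b v u)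
    ⟨fun y => hb.right y, fun y => hb.left y⟩ (fun u v => hB v u)]
  exact tr2_swap (f := fun i j => b (ev i) (ev j))
    fun i j => ricP_symm g ((xt m c).map_source hq) i j

theorem cd_dir_linear {Γ : Euc n → Euc n →L[ℝ] Euc n →L[ℝ] Euc n} (u w : Euc m → Euc n)
    (x : Euc m) : IsLinearMap ℝ fun v => cd Γ u w v x :=
  ⟨fun a b => cd_dir_add a b x, fun r a => cd_dir_smul r a x⟩

/-- The second covariant derivative of a bundle map `TM → φ⁻¹TN` in charts. -/
theorem tc_second (hφ : ContMDiff (𝓡 m) (𝓡 n) ∞ φ)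
    {Ψ : ∀ q : M, TangentSpace (𝓡 m) q → TangentSpace (𝓡 n) (φ q)} {ψ : Fin m → Euc m → Euc n}
    (hψ : ∀ k, ContDiffOn ℝ ∞ (ψ k) (dom m n c d φ))
    (hΨ : ∀ q ∈ (xt m c).source, φ q ∈ (xt n d).source → ∀ v,
      tc d (φ q) (Ψ q v) = ∑ k, tc c q v k • ψ k (xt m c q))
    {p : M} (hp : p ∈ (xt m c).source) (hd : φ p ∈ (xt n d).source)
    (u v : TangentSpace (𝓡 m) p) :
    tc d (φ p) (covAlong h φ (fun q => Ψ q (coordField p v q)) p u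
        - Ψ p (leviCivita g (coordField p v) p u)) =
      ∑ k, tc c p v k • cd (gam h d) (mloc m n c d φ) (ψ k) (tc c p u) (xt m c p)
        - ∑ k, gam g c (xt m c p) (tc c p u) (tc c p v) k • ψ k (xt m c p) := by
  -- The coordinate field of the chart at `p`, read in the chart at `c`, where its components are no
  -- longer constant.
  set a : Euc m → Euc m := fun x => fderiv ℝ (kap m c p) (kap m p c x) (tc p p v) with ha
  set S : Set (Euc m) := dom m n c d φ ∩ kapDom m p c with hS
  have hSo : IsOpen S := (dom_open hφ.continuous).inter (kapDom_open p c)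
  have hpS : xt m c p ∈ S := ⟨mem_dom hp hd, mem_kapDom (mem_xt p) hp⟩
  have ha_s : ContDiffOn ℝ ∞ a S := by
    refine ContDiffOn.clm_apply ?_ contDiffOn_const
    exact (smooth_fderiv (kapDom_open c p) (kap_smooth c p)).comp
      ((kap_smooth p c).mono Set.inter_subset_right) fun x hx => kap_maps hx.2
  have hav : ∀ x ∈ S, vloc c (coordField p v) x = a x := by
    intro x hx
    have h1 : (xt m c).symm x ∈ (xt m p).source := hx.2.2
    have h2 : (xt m c).symm x ∈ (xt m c).source := (xt m c).map_target hx.2.1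
    change tc c ((xt m c).symm x) (coordField p v ((xt m c).symm x)) = _
    rw [tc_kap h2 h1, tc_coordField v h1]
    rfl
  have hap : a (xt m c p) = tc c p v := by
    rw [← hav _ hpS]
    change tc c ((xt m c).symm (xt m c p)) (coordField p v ((xt m c).symm (xt m c p))) = _
    rw [(xt m c).left_inv hp, coordField_self]
  have hX : ∀ x ∈ S, sloc m c d φ (fun q => Ψ q (coordField p v q)) x =
      ∑ k, a x k • ψ k x := by
    intro x hx
    have h2 : (xt m c).symm x ∈ (xt m c).source := (xt m c).map_target hx.2.1
    have h3 := hΨ _ h2 hx.1.2 (coordField p v ((xt m c).symm x))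
    rw [(xt m c).right_inv hx.2.1] at h3
    rw [← hav x hx]
    exact h3
  have hak : ∀ k, ContDiffOn ℝ ∞ (fun x => a x k) S := fun k => (pr k).contDiff.comp_contDiffOn ha_s
  have hX_s : ContDiffOn ℝ ∞ (sloc m c d φ fun q => Ψ q (coordField p v q)) S :=
    (ContDiffOn.sum (f := fun k x => a x k • ψ k x) fun k _ =>
      (hak k).smul ((hψ k).mono Set.inter_subset_left)).congr hX
  have h1 := tc_covAlong_of h hφ hSo Set.inter_subset_left hX_s hpS hp hd u
  have hda : ∀ k, fderiv ℝ (fun x => a x k) (xt m c p) (tc c p u) =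
      (fderiv ℝ a (xt m c p) (tc c p u)) k := by
    intro k
    have := fderiv_comp (xt m c p) (pr k).differentiableAt (diffAt_of_smooth hSo ha_s hpS)
    have h2 := congrArg (fun T => T (tc c p u)) this
    simp only [ContinuousLinearMap.comp_apply, ContinuousLinearMap.fderiv, pr_apply] at h2
    exact h2
  rw [cd_congr hSo hX hpS, cd_sum (w := fun k x => a x k • ψ k x) _ hSo (fun k _ =>
    (hak k).smul ((hψ k).mono Set.inter_subset_left)) hpS] at h1
  simp only [fun k => cd_smul (Γ := gam h d) (u := mloc m n c d φ) hSo (hak k)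
    ((hψ k).mono Set.inter_subset_left) hpS (tc c p u), hap, hda] at h1
  have h2 : tc c p (leviCivita g (coordField p v) p u) =
      fderiv ℝ a (xt m c p) (tc c p u) + gam g c (xt m c p) (tc c p u) (tc c p v) := by
    have h3 := tc_covAlong_of (c := c) (d := c) g (φ := (id : M → M)) contMDiff_id
      (W := coordField p v) hSo (by rw [dom_id]; exact fun x hx => hx.2.1) (ha_s.congr hav) hpS hp
      hp u
    rw [cd_congr_map (u' := fun x => x) hSo (fun x hx => mloc_id hx.2.1) hav hpS, cd, hap] at h3
    simp only [fderiv_fun_id, ContinuousLinearMap.id_apply] at h3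
    exact h3
  -- The derivative of `a` occurs in both terms and cancels: the result is tensorial in `v`,
  -- independent of the extension.
  rw [map_sub, h1, hΨ p hp hd, h2]
  simp only [PiLp.add_apply, add_smul, Finset.sum_add_distrib]
  abel

theorem second_bilin {Γ : Euc n → Euc n →L[ℝ] Euc n →L[ℝ] Euc n} (u : Euc m → Euc n)
    (ψ : Fin m → Euc m → Euc n) (G : Euc m →L[ℝ] Euc m →L[ℝ] Euc m) (x : Euc m) :
    IsBilin fun a b => ∑ k, b k • cd Γ u (ψ k) a x - ∑ k, G a b k • ψ k x := by
  refine ⟨fun y => ⟨fun a b => ?_, fun r a => ?_⟩, fun y => ⟨fun a b => ?_, fun r a => ?_⟩⟩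
  · simp only [cd_dir_add, smul_add, map_add, add_apply, PiLp.add_apply, add_smul,
      Finset.sum_add_distrib]
    abel
  · simp only [cd_dir_smul, map_smul, smul_apply, PiLp.smul_apply, smul_assoc, smul_sub,
      Finset.smul_sum, smul_comm r]
  · simp only [map_add, PiLp.add_apply, add_smul, Finset.sum_add_distrib]
    abel
  · simp only [map_smul, PiLp.smul_apply, smul_assoc, smul_sub, Finset.smul_sum]

theorem second_ev {Γ : Euc n → Euc n →L[ℝ] Euc n →L[ℝ] Euc n} (u : Euc m → Euc n)
    (ψ : Fin m → Euc m → Euc n) (x : Euc m) (i j : Fin m) :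
    ∑ k, (ev j : Euc m) k • cd Γ u (ψ k) (ev i) x - ∑ k, gam g c x (ev i) (ev j) k • ψ k x =
      cd Γ u (ψ j) (ev i) x - ∑ k, chr g c k i j x • ψ k x := by
  have h1 : ∀ k, (gam g c x (ev i) (ev j)) k = chr g c k i j x := fun k => by
    rw [gam_ev, ← sum_ev (WithLp.toLp 2 fun l => chr g c l i j x)]
  simp only [h1]
  simp

variable {W : ∀ q : M, TangentSpace (𝓡 n) (φ q)}

theorem tc_covAlong_smooth (hφ : ContMDiff (𝓡 m) (𝓡 n) ∞ φ) (hW : IsSmoothSection m φ W)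
    {q : M} (hq : q ∈ (xt m c).source) (hd : φ q ∈ (xt n d).source) (v : TangentSpace (𝓡 m) q) :
    tc d (φ q) (covAlong h φ W q v) =
      cd (gam h d) (mloc m n c d φ) (sloc m c d φ W) (tc c q v) (xt m c q) :=
  tc_covAlong h hφ (sloc_smooth hW) hq hd v

theorem tc_cov2Along (hφ : ContMDiff (𝓡 m) (𝓡 n) ∞ φ) (hW : IsSmoothSection m φ W)
    {q : M} (hq : q ∈ (xt m c).source) (hd : φ q ∈ (xt n d).source)
    (u v : TangentSpace (𝓡 m) q) :
    tc d (φ q) (cov2Along g h φ W q u v) =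
      ∑ k, tc c q v k • cd (gam h d) (mloc m n c d φ)
        (cd (gam h d) (mloc m n c d φ) (sloc m c d φ W) (ev k)) (tc c q u) (xt m c q)
      - ∑ k, gam g c (xt m c q) (tc c q u) (tc c q v) k •
        cd (gam h d) (mloc m n c d φ) (sloc m c d φ W) (ev k) (xt m c q) :=
  tc_second g h hφ (Ψ := fun q v => covAlong h φ W q v)
    (fun k => (setup g h hφ c d).cd_smooth (sloc_smooth hW) (ev k))
    (fun q hq hd v => by
      rw [tc_covAlong_smooth h hφ hW hq hd]
      exact linear_expand (cd_dir_linear _ _ _) _) hq hd u v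

theorem tc_hessMap (hφ : ContMDiff (𝓡 m) (𝓡 n) ∞ φ)
    {q : M} (hq : q ∈ (xt m c).source) (hd : φ q ∈ (xt n d).source)
    (u v : TangentSpace (𝓡 m) q) :
    tc d (φ q) (hessMap g h φ q u v) =
      ∑ k, tc c q v k • cd (gam h d) (mloc m n c d φ)
        ((chartLoc g c).par (mloc m n c d φ) k) (tc c q u) (xt m c q)
      - ∑ k, gam g c (xt m c q) (tc c q u) (tc c q v) k •
        (chartLoc g c).par (mloc m n c d φ) k (xt m c q) :=
  tc_second g h hφ (Ψ := fun q v => dmap φ q v)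
    (fun k => (setup g h hφ c d).par_smooth k)
    (fun q hq hd v => by
      rw [tc_dmap hφ hq hd]
      exact linear_expand ⟨fun a b => map_add _ a b, fun r a => map_smul _ r a⟩ _) hq hd u v

theorem chart_point {x : Euc m} (hx : x ∈ dom m n c d φ) :
    (xt m c).symm x ∈ (xt m c).source ∧ φ ((xt m c).symm x) ∈ (xt n d).source ∧
      xt m c ((xt m c).symm x) = x :=
  ⟨(xt m c).map_target hx.1, hx.2, (xt m c).right_inv hx.1⟩

/-- The trace of the second covariant derivative, contracted with the metric or with `Ric`. -/
theorem sloc_roughLaplacian (hφ : ContMDiff (𝓡 m) (𝓡 n) ∞ φ) (hW : IsSmoothSection m φ W)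
    {x : Euc m} (hx : x ∈ dom m n c d φ) :
    sloc m c d φ (roughLaplacian g h φ W) x =
      - (chartLoc g c).lap (gam h d) (mloc m n c d φ) (sloc m c d φ W) x := by
  obtain ⟨hq, hd, hqx⟩ := chart_point hx
  have h1 := trace_eq g (tc d (φ ((xt m c).symm x))).toLinearMap hq
    (second_bilin (Γ := gam h d) (mloc m n c d φ) _ (gam g c (xt m c ((xt m c).symm x))) _)
    (tc_cov2Along g h hφ hW hq hd)
  simp only [second_ev] at h1
  change tc d (φ ((xt m c).symm x)) (- trace g _ _) = _
  rw [map_neg, Loc.lap]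
  rw [hqx] at h1
  exact congrArg _ h1

theorem sloc_tension (hφ : ContMDiff (𝓡 m) (𝓡 n) ∞ φ) {x : Euc m} (hx : x ∈ dom m n c d φ) :
    sloc m c d φ (tension g h φ) x = (chartLoc g c).ten (gam h d) (mloc m n c d φ) x := by
  obtain ⟨hq, hd, hqx⟩ := chart_point hx
  have h1 := trace_eq g (tc d (φ ((xt m c).symm x))).toLinearMap hq
    (second_bilin (Γ := gam h d) (mloc m n c d φ) _ (gam g c (xt m c ((xt m c).symm x))) _)
    (tc_hessMap g h hφ hq hd)
  simp only [second_ev] at h1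
  rw [hqx] at h1
  exact h1

theorem RC_bilin {Γ : Euc n → Euc n →L[ℝ] Euc n →L[ℝ] Euc n} (y : Euc n) (w : Euc n)
    (D : Euc m →L[ℝ] Euc n) : IsBilin fun a b => RC Γ y (D a) w (D b) :=
  ⟨fun _ => ⟨fun a b => by simp, fun r a => by simp⟩,
    fun _ => ⟨fun a b => by simp, fun r a => by simp⟩⟩

theorem tc_curv_dmap (hφ : ContMDiff (𝓡 m) (𝓡 n) ∞ φ) {q : M} (hq : q ∈ (xt m c).source)
    (hd : φ q ∈ (xt n d).source) (w : TangentSpace (𝓡 n) (φ q)) (u v : TangentSpace (𝓡 m) q) :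
    tc d (φ q) (curv h (φ q) (dmap φ q u) w (dmap φ q v)) =
      RC (gam h d) (mloc m n c d φ (xt m c q)) (fderiv ℝ (mloc m n c d φ) (xt m c q) (tc c q u))
        (tc d (φ q) w) (fderiv ℝ (mloc m n c d φ) (xt m c q) (tc c q v)) := by
  rw [tc_curv h hd, tc_dmap hφ hq hd, tc_dmap hφ hq hd, mloc_xt hq]

theorem sloc_trCurv (hφ : ContMDiff (𝓡 m) (𝓡 n) ∞ φ) (W : ∀ q : M, TangentSpace (𝓡 n) (φ q))
    {x : Euc m} (hx : x ∈ dom m n c d φ) :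
    sloc m c d φ (trCurv g h φ W) x =
      (chartLoc g c).trc (gam h d) (mloc m n c d φ) (gInv g c) (sloc m c d φ W) x := by
  obtain ⟨hq, hd, hqx⟩ := chart_point hx
  have h1 := trace_eq g (tc d (φ ((xt m c).symm x))).toLinearMap hq (RC_bilin _ _ _)
    (tc_curv_dmap h hφ hq hd (W _))
  rw [hqx] at h1
  exact h1

theorem sloc_trCurvRic (hφ : ContMDiff (𝓡 m) (𝓡 n) ∞ φ) (W : ∀ q : M, TangentSpace (𝓡 n) (φ q))
    {x : Euc m} (hx : x ∈ dom m n c d φ) :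
    sloc m c d φ (trCurvRic g h φ W) x =
      (chartLoc g c).trc (gam h d) (mloc m n c d φ) (ricP g c) (sloc m c d φ W) x := by
  obtain ⟨hq, hd, hqx⟩ := chart_point hx
  have h1 := trace_ric_left g (tc d (φ ((xt m c).symm x))).toLinearMap hq (RC_bilin _ _ _)
    (tc_curv_dmap h hφ hq hd (W _))
  rw [hqx] at h1
  exact h1

theorem isSmoothSection_congr (hφ : ContMDiff (𝓡 m) (𝓡 n) ∞ φ)
    {X : ∀ q : M, TangentSpace (𝓡 n) (φ q)} {f : M → N → Euc m → Euc n}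
    (hf : ∀ c d, ContDiffOn ℝ ∞ (f c d) (dom m n c d φ))
    (hX : ∀ c d, ∀ x ∈ dom m n c d φ, sloc m c d φ X x = f c d x) : IsSmoothSection m φ X :=
  isSmoothSection_of_sloc hφ fun c d => (hf c d).congr (hX c d)

theorem sloc_jacobi (hφ : ContMDiff (𝓡 m) (𝓡 n) ∞ φ) (hW : IsSmoothSection m φ W)
    {x : Euc m} (hx : x ∈ dom m n c d φ) :
    sloc m c d φ (jacobi g h φ W) x =
      (chartLoc g c).jac (gam h d) (mloc m n c d φ) (sloc m c d φ W) x := by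
  rw [Loc.jac, ← sloc_roughLaplacian g h hφ hW hx]
  change _ = _ + (chartLoc g c).trc (gam h d) (mloc m n c d φ) (gInv g c) (sloc m c d φ W) x
  rw [← sloc_trCurv g h hφ W hx]
  exact map_add (tc d (φ ((xt m c).symm x))) _ _

theorem tension_smooth (hφ : ContMDiff (𝓡 m) (𝓡 n) ∞ φ) : IsSmoothSection m φ (tension g h φ) :=
  isSmoothSection_congr hφ (fun c d => (setup g h hφ c d).ten_smooth)
    fun _ _ _ hx => sloc_tension g h hφ hx

theorem roughLaplacian_smooth (hφ : ContMDiff (𝓡 m) (𝓡 n) ∞ φ) (hW : IsSmoothSection m φ W) :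
    IsSmoothSection m φ (roughLaplacian g h φ W) :=
  isSmoothSection_congr hφ (fun c d => ((setup g h hφ c d).lap_smooth (sloc_smooth hW)).neg)
    fun _ _ _ hx => sloc_roughLaplacian g h hφ hW hx

theorem jacobi_smooth (hφ : ContMDiff (𝓡 m) (𝓡 n) ∞ φ) (hW : IsSmoothSection m φ W) :
    IsSmoothSection m φ (jacobi g h φ W) :=
  isSmoothSection_congr hφ (fun c d => (setup g h hφ c d).jac_smooth (sloc_smooth hW))
    fun _ _ _ hx => sloc_jacobi g h hφ hW hx

end Dictionary

namespace Loc

variable {m : ℕ} {E F : Type*} [NormedAddCommGroup E] [NormedSpace ℝ E]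
  [NormedAddCommGroup F] [NormedSpace ℝ F] {K : Loc m E} {U : Set E}
  {Γ : F → F →L[ℝ] F →L[ℝ] F} {u w w' : E → F}

/-- Locality. Sections such as `jacobi g h φ W` are known only on the domain of the charts, yet have
to be differentiated again. -/
theorem cov_congr (hU : IsOpen U) (hw : ∀ z ∈ U, w z = w' z) {z : E} (hz : z ∈ U) (i : Fin m) :
    K.cov Γ u i w z = K.cov Γ u i w' z := cd_congr hU hw hz _

theorem cov2_congr (hU : IsOpen U) (hw : ∀ z ∈ U, w z = w' z) {z : E} (hz : z ∈ U)
    (i j : Fin m) : K.cov2 Γ u i j w z = K.cov2 Γ u i j w' z := by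
  rw [cov2, cov2, cov_congr hU (fun y hy => cov_congr hU hw hy j) hz]
  simp only [cov_congr hU hw hz]

theorem lap_congr (hU : IsOpen U) (hw : ∀ z ∈ U, w z = w' z) {z : E} (hz : z ∈ U) :
    K.lap Γ u w z = K.lap Γ u w' z := by
  simp only [lap, cov2_congr hU hw hz]

theorem jac_congr (hU : IsOpen U) (hw : ∀ z ∈ U, w z = w' z) {z : E} (hz : z ∈ U) :
    K.jac Γ u w z = K.jac Γ u w' z := by
  rw [jac, jac, lap_congr hU hw hz, trc, trc, hw z hz]

end Loc

section Dictionary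

variable {m n : ℕ}
  {M : Type*} [TopologicalSpace M] [ChartedSpace (Euc m) M] [IsManifold (𝓡 m) ∞ M]
  {N : Type*} [TopologicalSpace N] [ChartedSpace (Euc n) N] [IsManifold (𝓡 n) ∞ N]
  {φ : M → N} {c : M} {d : N} (g : Metric m M) (h : Metric n N)
  {V W : ∀ q : M, TangentSpace (𝓡 n) (φ q)}

theorem NR_add₁ (Γ : Euc n → Euc n →L[ℝ] Euc n →L[ℝ] Euc n) (y x x' a b c : Euc n) :
    NR Γ y (x + x') a b c = NR Γ y x a b c + NR Γ y x' a b c := by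
  simp only [NR, map_add, add_apply]; abel

theorem NR_smul₁ (Γ : Euc n → Euc n →L[ℝ] Euc n →L[ℝ] Euc n) (r : ℝ) (y x a b c : Euc n) :
    NR Γ y (r • x) a b c = r • NR Γ y x a b c := by
  simp only [NR, map_smul, smul_apply, smul_add, smul_sub]

theorem NR_add₂ (Γ : Euc n → Euc n →L[ℝ] Euc n →L[ℝ] Euc n) (y x a a' b c : Euc n) :
    NR Γ y x (a + a') b c = NR Γ y x a b c + NR Γ y x a' b c := by
  simp only [NR, map_add, add_apply]; abel

theorem NR_smul₂ (Γ : Euc n → Euc n →L[ℝ] Euc n →L[ℝ] Euc n) (r : ℝ) (y x a b c : Euc n) :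
    NR Γ y x (r • a) b c = r • NR Γ y x a b c := by
  simp only [NR, map_smul, smul_apply, smul_add, smul_sub]

theorem NR_add₃ (Γ : Euc n → Euc n →L[ℝ] Euc n →L[ℝ] Euc n) (y x a b b' c : Euc n) :
    NR Γ y x a (b + b') c = NR Γ y x a b c + NR Γ y x a b' c := by
  simp only [NR, map_add, add_apply]; abel

theorem NR_smul₃ (Γ : Euc n → Euc n →L[ℝ] Euc n →L[ℝ] Euc n) (r : ℝ) (y x a b c : Euc n) :
    NR Γ y x a (r • b) c = r • NR Γ y x a b c := by
  simp only [NR, map_smul, smul_apply, smul_add, smul_sub]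

theorem NR_add₄ (Γ : Euc n → Euc n →L[ℝ] Euc n →L[ℝ] Euc n) (y x a b c c' : Euc n) :
    NR Γ y x a b (c + c') = NR Γ y x a b c + NR Γ y x a b c' := by
  simp only [NR, map_add]; abel

theorem NR_smul₄ (Γ : Euc n → Euc n →L[ℝ] Euc n →L[ℝ] Euc n) (r : ℝ) (y x a b c : Euc n) :
    NR Γ y x a b (r • c) = r • NR Γ y x a b c := by
  simp only [NR, map_smul, smul_add, smul_sub]

theorem sloc_jacobi2 (hφ : ContMDiff (𝓡 m) (𝓡 n) ∞ φ) (hW : IsSmoothSection m φ W)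
    {x : Euc m} (hx : x ∈ dom m n c d φ) :
    sloc m c d φ (jacobi2 g h φ W) x =
      (chartLoc g c).jac2 (gam h d) (mloc m n c d φ) (sloc m c d φ W) x := by
  obtain ⟨hq, hd, hqx⟩ := chart_point hx
  set q := (xt m c).symm x with hqdef
  have hst := setup g h hφ c d
  set u := mloc m n c d φ with hu
  set w := sloc m c d φ W with hw
  have hux : xt n d (φ q) = u x := rfl
  have hwx : tc d (φ q) (W q) = w x := rfl
  have hτ : tc d (φ q) (tension g h φ q) = (chartLoc g c).ten (gam h d) u x :=
    sloc_tension g h hφ hx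
  have hcτ : ∀ b, tc d (φ q) (covAlong h φ (tension g h φ) q b) =
      cd (gam h d) u ((chartLoc g c).ten (gam h d) u) (tc c q b) x := by
    intro b
    rw [tc_covAlong_smooth h hφ (tension_smooth g h hφ) hq hd, hqx]
    exact cd_congr hst.hU (fun y hy => sloc_tension g h hφ hy) hx _
  have hcW : ∀ b, tc d (φ q) (covAlong h φ W q b) = cd (gam h d) u w (tc c q b) x := by
    intro b
    rw [tc_covAlong_smooth h hφ hW hq hd, hqx]
  have hdm : ∀ a, tc d (φ q) (dmap φ q a) = fderiv ℝ u x (tc c q a) := by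
    intro a
    rw [tc_dmap hφ hq hd, hqx]
  have h1 : tc d (φ q) (jacobi g h φ (jacobi g h φ W) q) =
      (chartLoc g c).jac (gam h d) u ((chartLoc g c).jac (gam h d) u w) x := by
    have := sloc_jacobi g h hφ (jacobi_smooth g h hφ hW) hx
    rw [Loc.jac_congr hst.hU (fun y hy => sloc_jacobi g h hφ hW hy) hx] at this
    exact this
  have h2 := trace_eq g (tc d (φ q)).toLinearMap hq
    (B := fun a b => covCurv h (φ q) (tension g h φ q) (dmap φ q a) (W q) (dmap φ q b))
    (b := fun a b => NR (gam h d) (u x) ((chartLoc g c).ten (gam h d) u x) (fderiv ℝ u x a)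
      (w x) (fderiv ℝ u x b))
    ⟨fun _ => ⟨fun a b => by rw [map_add, NR_add₂], fun r a => by rw [map_smul, NR_smul₂]⟩,
      fun _ => ⟨fun a b => by rw [map_add, NR_add₄], fun r a => by rw [map_smul, NR_smul₄]⟩⟩
    (fun a b => by
      rw [ContinuousLinearMap.coe_coe, tc_covCurv h hd, hτ, hdm, hdm, hwx, hux])
  have h3 := trace_eq g (tc d (φ q)).toLinearMap hq
    (B := fun a b => covCurv h (φ q) (dmap φ q a) (tension g h φ q) (dmap φ q b) (W q)
        + (2 : ℝ) • curv h (φ q) (W q) (dmap φ q a) (covAlong h φ (tension g h φ) q b)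
        + (2 : ℝ) • curv h (φ q) (tension g h φ q) (dmap φ q a) (covAlong h φ W q b))
    (b := fun a b => NR (gam h d) (u x) (fderiv ℝ u x a) ((chartLoc g c).ten (gam h d) u x)
        (fderiv ℝ u x b) (w x)
      + (2 : ℝ) • RC (gam h d) (u x) (w x) (fderiv ℝ u x a)
        (cd (gam h d) u ((chartLoc g c).ten (gam h d) u) b x)
      + (2 : ℝ) • RC (gam h d) (u x) ((chartLoc g c).ten (gam h d) u x) (fderiv ℝ u x a)
        (cd (gam h d) u w b x))
    ⟨fun _ => ⟨fun a b => by simp only [map_add, NR_add₁, add_apply, smul_add]; abel,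
        fun r a => by simp only [map_smul, NR_smul₁, smul_apply, smul_add, smul_comm r]⟩,
      fun _ => ⟨fun a b => by simp only [map_add, NR_add₃, cd_dir_add, smul_add]; abel,
        fun r a => by simp only [map_smul, NR_smul₃, cd_dir_smul, smul_add, smul_comm r]⟩⟩
    (fun a b => by
      rw [ContinuousLinearMap.coe_coe, map_add, map_add, map_smul, map_smul, tc_covCurv h hd,
        tc_curv h hd, tc_curv h hd, hτ, hdm, hdm, hwx, hux, hcτ, hcW])
  rw [hqx] at h2 h3
  change tc d (φ q) (jacobi g h φ (jacobi g h φ W) q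
    - curv h (φ q) (tension g h φ q) (W q) (tension g h φ q) - trace g q _ + trace g q _) = _
  rw [map_add, map_sub, map_sub, h1, tc_curv h hd, hτ, hwx, hux, Loc.jac2]
  rw [ContinuousLinearMap.coe_coe] at h2 h3
  rw [h2, h3]
  rfl

/-- Besides translating the operator, this yields smoothness of `J₂ᶜ W`: the preferred chart jumps
from point to point in the definition, whereas the local expression uses one fixed pair of charts.
-/
theorem sloc_jacobi2c (hφ : ContMDiff (𝓡 m) (𝓡 n) ∞ φ) (hW : IsSmoothSection m φ W)
    {x : Euc m} (hx : x ∈ dom m n c d φ) :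
    sloc m c d φ (jacobi2c g h φ W) x =
      (chartLoc g c).jac2c (gam h d) (mloc m n c d φ) (sloc m c d φ W) x := by
  obtain ⟨hq, hd, hqx⟩ := chart_point hx
  set q := (xt m c).symm x with hqdef
  have h1 : tc d (φ q) (jacobi2 g h φ W q) = _ := sloc_jacobi2 g h hφ hW hx
  have h2 : tc d (φ q) (trCurvRic g h φ W q) = _ := sloc_trCurvRic g h hφ W hx
  have h3 : tc d (φ q) (jacobi g h φ W q) = _ := sloc_jacobi g h hφ hW hx
  have h4 := trace_ric_left g (tc d (φ q)).toLinearMap hq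
    (second_bilin (Γ := gam h d) (mloc m n c d φ) _ (gam g c (xt m c q)) _)
    (tc_cov2Along g h hφ hW hq hd)
  simp only [second_ev, ContinuousLinearMap.coe_coe] at h4
  rw [hqx] at h4
  have hsc : ∀ y ∈ (xt m c).target, scal g ((xt m c).symm y) = scalL g c y := by
    intro y hy
    rw [scal_eq g ((xt m c).map_target hy), (xt m c).right_inv hy]
  have hscs : ContDiffOn ℝ ∞ (fun y => scal g ((xt m c).symm y)) (xt m c).target :=
    (scalL_smooth g c).congr hsc
  have h5 : tc d (φ q) (covAlong h φ W q (grad g (scal g) q)) =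
      tr2 (gInv g c) x fun i j => fderiv ℝ (scalL g c) x (ev i) •
        cd (gam h d) (mloc m n c d φ) (sloc m c d φ W) (ev j) x := by
    rw [tc_covAlong_smooth h hφ hW hq hd, tc_grad g hq (hscs.contDiffAt
      ((xt_target_open c).mem_nhds ((xt m c).map_source hq))), hqx, gradL, cd_dir_sum]
    simp only [cd_dir_sum, cd_dir_smul, fderiv_congr_on (xt_target_open c) hsc hx.1]
    rfl
  change tc d (φ q) (jacobi2 g h φ W q - (2 : ℝ) • trCurvRic g h φ W q
    + ((2 / 3 : ℝ) * scal g q) • jacobi g h φ W q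
    + (2 : ℝ) • trace g q (fun a b => cov2Along g h φ W q (ricci g q a) b)
    + (1 / 3 : ℝ) • covAlong h φ W q (grad g (scal g) q)) = _
  simp only [map_add, map_sub, map_smul]
  rw [h1, h2, h3, h4, h5, hsc x hx.1]
  rfl

theorem hessIntegrand_eq (hφ : ContMDiff (𝓡 m) (𝓡 n) ∞ φ) (hV : IsSmoothSection m φ V)
    (hW : IsSmoothSection m φ W) {x : Euc m} (hx : x ∈ dom m n c d φ) :
    hessIntegrand g h φ V W ((xt m c).symm x) =
      (chartLoc g c).hessI (metL h d) (gam h d) (mloc m n c d φ) (sloc m c d φ V)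
        (sloc m c d φ W) x := by
  obtain ⟨hq, hd, hqx⟩ := chart_point hx
  set q := (xt m c).symm x with hqdef
  have hux : xt n d (φ q) = mloc m n c d φ x := rfl
  have hvx : tc d (φ q) (V q) = sloc m c d φ V x := rfl
  have h1 : tc d (φ q) (jacobi2 g h φ W q) = _ := sloc_jacobi2 g h hφ hW hx
  have h2 : tc d (φ q) (trCurvRic g h φ W q) = _ := sloc_trCurvRic g h hφ W hx
  have h3 : tc d (φ q) (trCurv g h φ W q) = _ := sloc_trCurv g h hφ W hx
  have hb : IsBilin fun a b => metL h d (mloc m n c d φ x)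
      (cd (gam h d) (mloc m n c d φ) (sloc m c d φ W) a x)
      (cd (gam h d) (mloc m n c d φ) (sloc m c d φ V) b x) :=
    ⟨fun _ => ⟨fun a b => by rw [cd_dir_add, map_add, add_apply],
        fun r a => by rw [cd_dir_smul, map_smul, smul_apply]⟩,
      fun _ => ⟨fun a b => by rw [cd_dir_add, map_add],
        fun r a => by rw [cd_dir_smul, map_smul]⟩⟩
  have hB : ∀ a b, (LinearMap.id (R := ℝ) (M := ℝ))
      (h.inner (φ q) (covAlong h φ W q a) (covAlong h φ V q b)) =
      metL h d (mloc m n c d φ x)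
      (cd (gam h d) (mloc m n c d φ) (sloc m c d φ W) (tc c q a) x)
      (cd (gam h d) (mloc m n c d φ) (sloc m c d φ V) (tc c q b) x) := by
    intro a b
    rw [LinearMap.id_apply, inner_eq h hd, tc_covAlong_smooth h hφ hW hq hd,
      tc_covAlong_smooth h hφ hV hq hd, hqx, hux]
  have h4 := trace_eq g (LinearMap.id (R := ℝ) (M := ℝ)) hq hb hB
  have h5 := trace_ric_right g (LinearMap.id (R := ℝ) (M := ℝ)) hq hb hB
  rw [hqx, LinearMap.id_apply] at h4 h5
  rw [hessIntegrand, inner_eq h hd, inner_eq h hd, map_sub, map_smul, h1, h2, h3, h4, h5,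
    scal_eq g hq, hqx, hux, hvx]
  rfl

/-- The integrand of the conformal-bienergy. -/
def density (g : Metric m M) (h : Metric n N) (φ : M → N) (p : M) : ℝ :=
  h.inner (φ p) (tension g h φ p) (tension g h φ p)
    + (2 / 3) * scal g p * trace g p (fun a b => h.inner (φ p) (dmap φ p a) (dmap φ p b))
    - 2 * trace g p (fun a b => h.inner (φ p) (dmap φ p (ricci g p a)) (dmap φ p b))

theorem density_eq (hφ : ContMDiff (𝓡 m) (𝓡 n) ∞ φ) {x : Euc m} (hx : x ∈ dom m n c d φ) :
    density g h φ ((xt m c).symm x) =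
      (chartLoc g c).dens (metL h d) (gam h d) (mloc m n c d φ) x := by
  obtain ⟨hq, hd, hqx⟩ := chart_point hx
  set q := (xt m c).symm x with hqdef
  have hux : xt n d (φ q) = mloc m n c d φ x := rfl
  have h1 : tc d (φ q) (tension g h φ q) = _ := sloc_tension g h hφ hx
  have hb : IsBilin fun a b => metL h d (mloc m n c d φ x)
      (fderiv ℝ (mloc m n c d φ) x a) (fderiv ℝ (mloc m n c d φ) x b) :=
    ⟨fun _ => ⟨fun a b => by rw [map_add, map_add, add_apply],
        fun r a => by rw [map_smul, map_smul, smul_apply]⟩,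
      fun _ => ⟨fun a b => by rw [map_add, map_add],
        fun r a => by rw [map_smul, map_smul]⟩⟩
  have hB : ∀ a b, (LinearMap.id (R := ℝ) (M := ℝ))
      (h.inner (φ q) (dmap φ q a) (dmap φ q b)) =
      metL h d (mloc m n c d φ x)
      (fderiv ℝ (mloc m n c d φ) x (tc c q a)) (fderiv ℝ (mloc m n c d φ) x (tc c q b)) := by
    intro a b
    rw [LinearMap.id_apply, inner_eq h hd, tc_dmap hφ hq hd, tc_dmap hφ hq hd, hqx, hux]
  have h4 := trace_eq g (LinearMap.id (R := ℝ) (M := ℝ)) hq hb hB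
  have h5 := trace_ric_left g (LinearMap.id (R := ℝ) (M := ℝ)) hq hb hB
  rw [hqx, LinearMap.id_apply] at h4 h5
  rw [density, inner_eq h hd, h1, h4, h5, scal_eq g hq, hqx, hux]
  rfl

theorem jacobi2c_smooth (hφ : ContMDiff (𝓡 m) (𝓡 n) ∞ φ) (hW : IsSmoothSection m φ W) :
    IsSmoothSection m φ (jacobi2c g h φ W) :=
  isSmoothSection_congr hφ (fun c d => (setup g h hφ c d).jac2c_smooth (sloc_smooth hW))
    fun _ _ _ hx => sloc_jacobi2c g h hφ hW hx

end Dictionary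

end CBiharmonic

end

/-! ### The volume density: Jacobi's formula, divergence, change of charts. -/

noncomputable section

set_option linter.unusedSectionVars false
set_option synthInstance.maxHeartbeats 200000

namespace CBiharmonic

/-! ### The derivative of a determinant -/

section Det

variable {m : ℕ} {E : Type*} [NormedAddCommGroup E] [NormedSpace ℝ E]

/-- Jacobi's formula. The determinant is multilinear in the rows, so its derivative replaces one row
at a time, and Cramer's rule expresses these determinants by the adjugate. -/
theorem fderiv_det {A : E → Matrix (Fin m) (Fin m) ℝ} {x : E}
    (hA : ∀ i j, DifferentiableAt ℝ (fun y => A y i j) x) (v : E) :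
    fderiv ℝ (fun y => (A y).det) x v =
      ∑ i, ∑ j, (A x).adjugate j i * fderiv ℝ (fun y => A y i j) x v := by
  let D : ContinuousMultilinearMap ℝ (fun _ : Fin m => Fin m → ℝ) ℝ :=
    { (Matrix.detRowAlternating (R := ℝ) (n := Fin m)).toMultilinearMap with
      cont := (continuous_id (X := Matrix (Fin m) (Fin m) ℝ)).matrix_det }
  have hA' : DifferentiableAt ℝ (fun y i j => A y i j) x :=
    differentiableAt_pi.mpr fun i => differentiableAt_pi.mpr fun j => hA i j
  have h1 : fderiv ℝ (fun y => (A y).det) x v = D.linearDeriv (fun i j => A x i j)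
      (fderiv ℝ (fun y i j => A y i j) x v) :=
    congrArg (fun T => T v) ((D.hasFDerivAt (fun i j => A x i j)).comp x hA'.hasFDerivAt).fderiv
  have h2 : ∀ i j, fderiv ℝ (fun y i j => A y i j) x v i j = fderiv ℝ (fun y => A y i j) x v := by
    intro i j
    rw [fderiv_pi fun i => differentiableAt_pi.mpr fun j => hA i j]
    simp only [ContinuousLinearMap.coe_pi']
    rw [fderiv_pi fun j => hA i j]
    rfl
  rw [h1, ContinuousMultilinearMap.linearDeriv_apply]
  refine Finset.sum_congr rfl fun i _ => ?_
  have h3 : D (Function.update (fun i j => A x i j) i (fderiv ℝ (fun y i j => A y i j) x v i)) =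
      ((A x).updateRow i (fderiv ℝ (fun y i j => A y i j) x v i)).det := rfl
  rw [h3, ← Matrix.cramer_transpose_apply, Matrix.cramer_eq_adjugate_mulVec, Matrix.mulVec,
    dotProduct]
  refine Finset.sum_congr rfl fun j _ => ?_
  rw [h2, ← Matrix.adjugate_transpose, Matrix.transpose_apply]

end Det

section Density

variable {m : ℕ} {M : Type*} [TopologicalSpace M] [ChartedSpace (Euc m) M] [IsManifold (𝓡 m) ∞ M]
  {c : M} {x : Euc m}

/-- The Riemannian volume density in the chart at `c`. -/
def sqG (g : Metric m M) (c : M) (x : Euc m) : ℝ := √(gramL (metL g c) x).det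

theorem sqG_pos (g : Metric m M) (hx : x ∈ (xt m c).target) : 0 < sqG g c x :=
  Real.sqrt_pos.mpr (gramL_det_pos (metL_metric g c) hx)

theorem sqG_smooth (g : Metric m M) (c : M) : ContDiffOn ℝ ∞ (sqG g c) (xt m c).target :=
  (smooth_det (gramL_smooth (metL_metric g c))).sqrt
    fun _ hx => (gramL_det_pos (metL_metric g c) hx).ne'

/-- Jacobi's formula gives half the trace of `G⁻¹ ∂_v G`. By compatibility `∂_v G` is the sum of two
`Γ`-terms, each contributing the trace of `Γ_v`. -/
theorem fderiv_sqG (g : Metric m M) (hx : x ∈ (xt m c).target) (v : Euc m) :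
    fderiv ℝ (sqG g c) x v = sqG g c x * ∑ i, gam g c x v (ev i) i := by
  have ho := xt_target_open (n := m) c
  have hG := metL_metric g c
  have hpos := gramL_det_pos hG hx
  have hd : DifferentiableAt ℝ (fun y => (gramL (metL g c) y).det) x :=
    diffAt_of_smooth ho (smooth_det (gramL_smooth hG)) hx
  have h1 : fderiv ℝ (sqG g c) x v =
      (1 / (2 * sqG g c x)) * fderiv ℝ (fun y => (gramL (metL g c) y).det) x v := by
    have := (hd.hasFDerivAt.sqrt hpos.ne').fderiv
    exact congrArg (fun T => T v) this
  have h2 : ∀ i j, fderiv ℝ (fun y => gramL (metL g c) y i j) x v =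
      metL g c x (gam g c x v (ev i)) (ev j) + metL g c x (ev i) (gam g c x v (ev j)) := by
    intro i j
    rw [← gam_compat g c x hx]
    have := fderiv_apply₂ ho hG.smooth (contDiffOn_const (c := ev i))
      (contDiffOn_const (c := ev j)) hx v
    simp only [fderiv_fun_const, Pi.zero_apply, zero_apply, map_zero, add_zero] at this
    exact this
  have h3 : ∀ i j, (gramL (metL g c) x).adjugate j i =
      (gramL (metL g c) x).det * gInv g c i j x := by
    intro i j
    rw [gInv_symm g hx, gInv, Matrix.inv_def, Ring.inverse_eq_inv', Matrix.smul_apply,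
      smul_eq_mul, mul_inv_cancel_left₀ hpos.ne']
  have h4 : ∑ i, ∑ j, gInv g c i j x * metL g c x (gam g c x v (ev i)) (ev j) =
      ∑ i, gam g c x v (ev i) i :=
    Finset.sum_congr rfl fun i _ => (component_eq g hx _ _).symm
  have h5 : ∑ i, ∑ j, gInv g c i j x * metL g c x (ev i) (gam g c x v (ev j)) =
      ∑ i, gam g c x v (ev i) i := by
    rw [← h4, Finset.sum_comm]
    refine Finset.sum_congr rfl fun i _ => Finset.sum_congr rfl fun j _ => ?_
    rw [gInv_symm g hx, hG.symm x hx]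
  have h6 : sqG g c x * sqG g c x = (gramL (metL g c) x).det := Real.mul_self_sqrt hpos.le
  rw [h1, fderiv_det fun i j => diffAt_of_smooth ho (gramL_smooth hG i j) hx]
  simp only [h2, h3, mul_assoc, mul_add, Finset.sum_add_distrib, ← Finset.mul_sum, h4, h5]
  rw [← h6]
  have := (sqG_pos g hx).ne'
  field_simp
  rw [mul_comm, one_add_one_eq_two]

/-- The divergence in terms of the volume density. -/
theorem sqG_mul_divL (g : Metric m M) {Y : Euc m → Euc m}
    (hY : ContDiffOn ℝ ∞ Y (xt m c).target) (hx : x ∈ (xt m c).target) :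
    sqG g c x * divL g c Y x = ∑ k, fderiv ℝ (fun y => sqG g c y * Y y k) x (ev k) := by
  have ho := xt_target_open (n := m) c
  have hYk : ∀ k, ContDiffOn ℝ ∞ (fun y => Y y k) (xt m c).target := fun k =>
    (pr k).contDiff.comp_contDiffOn hY
  have hYd : ∀ l v, fderiv ℝ (fun x => Y x l) x v = (fderiv ℝ Y x v) l := by
    intro l v
    have := fderiv_comp x (pr l).differentiableAt (diffAt_of_smooth ho hY hx)
    have h2 := congrArg (fun T => T v) this
    simp only [ContinuousLinearMap.comp_apply, ContinuousLinearMap.fderiv, pr_apply] at h2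
    exact h2
  have h1 : ∀ k, fderiv ℝ (fun y => sqG g c y * Y y k) x (ev k) =
      sqG g c x * (fderiv ℝ Y x (ev k)) k + sqG g c x * (Y x k * ∑ i, gam g c x (ev k) (ev i) i) := by
    intro k
    rw [fderiv_fun_mul (diffAt_of_smooth ho (sqG_smooth g c) hx) (diffAt_of_smooth ho (hYk k) hx)]
    simp only [add_apply, smul_apply, smul_eq_mul, fderiv_sqG g hx, hYd]
    ring
  have h2 : ∑ k, gam g c x (ev k) (Y x) k = ∑ k, Y x k * ∑ i, gam g c x (ev k) (ev i) i := by
    have h3 : ∀ k, gam g c x (ev k) (Y x) k = ∑ l, Y x l * gam g c x (ev l) (ev k) k := by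
      intro k
      rw [gam_symm g c x hx, linear_expand (L := fun y => gam g c x y (ev k))
        ⟨by simp, by simp⟩ (Y x)]
      simp
    simp only [h3, Finset.mul_sum]
    exact Finset.sum_comm
  simp only [h1, divL, cd, fderiv_fun_id, ContinuousLinearMap.id_apply, PiLp.add_apply,
    Finset.sum_add_distrib, ← Finset.mul_sum, h2]
  ring

theorem divL_smul (g : Metric m M) {U : Set (Euc m)} (hU : IsOpen U) {f : Euc m → ℝ}
    {Y : Euc m → Euc m} (hf : ContDiffOn ℝ ∞ f U) (hY : ContDiffOn ℝ ∞ Y U) (hx : x ∈ U) :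
    divL g c (fun x => f x • Y x) x = fderiv ℝ f x (Y x) + f x * divL g c Y x := by
  have h1 : fderiv ℝ f x (Y x) = ∑ k, fderiv ℝ f x (ev k) * Y x k := by
    rw [linear_expand (L := fderiv ℝ f x) ⟨by simp, by simp⟩ (Y x)]
    exact Finset.sum_congr rfl fun k _ => mul_comm _ _
  rw [h1]
  simp only [divL, fun k => cd_smul (Γ := gam g c) (u := fun x => x) hU hf hY hx (ev k),
    PiLp.add_apply, PiLp.smul_apply, smul_eq_mul, Finset.sum_add_distrib, Finset.mul_sum]

theorem divL_congr (g : Metric m M) {U : Set (Euc m)} (hU : IsOpen U) {Y Y' : Euc m → Euc m}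
    (h : ∀ x ∈ U, Y x = Y' x) (hx : x ∈ U) : divL g c Y x = divL g c Y' x := by
  simp only [divL, cd_congr hU h hx]

/-- The change of the volume density under a change of charts. -/
theorem sqG_kap (g : Metric m M) {c c' : M} (hx : x ∈ kapDom m c c') :
    sqG g c' x = |(fderiv ℝ (kap m c c') x).det| * sqG g c (kap m c c' x) := by
  set L := fderiv ℝ (kap m c c') x with hL
  set J : Matrix (Fin m) (Fin m) ℝ := Matrix.of fun k i => (L (ev i)) k with hJ
  have h1 : gramL (metL g c') x = J.transpose * gramL (metL g c) (kap m c c' x) * J := by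
    ext i j
    rw [Matrix.mul_apply]
    simp only [gramL, Matrix.of_apply, Matrix.mul_apply, hJ, Matrix.transpose_apply]
    rw [metL_kap g hx, ← hL]
    generalize L (ev i) = a
    generalize L (ev j) = b
    conv_lhs => rw [sum_ev a, sum_ev b]
    simp only [map_sum, map_smul, sum_apply, smul_apply, smul_eq_mul, Finset.mul_sum,
      Finset.sum_mul]
    refine Finset.sum_congr rfl fun k _ => Finset.sum_congr rfl fun l _ => ?_
    ring
  -- `J` is the matrix of `L` in the standard basis.
  have h2 : J.det = L.det := by
    have h3 : LinearMap.toMatrix (EuclideanSpace.basisFun (Fin m) ℝ).toBasis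
        (EuclideanSpace.basisFun (Fin m) ℝ).toBasis L.toLinearMap = J := by
      ext k i
      rw [LinearMap.toMatrix_apply]
      simp [hJ, ev]
    rw [← h3, LinearMap.det_toMatrix]
  have h3 : (gramL (metL g c') x).det = L.det ^ 2 * (gramL (metL g c) (kap m c c' x)).det := by
    rw [h1, Matrix.det_mul, Matrix.det_mul, Matrix.det_transpose, h2]; ring
  rw [sqG, h3, Real.sqrt_mul (sq_nonneg _), Real.sqrt_sq_eq_abs, sqG]

end Density

end CBiharmonic

end

/-! ### Integration against the Riemannian volume and the divergence theorem. -/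

noncomputable section

set_option linter.unusedSectionVars false
set_option synthInstance.maxHeartbeats 200000

namespace CBiharmonic

/-- Functions which are smooth in charts. -/
theorem continuous_of_charts {m : ℕ} {M : Type*} [TopologicalSpace M] [ChartedSpace (Euc m) M]
    [IsManifold (𝓡 m) ∞ M] {f : M → ℝ}
    (hf : ∀ c, ContDiffOn ℝ ∞ (fun x => f ((xt m c).symm x)) (xt m c).target) : Continuous f := by
  rw [continuous_iff_continuousAt]
  intro p
  have h1 : ContinuousAt (fun x => f ((xt m p).symm x)) (xt m p p) :=
    (hf p).continuousOn.continuousAt ((xt_target_open p).mem_nhds ((xt m p).map_source (mem_xt p)))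
  have h2 : ContinuousAt (fun q => f ((xt m p).symm (xt m p q))) p :=
    h1.comp (f := fun q => xt m p q) (continuousAt_extChartAt p)
  refine h2.congr ?_
  filter_upwards [(xt_source_open (n := m) p).mem_nhds (mem_xt p)] with q hq
  rw [(xt m p).left_inv hq]

section Volume

variable {m : ℕ} {M : Type*} [TopologicalSpace M] [ChartedSpace (Euc m) M] [IsManifold (𝓡 m) ∞ M]
  [T2Space M] [CompactSpace M]

/-! ### The partition of unity -/

theorem rho_subordinate (c : M) : tsupport (chartPartition m M c) ⊆ (xt m c).source := by
  rw [extChartAt_source]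
  exact Classical.choose_spec
    (SmoothPartitionOfUnity.exists_isSubordinate_chartAt_source (𝓡 m) M) c

theorem rho_finite (m : ℕ) (M : Type*) [TopologicalSpace M] [ChartedSpace (Euc m) M]
    [IsManifold (𝓡 m) ∞ M] [T2Space M] [CompactSpace M] :
    {c : M | (Function.support (chartPartition m M c)).Nonempty}.Finite :=
  (chartPartition m M).locallyFinite.finite_nonempty_of_compact

/-- The finitely many charts which are met by the partition of unity. -/
def charts (m : ℕ) (M : Type*) [TopologicalSpace M] [ChartedSpace (Euc m) M]
    [IsManifold (𝓡 m) ∞ M] [T2Space M] [CompactSpace M] : Finset M := (rho_finite m M).toFinset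

theorem rho_eq_zero {c : M} (hc : c ∉ charts m M) (p : M) : chartPartition m M c p = 0 := by
  by_contra h
  exact hc ((rho_finite m M).mem_toFinset.mpr ⟨p, h⟩)

theorem sum_rho (p : M) : ∑ c ∈ charts m M, chartPartition m M c p = 1 := by
  rw [← (chartPartition m M).sum_eq_one (Set.mem_univ p)]
  refine (finsum_eq_sum_of_support_subset _ fun c hc => ?_).symm
  by_contra h
  exact hc (rho_eq_zero h p)

theorem rho_cont (c : M) : Continuous (chartPartition m M c) :=
  (chartPartition m M c).contMDiff.continuous

theorem rho_nonneg (c p : M) : 0 ≤ chartPartition m M c p := (chartPartition m M).nonneg c p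

theorem eq_zero_of_tsupport {f : M → ℝ} {c : M} (hf : tsupport f ⊆ (xt m c).source) {p : M}
    (hp : p ∉ (xt m c).source) : f p = 0 :=
  image_eq_zero_of_notMem_tsupport fun h => hp (hf h)

/-! ### The Riemannian volume in charts -/

theorem continuousOn_chart {f : M → ℝ} (hf : Continuous f) (c : M) :
    ContinuousOn (fun x => f ((xt m c).symm x)) (xt m c).target :=
  hf.comp_continuousOn (xt_symm_cont c)

/-- The image in a chart of the support of a function. -/
def chartSupp (m : ℕ) {M : Type*} [TopologicalSpace M] [ChartedSpace (Euc m) M]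
    (c : M) (f : M → ℝ) : Set (Euc m) := xt m c '' tsupport f

theorem chartSupp_compact {f : M → ℝ} {c : M} (hf : tsupport f ⊆ (xt m c).source) :
    IsCompact (chartSupp m c f) :=
  (isClosed_tsupport f).isCompact.image_of_continuousOn ((xt_cont c).mono hf)

theorem chartSupp_subset {f : M → ℝ} {c : M} (hf : tsupport f ⊆ (xt m c).source) :
    chartSupp m c f ⊆ (xt m c).target := by
  rintro _ ⟨p, hp, rfl⟩
  exact (xt m c).map_source (hf hp)

theorem notMem_tsupport_of {f : M → ℝ} {c : M} {x : Euc m} (hx : x ∈ (xt m c).target)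
    (hxs : x ∉ chartSupp m c f) : (xt m c).symm x ∉ tsupport f :=
  fun h => hxs ⟨_, h, (xt m c).right_inv hx⟩

theorem integrableOn_of_compact {f : Euc m → ℝ} {S K : Set (Euc m)} (hS : MeasurableSet S)
    (hf : ContinuousOn f S) (hK : IsCompact K) (hKS : K ⊆ S) (h0 : ∀ x ∈ S, x ∉ K → f x = 0) :
    IntegrableOn f S :=
  ((hf.mono hKS).integrableOn_compact hK).of_forall_sdiff_eq_zero hS fun x hx => h0 x hx.1 hx.2

theorem integrableOn_chart (g : Metric m M) {f : M → ℝ} (hf : Continuous f) {c : M}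
    (hs : tsupport f ⊆ (xt m c).source) :
    IntegrableOn (fun x => f ((xt m c).symm x) * sqG g c x) (xt m c).target := by
  refine integrableOn_of_compact (xt_target_open c).measurableSet
    ((continuousOn_chart hf c).mul (sqG_smooth g c).continuousOn) (chartSupp_compact hs)
    (chartSupp_subset hs) fun x hx hxs => ?_
  rw [image_eq_zero_of_notMem_tsupport (notMem_tsupport_of hx hxs), zero_mul]

/-- The integral of a function over the domain of a chart. -/
def chartInt (g : Metric m M) (c : M) (f : M → ℝ) : ℝ :=
  ∫ x in (xt m c).target, f ((xt m c).symm x) * sqG g c x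

/-- Both integrals live on the overlap of the charts, where the change of variables formula and the
transformation of `√det` by the Jacobian agree. -/
theorem chartInt_change (g : Metric m M) {c c' : M} {f : M → ℝ}
    (hf : ∀ p ∉ (xt m c).source, f p = 0) (hf' : ∀ p ∉ (xt m c').source, f p = 0) :
    chartInt g c f = chartInt g c' f := by
  have hsub : ∀ c c' : M, (∀ p ∉ (xt m c).source, f p = 0) →
      chartInt g c' f = ∫ x in kapDom m c c', f ((xt m c').symm x) * sqG g c' x := by
    intro c c' hf
    refine setIntegral_eq_of_subset_of_forall_sdiff_eq_zero (xt_target_open c').measurableSet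
      (kapDom_subset c c') fun x hx => ?_
    rw [hf _ fun h => hx.2 ⟨hx.1, h⟩, zero_mul]
  rw [hsub c c' hf, hsub c' c hf']
  have himg : kap m c c' '' kapDom m c c' = kapDom m c' c := by
    ext y
    constructor
    · rintro ⟨x, hx, rfl⟩
      exact kap_maps hx
    · intro hy
      exact ⟨kap m c' c y, kap_maps hy, kap_kap hy⟩
  rw [← himg, integral_image_eq_integral_abs_det_fderiv_smul volume
    (kapDom_open c c').measurableSet (fun x hx => (diffAt_of_smooth (kapDom_open c c')
      (kap_smooth c c') hx).hasFDerivAt.hasFDerivWithinAt)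
    (fun x hx y hy hxy => by rw [← kap_kap hx, ← kap_kap hy, hxy])]
  refine setIntegral_congr_fun (kapDom_open c c').measurableSet fun x hx => ?_
  have h1 : (xt m c).symm (kap m c c' x) = (xt m c').symm x := (xt m c).left_inv hx.2
  simp only [h1, sqG_kap g hx, smul_eq_mul]
  ring

variable [MeasurableSpace M] [BorelSpace M]

/-- The contribution of a chart to the Riemannian volume. -/
def volPart (g : Metric m M) (c : M) : Measure M :=
  Measure.map (xt m c).symm
      (((volume : Measure (Euc m)).restrict (xt m c).target).withDensity fun x =>
        ENNReal.ofReal (chartPartition m M c ((xt m c).symm x) *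
          Real.sqrt (gram g c ((xt m c).symm x)).det))

theorem volPart_density (g : Metric m M) (c : M) {x : Euc m} (hx : x ∈ (xt m c).target) :
    √(gram g c ((xt m c).symm x)).det = sqG g c x := by
  rw [gram_eq g ((xt m c).map_target hx), (xt m c).right_inv hx, sqG]

theorem density_aemeasurable (g : Metric m M) (c : M) :
    AEMeasurable (fun x => ENNReal.ofReal (chartPartition m M c ((xt m c).symm x) *
      Real.sqrt (gram g c ((xt m c).symm x)).det)) (volume.restrict (xt m c).target) := by
  have h1 : ContinuousOn (fun x => chartPartition m M c ((xt m c).symm x) *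
      Real.sqrt (gram g c ((xt m c).symm x)).det) (xt m c).target :=
    ((continuousOn_chart (rho_cont (m := m) c) c).mul (sqG_smooth g c).continuousOn).congr
      fun x hx => by rw [volPart_density g c hx]; rfl
  exact (h1.aemeasurable (xt_target_open c).measurableSet).ennreal_ofReal

theorem volPart_eq_zero (g : Metric m M) {c : M} (hc : c ∉ charts m M) : volPart g c = 0 := by
  simp [volPart, rho_eq_zero hc]

/-- The defining sum runs over all points of `M`, but by compactness only finitely many members of
the partition of unity are nonzero. -/
theorem vol_eq (g : Metric m M) : vol g = ∑ c ∈ charts m M, volPart g c := by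
  change Measure.sum (fun c => volPart g c) = _
  ext s hs
  rw [Measure.sum_apply _ hs, Measure.finsetSum_apply, tsum_eq_sum]
  intro c hc
  rw [volPart_eq_zero g hc]
  rfl

theorem rho_mul_tsupport (c : M) (f : M → ℝ) :
    tsupport (fun p => chartPartition m M c p * f p) ⊆ (xt m c).source :=
  (closure_mono (Function.support_mul_subset_left _ _)).trans (rho_subordinate c)

theorem integrable_volPart (g : Metric m M) (c : M) {f : M → ℝ} (hf : Continuous f) :
    Integrable f (volPart g c) ∧
      ∫ p, f p ∂(volPart g c) = chartInt g c fun p => chartPartition m M c p * f p := by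
  have hm : AEMeasurable (xt m c).symm
      (((volume : Measure (Euc m)).restrict (xt m c).target).withDensity fun x =>
        ENNReal.ofReal (chartPartition m M c ((xt m c).symm x) *
          Real.sqrt (gram g c ((xt m c).symm x)).det)) :=
    ((xt_symm_cont c).aemeasurable (xt_target_open c).measurableSet).mono_ac
      (withDensity_absolutelyContinuous _ _)
  have hd := density_aemeasurable g c
  have hfin : ∀ᵐ x ∂(volume : Measure (Euc m)).restrict (xt m c).target,
      ENNReal.ofReal (chartPartition m M c ((xt m c).symm x) *
          Real.sqrt (gram g c ((xt m c).symm x)).det) < ⊤ :=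
    Filter.Eventually.of_forall fun x => ENNReal.ofReal_lt_top
  have he : ∀ x ∈ (xt m c).target, (ENNReal.ofReal (chartPartition m M c ((xt m c).symm x) *
          Real.sqrt (gram g c ((xt m c).symm x)).det)).toReal • f ((xt m c).symm x) =
      (fun p => chartPartition m M c p * f p) ((xt m c).symm x) * sqG g c x := by
    intro x hx
    rw [ENNReal.toReal_ofReal (mul_nonneg (rho_nonneg _ _) (Real.sqrt_nonneg _)),
      volPart_density g c hx, smul_eq_mul]
    ring
  constructor
  · rw [volPart, integrable_map_measure hf.aestronglyMeasurable hm,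
      integrable_withDensity_iff_integrable_smul₀' hd hfin]
    exact (integrableOn_congr_fun he (xt_target_open c).measurableSet).mpr
      (integrableOn_chart g ((rho_cont c).mul hf) (rho_mul_tsupport c f))
  · rw [volPart, integral_map hm hf.aestronglyMeasurable,
      integral_withDensity_eq_integral_toReal_smul₀ hd hfin]
    exact setIntegral_congr_fun (xt_target_open c).measurableSet he

theorem integrable_vol (g : Metric m M) {f : M → ℝ} (hf : Continuous f) :
    Integrable f (vol g) := by
  rw [vol_eq, integrable_finsetSum_measure]
  exact fun c _ => (integrable_volPart g c hf).1

theorem integral_vol (g : Metric m M) {f : M → ℝ} (hf : Continuous f) :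
    ∫ p, f p ∂(vol g) =
      ∑ c ∈ charts m M, chartInt g c fun p => chartPartition m M c p * f p := by
  rw [vol_eq, integral_finsetSum_measure fun c _ => (integrable_volPart g c hf).1]
  exact Finset.sum_congr rfl fun c _ => (integrable_volPart g c hf).2

/-- The integral of a function which is supported in the domain of a chart. -/
theorem integral_vol_chart (g : Metric m M) {f : M → ℝ} (hf : Continuous f) {c : M}
    (hs : tsupport f ⊆ (xt m c).source) : ∫ p, f p ∂(vol g) = chartInt g c f := by
  rw [integral_vol g hf]
  have hs' : ∀ c', tsupport (fun p => chartPartition m M c' p * f p) ⊆ (xt m c).source := fun c' =>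
    (closure_mono (Function.support_mul_subset_right _ _)).trans hs
  -- Each piece is supported in both charts and is moved to the fixed chart `c`; there the partition
  -- of unity sums to one.
  have h1 : ∀ c', chartInt g c' (fun p => chartPartition m M c' p * f p) =
      chartInt g c fun p => chartPartition m M c' p * f p := fun c' =>
    chartInt_change g (fun p hp => eq_zero_of_tsupport (rho_mul_tsupport c' f) hp)
      fun p hp => eq_zero_of_tsupport (hs' c') hp
  simp only [h1]
  simp only [chartInt]
  have h2 : ∀ c', IntegrableOn (fun x => chartPartition m M c' ((xt m c).symm x) *
      f ((xt m c).symm x) * sqG g c x) (xt m c).target := fun c' =>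
    integrableOn_chart g ((rho_cont c').mul hf) (hs' c')
  rw [← integral_finsetSum _ fun c' _ => h2 c']
  refine integral_congr_ae (Filter.Eventually.of_forall fun x => ?_)
  simp only [← Finset.sum_mul, sum_rho, one_mul]

/-! ### The divergence theorem -/

/-- Integration by parts against the constant `1`. The function vanishes off a compact subset of
`S`, hence is differentiable on the whole space. -/
theorem integral_fderiv_eq_zero {f : Euc m → ℝ} {S K : Set (Euc m)} (hS : IsOpen S)
    (hf : ContDiffOn ℝ ∞ f S) (hK : IsCompact K) (hKS : K ⊆ S) (h0 : ∀ x ∉ K, f x = 0)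
    (v : Euc m) : ∫ x in S, fderiv ℝ f x v = 0 := by
  have hKc : IsOpen Kᶜ := hK.isClosed.isOpen_compl
  have hd : Differentiable ℝ f := by
    intro x
    by_cases hx : x ∈ K
    · exact diffAt_of_smooth hS hf (hKS hx)
    · exact (differentiableAt_const (0 : ℝ)).congr_of_eventuallyEq
        (Filter.eventually_of_mem (hKc.mem_nhds hx) h0)
  have hd0 : ∀ x ∉ K, fderiv ℝ f x = 0 := by
    intro x hx
    have h1 : f =ᶠ[nhds x] fun _ => 0 := Filter.eventually_of_mem (hKc.mem_nhds hx) h0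
    rw [h1.fderiv_eq, fderiv_fun_const]
    rfl
  have hi : ∀ F : Euc m → ℝ, ContinuousOn F S → (∀ x ∉ K, F x = 0) → Integrable F := by
    intro F hF hF0
    have := integrableOn_of_compact hS.measurableSet hF hK hKS fun x _ hx => hF0 x hx
    exact (integrableOn_iff_integrable_of_support_subset fun x hx => by
      by_contra hxS
      exact hx (hF0 x fun h => hxS (hKS h))).mp this
  have hcf := (smooth_fderiv_apply hS hf v).continuousOn
  have hv0 : ∀ x ∉ K, fderiv ℝ f x v = 0 := fun x hx => by rw [hd0 x hx]; rfl
  rw [setIntegral_eq_integral_of_forall_compl_eq_zero fun x hx => hv0 x fun h => hx (hKS h)]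
  have h := integral_mul_fderiv_eq_neg_fderiv_mul_of_integrable (μ := (volume : Measure (Euc m)))
    (f := fun _ : Euc m => (1 : ℝ)) (g := f) (v := v)
    (by simp) (by simpa using hi _ hcf hv0) (by simpa using hi _ hf.continuousOn h0)
    (fun x _ => differentiableAt_const _) (fun x _ => hd x)
  simpa using h

theorem integral_divL_eq_zero (g : Metric m M) {c : M} {Y : Euc m → Euc m}
    (hY : ContDiffOn ℝ ∞ Y (xt m c).target) {K : Set (Euc m)} (hK : IsCompact K)
    (hKS : K ⊆ (xt m c).target) (h0 : ∀ x ∉ K, Y x = 0) :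
    ∫ x in (xt m c).target, divL g c Y x * sqG g c x = 0 := by
  have ho := xt_target_open (n := m) c
  have hs : ∀ k, ContDiffOn ℝ ∞ (fun y => sqG g c y * Y y k) (xt m c).target := fun k =>
    (sqG_smooth g c).mul ((pr k).contDiff.comp_contDiffOn hY)
  have h1 : ∀ k x, x ∉ K → sqG g c x * Y x k = 0 := fun k x hx => by simp [h0 x hx]
  have h2 : ∫ x in (xt m c).target, divL g c Y x * sqG g c x =
      ∫ x in (xt m c).target, ∑ k, fderiv ℝ (fun y => sqG g c y * Y y k) x (ev k) :=
    setIntegral_congr_fun ho.measurableSet fun x hx => by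
      simp only [← sqG_mul_divL g hY hx, mul_comm]
  rw [h2, integral_finsetSum]
  · exact Finset.sum_eq_zero fun k _ => integral_fderiv_eq_zero ho (hs k) hK hKS (h1 k) _
  · intro k _
    refine integrableOn_of_compact ho.measurableSet
      (smooth_fderiv_apply ho (hs k) (ev k)).continuousOn hK hKS fun x _ hxK => ?_
    have : (fun y => sqG g c y * Y y k) =ᶠ[nhds x] fun _ => 0 :=
      Filter.eventually_of_mem (hK.isClosed.isOpen_compl.mem_nhds hxK) (h1 k)
    rw [this.fderiv_eq, fderiv_fun_const]
    rfl

theorem rho_smooth (c' c : M) :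
    ContDiffOn ℝ ∞ (fun x => chartPartition m M c' ((xt m c).symm x)) (xt m c).target := by
  rw [← contMDiffOn_iff_contDiffOn]
  exact (chartPartition m M c').contMDiff.comp_contMDiffOn (contMDiffOn_extChartAt_symm c)

/-- The divergence theorem. -/
theorem integral_div_eq_zero (g : Metric m M) {Z : ∀ q : M, TangentSpace (𝓡 m) q}
    (hZ : ∀ c, ContDiffOn ℝ ∞ (vloc c Z) (xt m c).target) {f : M → ℝ}
    (hf : ∀ c, ∀ x ∈ (xt m c).target, f ((xt m c).symm x) = divL g c (vloc c Z) x) :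
    ∫ p, f p ∂(vol g) = 0 := by
  have hfs : ∀ c, ContDiffOn ℝ ∞ (fun x => f ((xt m c).symm x)) (xt m c).target := by
    intro c
    refine ContDiffOn.congr ?_ (hf c)
    exact ContDiffOn.sum fun k _ => (pr k).contDiff.comp_contDiffOn
      (cd_smooth (xt_target_open c) (gam_smooth g c) contDiffOn_id (fun z hz => hz) (hZ c) _)
  -- The divergence of `ρ_c' Z`, supported in one chart.
  set r : M → M → ℝ := fun c' p => dfun (chartPartition m M c') p (Z p) +
    chartPartition m M c' p * f p with hr
  have hloc : ∀ c' c, ∀ x ∈ (xt m c).target, r c' ((xt m c).symm x) =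
      divL g c (fun x => chartPartition m M c' ((xt m c).symm x) • vloc c Z x) x := by
    intro c' c x hx
    have hq := (xt m c).map_target hx
    rw [divL_smul g (xt_target_open c) (rho_smooth c' c) (hZ c) hx, ← hf c x hx]
    simp only [hr]
    rw [dfun_eq hq, (xt m c).right_inv hx]
    · rfl
    · exact (rho_smooth c' c).contDiffAt ((xt_target_open c).mem_nhds ((xt m c).map_source hq))
  have hYs : ∀ c' c, ContDiffOn ℝ ∞
      (fun x => chartPartition m M c' ((xt m c).symm x) • vloc c Z x) (xt m c).target :=
    fun c' c => (rho_smooth c' c).smul (hZ c)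
  have hrc : ∀ c', Continuous (r c') := by
    intro c'
    refine continuous_of_charts fun c => ContDiffOn.congr ?_ (hloc c' c)
    exact ContDiffOn.sum fun k _ => (pr k).contDiff.comp_contDiffOn
      (cd_smooth (xt_target_open c) (gam_smooth g c) contDiffOn_id (fun z hz => hz) (hYs c' c) _)
  have hrs : ∀ c', tsupport (r c') ⊆ tsupport (chartPartition m M c') := by
    intro c'
    refine closure_minimal (fun p hp => ?_) (isClosed_tsupport _)
    by_contra hn
    refine hp ?_
    have h1 : (chartPartition m M c' : M → ℝ) =ᶠ[nhds p] fun _ => 0 :=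
      Filter.eventually_of_mem ((isClosed_tsupport _).isOpen_compl.mem_nhds hn)
        fun q hq => image_eq_zero_of_notMem_tsupport hq
    simp only [hr]
    rw [image_eq_zero_of_notMem_tsupport hn, zero_mul, add_zero, dfun, h1.mfderiv_eq,
      mfderiv_const]
    rfl
  have hr0 : ∀ c', ∫ p, r c' p ∂(vol g) = 0 := by
    intro c'
    have hsub := (hrs c').trans (rho_subordinate c')
    rw [integral_vol_chart g (hrc c') hsub]
    have hsupp := rho_subordinate (m := m) c'
    classical
    -- Outside its target the inverse chart has uncontrolled values, so the field is cut off to be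
    -- zero there.
    set Y : Euc m → Euc m := (xt m c').target.indicator
      fun x => chartPartition m M c' ((xt m c').symm x) • vloc c' Z x with hY
    have hYe : ∀ x ∈ (xt m c').target, Y x =
        chartPartition m M c' ((xt m c').symm x) • vloc c' Z x := fun x hx =>
      Set.indicator_of_mem hx _
    rw [← integral_divL_eq_zero g (Y := Y) ((hYs c' c').congr hYe) (chartSupp_compact hsupp)
      (chartSupp_subset hsupp)]
    · refine setIntegral_congr_fun (xt_target_open c').measurableSet fun x hx => ?_
      simp only [hloc c' c' x hx, divL_congr g (xt_target_open c') hYe hx]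
    · intro x hx
      by_cases hxt : x ∈ (xt m c').target
      · rw [hYe x hxt, image_eq_zero_of_notMem_tsupport (notMem_tsupport_of hxt hx), zero_smul]
      · exact Set.indicator_of_notMem hxt _
  -- The differentials of the partition functions add up to the differential of the constant `1`.
  have hsum : ∀ p, ∑ c' ∈ charts m M, r c' p = f p := by
    intro p
    simp only [hr, Finset.sum_add_distrib, ← Finset.sum_mul, sum_rho, one_mul]
    have hx := (xt m p).map_source (mem_xt p)
    have h1 : ∀ c', dfun (chartPartition m M c') p (Z p) =
        fderiv ℝ (fun x => chartPartition m M c' ((xt m p).symm x)) (xt m p p)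
          (tc p p (Z p)) := fun c' =>
      dfun_eq (mem_xt p) ((rho_smooth c' p).contDiffAt ((xt_target_open p).mem_nhds hx)) _
    simp only [h1]
    rw [← sum_apply, ← fderiv_fun_sum fun c' _ =>
      diffAt_of_smooth (xt_target_open p) (rho_smooth c' p) hx]
    simp only [sum_rho, fderiv_fun_const]
    simp
  simp only [← hsum]
  rw [integral_finsetSum _ fun c' _ => integrable_vol g (hrc c')]
  exact Finset.sum_eq_zero fun c' _ => hr0 c'

end Volume

end CBiharmonic

end

/-! ### Global divergences, symmetry of the integrals, and selfadjointness. -/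

noncomputable section

set_option linter.unusedSectionVars false
set_option synthInstance.maxHeartbeats 200000

namespace CBiharmonic

section Divergence

variable {m : ℕ} {M : Type*} [TopologicalSpace M] [ChartedSpace (Euc m) M] [IsManifold (𝓡 m) ∞ M]
  {c : M}

/-- The divergence of a vector field. -/
def divG (g : Metric m M) (Z : ∀ q : M, TangentSpace (𝓡 m) q) (q : M) : ℝ :=
  divL g q (vloc q Z) (xt m q q)

/-- The divergence is the trace of `v ↦ ∇_v Z`, and the coordinate expressions of this endomorphism
in two charts are conjugate. -/
theorem divG_eq (g : Metric m M) {Z : ∀ q : M, TangentSpace (𝓡 m) q}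
    (hZ : ∀ c, ContDiffOn ℝ ∞ (vloc c Z) (xt m c).target) {q : M} (hq : q ∈ (xt m c).source) :
    divG g Z q = divL g c (vloc c Z) (xt m c q) := by
  have hlin : ∀ c x, IsLinearMap ℝ fun v => cd (gam g c) (fun x => x) (vloc c Z) v x := fun c x =>
    cd_dir_linear _ _ _
  refine (trace_conj (hlin c _) (hlin q _) (L := (fderiv ℝ (kap m c q) (xt m q q)).toLinearMap)
    (fderiv_kap_surjective (mem_kapDom hq (mem_xt q))) fun a => ?_).symm
  have h1 := tc_leviCivita g (hZ c) hq (fm q q a)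
  have h2 := tc_leviCivita g (hZ q) (mem_xt q) (fm q q a)
  rw [tc_fm (mem_xt q)] at h2
  rw [tc_kap hq (mem_xt q) (fm q q a), tc_fm (mem_xt q), tc_kap hq (mem_xt q), h2] at h1
  exact h1.symm

/-- The vector field dual to a `1`-form. -/
def sharpG (g : Metric m M) (Θ : ∀ q : M, TangentSpace (𝓡 m) q → ℝ) (q : M) :
    TangentSpace (𝓡 m) q := trace g q fun a b => Θ q a • b

theorem tc_sharpG (g : Metric m M) {Θ : ∀ q : M, TangentSpace (𝓡 m) q → ℝ} {q : M}
    (hq : q ∈ (xt m c).source) {θ : Fin m → Euc m → ℝ}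
    (hΘ : ∀ v, Θ q v = ∑ k, tc c q v k * θ k (xt m c q)) :
    tc c q (sharpG g Θ q) = sharp g c θ (xt m c q) := by
  refine (trace_eq g (tc c q).toLinearMap hq
    (b := fun a b => (∑ k, a k * θ k (xt m c q)) • b) ?_ ?_).trans ?_
  · exact ⟨fun y => ⟨fun a b => by
        simp only [PiLp.add_apply, add_mul, Finset.sum_add_distrib, add_smul],
      fun r a => by
        simp only [PiLp.smul_apply, smul_eq_mul, mul_assoc, ← Finset.mul_sum, mul_smul]⟩,
      fun y => ⟨by simp, fun r a => by rw [smul_comm]⟩⟩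
  · intro a b
    simp [hΘ]
  · simp [sharp]

end Divergence

section Integrals

variable {m n : ℕ}
  {M : Type*} [TopologicalSpace M] [ChartedSpace (Euc m) M] [IsManifold (𝓡 m) ∞ M]
  {N : Type*} [TopologicalSpace N] [ChartedSpace (Euc n) N] [IsManifold (𝓡 n) ∞ N]
  {φ : M → N} {c : M} {d : N} (g : Metric m M) (h : Metric n N)
  {V W : ∀ q : M, TangentSpace (𝓡 n) (φ q)}

/-- Smoothness in the charts of source and target implies smoothness in the charts of the
source. -/
theorem contDiffOn_target_of_dom {X : Type*} [NormedAddCommGroup X] [NormedSpace ℝ X]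
    (hφ : Continuous φ) {f : Euc m → X} (hf : ∀ d, ContDiffOn ℝ ∞ f (dom m n c d φ)) :
    ContDiffOn ℝ ∞ f (xt m c).target := fun x hx =>
  ((hf (φ ((xt m c).symm x))).contDiffAt ((dom_open hφ).mem_nhds
    ⟨hx, mem_xt _⟩)).contDiffWithinAt

theorem continuous_of_dom (hφ : Continuous φ) {f : M → ℝ} {F : M → N → Euc m → ℝ}
    (hF : ∀ c d, ContDiffOn ℝ ∞ (F c d) (dom m n c d φ))
    (hf : ∀ c d, ∀ x ∈ dom m n c d φ, f ((xt m c).symm x) = F c d x) : Continuous f :=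
  continuous_of_charts fun c => contDiffOn_target_of_dom hφ fun d => (hF c d).congr (hf c d)

theorem inner_sloc {x : Euc m} (hxd : x ∈ dom m n c d φ) :
    h.inner (φ ((xt m c).symm x)) (V ((xt m c).symm x)) (W ((xt m c).symm x)) =
      metL h d (mloc m n c d φ x) (sloc m c d φ V x) (sloc m c d φ W x) :=
  inner_eq h hxd.2 _ _

theorem inner_continuous (hφ : ContMDiff (𝓡 m) (𝓡 n) ∞ φ) (hV : IsSmoothSection m φ V)
    (hW : IsSmoothSection m φ W) : Continuous fun p => h.inner (φ p) (V p) (W p) :=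
  continuous_of_dom hφ.continuous (F := fun c d x =>
      metL h d (mloc m n c d φ x) (sloc m c d φ V x) (sloc m c d φ W x))
    (fun _ d => ((((metL_metric h d).smooth.comp (mloc_smooth hφ) fun _ hx => mloc_maps hx).clm_apply
      (sloc_smooth hV)).clm_apply (sloc_smooth hW)))
    fun _ _ _ hx => inner_sloc h hx

theorem hessIntegrand_continuous (hφ : ContMDiff (𝓡 m) (𝓡 n) ∞ φ) (hV : IsSmoothSection m φ V)
    (hW : IsSmoothSection m φ W) : Continuous (hessIntegrand g h φ V W) :=
  continuous_of_dom hφ.continuous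
    (fun c d => (setup g h hφ c d).hessI_smooth (sloc_smooth hV) (sloc_smooth hW))
    fun _ _ _ hx => hessIntegrand_eq g h hφ hV hW hx

/-- A global one-form with local components `θ` on the common domains of charts. -/
structure IsForm (n : ℕ) {N : Type*} [TopologicalSpace N] [ChartedSpace (Euc n) N] (φ : M → N) (Θ : ∀ q : M, TangentSpace (𝓡 m) q → ℝ)
    (θ : M → N → Fin m → Euc m → ℝ) : Prop where
  smooth : ∀ c d j, ContDiffOn ℝ ∞ (θ c d j) (dom m n c d φ)
  eq : ∀ c d, ∀ q ∈ (xt m c).source, φ q ∈ (xt n d).source → ∀ v,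
    Θ q v = ∑ k, tc c q v k * θ c d k (xt m c q)

variable {Θ : ∀ q : M, TangentSpace (𝓡 m) q → ℝ} {θ : M → N → Fin m → Euc m → ℝ}

theorem IsForm.vloc_sharpG (hθ : IsForm n φ Θ θ) {x : Euc m} (hx : x ∈ dom m n c d φ) :
    vloc c (sharpG g Θ) x = sharp g c (θ c d) x := by
  obtain ⟨hq, hd, hqx⟩ := chart_point hx
  have := tc_sharpG g hq (hθ.eq c d _ hq hd)
  rwa [hqx] at this

theorem IsForm.sharpG_smooth (hθ : IsForm n φ Θ θ) (hφ : Continuous φ) (c : M) :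
    ContDiffOn ℝ ∞ (vloc c (sharpG g Θ)) (xt m c).target :=
  contDiffOn_target_of_dom hφ fun d => (sharp_smooth g dom_subset (hθ.smooth c d)).congr
    fun _ hx => hθ.vloc_sharpG g hx

/-- The divergence of the dual of a one-form. -/
theorem IsForm.divG_sharpG (hθ : IsForm n φ Θ θ) (hφ : Continuous φ) {x : Euc m}
    (hx : x ∈ dom m n c d φ) :
    divG g (sharpG g Θ) ((xt m c).symm x) = (chartLoc g c).div (θ c d) x := by
  obtain ⟨hq, hd, hqx⟩ := chart_point hx
  rw [divG_eq g (hθ.sharpG_smooth g hφ) hq, hqx,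
    divL_congr g (dom_open hφ) (fun y hy => hθ.vloc_sharpG g hy) hx,
    divL_sharp g (dom_open hφ) dom_subset (hθ.smooth c d) hx]
  simp only [nabla_ev]
  rfl

/-! ### The second variation integrand -/

theorem isForm_cov (hφ : ContMDiff (𝓡 m) (𝓡 n) ∞ φ) (hV : IsSmoothSection m φ V)
    (hW : IsSmoothSection m φ W) :
    IsForm n φ (fun q v => h.inner (φ q) (covAlong h φ W q v) (V q)) fun c d k x =>
      metL h d (mloc m n c d φ x) ((chartLoc g c).cov (gam h d) (mloc m n c d φ) k
        (sloc m c d φ W) x) (sloc m c d φ V x) where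
  smooth c d j := (setup g h hφ c d).H_smooth
    ((setup g h hφ c d).cov_smooth (sloc_smooth hW) j) (sloc_smooth hV)
  eq c d q hq hd v := by
    rw [inner_eq h hd, tc_covAlong_smooth h hφ hW hq hd, ← mloc_xt hq, ← sloc_xt hq V,
      linear_expand (cd_dir_linear _ _ _) (tc c q v)]
    simp only [map_sum, map_smul, sum_apply, smul_apply, smul_eq_mul]
    rfl

/-- The global form of the one-form `form`. -/
def formG (φ : M → N) (V W : ∀ q : M, TangentSpace (𝓡 n) (φ q)) (q : M)
    (v : TangentSpace (𝓡 m) q) : ℝ :=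
  h.inner (φ q) (covAlong h φ (jacobi g h φ W) q v) (V q)
    + (-1) * h.inner (φ q) (covAlong h φ V q v) (jacobi g h φ W q)
    + 2 * h.inner (φ q) (curv h (φ q) (dmap φ q v) (W q) (tension g h φ q)) (V q)

theorem isForm_formG (hφ : ContMDiff (𝓡 m) (𝓡 n) ∞ φ) (hV : IsSmoothSection m φ V)
    (hW : IsSmoothSection m φ W) :
    IsForm n φ (formG g h φ V W) fun c d => Setup.form (chartLoc g c) (metL h d) (gam h d)
      (mloc m n c d φ) (sloc m c d φ V) (sloc m c d φ W) where
  smooth c d j := (setup g h hφ c d).form_smooth (sloc_smooth hV) (sloc_smooth hW) j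
  eq c d q hq hd v := by
    have hJ := jacobi_smooth g h hφ hW
    have hx := mem_dom hq hd
    have hqx : (xt m c).symm (xt m c q) = q := (xt m c).left_inv hq
    have hst := setup g h hφ c d
    have e1 := (isForm_cov g h hφ hV hJ).eq c d q hq hd v
    have e2 := (isForm_cov g h hφ hJ hV).eq c d q hq hd v
    have e3 : h.inner (φ q) (curv h (φ q) (dmap φ q v) (W q) (tension g h φ q)) (V q) =
        ∑ k, tc c q v k * metL h d (mloc m n c d φ (xt m c q))
          (RC (gam h d) (mloc m n c d φ (xt m c q))
            ((chartLoc g c).par (mloc m n c d φ) k (xt m c q))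
            (sloc m c d φ W (xt m c q)) ((chartLoc g c).ten (gam h d) (mloc m n c d φ) (xt m c q)))
          (sloc m c d φ V (xt m c q)) := by
      rw [← sloc_tension g h hφ hx, inner_eq h hd, tc_curv h hd, tc_dmap hφ hq hd, ← mloc_xt hq,
        ← sloc_xt hq V, ← sloc_xt hq W, ← sloc_xt hq (tension g h φ),
        linear_expand (L := fun y => fderiv ℝ (mloc m n c d φ) (xt m c q) y)
        ⟨by simp, by simp⟩ (tc c q v)]
      simp only [map_sum, map_smul, sum_apply, smul_apply, smul_eq_mul]
      rfl
    rw [formG, e1, e2, e3]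
    simp only [Finset.mul_sum, ← Finset.sum_add_distrib]
    refine Finset.sum_congr rfl fun k _ => ?_
    rw [Setup.form, Loc.cov_congr hst.hU (fun y hy => sloc_jacobi g h hφ hW hy) hx,
      sloc_jacobi g h hφ hW hx]
    ring

/-- The second variation integrand before integration by parts. -/
def secG (φ : M → N) (V W : ∀ q : M, TangentSpace (𝓡 n) (φ q)) (q : M) : ℝ :=
  hessIntegrand g h φ V W q + divG g (sharpG g (formG g h φ V W)) q

/-- As `hessIntegrand` plus a divergence, `secG` has the right integral at once. By `sec_sub_hessI`
it is locally `Loc.sec`, which is visibly the second variation and is symmetric. -/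
theorem secG_eq (hφ : ContMDiff (𝓡 m) (𝓡 n) ∞ φ) (hV : IsSmoothSection m φ V)
    (hW : IsSmoothSection m φ W) {x : Euc m} (hx : x ∈ dom m n c d φ) :
    secG g h φ V W ((xt m c).symm x) = (chartLoc g c).sec (metL h d) (gam h d)
      (mloc m n c d φ) (sloc m c d φ V) (sloc m c d φ W) x := by
  rw [secG, hessIntegrand_eq g h hφ hV hW hx,
    (isForm_formG g h hφ hV hW).divG_sharpG g hφ.continuous hx,
    ← (setup g h hφ c d).sec_sub_hessI (sloc_smooth hV) (sloc_smooth hW) hx]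
  ring

theorem secG_symm (hφ : ContMDiff (𝓡 m) (𝓡 n) ∞ φ) (hV : IsSmoothSection m φ V)
    (hW : IsSmoothSection m φ W) : secG g h φ V W = secG g h φ W V := by
  ext p
  have hx : xt m p p ∈ dom m n p (φ p) φ := mem_dom (mem_xt p) (mem_xt _)
  have h1 := secG_eq g h hφ hV hW hx
  have h2 := secG_eq g h hφ hW hV hx
  rw [(xt m p).left_inv (mem_xt p)] at h1 h2
  rw [h1, h2, (setup g h hφ p (φ p)).sec_symm hx]

theorem divG_continuous (hθ : IsForm n φ Θ θ) (hφ : Continuous φ) :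
    Continuous (divG g (sharpG g Θ)) :=
  continuous_of_charts fun c =>
    (ContDiffOn.sum fun k _ => (pr k).contDiff.comp_contDiffOn
      (cd_smooth (xt_target_open c) (gam_smooth g c) contDiffOn_id (fun z hz => hz)
        (hθ.sharpG_smooth g hφ c) _)).congr fun x hx => by
    rw [divG_eq g (hθ.sharpG_smooth g hφ) ((xt m c).map_target hx), (xt m c).right_inv hx]
    rfl

theorem secG_continuous (hφ : ContMDiff (𝓡 m) (𝓡 n) ∞ φ) (hV : IsSmoothSection m φ V)
    (hW : IsSmoothSection m φ W) : Continuous (secG g h φ V W) :=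
  (hessIntegrand_continuous g h hφ hV hW).add
    (divG_continuous g (isForm_formG g h hφ hV hW) hφ.continuous)

variable [T2Space M] [CompactSpace M] [MeasurableSpace M] [BorelSpace M]

theorem integral_divG (hθ : IsForm n φ Θ θ) (hφ : Continuous φ) :
    ∫ p, divG g (sharpG g Θ) p ∂(vol g) = 0 :=
  integral_div_eq_zero g (hθ.sharpG_smooth g hφ) fun c x hx => by
    rw [divG_eq g (hθ.sharpG_smooth g hφ) ((xt m c).map_target hx), (xt m c).right_inv hx]

theorem integral_secG (hφ : ContMDiff (𝓡 m) (𝓡 n) ∞ φ) (hV : IsSmoothSection m φ V)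
    (hW : IsSmoothSection m φ W) :
    ∫ p, secG g h φ V W p ∂(vol g) = ∫ p, hessIntegrand g h φ V W p ∂(vol g) := by
  simp only [secG]
  rw [integral_add (integrable_vol g (hessIntegrand_continuous g h hφ hV hW))
    (integrable_vol g (divG_continuous g (isForm_formG g h hφ hV hW) hφ.continuous)),
    integral_divG g (isForm_formG g h hφ hV hW) hφ.continuous, add_zero]

theorem integral_hessIntegrand_symm (hφ : ContMDiff (𝓡 m) (𝓡 n) ∞ φ) (hV : IsSmoothSection m φ V)
    (hW : IsSmoothSection m φ W) :
    ∫ p, hessIntegrand g h φ V W p ∂(vol g) = ∫ p, hessIntegrand g h φ W V p ∂(vol g) := by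
  rw [← integral_secG g h hφ hV hW, ← integral_secG g h hφ hW hV, secG_symm g h hφ hV hW]

/-- The integrands of the two expressions for the second variation differ by a divergence. -/
theorem integral_jacobi2c (hφ : ContMDiff (𝓡 m) (𝓡 n) ∞ φ) (hV : IsSmoothSection m φ V)
    (hW : IsSmoothSection m φ W) :
    ∫ p, h.inner (φ p) (jacobi2c g h φ W p) (V p) ∂(vol g) =
      ∫ p, hessIntegrand g h φ V W p ∂(vol g) := by
  have hJc := inner_continuous h hφ (jacobi2c_smooth g h hφ hW) hV
  have hHc := hessIntegrand_continuous g h hφ hV hW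
  have hform := isForm_cov g h hφ hV hW
  set Θ : ∀ q : M, TangentSpace (𝓡 m) q → ℝ := fun q v =>
    h.inner (φ q) (covAlong h φ W q v) (V q) with hΘ
  -- The field which integrates the two gradient terms by parts: `(2/3) Scal - 2 Ric` applied to the
  -- dual of `⟨∇W, V⟩`.
  set Z : ∀ q : M, TangentSpace (𝓡 m) q := fun q =>
    ((2 / 3 : ℝ) * scal g q) • sharpG g Θ q - (2 : ℝ) • ricci g q (sharpG g Θ q) with hZdef
  have hvZ : ∀ c, ∀ x ∈ (xt m c).target, vloc c Z x =
      ((2 / 3 : ℝ) * scalL g c x) • vloc c (sharpG g Θ) x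
        - (2 : ℝ) • ricE g c x (vloc c (sharpG g Θ) x) := by
    intro c x hx
    have hq := (xt m c).map_target hx
    have hqx := (xt m c).right_inv hx
    change tc c ((xt m c).symm x) (Z ((xt m c).symm x)) = _
    rw [hZdef]
    simp only [map_sub, map_smul]
    rw [tc_ricci g hq, scal_eq g hq, hqx]
    rfl
  have hYs := hform.sharpG_smooth g hφ.continuous
  have hEs : ∀ c, ContDiffOn ℝ ∞ (fun x => ricE g c x (vloc c (sharpG g Θ) x)) (xt m c).target := by
    intro c
    have h1 : ∀ x, ricE g c x (vloc c (sharpG g Θ) x) =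
        ∑ k, vloc c (sharpG g Θ) x k • ricE g c x (ev k) := fun x =>
      linear_expand (ricE_linear g x) _
    simp only [h1]
    exact ContDiffOn.sum fun k _ => ((pr k).contDiff.comp_contDiffOn (hYs c)).smul
      (ricE_smooth g c (ev k))
  have hS1 : ∀ c, ContDiffOn ℝ ∞ (fun x => (2 / 3 : ℝ) * scalL g c x) (xt m c).target := fun c =>
    contDiffOn_const.mul (scalL_smooth g c)
  have hZs : ∀ c, ContDiffOn ℝ ∞ (vloc c Z) (xt m c).target := fun c =>
    (((hS1 c).smul (hYs c)).sub ((hEs c).const_smul (2 : ℝ))).congr (hvZ c)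
  have key : ∀ c, ∀ x ∈ (xt m c).target,
      (fun p => hessIntegrand g h φ V W p - h.inner (φ p) (jacobi2c g h φ W p) (V p))
        ((xt m c).symm x) = divL g c (vloc c Z) x := by
    intro c x hx
    set d := φ ((xt m c).symm x) with hd
    have hxd : x ∈ dom m n c d φ := ⟨hx, mem_xt _⟩
    have hst := setup g h hφ c d
    have ho := xt_target_open (n := m) c
    set θ : Fin m → Euc m → ℝ := fun k x => metL h d (mloc m n c d φ x)
      ((chartLoc g c).cov (gam h d) (mloc m n c d φ) k (sloc m c d φ W) x)
      (sloc m c d φ V x) with hθ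
    have hθs : ∀ j, ContDiffOn ℝ ∞ (θ j) (dom m n c d φ) := fun j => hform.smooth c d j
    have hYe : ∀ y ∈ dom m n c d φ, vloc c (sharpG g Θ) y = sharp g c θ y := fun y hy =>
      hform.vloc_sharpG g hy
    have d1 : divL g c (vloc c Z) x =
        divL g c (fun x => ((2 / 3 : ℝ) * scalL g c x) • vloc c (sharpG g Θ) x) x
          - 2 * divL g c (fun x => ricE g c x (vloc c (sharpG g Θ) x)) x := by
      rw [divL_congr g ho (hvZ c) hx]
      rw [divL, divL, divL, Finset.mul_sum, ← Finset.sum_sub_distrib]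
      refine Finset.sum_congr rfl fun k _ => ?_
      rw [cd_sub (Γ := gam g c) (u := fun x => x)
        (w := fun x => ((2 / 3 : ℝ) * scalL g c x) • vloc c (sharpG g Θ) x)
        (w' := fun x => (2 : ℝ) • ricE g c x (vloc c (sharpG g Θ) x)) ho
        ((hS1 c).smul (hYs c)) ((hEs c).const_smul (2 : ℝ)) hx (ev k),
        cd_const_smul (Γ := gam g c) (u := fun x => x)
        (w := fun x => ricE g c x (vloc c (sharpG g Θ) x)) ho (2 : ℝ) (hEs c) hx (ev k),
        PiLp.sub_apply, PiLp.smul_apply, smul_eq_mul]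
    have d2 : divL g c (vloc c (sharpG g Θ)) x = (chartLoc g c).div θ x := by
      rw [divL_congr g hst.hU hYe hxd, divL_sharp g hst.hU dom_subset hθs hxd]
      simp only [nabla_ev]
      rfl
    -- The contracted Bianchi identity enters here. With `d9` the total coefficient of the gradient
    -- of `Scal` is `2/3 - 2 · (1/2) = -1/3`, which matches the last term of `J₂ᶜ`.
    have d3 : divL g c (fun x => ricE g c x (vloc c (sharpG g Θ) x)) x =
        (tr2 (ricP g c) x fun i j => fderiv ℝ (θ j) x (ev i)
          - ∑ k, chr g c k i j x * θ k x)
        + (1 / 2) * fderiv ℝ (scalL g c) x (sharp g c θ x) := by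
      rw [divL_congr g hst.hU (fun y hy => by rw [hYe y hy]) hxd,
        divL_ricE_sharp g hst.hU dom_subset hθs hxd]
      simp only [nabla_ev]
      rfl
    have d4 : fderiv ℝ (scalL g c) x (sharp g c θ x) = metL h d (mloc m n c d φ x)
        (tr2 (gInv g c) x (fun i j => fderiv ℝ (scalL g c) x (ev i) •
          (chartLoc g c).cov (gam h d) (mloc m n c d φ) j (sloc m c d φ W) x))
        (sloc m c d φ V x) := by
      rw [Setup.H_tr2, sharp]
      simp only [map_sum, map_smul, smul_apply, smul_eq_mul, tr2]
      rw [Finset.sum_comm]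
      refine Finset.sum_congr rfl fun i _ => Finset.sum_congr rfl fun j _ => ?_
      rw [gInv_symm g hx]; ring
    have d5 := hst.div_cov (sloc_smooth hV) (sloc_smooth hW) hxd (gInv g c)
      (fun i j => gInv_symm g hx i j)
    have d6 := hst.div_cov (sloc_smooth hV) (sloc_smooth hW) hxd (ricP g c)
      (fun i j => ricP_symm g hx i j)
    have d7 : (chartLoc g c).div θ x = _ := d5
    have d8 : (tr2 (ricP g c) x fun i j => fderiv ℝ (θ j) x (ev i)
          - ∑ k, chr g c k i j x * θ k x) = _ := d6
    have d9 : fderiv ℝ (fun x => (2 / 3 : ℝ) * scalL g c x) x (sharp g c θ x) =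
        (2 / 3) * fderiv ℝ (scalL g c) x (sharp g c θ x) := by
      rw [fderiv_const_mul (diffAt_of_smooth ho (scalL_smooth g c) hx)]
      rfl
    rw [d1, divL_smul g ho (hS1 c) (hYs c) hx, d2, d3, hYe x hxd, d9, d4, d7, d8]
    simp only
    rw [hessIntegrand_eq g h hφ hV hW hxd]
    have e1 : h.inner (φ ((xt m c).symm x)) (jacobi2c g h φ W ((xt m c).symm x))
        (V ((xt m c).symm x)) = metL h d (mloc m n c d φ x)
        ((chartLoc g c).jac2c (gam h d) (mloc m n c d φ) (sloc m c d φ W) x)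
        (sloc m c d φ V x) := by
      rw [← sloc_jacobi2c g h hφ hW hxd]
      exact inner_eq h hxd.2 _ _
    rw [e1, Loc.hessI, Loc.jac2c, Loc.jac, Loc.lap]
    simp only [map_add, map_sub, map_neg, map_smul, add_apply, sub_apply, neg_apply, smul_apply,
      smul_eq_mul]
    change _ = 2 / 3 * _ + 2 / 3 * (chartLoc g c).S x * _ - 2 * (_ + 1 / 2 * _)
    simp only [chartLoc]
    ring
  have h0 := integral_div_eq_zero g (f := fun p =>
    hessIntegrand g h φ V W p - h.inner (φ p) (jacobi2c g h φ W p) (V p)) hZs key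
  rw [integral_sub (integrable_vol g hHc) (integrable_vol g hJc)] at h0
  linarith

theorem integral_jacobi2c_symm (hφ : ContMDiff (𝓡 m) (𝓡 n) ∞ φ) (hV : IsSmoothSection m φ V)
    (hW : IsSmoothSection m φ W) :
    ∫ p, h.inner (φ p) (jacobi2c g h φ W p) (V p) ∂(vol g) =
      ∫ p, h.inner (φ p) (W p) (jacobi2c g h φ V p) ∂(vol g) := by
  rw [integral_jacobi2c g h hφ hV hW, integral_hessIntegrand_symm g h hφ hV hW,
    ← integral_jacobi2c g h hφ hW hV]
  simp only [h.symm]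

end Integrals

end CBiharmonic

end

/-! ### Algebra of smooth sections and Leibniz rules for first and second derivatives. -/

noncomputable section

set_option linter.unusedSectionVars false
set_option synthInstance.maxHeartbeats 200000

namespace CBiharmonic

/-! ### Calculus of sections -/

section Sections

variable {m n : ℕ}
  {M : Type*} [TopologicalSpace M] [ChartedSpace (Euc m) M] [IsManifold (𝓡 m) ∞ M]
  {N : Type*} [TopologicalSpace N] [ChartedSpace (Euc n) N] [IsManifold (𝓡 n) ∞ N]
  {φ : M → N} {c : M} {d : N} (g : Metric m M) (h : Metric n N)
  {V W : ∀ q : M, TangentSpace (𝓡 n) (φ q)} {f : M → ℝ}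

theorem chart_smooth (hf : ContMDiff (𝓡 m) 𝓘(ℝ, ℝ) ∞ f) (c : M) :
    ContDiffOn ℝ ∞ (fun x => f ((xt m c).symm x)) (xt m c).target := by
  rw [← contMDiffOn_iff_contDiffOn]
  exact hf.comp_contMDiffOn (contMDiffOn_extChartAt_symm c)

theorem chart_smooth_at (hf : ContMDiff (𝓡 m) 𝓘(ℝ, ℝ) ∞ f) {q : M} (hq : q ∈ (xt m c).source) :
    ContDiffAt ℝ ∞ (fun x => f ((xt m c).symm x)) (xt m c q) :=
  (chart_smooth hf c).contDiffAt ((xt_target_open c).mem_nhds ((xt m c).map_source hq))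

theorem sloc_add (V W : ∀ q : M, TangentSpace (𝓡 n) (φ q)) (x : Euc m) :
    sloc m c d φ (fun p => V p + W p) x = sloc m c d φ V x + sloc m c d φ W x :=
  map_add (tc d _) _ _

theorem sloc_smul (f : M → ℝ) (W : ∀ q : M, TangentSpace (𝓡 n) (φ q)) (x : Euc m) :
    sloc m c d φ (fun p => f p • W p) x = f ((xt m c).symm x) • sloc m c d φ W x :=
  map_smul (tc d _) _ _

theorem section_add (hφ : ContMDiff (𝓡 m) (𝓡 n) ∞ φ) (hV : IsSmoothSection m φ V)
    (hW : IsSmoothSection m φ W) : IsSmoothSection m φ fun p => V p + W p :=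
  isSmoothSection_congr hφ (fun _ _ => (sloc_smooth hV).add (sloc_smooth hW))
    fun _ _ _ _ => sloc_add V W _

theorem section_smul (hφ : ContMDiff (𝓡 m) (𝓡 n) ∞ φ) (hf : ContMDiff (𝓡 m) 𝓘(ℝ, ℝ) ∞ f)
    (hW : IsSmoothSection m φ W) : IsSmoothSection m φ fun p => f p • W p :=
  isSmoothSection_congr hφ
    (fun c _ => ((chart_smooth hf c).mono dom_subset).smul (sloc_smooth hW))
    fun _ _ _ _ => sloc_smul f W _

theorem section_const_smul (hφ : ContMDiff (𝓡 m) (𝓡 n) ∞ φ) (r : ℝ)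
    (hW : IsSmoothSection m φ W) : IsSmoothSection m φ fun p => r • W p :=
  section_smul hφ (f := fun _ => r) contMDiff_const hW

theorem section_sub (hφ : ContMDiff (𝓡 m) (𝓡 n) ∞ φ) (hV : IsSmoothSection m φ V)
    (hW : IsSmoothSection m φ W) : IsSmoothSection m φ fun p => V p - W p := by
  simpa only [neg_one_smul, ← sub_eq_add_neg] using
    section_add hφ hV (section_const_smul hφ (-1) hW)

theorem section_zero (hφ : ContMDiff (𝓡 m) (𝓡 n) ∞ φ) :
    IsSmoothSection m φ fun p => (0 : TangentSpace (𝓡 n) (φ p)) :=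
  isSmoothSection_congr hφ (f := fun _ _ _ => 0) (fun _ _ => contDiffOn_const)
    fun _ _ _ _ => map_zero (tc _ _)

theorem section_sum (hφ : ContMDiff (𝓡 m) (𝓡 n) ∞ φ) {ι : Type*} (s : Finset ι)
    {W : ι → ∀ q : M, TangentSpace (𝓡 n) (φ q)} (hW : ∀ i, IsSmoothSection m φ (W i)) :
    IsSmoothSection m φ fun p => ∑ i ∈ s, W i p :=
  isSmoothSection_congr hφ (fun _ _ => ContDiffOn.sum fun i _ => sloc_smooth (hW i))
    fun _ _ _ _ => map_sum (tc _ _) _ _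

theorem covAlong_add (hφ : ContMDiff (𝓡 m) (𝓡 n) ∞ φ) (hV : IsSmoothSection m φ V)
    (hW : IsSmoothSection m φ W) (q : M) (v : TangentSpace (𝓡 m) q) :
    covAlong h φ (fun p => V p + W p) q v = covAlong h φ V q v + covAlong h φ W q v := by
  have hq := mem_xt (n := m) q
  have hd := mem_xt (n := n) (φ q)
  refine tc_inj hd ?_
  rw [map_add, tc_covAlong_smooth h hφ (section_add hφ hV hW) hq hd,
    tc_covAlong_smooth h hφ hV hq hd, tc_covAlong_smooth h hφ hW hq hd]
  exact cd_add (dom_open hφ.continuous) (sloc_smooth hV) (sloc_smooth hW) (mem_dom hq hd) _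
    |>.symm.trans (cd_congr (dom_open hφ.continuous) (fun y _ => (sloc_add V W y).symm)
      (mem_dom hq hd) _) |>.symm

theorem covAlong_smul (hφ : ContMDiff (𝓡 m) (𝓡 n) ∞ φ) (hf : ContMDiff (𝓡 m) 𝓘(ℝ, ℝ) ∞ f)
    (hW : IsSmoothSection m φ W) (q : M) (v : TangentSpace (𝓡 m) q) :
    covAlong h φ (fun p => f p • W p) q v = dfun f q v • W q + f q • covAlong h φ W q v := by
  have hq := mem_xt (n := m) q
  have hd := mem_xt (n := n) (φ q)
  refine tc_inj hd ?_
  rw [map_add, map_smul, map_smul, tc_covAlong_smooth h hφ (section_smul hφ hf hW) hq hd,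
    tc_covAlong_smooth h hφ hW hq hd, dfun_eq hq (chart_smooth_at hf hq), ← sloc_xt hq W,
    cd_congr (dom_open hφ.continuous) (fun y _ => sloc_smul f W y) (mem_dom hq hd),
    cd_smul (dom_open hφ.continuous) ((chart_smooth hf q).mono dom_subset) (sloc_smooth hW)
      (mem_dom hq hd), (xt m q).left_inv hq]

/-- The Hessian of a function. -/
def hessF (g : Metric m M) (f : M → ℝ) (q : M) (u v : TangentSpace (𝓡 m) q) : ℝ :=
  ∑ k, tc q q v k * fderiv ℝ (fun x => fderiv ℝ (fun x => f ((xt m q).symm x)) x (ev k))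
    (xt m q q) (tc q q u)
  - ∑ k, gam g q (xt m q q) (tc q q u) (tc q q v) k *
    fderiv ℝ (fun x => f ((xt m q).symm x)) (xt m q q) (ev k)

theorem cov2Along_add (hφ : ContMDiff (𝓡 m) (𝓡 n) ∞ φ) (hV : IsSmoothSection m φ V)
    (hW : IsSmoothSection m φ W) (q : M) (u v : TangentSpace (𝓡 m) q) :
    cov2Along g h φ (fun p => V p + W p) q u v =
      cov2Along g h φ V q u v + cov2Along g h φ W q u v := by
  have hq := mem_xt (n := m) q
  have hd := mem_xt (n := n) (φ q)
  have hx := mem_dom (n := n) hq hd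
  have ho := dom_open (m := m) (n := n) (c := q) (d := φ q) hφ.continuous
  have hst := setup g h hφ q (φ q)
  have h1 : ∀ k, ∀ y ∈ dom m n q (φ q) φ,
      cd (gam h (φ q)) (mloc m n q (φ q) φ) (sloc m q (φ q) φ fun p => V p + W p) (ev k) y =
      cd (gam h (φ q)) (mloc m n q (φ q) φ) (sloc m q (φ q) φ V) (ev k) y
      + cd (gam h (φ q)) (mloc m n q (φ q) φ) (sloc m q (φ q) φ W) (ev k) y := fun k y hy => by
    rw [cd_congr ho (fun y _ => sloc_add V W y) hy,
      cd_add ho (sloc_smooth hV) (sloc_smooth hW) hy]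
  refine tc_inj hd ?_
  rw [map_add, tc_cov2Along g h hφ (section_add hφ hV hW) hq hd, tc_cov2Along g h hφ hV hq hd,
    tc_cov2Along g h hφ hW hq hd]
  simp only [h1 _ _ hx, fun k => cd_congr (Γ := gam h (φ q)) (u := mloc m n q (φ q) φ) ho (h1 k) hx,
    fun k => cd_add (Γ := gam h (φ q)) (u := mloc m n q (φ q) φ) ho
      (hst.cd_smooth (sloc_smooth hV) (ev k)) (hst.cd_smooth (sloc_smooth hW) (ev k)) hx,
    smul_add, Finset.sum_add_distrib]
  abel

/-- The second order Leibniz rule. It exhibits the commutator of `∇²` with a function as a first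
order operator, and so determines the order and the symbol of the Laplacian. -/
theorem cov2Along_smul (hφ : ContMDiff (𝓡 m) (𝓡 n) ∞ φ) (hf : ContMDiff (𝓡 m) 𝓘(ℝ, ℝ) ∞ f)
    (hW : IsSmoothSection m φ W) (q : M) (u v : TangentSpace (𝓡 m) q) :
    cov2Along g h φ (fun p => f p • W p) q u v =
      f q • cov2Along g h φ W q u v + dfun f q u • covAlong h φ W q v
        + dfun f q v • covAlong h φ W q u + hessF g f q u v • W q := by
  have hq := mem_xt (n := m) q
  have hd := mem_xt (n := n) (φ q)
  have hx := mem_dom (n := n) hq hd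
  have ho := dom_open (m := m) (n := n) (c := q) (d := φ q) hφ.continuous
  have hst := setup g h hφ q (φ q)
  set F : Euc m → ℝ := fun x => f ((xt m q).symm x) with hF
  have hFs : ContDiffOn ℝ ∞ F (dom m n q (φ q) φ) := (chart_smooth hf q).mono dom_subset
  have hFx : F (xt m q q) = f q := by rw [hF]; simp only [(xt m q).left_inv hq]
  set w := sloc m q (φ q) φ W with hw
  have hws : ContDiffOn ℝ ∞ w (dom m n q (φ q) φ) := sloc_smooth hW
  have hdF : ∀ k, ContDiffOn ℝ ∞ (fun y => fderiv ℝ F y (ev k)) (dom m n q (φ q) φ) :=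
    fun k => smooth_fderiv_apply ho hFs _
  have h1 : ∀ k, ∀ y ∈ dom m n q (φ q) φ,
      cd (gam h (φ q)) (mloc m n q (φ q) φ) (sloc m q (φ q) φ fun p => f p • W p) (ev k) y =
      fderiv ℝ F y (ev k) • w y
      + F y • cd (gam h (φ q)) (mloc m n q (φ q) φ) w (ev k) y := fun k y hy => by
    rw [cd_congr ho (fun y _ => sloc_smul f W y) hy, cd_smul ho hFs hws hy]
  have h2 : ∀ k, cd (gam h (φ q)) (mloc m n q (φ q) φ)
        (cd (gam h (φ q)) (mloc m n q (φ q) φ) (sloc m q (φ q) φ fun p => f p • W p) (ev k))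
        (tc q q u) (xt m q q) =
      (fderiv ℝ (fun y => fderiv ℝ F y (ev k)) (xt m q q) (tc q q u) • w (xt m q q)
        + fderiv ℝ F (xt m q q) (ev k) •
          cd (gam h (φ q)) (mloc m n q (φ q) φ) w (tc q q u) (xt m q q))
      + (fderiv ℝ F (xt m q q) (tc q q u) •
          cd (gam h (φ q)) (mloc m n q (φ q) φ) w (ev k) (xt m q q)
        + F (xt m q q) • cd (gam h (φ q)) (mloc m n q (φ q) φ)
          (cd (gam h (φ q)) (mloc m n q (φ q) φ) w (ev k)) (tc q q u) (xt m q q)) := fun k => by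
    rw [cd_congr ho (h1 k) hx, cd_add (w := fun y => fderiv ℝ F y (ev k) • w y)
      (w' := fun y => F y • cd (gam h (φ q)) (mloc m n q (φ q) φ) w (ev k) y) ho
      ((hdF k).smul hws) (hFs.smul (hst.cd_smooth hws _)) hx,
      cd_smul ho (hdF k) hws hx, cd_smul ho hFs (hst.cd_smooth hws _) hx]
  have h3 : cd (gam h (φ q)) (mloc m n q (φ q) φ) w (tc q q v) (xt m q q) = _ :=
    linear_expand (cd_dir_linear (Γ := gam h (φ q)) (mloc m n q (φ q) φ) w (xt m q q)) (tc q q v)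
  have h4 : fderiv ℝ F (xt m q q) (tc q q v) = _ :=
    linear_expand (L := fun y => fderiv ℝ F (xt m q q) y) ⟨by simp, by simp⟩ (tc q q v)
  refine tc_inj hd ?_
  rw [tc_cov2Along g h hφ (section_smul hφ hf hW) hq hd]
  simp only [map_add, map_smul]
  rw [tc_cov2Along g h hφ hW hq hd, tc_covAlong_smooth h hφ hW hq hd,
    tc_covAlong_smooth h hφ hW hq hd, dfun_eq hq (chart_smooth_at hf hq),
    dfun_eq hq (chart_smooth_at hf hq), ← sloc_xt hq W, hessF]
  simp only [h1 _ _ hx, h2, ← hw, ← hF, h3, h4, hFx, smul_add, smul_sub, sub_smul,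
    Finset.sum_add_distrib, Finset.smul_sum, Finset.sum_smul, smul_smul, smul_eq_mul]
  simp only [mul_comm (f q), mul_comm (fderiv ℝ F (xt m q q) (tc q q u))]
  abel

end Sections

end CBiharmonic

end

/-! ### Order of an operator by iterated commutators. -/

noncomputable section

set_option linter.unusedSectionVars false
set_option synthInstance.maxHeartbeats 200000

namespace CBiharmonic

/-! ### Differential operators -/

section Operators

variable {m n : ℕ}
  {M : Type*} [TopologicalSpace M] [ChartedSpace (Euc m) M] [IsManifold (𝓡 m) ∞ M]
  {N : Type*} [TopologicalSpace N] [ChartedSpace (Euc n) N] [IsManifold (𝓡 n) ∞ N]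
  {φ : M → N}

/-- Operators on sections of `φ⁻¹TN`. -/
abbrev SecOp (n : ℕ) {M : Type*}
    {N : Type*} [TopologicalSpace N] [ChartedSpace (Euc n) N] (φ : M → N) : Type _ :=
  (∀ p : M, TangentSpace (𝓡 n) (φ p)) → ∀ p : M, TangentSpace (𝓡 n) (φ p)

/-- The commutator with the multiplication by a function. -/
def ad (f : M → ℝ) (P : SecOp n φ) : SecOp n φ := fun W p =>
  P (fun q => f q • W q) p - f p • P W p

/-- Additivity and homogeneity on smooth sections. -/
structure IsLin (m : ℕ) {M : Type*} [TopologicalSpace M] [ChartedSpace (Euc m) M]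
    [IsManifold (𝓡 m) ∞ M] {φ : M → N} (P : SecOp n φ) : Prop where
  add : ∀ V W, IsSmoothSection m φ V → IsSmoothSection m φ W →
    ∀ p, P (fun q => V q + W q) p = P V p + P W p
  smul : ∀ (r : ℝ) (W), IsSmoothSection m φ W → ∀ p, P (fun q => r • W q) p = r • P W p

/-- `P` is linear on smooth sections, and its iterated commutators with `k + 1` smooth functions
vanish. Smoothness of the values is not required. -/
def HasOrder (m : ℕ) {M : Type*} [TopologicalSpace M] [ChartedSpace (Euc m) M]
    [IsManifold (𝓡 m) ∞ M] {φ : M → N} : ℕ → SecOp n φ → Prop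
  | 0, P => IsLin m P ∧ ∀ f : M → ℝ, ContMDiff (𝓡 m) 𝓘(ℝ, ℝ) ∞ f → ∀ W, IsSmoothSection m φ W →
        ∀ p, ad f P W p = 0
  | k + 1, P => IsLin m P ∧ ∀ f : M → ℝ, ContMDiff (𝓡 m) 𝓘(ℝ, ℝ) ∞ f → HasOrder m k (ad f P)

variable {P Q : SecOp n φ} {k l : ℕ}

theorem HasOrder.isLin (hP : HasOrder m k P) : IsLin m P := by
  cases k <;> exact hP.1

theorem IsLin.congr (hP : IsLin m P) (hφ : ContMDiff (𝓡 m) (𝓡 n) ∞ φ)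
    (h : ∀ W, IsSmoothSection m φ W → ∀ p, P W p = Q W p) : IsLin m Q where
  add V W hV hW p := by
    rw [← h _ (section_add hφ hV hW), ← h _ hV, ← h _ hW, hP.add _ _ hV hW]
  smul r W hW p := by rw [← h _ (section_const_smul hφ r hW), ← h _ hW, hP.smul _ _ hW]

theorem ad_congr (hφ : ContMDiff (𝓡 m) (𝓡 n) ∞ φ) {f : M → ℝ}
    (hf : ContMDiff (𝓡 m) 𝓘(ℝ, ℝ) ∞ f) (h : ∀ W, IsSmoothSection m φ W → ∀ p, P W p = Q W p)
    {W} (hW : IsSmoothSection m φ W) (p : M) : ad f P W p = ad f Q W p := by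
  rw [ad, ad, h _ (section_smul hφ hf hW), h _ hW]

theorem HasOrder.congr (hφ : ContMDiff (𝓡 m) (𝓡 n) ∞ φ) (hP : HasOrder m k P)
    (h : ∀ W, IsSmoothSection m φ W → ∀ p, P W p = Q W p) : HasOrder m k Q := by
  induction k generalizing P Q with
  | zero => exact ⟨hP.1.congr hφ h, fun f hf W hW p => by
      rw [← ad_congr hφ hf h hW, hP.2 f hf W hW]⟩
  | succ k ih => exact ⟨hP.1.congr hφ h, fun f hf => ih (hP.2 f hf) fun W hW p =>
      ad_congr hφ hf h hW p⟩

theorem IsLin.zero : IsLin m (fun _ _ => 0 : SecOp n φ) := ⟨by simp, by simp⟩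

theorem HasOrder.zero (k : ℕ) : HasOrder m k (fun _ _ => 0 : SecOp n φ) := by
  induction k with
  | zero => exact ⟨IsLin.zero, by simp [ad]⟩
  | succ k ih =>
    refine ⟨IsLin.zero, fun f _ => ?_⟩
    have h : ad f (fun _ _ => 0 : SecOp n φ) = fun _ _ => 0 := by funext W p; simp [ad]
    rwa [h]

theorem HasOrder.succ (hφ : ContMDiff (𝓡 m) (𝓡 n) ∞ φ) (hP : HasOrder m k P) :
    HasOrder m (k + 1) P := by
  induction k generalizing P with
  | zero => exact ⟨hP.1, fun f hf => (HasOrder.zero 0).congr hφ fun W hW p =>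
      (hP.2 f hf W hW p).symm⟩
  | succ k ih => exact ⟨hP.1, fun f hf => ih (hP.2 f hf)⟩

theorem HasOrder.mono (hφ : ContMDiff (𝓡 m) (𝓡 n) ∞ φ) (hP : HasOrder m k P) (hkl : k ≤ l) :
    HasOrder m l P := by
  induction hkl with
  | refl => exact hP
  | step _ ih => exact ih.succ hφ

theorem IsLin.add_op (hP : IsLin m P) (hQ : IsLin m Q) : IsLin m (fun W p => P W p + Q W p) where
  add V W hV hW p := by rw [hP.add _ _ hV hW, hQ.add _ _ hV hW]; abel
  smul r W hW p := by rw [hP.smul _ _ hW, hQ.smul _ _ hW, smul_add]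

theorem HasOrder.add (hφ : ContMDiff (𝓡 m) (𝓡 n) ∞ φ) (hP : HasOrder m k P) (hQ : HasOrder m k Q) :
    HasOrder m k (fun W p => P W p + Q W p) := by
  have h : ∀ (P Q : SecOp n φ) f W p,
      ad f (fun W p => P W p + Q W p) W p = ad f P W p + ad f Q W p := fun P Q f W p => by
    simp only [ad, smul_add]; abel
  induction k generalizing P Q with
  | zero => exact ⟨hP.1.add_op hQ.1, fun f hf W hW p => by
      rw [h, hP.2 f hf W hW, hQ.2 f hf W hW, add_zero]⟩
  | succ k ih => exact ⟨hP.1.add_op hQ.1, fun f hf =>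
      (ih (hP.2 f hf) (hQ.2 f hf)).congr hφ fun W _ p => (h P Q f W p).symm⟩

/-- Composition with an endomorphism of the bundle. -/
theorem HasOrder.fibre (hφ : ContMDiff (𝓡 m) (𝓡 n) ∞ φ) (hP : HasOrder m k P)
    {A : ∀ p, TangentSpace (𝓡 n) (φ p) → TangentSpace (𝓡 n) (φ p)}
    (hA : ∀ p, IsLinearMap ℝ (A p)) : HasOrder m k (fun W p => A p (P W p)) := by
  have hl : ∀ {P : SecOp n φ}, IsLin m P → IsLin m (fun W p => A p (P W p)) := fun hP =>
    ⟨fun V W hV hW p => by rw [hP.add _ _ hV hW, (hA p).map_add],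
      fun r W hW p => by rw [hP.smul _ _ hW, (hA p).map_smul]⟩
  have h : ∀ (P : SecOp n φ) f W p, ad f (fun W p => A p (P W p)) W p = A p (ad f P W p) :=
    fun P f W p => by simp only [ad, (hA p).map_sub, (hA p).map_smul]
  induction k generalizing P with
  | zero => exact ⟨hl hP.1, fun f hf W hW p => by rw [h, hP.2 f hf W hW, (hA p).map_zero]⟩
  | succ k ih => exact ⟨hl hP.1, fun f hf =>
      (ih (hP.2 f hf)).congr hφ fun W _ p => (h P f W p).symm⟩

theorem HasOrder.smul (hφ : ContMDiff (𝓡 m) (𝓡 n) ∞ φ) (hP : HasOrder m k P) (a : M → ℝ) :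
    HasOrder m k (fun W p => a p • P W p) :=
  hP.fibre hφ (A := fun p v => a p • v) fun p => ⟨smul_add _, fun r v => smul_comm _ r v⟩

theorem HasOrder.neg (hφ : ContMDiff (𝓡 m) (𝓡 n) ∞ φ) (hP : HasOrder m k P) :
    HasOrder m k (fun W p => - P W p) :=
  (hP.smul hφ fun _ => -1).congr hφ fun W _ p => neg_one_smul ℝ (P W p)

theorem HasOrder.sub (hφ : ContMDiff (𝓡 m) (𝓡 n) ∞ φ) (hP : HasOrder m k P) (hQ : HasOrder m k Q) :
    HasOrder m k (fun W p => P W p - Q W p) :=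
  (hP.add hφ (hQ.neg hφ)).congr hφ fun W _ p => (sub_eq_add_neg _ _).symm

theorem HasOrder.sum (hφ : ContMDiff (𝓡 m) (𝓡 n) ∞ φ) {ι : Type*} (s : Finset ι)
    {P : ι → SecOp n φ} (hP : ∀ i, HasOrder m k (P i)) :
    HasOrder m k (fun W p => ∑ i ∈ s, P i W p) := by
  classical
  induction s using Finset.induction_on with
  | empty => simpa using HasOrder.zero k
  | insert i s hi ih => simpa only [Finset.sum_insert hi] using (hP i).add hφ ih

/-- The vectors `basisVec p i` jump with the preferred chart, so the single summands need not
preserve smooth sections. This is why `HasOrder` does not ask for smooth values. -/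
theorem HasOrder.trace (hφ : ContMDiff (𝓡 m) (𝓡 n) ∞ φ) (g : Metric m M)
    {P : (∀ p : M, TangentSpace (𝓡 n) (φ p)) → ∀ p : M, TangentSpace (𝓡 m) p →
      TangentSpace (𝓡 m) p → TangentSpace (𝓡 n) (φ p)}
    (hP : ∀ i j, HasOrder m k fun W p => P W p (basisVec p i) (basisVec p j)) :
    HasOrder m k fun W p => trace g p (P W p) :=
  HasOrder.sum hφ Finset.univ (P := fun i W p => ∑ j, gramInv g p i j •
      P W p (basisVec p i) (basisVec p j)) fun i =>
    HasOrder.sum hφ Finset.univ (P := fun j W p => gramInv g p i j •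
      P W p (basisVec p i) (basisVec p j)) fun j => (hP i j).smul hφ _

theorem HasOrder.id : HasOrder m 0 (fun W p => W p : SecOp n φ) :=
  ⟨⟨fun _ _ _ _ _ => rfl, fun _ _ _ _ => rfl⟩, fun f _ W _ p => sub_self (f p • W p)⟩

/-- Endomorphisms of the bundle are operators of order zero. -/
theorem HasOrder.tensor (hφ : ContMDiff (𝓡 m) (𝓡 n) ∞ φ)
    {A : ∀ p, TangentSpace (𝓡 n) (φ p) → TangentSpace (𝓡 n) (φ p)}
    (hA : ∀ p, IsLinearMap ℝ (A p)) : HasOrder m k (fun W p => A p (W p)) :=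
  (HasOrder.id.fibre hφ hA).mono hφ k.zero_le

theorem ad_smooth (hφ : ContMDiff (𝓡 m) (𝓡 n) ∞ φ) {f : M → ℝ}
    (hf : ContMDiff (𝓡 m) 𝓘(ℝ, ℝ) ∞ f) (hP : ∀ W, IsSmoothSection m φ W → IsSmoothSection m φ (P W))
    {W} (hW : IsSmoothSection m φ W) : IsSmoothSection m φ (ad f P W) :=
  section_sub hφ (hP _ (section_smul hφ hf hW)) (section_smul hφ hf (hP _ hW))

/-- `ad f` is a derivation, `ad f (PQ) = (ad f P) Q + P (ad f Q)`, and each summand has smaller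
total order. The inner operator must preserve smooth sections, since `P` is controlled only on
these. -/
theorem HasOrder.comp (hφ : ContMDiff (𝓡 m) (𝓡 n) ∞ φ) (hP : HasOrder m k P) (hQ : HasOrder m l Q)
    (hQs : ∀ W, IsSmoothSection m φ W → IsSmoothSection m φ (Q W)) :
    HasOrder m (k + l) (fun W => P (Q W)) := by
  have hlin : ∀ {P Q : SecOp n φ}, IsLin m P → IsLin m Q →
      (∀ W, IsSmoothSection m φ W → IsSmoothSection m φ (Q W)) → IsLin m (fun W => P (Q W)) := by
    intro P Q hP hQ hQs
    constructor
    · intro V W hV hW p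
      have : Q (fun q => V q + W q) = fun q => Q V q + Q W q := funext (hQ.add _ _ hV hW)
      rw [this, hP.add _ _ (hQs _ hV) (hQs _ hW)]
    · intro r W hW p
      have : Q (fun q => r • W q) = fun q => r • Q W q := funext (hQ.smul _ _ hW)
      rw [this, hP.smul _ _ (hQs _ hW)]
  have had : ∀ {P Q : SecOp n φ}, IsLin m P →
      (∀ W, IsSmoothSection m φ W → IsSmoothSection m φ (Q W)) → ∀ {f : M → ℝ},
      ContMDiff (𝓡 m) 𝓘(ℝ, ℝ) ∞ f → ∀ W, IsSmoothSection m φ W → ∀ p,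
      ad f (fun W => P (Q W)) W p = ad f P (Q W) p + P (ad f Q W) p := by
    intro P Q hP hQs f hf W hW p
    have h1 : Q (fun q => f q • W q) = fun q => f q • Q W q + ad f Q W q := by
      funext q; simp only [ad]; abel
    change P (Q fun q => f q • W q) p - f p • P (Q W) p =
      P (fun q => f q • Q W q) p - f p • P (Q W) p + P (ad f Q W) p
    rw [h1, hP.add _ _ (section_smul hφ hf (hQs _ hW)) (ad_smooth hφ hf hQs hW)]
    abel
  -- Induction on the total order, as either factor may lose one.
  obtain ⟨N, hN⟩ : ∃ N, k + l = N := ⟨_, rfl⟩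
  rw [hN]
  induction N generalizing k l P Q with
  | zero =>
    obtain ⟨rfl, rfl⟩ : k = 0 ∧ l = 0 := by omega
    refine ⟨hlin hP.1 hQ.1 hQs, fun f hf W hW p => ?_⟩
    have h1 : ad f Q W = fun _ => 0 := funext (hQ.2 f hf W hW)
    -- Homogeneity with factor `0` shows that `P` kills the zero section.
    have h2 := hP.1.smul 0 W hW p
    simp only [zero_smul] at h2
    rw [had hP.1 hQs hf W hW, hP.2 f hf _ (hQs W hW), h1, h2, add_zero]
  | succ N ih =>
    refine ⟨hlin hP.isLin hQ.isLin hQs, fun f hf => ?_⟩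
    have h1 : HasOrder m N (fun W => ad f P (Q W)) := by
      cases k with
      | zero => exact (HasOrder.zero N).congr hφ fun W hW p => (hP.2 f hf _ (hQs W hW) p).symm
      | succ k => exact ih (hP.2 f hf) hQ hQs (by omega)
    have h2 : HasOrder m N (fun W => P (ad f Q W)) := by
      cases l with
      | zero =>
        refine (HasOrder.zero N).congr hφ fun W hW p => ?_
        have h1 : ad f Q W = fun _ => 0 := funext (hQ.2 f hf W hW)
        have h2 := hP.isLin.smul 0 W hW p
        simp only [zero_smul] at h2
        rw [h1, h2]
      | succ l => exact ih hP (hQ.2 f hf) (fun W hW => ad_smooth hφ hf hQs hW) (by omega)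
    exact (h1.add hφ h2).congr hφ fun W hW p => (had hP.isLin hQs hf W hW p).symm

/-- Smoothness of the values is needed for the complete operator only, because commutators inherit
it. -/
theorem HasOrder.isDiffOp (hφ : ContMDiff (𝓡 m) (𝓡 n) ∞ φ) (hP : HasOrder m k P)
    (hs : ∀ W, IsSmoothSection m φ W → IsSmoothSection m φ (P W)) : IsDiffOp m φ k P := by
  have hl : ∀ {P : SecOp n φ}, IsLin m P →
      (∀ W, IsSmoothSection m φ W → IsSmoothSection m φ (P W)) → IsLinearOnSections m φ P :=
    fun hP hs => ⟨hs, fun V W hV hW => funext (hP.add V W hV hW),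
      fun r W hW => funext (hP.smul r W hW)⟩
  induction k generalizing P with
  | zero => exact ⟨hl hP.1 hs, fun f hf W hW => funext fun p => sub_eq_zero.mp (hP.2 f hf W hW p)⟩
  | succ k ih => exact ⟨hl hP.1 hs, fun f hf => ih (hP.2 f hf) fun W hW => ad_smooth hφ hf hs hW⟩

theorem IsDiffOp.hasOrder (hP : IsDiffOp m φ k P) : HasOrder m k P := by
  have hl : ∀ {P : SecOp n φ}, IsLinearOnSections m φ P → IsLin m P := fun hP =>
    ⟨fun V W hV hW p => congrFun (hP.add V W hV hW) p, fun r W hW p => congrFun (hP.smul r W hW) p⟩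
  induction k generalizing P with
  | zero => exact ⟨hl hP.1, fun f hf W hW p => sub_eq_zero.mpr (congrFun (hP.2 f hf W hW) p)⟩
  | succ k ih => exact ⟨hl hP.1, fun f hf => ih (hP.2 f hf)⟩

/-- An operator of order `k` does not see sections which vanish to order `k + 1` at a point. -/
theorem HasOrder.pow_eq_zero (hP : HasOrder m k P) {f : M → ℝ}
    (hf : ContMDiff (𝓡 m) 𝓘(ℝ, ℝ) ∞ f) {p : M} (hp : f p = 0) {W} (hW : IsSmoothSection m φ W) :
    P (fun q => f q ^ (k + 1) • W q) p = 0 := by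
  induction k generalizing P with
  | zero =>
    have h := hP.2 f hf W hW p
    rw [ad, hp, zero_smul, sub_zero] at h
    simpa using h
  | succ k ih =>
    -- The induction is applied to `ad f P`. At a zero of `f` its second term drops out, which
    -- leaves `P` with one more power of `f`.
    have h := ih (hP.2 f hf)
    rw [ad, hp, zero_smul, sub_zero] at h
    simpa only [smul_smul, ← pow_succ'] using h

end Operators

end CBiharmonic

end

/-! ### Order, principal symbol and ellipticity of the conformal Jacobi operator. -/

noncomputable section

set_option linter.unusedSectionVars false
set_option synthInstance.maxHeartbeats 200000

namespace CBiharmonic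

section GeometricOperators

variable {m n : ℕ}
  {M : Type*} [TopologicalSpace M] [ChartedSpace (Euc m) M] [IsManifold (𝓡 m) ∞ M]
  {N : Type*} [TopologicalSpace N] [ChartedSpace (Euc n) N] [IsManifold (𝓡 n) ∞ N]
  {φ : M → N} (g : Metric m M) (h : Metric n N)
  {V W : ∀ q : M, TangentSpace (𝓡 n) (φ q)} {f : M → ℝ}

theorem curv_linear₁ (y : N) (v w : TangentSpace (𝓡 n) y) :
    IsLinearMap ℝ fun u => curv h y u v w :=
  ⟨fun a b => tc_inj (mem_xt y) (by simp only [tc_curv h (mem_xt y), map_add, add_apply]),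
    fun r a => tc_inj (mem_xt y) (by simp only [tc_curv h (mem_xt y), map_smul, smul_apply])⟩

theorem curv_linear₂ (y : N) (u w : TangentSpace (𝓡 n) y) :
    IsLinearMap ℝ fun v => curv h y u v w :=
  ⟨fun a b => tc_inj (mem_xt y) (by simp only [tc_curv h (mem_xt y), map_add, add_apply]),
    fun r a => tc_inj (mem_xt y) (by simp only [tc_curv h (mem_xt y), map_smul, smul_apply])⟩

theorem curv_linear₃ (y : N) (u v : TangentSpace (𝓡 n) y) :
    IsLinearMap ℝ fun w => curv h y u v w :=
  ⟨fun a b => tc_inj (mem_xt y) (by simp only [tc_curv h (mem_xt y), map_add]),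
    fun r a => tc_inj (mem_xt y) (by simp only [tc_curv h (mem_xt y), map_smul])⟩

theorem covCurv_linear₃ (y : N) (x u w : TangentSpace (𝓡 n) y) :
    IsLinearMap ℝ fun v => covCurv h y x u v w :=
  ⟨fun a b => tc_inj (mem_xt y) (by simp only [tc_covCurv h (mem_xt y), map_add, NR_add₃]),
    fun r a => tc_inj (mem_xt y) (by simp only [tc_covCurv h (mem_xt y), map_smul, NR_smul₃])⟩

theorem covCurv_linear₄ (y : N) (x u v : TangentSpace (𝓡 n) y) :
    IsLinearMap ℝ fun w => covCurv h y x u v w :=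
  ⟨fun a b => tc_inj (mem_xt y) (by simp only [tc_covCurv h (mem_xt y), map_add, NR_add₄]),
    fun r a => tc_inj (mem_xt y) (by simp only [tc_covCurv h (mem_xt y), map_smul, NR_smul₄])⟩

theorem dfun_const (r : ℝ) (p : M) (v : TangentSpace (𝓡 m) p) : dfun (fun _ : M => r) p v = 0 := by
  rw [dfun, mfderiv_const]
  rfl

theorem hessF_const (r : ℝ) (p : M) (u v : TangentSpace (𝓡 m) p) :
    hessF g (fun _ : M => r) p u v = 0 := by
  simp [hessF]

variable (hφ : ContMDiff (𝓡 m) (𝓡 n) ∞ φ)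
include hφ

/-- By the Leibniz rule the commutator with `f` is multiplication by `df(Z)`. Smoothness of `Z` is
not required. -/
theorem hasOrder_covAlong (Z : ∀ p : M, TangentSpace (𝓡 m) p) :
    HasOrder m 1 (fun W p => covAlong h φ W p (Z p) : SecOp n φ) := by
  refine ⟨⟨fun V W hV hW p => covAlong_add h hφ hV hW p _, fun r W hW p => ?_⟩, fun f hf => ?_⟩
  · rw [covAlong_smul h hφ (f := fun _ => r) contMDiff_const hW, dfun_const, zero_smul, zero_add]
  · refine (HasOrder.id.smul hφ fun p => dfun f p (Z p)).congr hφ fun W hW p => ?_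
    rw [ad, covAlong_smul h hφ hf hW, add_sub_cancel_right]

theorem hasOrder_cov2Along (X Y : ∀ p : M, TangentSpace (𝓡 m) p) :
    HasOrder m 2 (fun W p => cov2Along g h φ W p (X p) (Y p) : SecOp n φ) := by
  refine ⟨⟨fun V W hV hW p => cov2Along_add g h hφ hV hW p _ _, fun r W hW p => ?_⟩,
    fun f hf => ?_⟩
  · rw [cov2Along_smul g h hφ (f := fun _ => r) contMDiff_const hW, dfun_const, dfun_const,
      hessF_const]
    simp only [zero_smul, add_zero]
  · refine ((((hasOrder_covAlong h hφ Y).smul hφ fun p => dfun f p (X p)).add hφ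
      ((hasOrder_covAlong h hφ X).smul hφ fun p => dfun f p (Y p))).add hφ
      (((HasOrder.id.mono hφ (Nat.zero_le 1)).smul hφ
        fun p => hessF g f p (X p) (Y p)))).congr hφ fun W hW p => ?_
    rw [ad, cov2Along_smul g h hφ hf hW]
    abel

theorem hasOrder_roughLaplacian : HasOrder m 2 (roughLaplacian g h φ) :=
  (HasOrder.trace hφ g fun _ _ => hasOrder_cov2Along g h hφ _ _).neg hφ

theorem hasOrder_trCurv (k : ℕ) : HasOrder m k (trCurv g h φ) :=
  HasOrder.trace hφ g (P := fun W p a b => curv h (φ p) (dmap φ p a) (W p) (dmap φ p b))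
    fun i j => HasOrder.tensor hφ
      (A := fun p w => curv h (φ p) (dmap φ p (basisVec p i)) w (dmap φ p (basisVec p j)))
      fun p => curv_linear₂ h _ _ _

theorem trCurv_smooth (hW : IsSmoothSection m φ W) : IsSmoothSection m φ (trCurv g h φ W) :=
  isSmoothSection_congr hφ (fun c d => (setup g h hφ c d).trc_smooth (setup g h hφ c d).hGI
    (sloc_smooth hW)) fun _ _ _ hx => sloc_trCurv g h hφ W hx

theorem hasOrder_jacobi : HasOrder m 2 (jacobi g h φ) :=
  (hasOrder_roughLaplacian g h hφ).add hφ (hasOrder_trCurv g h hφ 2)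

/-- The terms of `J₂` of order at most one. -/
theorem hasOrder_jacobi2_lower : HasOrder m 1 (fun W p =>
    jacobi2 g h φ W p - jacobi g h φ (jacobi g h φ W) p : SecOp n φ) := by
  have h1 : HasOrder m 1 (fun W p => curv h (φ p) (tension g h φ p) (W p) (tension g h φ p) :
      SecOp n φ) := HasOrder.tensor hφ
    (A := fun p w => curv h (φ p) (tension g h φ p) w (tension g h φ p))
    fun p => curv_linear₂ h _ _ _
  have h2 : HasOrder m 1 (fun W p => trace g p (fun a b =>
      covCurv h (φ p) (tension g h φ p) (dmap φ p a) (W p) (dmap φ p b)) : SecOp n φ) :=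
    HasOrder.trace hφ g (P := fun W p a b =>
      covCurv h (φ p) (tension g h φ p) (dmap φ p a) (W p) (dmap φ p b)) fun i j =>
    HasOrder.tensor hφ (A := fun p w =>
      covCurv h (φ p) (tension g h φ p) (dmap φ p (basisVec p i)) w (dmap φ p (basisVec p j)))
      fun p => covCurv_linear₃ h _ _ _ _
  have h3 : HasOrder m 1 (fun W p => trace g p (fun a b =>
        covCurv h (φ p) (dmap φ p a) (tension g h φ p) (dmap φ p b) (W p)
        + (2 : ℝ) • curv h (φ p) (W p) (dmap φ p a) (covAlong h φ (tension g h φ) p b)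
        + (2 : ℝ) • curv h (φ p) (tension g h φ p) (dmap φ p a) (covAlong h φ W p b)) :
      SecOp n φ) := by
    refine HasOrder.trace hφ g (P := fun W p a b =>
        covCurv h (φ p) (dmap φ p a) (tension g h φ p) (dmap φ p b) (W p)
        + (2 : ℝ) • curv h (φ p) (W p) (dmap φ p a) (covAlong h φ (tension g h φ) p b)
        + (2 : ℝ) • curv h (φ p) (tension g h φ p) (dmap φ p a) (covAlong h φ W p b))
        fun i j => HasOrder.add hφ (HasOrder.add hφ ?_ ?_) ?_
    · exact HasOrder.tensor hφ (A := fun p w => covCurv h (φ p) (dmap φ p (basisVec p i))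
        (tension g h φ p) (dmap φ p (basisVec p j)) w) fun p => covCurv_linear₄ h _ _ _ _
    · exact (HasOrder.tensor hφ (A := fun p w => curv h (φ p) w (dmap φ p (basisVec p i))
        (covAlong h φ (tension g h φ) p (basisVec p j))) fun p => curv_linear₁ h _ _ _).smul hφ
          fun _ => 2
    · exact ((hasOrder_covAlong h hφ fun p => basisVec p j).fibre hφ (A := fun p w =>
        curv h (φ p) (tension g h φ p) (dmap φ p (basisVec p i)) w)
        fun p => curv_linear₃ h _ _ _).smul hφ fun _ => 2
  refine ((h3.sub hφ h1).sub hφ h2).congr hφ fun W _ p => ?_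
  rw [jacobi2]
  abel

/-- Writing `J = Δ + R`, with `R` of order zero, gives `J² - Δ² = ΔR + RJ`, of order two; every
other term has order at most two as well. -/
theorem hasOrder_jacobi2c_sub : HasOrder m 2 (fun W p =>
    jacobi2c g h φ W p - roughLaplacian g h φ (roughLaplacian g h φ W) p : SecOp n φ) := by
  have h1 : HasOrder m (0 + 2) (fun W p => trCurv g h φ (jacobi g h φ W) p : SecOp n φ) :=
    (hasOrder_trCurv g h hφ 0).comp hφ (hasOrder_jacobi g h hφ) fun W hW => jacobi_smooth g h hφ hW
  have h2 : HasOrder m (2 + 0) (fun W p => roughLaplacian g h φ (trCurv g h φ W) p : SecOp n φ) :=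
    (hasOrder_roughLaplacian g h hφ).comp hφ (hasOrder_trCurv g h hφ 0)
      fun W hW => trCurv_smooth g h hφ hW
  have h3 : HasOrder m 2 (trCurvRic g h φ) :=
    HasOrder.trace hφ g (P := fun W p a b =>
      curv h (φ p) (dmap φ p (ricci g p a)) (W p) (dmap φ p b)) fun i j => HasOrder.tensor hφ
      (A := fun p w => curv h (φ p) (dmap φ p (ricci g p (basisVec p i))) w
        (dmap φ p (basisVec p j))) fun p => curv_linear₂ h _ _ _
  have h4 : HasOrder m 2 (fun W p => trace g p (fun a b => cov2Along g h φ W p (ricci g p a) b) :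
      SecOp n φ) := HasOrder.trace hφ g (P := fun W p a b => cov2Along g h φ W p (ricci g p a) b)
    fun i j => hasOrder_cov2Along g h hφ (fun p => ricci g p (basisVec p i)) fun p => basisVec p j
  refine (((((((hasOrder_jacobi2_lower g h hφ).succ hφ).add hφ h1).add hφ h2).sub hφ
    (h3.smul hφ fun _ => 2)).add hφ ((hasOrder_jacobi g h hφ).smul hφ fun p =>
      (2 / 3 : ℝ) * scal g p)).add hφ (h4.smul hφ fun _ => 2)).add hφ
    (((hasOrder_covAlong h hφ (grad g (scal g))).succ hφ).smul hφ fun _ => 1 / 3) |>.congr hφ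
    fun W hW p => ?_
  have e1 : jacobi g h φ (jacobi g h φ W) p = roughLaplacian g h φ (roughLaplacian g h φ W) p
      + roughLaplacian g h φ (trCurv g h φ W) p + trCurv g h φ (jacobi g h φ W) p := by
    rw [← (hasOrder_roughLaplacian g h hφ).isLin.add _ _ (roughLaplacian_smooth g h hφ hW)
      (trCurv_smooth g h hφ hW)]
    rfl
  rw [jacobi2c, e1]
  abel

theorem hasOrder_biLaplacian : HasOrder m 4 (fun W =>
    roughLaplacian g h φ (roughLaplacian g h φ W) : SecOp n φ) :=
  (hasOrder_roughLaplacian g h hφ).comp hφ (hasOrder_roughLaplacian g h hφ)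
    fun W hW => roughLaplacian_smooth g h hφ hW

theorem hasOrder_jacobi2c : HasOrder m 4 (jacobi2c g h φ) :=
  (((hasOrder_jacobi2c_sub g h hφ).mono hφ (by norm_num)).add hφ
    (hasOrder_biLaplacian g h hφ)).congr hφ fun W _ p => sub_add_cancel _ _

/-! ### Principal symbol -/

omit hφ in
/-- The squared norm of the differential of a function. -/
def normSq (g : Metric m M) (f : M → ℝ) (p : M) : ℝ :=
  trace g p fun a b => dfun f p a * dfun f p b

/-- Of the second order Leibniz rule only the products `df ⊗ df` survive two commutators, twice,
with the sign of `Δ = - Tr ∇²`. -/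
theorem ad_ad_roughLaplacian (hf : ContMDiff (𝓡 m) 𝓘(ℝ, ℝ) ∞ f) (hW : IsSmoothSection m φ W)
    (p : M) : ad f (ad f (roughLaplacian g h φ)) W p = (-2 * normSq g f p) • W p := by
  have hfW := section_smul hφ hf hW
  simp only [ad, roughLaplacian, trace, normSq, smul_neg, Finset.smul_sum, Finset.mul_sum,
    Finset.sum_smul, ← Finset.sum_neg_distrib, ← Finset.sum_sub_distrib]
  refine Finset.sum_congr rfl fun i _ => Finset.sum_congr rfl fun j _ => ?_
  rw [cov2Along_smul g h hφ hf hfW, cov2Along_smul g h hφ hf hW, covAlong_smul h hφ hf hW,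
    covAlong_smul h hφ hf hW, smul_eq_mul]
  module

/-- Each Laplacian consumes two powers of `f` and leaves a factor `-2|df|²`: the first with the
binomial coefficient `6`, the second with `1`, so that `24 = 6 · 2 · 2`. -/
theorem biLaplacian_pow (hf : ContMDiff (𝓡 m) 𝓘(ℝ, ℝ) ∞ f) (hW : IsSmoothSection m φ W) {p : M}
    (hp : f p = 0) :
    roughLaplacian g h φ (roughLaplacian g h φ fun q => f q ^ 4 • W q) p =
      (24 * normSq g f p ^ 2) • W p := by
  set D := roughLaplacian g h φ with hD
  set A : SecOp n φ := ad f D with hA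
  have hDs : ∀ U, IsSmoothSection m φ U → IsSmoothSection m φ (D U) := fun U hU =>
    roughLaplacian_smooth g h hφ hU
  have hAs : ∀ U, IsSmoothSection m φ U → IsSmoothSection m φ (A U) := fun U hU =>
    ad_smooth hφ hf hDs hU
  have hs : ∀ {U : ∀ q : M, TangentSpace (𝓡 n) (φ q)}, IsSmoothSection m φ U →
    IsSmoothSection m φ (fun q => f q • U q) := fun hU => section_smul hφ hf hU
  have e1 : ∀ (U : ∀ q : M, TangentSpace (𝓡 n) (φ q)) q,
      D (fun q => f q • U q) q = f q • D U q + A U q := fun U q => by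
    rw [hA, ad]; abel
  have e2 : ∀ U, IsSmoothSection m φ U → ∀ q,
      A (fun q => f q • U q) q = f q • A U q + (-2 * normSq g f q) • U q := fun U hU q => by
    rw [← ad_ad_roughLaplacian g h hφ hf hU, ad]; abel
  have e3 : ∀ U, IsSmoothSection m φ U → ∀ q, D (fun q => f q • f q • U q) q =
      f q • (f q • D U q) + (2 : ℝ) • f q • A U q + (-2 * normSq g f q) • U q := fun U hU q => by
    rw [e1, e1, e2 U hU]; module
  -- From `D f⁴ = f⁴ D + 4 f³ A + 6 f² [A, f]` with `A = [D, f]`, one factor `f²` is split off.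
  -- Writing the last term as a commutator keeps `Y` visibly smooth.
  set Y : ∀ q : M, TangentSpace (𝓡 n) (φ q) := fun q => (f q • f q • D W q
    + (4 : ℝ) • f q • A W q) + (6 : ℝ) • (A (fun q => f q • W q) q - f q • A W q) with hY
  have hYs : IsSmoothSection m φ Y :=
    section_add hφ (section_add hφ (hs (hs (hDs _ hW)))
      (section_const_smul hφ 4 (hs (hAs _ hW))))
      (section_const_smul hφ 6 (section_sub hφ (hAs _ (hs hW)) (hs (hAs _ hW))))
  have e4 : D (fun q => f q ^ 4 • W q) = fun q => f q • f q • Y q := by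
    have : (fun q => f q ^ 4 • W q) = fun q => f q • f q • f q • f q • W q := by
      funext q; module
    rw [this]
    funext q
    rw [e3 _ (hs (hs hW)), e3 _ hW, e2 _ (hs hW), e2 _ hW, hY]
    simp only [e2 _ hW]
    module
  rw [e4, e3 _ hYs, hp, hY]
  simp only [hp, e2 _ hW]
  module

/-- The difference from the square of the Laplacian has order at most three and does not see `f⁴ W`
at a zero of `f`. -/
theorem jacobi2c_pow (hf : ContMDiff (𝓡 m) 𝓘(ℝ, ℝ) ∞ f) (hW : IsSmoothSection m φ W) {p : M}
    (hp : f p = 0) :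
    jacobi2c g h φ (fun q => f q ^ 4 • W q) p = (24 * normSq g f p ^ 2) • W p := by
  have h1 := ((hasOrder_jacobi2c_sub g h hφ).succ hφ).pow_eq_zero hf hp hW
  rw [← biLaplacian_pow g h hφ hf hW hp]
  exact sub_eq_zero.mp h1

omit hφ in
theorem covector_normSq_pos {p : M} {ξ : TangentSpace (𝓡 m) p →ₗ[ℝ] ℝ} (hξ : ξ ≠ 0) :
    0 < trace g p fun a b => ξ a * ξ b := by
  have hpos := (gramL_posDef (metL_metric g p) ((xt m p).map_source (mem_xt p))).inv
  set x : Fin m → ℝ := fun i => ξ (basisVec p i) with hx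
  have hx0 : x ≠ 0 := by
    intro h0
    refine hξ (LinearMap.ext fun v => ?_)
    have h1 : v = ∑ k, tc p p v k • basisVec p k := by
      refine tc_inj (mem_xt p) ?_
      simp only [map_sum, map_smul, tc_basisVec]
      exact sum_ev _
    rw [h1, map_sum]
    simp only [map_smul]
    refine Finset.sum_eq_zero fun k _ => ?_
    have := congrFun h0 k
    simp only [hx, Pi.zero_apply] at this
    rw [this, smul_zero]
  have h1 := hpos.dotProduct_mulVec_pos hx0
  have h2 : (trace g p fun a b => ξ a * ξ b) = star x ⬝ᵥ ((gramL (metL g p) (xt m p p))⁻¹).mulVec x := by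
    simp only [trace, gramInv_self, dotProduct, Matrix.mulVec, star_trivial, Finset.mul_sum,
      smul_eq_mul, hx]
    exact Finset.sum_congr rfl fun i _ => Finset.sum_congr rfl fun j _ => by ring
  rwa [h2]

/-- The symbol is multiplication by `|ξ|⁴`, the factor `24` being `4!`. -/
theorem isElliptic_jacobi2c : IsElliptic m φ 4 (jacobi2c g h φ) := by
  intro p ξ hξ
  have hpos := covector_normSq_pos g hξ
  refine ⟨LinearEquiv.smulOfNeZero ℝ _ ((trace g p fun a b => ξ a * ξ b) ^ 2)
    (pow_ne_zero 2 hpos.ne'), fun f hf hp hdf W hW => ?_⟩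
  rw [jacobi2c_pow g h hφ hf hW hp, normSq]
  simp only [hdf, LinearEquiv.smulOfNeZero_apply, smul_smul]
  norm_num [Nat.factorial]

theorem isDiffOp_jacobi2c : IsDiffOp m φ 4 (jacobi2c g h φ) :=
  (hasOrder_jacobi2c g h hφ).isDiffOp hφ fun _ hW => jacobi2c_smooth g h hφ hW

theorem isDiffOp_jacobi2c_sub : IsDiffOp m φ 3 (fun W p =>
    jacobi2c g h φ W p - roughLaplacian g h φ (roughLaplacian g h φ W) p) :=
  ((hasOrder_jacobi2c_sub g h hφ).succ hφ).isDiffOp hφ fun _ hW =>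
    section_sub hφ (jacobi2c_smooth g h hφ hW)
      (roughLaplacian_smooth g h hφ (roughLaplacian_smooth g h hφ hW))

/-! ### Functions and sections with prescribed values -/

omit hφ in
-- A centred coordinate function times a bump function; the derivative of the bump drops out because
-- the coordinate vanishes at `p`.
theorem exists_function [T2Space M] (p : M) (i : Fin m) : ∃ f : M → ℝ,
    ContMDiff (𝓡 m) 𝓘(ℝ, ℝ) ∞ f ∧ f p = 0 ∧ ∀ v, dfun f p v = tc p p v i := by
  obtain ⟨χ⟩ : Nonempty (SmoothBumpFunction (𝓡 m) p) := inferInstance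
  have hp := mem_xt (n := m) p
  have hcoord : ContMDiffOn (𝓡 m) 𝓘(ℝ, ℝ) ∞ (fun q => xt m p q i - xt m p p i)
      (chartAt (Euc m) p).source :=
    ((pr i).contDiff.sub contDiff_const).contMDiff.comp_contMDiffOn
      (contMDiffOn_extChartAt (I := 𝓡 m) (n := ∞) (x := p))
  have hf := χ.contMDiff_smul hcoord
  refine ⟨_, hf, by simp, fun v => ?_⟩
  rw [dfun_eq hp (chart_smooth_at hf hp)]
  have hev : (fun x => χ ((xt m p).symm x) • (xt m p ((xt m p).symm x) i - xt m p p i))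
      =ᶠ[nhds (xt m p p)] fun x => χ ((xt m p).symm x) * (pr i x - xt m p p i) := by
    filter_upwards [(xt_target_open p).mem_nhds ((xt m p).map_source hp)] with x hx
    rw [(xt m p).right_inv hx]; rfl
  rw [hev.fderiv_eq, fderiv_fun_mul
    ((chart_smooth_at χ.contMDiff hp).differentiableAt (by simp))
    ((pr i).differentiableAt.sub_const _)]
  have h0 : pr i (xt m p p) - xt m p p i = 0 := sub_self _
  rw [h0, (xt m p).left_inv hp, χ.eq_one, zero_smul, add_zero, one_smul, fderiv_sub_const]
  simp

/-- The product of a cutoff function with a section which is smooth near its support. -/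
theorem section_cutoff {χ : M → ℝ} (hχ : ContMDiff (𝓡 m) 𝓘(ℝ, ℝ) ∞ χ) {d : N}
    (hs : tsupport χ ⊆ φ ⁻¹' (xt n d).source)
    (hW : ∀ c, ContDiffOn ℝ ∞ (sloc m c d φ W) (dom m n c d φ)) :
    IsSmoothSection m φ fun p => χ p • W p := by
  refine isSmoothSection_of_sloc hφ fun c d' x hx => ContDiffAt.contDiffWithinAt ?_
  by_cases hxs : (xt m c).symm x ∈ tsupport χ
  · have hx' : x ∈ dom m n c d' φ ∩ dom m n c d φ := ⟨hx, hx.1, hs hxs⟩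
    have h1 := (sloc_smooth_kap hφ (d := d') subset_rfl (hW c)).contDiffAt
      (((dom_open hφ.continuous).inter (dom_open hφ.continuous)).mem_nhds hx')
    have h2 := (chart_smooth hχ c).contDiffAt ((xt_target_open c).mem_nhds hx.1)
    exact (h2.smul h1).congr_of_eventuallyEq
      (Filter.Eventually.of_forall fun y => sloc_smul χ W y)
  · have hn : {y | y ∈ (xt m c).target ∧ (xt m c).symm y ∈ (tsupport χ)ᶜ} ∈ nhds x :=
      ((xt_symm_cont c).isOpen_inter_preimage (xt_target_open c)
        (isClosed_tsupport χ).isOpen_compl).mem_nhds ⟨hx.1, hxs⟩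
    refine (contDiffAt_const (c := (0 : Euc n))).congr_of_eventuallyEq ?_
    filter_upwards [hn] with y hy
    rw [sloc_smul, image_eq_zero_of_notMem_tsupport hy.2, zero_smul]

theorem exists_section [T2Space M] (p : M) (e : Euc n) : ∃ W : ∀ q : M, TangentSpace (𝓡 n) (φ q),
    IsSmoothSection m φ W ∧ tc (φ p) (φ p) (W p) = e := by
  have hnh : φ ⁻¹' (xt n (φ p)).source ∈ nhds p :=
    ((xt_source_open (φ p)).preimage hφ.continuous).mem_nhds (mem_xt (φ p))
  obtain ⟨χ, -, hχ⟩ := (SmoothBumpFunction.nhds_basis_tsupport (I := 𝓡 m) p).mem_iff.mp hnh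
  refine ⟨fun q => χ q • fm (φ p) (φ q) e, section_cutoff hφ χ.contMDiff hχ fun c => ?_, ?_⟩
  · exact (contDiffOn_const (c := e)).congr fun x hx => tc_fm hx.2 e
  · simp only [χ.eq_one, one_smul, tc_fm (mem_xt _)]

/-- Order three would annihilate `f⁴ W` at `p`, whereas the symbol gives a nonzero multiple of `W
p`. Positive dimensions provide `df ≠ 0` and `W p ≠ 0`. -/
theorem not_isDiffOp_jacobi2c [T2Space M] [Nonempty M] (hm : 0 < m) (hn : 0 < n) :
    ¬ IsDiffOp m φ 3 (jacobi2c g h φ) := by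
  intro hP
  obtain ⟨p⟩ := ‹Nonempty M›
  obtain ⟨f, hf, hp, hdf⟩ := exists_function p (⟨0, hm⟩ : Fin m)
  obtain ⟨W, hW, hWp⟩ := exists_section hφ p (ev (⟨0, hn⟩ : Fin n))
  have h1 := hP.hasOrder.pow_eq_zero hf hp hW
  rw [jacobi2c_pow g h hφ hf hW hp] at h1
  set ξ : TangentSpace (𝓡 m) p →ₗ[ℝ] ℝ :=
    ((pr (⟨0, hm⟩ : Fin m)).comp (tc p p)).toLinearMap with hξdef
  have hξ : ξ ≠ 0 := by
    intro h0
    have := LinearMap.congr_fun h0 (basisVec p ⟨0, hm⟩)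
    simp [hξdef, tc_basisVec] at this
  have hN : normSq g f p = trace g p fun a b => ξ a * ξ b := by
    simp only [normSq, hdf]; rfl
  have hpos := covector_normSq_pos g hξ
  rw [← hN] at hpos
  have hW0 : W p = 0 := (smul_eq_zero.mp h1).resolve_left (by positivity)
  rw [hW0, map_zero] at hWp
  have := congrArg (fun x => x ⟨0, hn⟩) hWp
  simp at this

end GeometricOperators

end CBiharmonic

end

/-! ### The first variation integrand, and local data extended by parameters. -/

noncomputable section

set_option linter.unusedSectionVars false
set_option synthInstance.maxHeartbeats 200000

namespace CBiharmonic

/-! ### The first variation integrand -/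

section FirstVariation

variable {m n : ℕ}
  {M : Type*} [TopologicalSpace M] [ChartedSpace (Euc m) M] [IsManifold (𝓡 m) ∞ M]
  {N : Type*} [TopologicalSpace N] [ChartedSpace (Euc n) N] [IsManifold (𝓡 n) ∞ N]
  {φ : M → N} {c : M} {d : N} (g : Metric m M) (h : Metric n N)
  {V W : ∀ q : M, TangentSpace (𝓡 n) (φ q)}

/-- The integrand of the first variation. -/
def linG (g : Metric m M) (h : Metric n N) (φ : M → N) (W : ∀ q : M, TangentSpace (𝓡 n) (φ q))
    (p : M) : ℝ :=
  - h.inner (φ p) (jacobi g h φ W p) (tension g h φ p)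
    + (2 / 3) * scal g p * trace g p (fun a b => h.inner (φ p) (covAlong h φ W p a) (dmap φ p b))
    - 2 * trace g p (fun a b => h.inner (φ p) (covAlong h φ W p (ricci g p a)) (dmap φ p b))

theorem linG_eq (hφ : ContMDiff (𝓡 m) (𝓡 n) ∞ φ) (hW : IsSmoothSection m φ W) {x : Euc m}
    (hx : x ∈ dom m n c d φ) :
    linG g h φ W ((xt m c).symm x) =
      (chartLoc g c).lin (metL h d) (gam h d) (mloc m n c d φ) (sloc m c d φ W) x := by
  obtain ⟨hq, hd, hqx⟩ := chart_point hx
  set q := (xt m c).symm x with hqdef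
  have hux : xt n d (φ q) = mloc m n c d φ x := rfl
  have h1 : tc d (φ q) (tension g h φ q) = _ := sloc_tension g h hφ hx
  have h2 : tc d (φ q) (jacobi g h φ W q) = _ := sloc_jacobi g h hφ hW hx
  have hb : IsBilin fun a b => metL h d (mloc m n c d φ x)
      (cd (gam h d) (mloc m n c d φ) (sloc m c d φ W) a x) (fderiv ℝ (mloc m n c d φ) x b) :=
    ⟨fun _ => ⟨fun a b => by rw [cd_dir_add, map_add, add_apply],
        fun r a => by rw [cd_dir_smul, map_smul, smul_apply]⟩,
      fun _ => ⟨fun a b => by rw [map_add, map_add],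
        fun r a => by rw [map_smul, map_smul]⟩⟩
  have hB : ∀ a b, (LinearMap.id (R := ℝ) (M := ℝ))
      (h.inner (φ q) (covAlong h φ W q a) (dmap φ q b)) =
      metL h d (mloc m n c d φ x)
      (cd (gam h d) (mloc m n c d φ) (sloc m c d φ W) (tc c q a) x)
      (fderiv ℝ (mloc m n c d φ) x (tc c q b)) := by
    intro a b
    rw [LinearMap.id_apply, inner_eq h hd, tc_covAlong_smooth h hφ hW hq hd, tc_dmap hφ hq hd,
      hqx, hux]
  have h4 := trace_eq g (LinearMap.id (R := ℝ) (M := ℝ)) hq hb hB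
  have h5 := trace_ric_left g (LinearMap.id (R := ℝ) (M := ℝ)) hq hb hB
  rw [hqx, LinearMap.id_apply] at h4 h5
  rw [linG, inner_eq h hd, h1, h2, h4, h5, scal_eq g hq, hqx, hux]
  rfl

theorem linG_continuous (hφ : ContMDiff (𝓡 m) (𝓡 n) ∞ φ) (hW : IsSmoothSection m φ W) :
    Continuous (linG g h φ W) :=
  continuous_of_dom hφ.continuous (fun c d => (setup g h hφ c d).lin_smooth (sloc_smooth hW))
    fun _ _ _ hx => linG_eq g h hφ hW hx

theorem linG_add (hφ : ContMDiff (𝓡 m) (𝓡 n) ∞ φ) (hV : IsSmoothSection m φ V)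
    (hW : IsSmoothSection m φ W) (p : M) :
    linG g h φ (fun q => V q + W q) p = linG g h φ V p + linG g h φ W p := by
  simp only [linG, trace, (hasOrder_jacobi g h hφ).isLin.add _ _ hV hW, covAlong_add h hφ hV hW,
    map_add, add_apply, smul_eq_mul, mul_add, Finset.sum_add_distrib]
  ring

theorem linG_zero (hφ : ContMDiff (𝓡 m) (𝓡 n) ∞ φ) (p : M) :
    linG g h φ (fun _ => 0) p = 0 := by
  have := linG_add g h hφ (section_zero hφ) (section_zero hφ) p
  simp only [add_zero] at this
  linarith

/-- Linearity in the section lets a partition of unity localise the first variation. -/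
theorem linG_sum (hφ : ContMDiff (𝓡 m) (𝓡 n) ∞ φ) {ι : Type*} (s : Finset ι)
    {W : ι → ∀ q : M, TangentSpace (𝓡 n) (φ q)} (hW : ∀ i, IsSmoothSection m φ (W i)) (p : M) :
    linG g h φ (fun q => ∑ i ∈ s, W i q) p = ∑ i ∈ s, linG g h φ (W i) p := by
  classical
  induction s using Finset.induction_on with
  | empty => simp [linG_zero g h hφ]
  | insert i s hi ih =>
    simp only [Finset.sum_insert hi]
    rw [linG_add g h hφ (hW i) (section_sum hφ s hW), ih]

end FirstVariation

/-! ### Local data depending on parameters -/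

section Slices

variable {T E F : Type*} [NormedAddCommGroup T] [NormedSpace ℝ T] [NormedAddCommGroup E]
  [NormedSpace ℝ E] [NormedAddCommGroup F] [NormedSpace ℝ F]

theorem fderiv_slice_right {f : T × E → F} {t : T} {x : E} (hf : DifferentiableAt ℝ f (t, x))
    (v : E) : fderiv ℝ (fun y => f (t, y)) x v = fderiv ℝ f (t, x) (0, v) := by
  have := (hf.hasFDerivAt.comp x (hasFDerivAt_prodMk_right t x)).fderiv
  exact congrArg (fun L => L v) this

theorem fderiv_slice_left {f : T × E → F} {t : T} {x : E} (hf : DifferentiableAt ℝ f (t, x)) :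
    fderiv ℝ (fun s => f (s, x)) t = (fderiv ℝ f (t, x)).comp (ContinuousLinearMap.inl ℝ T E) :=
  (hf.hasFDerivAt.comp t (hasFDerivAt_prodMk_left t x)).fderiv

theorem fderiv_slice_left_apply {f : T × E → F} {t : T} {x : E}
    (hf : DifferentiableAt ℝ f (t, x)) (a : T) :
    fderiv ℝ (fun s => f (s, x)) t a = fderiv ℝ f (t, x) (a, 0) := by
  rw [fderiv_slice_left hf]
  rfl

theorem fderiv_snd_left {f : E → F} {z : T × E} (hf : DifferentiableAt ℝ f z.2) (a : T) :
    fderiv ℝ (fun z : T × E => f z.2) z (a, 0) = 0 := by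
  have := (hf.hasFDerivAt.comp z (hasFDerivAt_snd (p := z))).fderiv
  rw [show (fun z : T × E => f z.2) = f ∘ Prod.snd from rfl, this]
  simp

variable {m : ℕ}

namespace Loc

/-- Local data which do not depend on the parameter. -/
def pull (T : Type*) [NormedAddCommGroup T] (K : Loc m E) : Loc m (T × E) where
  e i := (0, K.e i)
  GI i j z := K.GI i j z.2
  C k i j z := K.C k i j z.2
  P i j z := K.P i j z.2
  S z := K.S z.2

end Loc

variable {K : Loc m E} {U : Set (T × E)} {Ω : Set F} {H : F → F →L[ℝ] F →L[ℝ] ℝ}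
  {Γ : F → F →L[ℝ] F →L[ℝ] F} {u v w : T × E → F} {t : T} {x : E}

theorem par_slice (hu : DifferentiableAt ℝ u (t, x)) (i : Fin m) :
    (K.pull T).par u i (t, x) = K.par (fun y => u (t, y)) i x :=
  (fderiv_slice_right hu _).symm

theorem cov_slice (hu : DifferentiableAt ℝ u (t, x)) (hw : DifferentiableAt ℝ w (t, x))
    (i : Fin m) :
    (K.pull T).cov Γ u i w (t, x) = K.cov Γ (fun y => u (t, y)) i (fun y => w (t, y)) x := by
  rw [Loc.cov, Loc.cov, cd, cd, fderiv_slice_right hu, fderiv_slice_right hw]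
  rfl

namespace Setup

variable [FiniteDimensional ℝ F] (h : Setup (K.pull T) U Ω H Γ u)
include h

theorem slice_open (t : T) : IsOpen {y : E | (t, y) ∈ U} :=
  h.hU.preimage (Continuous.prodMk_right t)

variable (hw : ContDiffOn ℝ ∞ w U) (hv : ContDiffOn ℝ ∞ v U) (hx : (t, x) ∈ U)

include hw hx in
theorem cov_slice' (i : Fin m) :
    (K.pull T).cov Γ u i w (t, x) = K.cov Γ (fun y => u (t, y)) i (fun y => w (t, y)) x :=
  cov_slice (diffAt_of_smooth h.hU h.hu hx) (diffAt_of_smooth h.hU hw hx) i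

include hx in
theorem par_slice' (i : Fin m) :
    (K.pull T).par u i (t, x) = K.par (fun y => u (t, y)) i x :=
  par_slice (diffAt_of_smooth h.hU h.hu hx) i

include hw hx in
-- Space directions are tangent to the slice of fixed parameter, so an operator built from them may
-- be computed on the slice; the inner derivative is replaced on the whole open slice before the
-- outer one is taken.
theorem cov2_slice (i j : Fin m) :
    (K.pull T).cov2 Γ u i j w (t, x) = K.cov2 Γ (fun y => u (t, y)) i j (fun y => w (t, y)) x := by
  rw [Loc.cov2, Loc.cov2, h.cov_slice' (h.cov_smooth hw j) hx,
    Loc.cov_congr (h.slice_open t) (fun y hy => h.cov_slice' hw hy j) hx]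
  simp only [h.cov_slice' hw hx]
  rfl

include hx in
theorem ten_slice : (K.pull T).ten Γ u (t, x) = K.ten Γ (fun y => u (t, y)) x := by
  refine tr2_congr (A := K.GI) fun i j => ?_
  rw [Loc.hess, Loc.hess, h.cov_slice' (h.par_smooth j) hx,
    Loc.cov_congr (h.slice_open t) (fun y hy => h.par_slice' hy j) hx]
  simp only [h.par_slice' hx]
  rfl

include hw hx in
theorem jac_slice :
    (K.pull T).jac Γ u w (t, x) = K.jac Γ (fun y => u (t, y)) (fun y => w (t, y)) x := by
  rw [Loc.jac, Loc.jac, Loc.lap, Loc.lap, Loc.trc, Loc.trc]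
  simp only [h.cov2_slice hw hx, h.par_slice' hx]
  rfl

include hx in
theorem dens_slice : (K.pull T).dens H Γ u (t, x) = K.dens H Γ (fun y => u (t, y)) x := by
  rw [Loc.dens, Loc.dens]
  simp only [h.ten_slice hx, h.par_slice' hx]
  rfl

include hw hx in
theorem lin_slice :
    (K.pull T).lin H Γ u w (t, x) = K.lin H Γ (fun y => u (t, y)) (fun y => w (t, y)) x := by
  rw [Loc.lin, Loc.lin]
  simp only [h.ten_slice hx, h.par_slice' hx, h.jac_slice hw hx, h.cov_slice' hw hx]
  rfl

include hv hw hx in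
theorem sec_slice :
    (K.pull T).sec H Γ u v w (t, x) =
      K.sec H Γ (fun y => u (t, y)) (fun y => v (t, y)) (fun y => w (t, y)) x := by
  rw [Loc.sec, Loc.sec, Loc.comm, Loc.comm]
  simp only [h.ten_slice hx, h.par_slice' hx, h.jac_slice hw hx, h.jac_slice hv hx,
    h.cov_slice' hw hx, h.cov_slice' hv hx]
  rfl

end Setup

end Slices

end CBiharmonic

end

/-! ### Smooth families of maps: velocity, acceleration, variation of the integrand. -/

noncomputable section

set_option linter.unusedSectionVars false
set_option synthInstance.maxHeartbeats 200000

namespace CBiharmonic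

/-! ### Smooth families of maps -/

section Families

variable {m n : ℕ}
  {M : Type*} [TopologicalSpace M] [ChartedSpace (Euc m) M] [IsManifold (𝓡 m) ∞ M]
  {N : Type*} [TopologicalSpace N] [ChartedSpace (Euc n) N] [IsManifold (𝓡 n) ∞ N]
  {T : Type*} [NormedAddCommGroup T] [NormedSpace ℝ T]
  {Φ : T → M → N} {c : M} {d : N} (g : Metric m M) (h : Metric n N)

/-- Smooth families of maps. -/
def IsFamily (m n : ℕ) {M : Type*} [TopologicalSpace M] [ChartedSpace (Euc m) M]
    {N : Type*} [TopologicalSpace N] [ChartedSpace (Euc n) N]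
    {T : Type*} [NormedAddCommGroup T] [NormedSpace ℝ T] (Φ : T → M → N) : Prop :=
  ContMDiff (𝓘(ℝ, T).prod (𝓡 m)) (𝓡 n) ∞ fun z : T × M => Φ z.1 z.2

/-- The local representation of a family of maps. -/
def floc (m n : ℕ) {M : Type*} [TopologicalSpace M] [ChartedSpace (Euc m) M]
    {N : Type*} [TopologicalSpace N] [ChartedSpace (Euc n) N] {T : Type*}
    (c : M) (d : N) (Φ : T → M → N) (z : T × Euc m) : Euc n :=
  xt n d (Φ z.1 ((xt m c).symm z.2))

/-- The domain of the local representation of a family of maps. -/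
def fdom (m n : ℕ) {M : Type*} [TopologicalSpace M] [ChartedSpace (Euc m) M]
    {N : Type*} [TopologicalSpace N] [ChartedSpace (Euc n) N] {T : Type*}
    (c : M) (d : N) (Φ : T → M → N) : Set (T × Euc m) :=
  {z | z.2 ∈ (xt m c).target ∧ Φ z.1 ((xt m c).symm z.2) ∈ (xt n d).source}

theorem param_symm_smooth (T : Type*) [NormedAddCommGroup T] [NormedSpace ℝ T] (c : M) :
    ContMDiffOn 𝓘(ℝ, T × Euc m) (𝓘(ℝ, T).prod (𝓡 m)) ∞
      (fun z : T × Euc m => (z.1, (xt m c).symm z.2)) {z | z.2 ∈ (xt m c).target} :=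
  (contDiff_fst.contMDiff.contMDiffOn).prodMk
    ((contMDiffOn_extChartAt_symm c).comp contDiff_snd.contMDiff.contMDiffOn fun _ hz => hz)

theorem param_target_open (T : Type*) [TopologicalSpace T] (c : M) :
    IsOpen {z : T × Euc m | z.2 ∈ (xt m c).target} :=
  (xt_target_open c).preimage continuous_snd

theorem IsFamily.slice (hΦ : IsFamily m n Φ) (t : T) : ContMDiff (𝓡 m) (𝓡 n) ∞ (Φ t) :=
  ContMDiff.comp (I' := 𝓘(ℝ, T).prod (𝓡 m)) (f := fun p : M => (t, p)) hΦ
    (contMDiff_const.prodMk contMDiff_id)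

theorem IsFamily.curve (hΦ : IsFamily m n Φ) (p : M) : ContMDiff 𝓘(ℝ, T) (𝓡 n) ∞ fun t => Φ t p :=
  ContMDiff.comp (I' := 𝓘(ℝ, T).prod (𝓡 m)) (f := fun t : T => (t, p)) hΦ
    (contMDiff_id.prodMk contMDiff_const)

theorem fdom_open (hΦ : IsFamily m n Φ) : IsOpen (fdom m n c d Φ) :=
  ((hΦ.continuous.comp_continuousOn (param_symm_smooth T c).continuousOn).isOpen_inter_preimage
    (param_target_open T c) (xt_source_open d))

theorem floc_smooth (hΦ : IsFamily m n Φ) : ContDiffOn ℝ ∞ (floc m n c d Φ) (fdom m n c d Φ) := by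
  have h1 : ContMDiffOn 𝓘(ℝ, T × Euc m) 𝓘(ℝ, Euc n) ∞ (floc m n c d Φ) (fdom m n c d Φ) := by
    refine ContMDiffOn.comp (t := (chartAt (Euc n) d).source)
      (contMDiffOn_extChartAt (I := 𝓡 n) (n := ∞) (x := d))
      (ContMDiff.comp_contMDiffOn hΦ ((param_symm_smooth T c).mono fun z hz => hz.1)) ?_
    intro y hy
    exact mem_chart_of_xt hy.2
  exact h1.contDiffOn

theorem fsetup (hΦ : IsFamily m n Φ) (c : M) (d : N) :
    Setup ((chartLoc g c).pull T) (fdom m n c d Φ) (xt n d).target (metL h d) (gam h d)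
      (floc m n c d Φ) where
  hU := fdom_open hΦ
  hΩ := xt_target_open d
  hΓ := gam_smooth h d
  hs := gam_symm h d
  hH := (metL_metric h d).smooth
  hHs := (metL_metric h d).symm
  hc := gam_compat h d
  hu := floc_smooth hΦ
  hm := fun _ hx => (xt n d).map_source hx.2
  hGI := fun i j => (gInv_smooth g c i j).comp contDiffOn_snd fun _ hz => hz.1
  hGIs := fun _ hx i j => gInv_symm g hx.1 i j
  hC := fun k i j => (chr_smooth g c k i j).comp contDiffOn_snd fun _ hz => hz.1
  hP := fun i j => (ricP_smooth g c i j).comp contDiffOn_snd fun _ hz => hz.1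
  hPs := fun _ hx i j => ricP_symm g hx.1 i j
  hS := (scalL_smooth g c).comp contDiffOn_snd fun _ hz => hz.1

theorem pull_indep (c : M) (Φ : T → M → N) (a : T) :
    Setup.Indep ((chartLoc g c).pull T) (fdom m n c d Φ) (a, 0) where
  GI i j _ hz := fderiv_snd_left (diffAt_of_smooth (xt_target_open c) (gInv_smooth g c i j) hz.1) a
  C k i j _ hz := fderiv_snd_left (diffAt_of_smooth (xt_target_open c) (chr_smooth g c k i j) hz.1) a
  P i j _ hz := fderiv_snd_left (diffAt_of_smooth (xt_target_open c) (ricP_smooth g c i j) hz.1) a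
  S _ hz := fderiv_snd_left (diffAt_of_smooth (xt_target_open c) (scalL_smooth g c) hz.1) a

/-! ### Velocity and acceleration -/

/-- The velocity of a family of maps in the direction of a parameter. -/
def vel (n : ℕ) {M : Type*} {N : Type*} [TopologicalSpace N] [ChartedSpace (Euc n) N]
    {T : Type*} [NormedAddCommGroup T] [NormedSpace ℝ T] (Φ : T → M → N)
    (t a : T) (p : M) : TangentSpace (𝓡 n) (Φ t p) :=
  mfderiv 𝓘(ℝ, T) (𝓡 n) (fun s => Φ s p) t a

theorem tc_vel (hΦ : IsFamily m n Φ) {t : T} {p : M} (hd : Φ t p ∈ (xt n d).source) (a : T) :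
    tc d (Φ t p) (vel n Φ t a p) = fderiv ℝ (fun s => xt n d (Φ s p)) t a := by
  have h2 := mfderiv_comp t (I := 𝓘(ℝ, T)) (I' := 𝓡 n) (I'' := 𝓘(ℝ, Euc n)) (g := xt n d)
    (f := fun s => Φ s p) (mdifferentiableAt_extChartAt (mem_chart_of_xt hd))
    ((hΦ.curve p).mdifferentiableAt (by simp))
  rw [tc_eq_mfderiv hd, ← mfderiv_eq_fderiv]
  exact congrArg (fun L => L a) h2.symm

theorem sloc_vel (hΦ : IsFamily m n Φ) {t a : T} {x : Euc m} (hx : (t, x) ∈ fdom m n c d Φ) :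
    sloc m c d (Φ t) (vel n Φ t a) x = fderiv ℝ (floc m n c d Φ) (t, x) (a, 0) := by
  rw [← fderiv_slice_left_apply (diffAt_of_smooth (fdom_open hΦ) (floc_smooth hΦ) hx)]
  exact tc_vel hΦ hx.2 a

theorem slice_smooth {X : Type*} [NormedAddCommGroup X] [NormedSpace ℝ X] {f : T × Euc m → X}
    (hf : ContDiffOn ℝ ∞ f (fdom m n c d Φ)) (t : T) :
    ContDiffOn ℝ ∞ (fun x => f (t, x)) (dom m n c d (Φ t)) :=
  hf.comp (contDiff_prodMk_right t).contDiffOn fun _ hx => hx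

theorem vel_smooth (hΦ : IsFamily m n Φ) (t a : T) : IsSmoothSection m (Φ t) (vel n Φ t a) :=
  isSmoothSection_congr (hΦ.slice t)
    (fun _ _ => slice_smooth (smooth_fderiv_apply (fdom_open hΦ) (floc_smooth hΦ) (a, 0)) t)
    fun _ _ _ hx => sloc_vel hΦ hx

/-- The covariant derivative of the velocity in the direction `b` in the direction `a`. -/
def acc (h : Metric n N) (Φ : T → M → N) (t a b : T) (p : M) : TangentSpace (𝓡 n) (Φ t p) :=
  fm (Φ t p) (Φ t p) (cd (gam h (Φ t p)) (fun s => xt n (Φ t p) (Φ s p))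
    (fun s => fderiv ℝ (fun s => xt n (Φ t p) (Φ s p)) s b) a t)

theorem curve_smooth (hΦ : IsFamily m n Φ) (d : N) (p : M) :
    ContDiffOn ℝ ∞ (fun s => xt n d (Φ s p)) {s | Φ s p ∈ (xt n d).source} := by
  have h1 : ContMDiffOn 𝓘(ℝ, T) 𝓘(ℝ, Euc n) ∞ (fun s => xt n d (Φ s p))
      {s | Φ s p ∈ (xt n d).source} :=
    ContMDiffOn.comp (t := (chartAt (Euc n) d).source)
      (contMDiffOn_extChartAt (I := 𝓡 n) (n := ∞) (x := d)) (hΦ.curve p).contMDiffOn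
      fun y hy => mem_chart_of_xt hy
  exact h1.contDiffOn

/-- Chart independence of the acceleration: velocities correspond under the transition map, and so
do their covariant derivatives by `cd_transform`. -/
theorem tc_acc (hΦ : IsFamily m n Φ) {t : T} {p : M} (hd : Φ t p ∈ (xt n d).source) (a b : T) :
    tc d (Φ t p) (acc h Φ t a b p) = cd (gam h d) (fun s => xt n d (Φ s p))
      (fun s => fderiv ℝ (fun s => xt n d (Φ s p)) s b) a t := by
  set d' := Φ t p with hd'
  set U : Set T := {s | Φ s p ∈ (xt n d).source} ∩ {s | Φ s p ∈ (xt n d').source} with hU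
  have hUo : ∀ d, IsOpen {s | Φ s p ∈ (xt n d).source} := fun d =>
    (xt_source_open d).preimage (hΦ.curve p).continuous
  have hUo' : IsOpen U := (hUo d).inter (hUo d')
  have htU : t ∈ U := ⟨hd, mem_xt _⟩
  have hγ := (curve_smooth hΦ d' p).mono (Set.inter_subset_right : U ⊆ _)
  have hm : ∀ s ∈ U, xt n d' (Φ s p) ∈ kapDom n d d' := fun s hs => mem_kapDom hs.1 hs.2
  have e1 : ∀ s ∈ U, kap n d d' (xt n d' (Φ s p)) = xt n d (Φ s p) := fun s hs => kap_xt hs.2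
  have h2 := cd_transform (Γ := gam h d) (Γ' := gam h d') (kapDom_open d d') (kap_smooth d d')
    (gam_kap h d d') hUo' (u := fun s => xt n d' (Φ s p))
    (w := fun s => fderiv ℝ (fun s => xt n d' (Φ s p)) s b) hγ hm
    (smooth_fderiv_apply hUo' hγ b) htU a
  rw [tc_kap hd (mem_xt d'), acc, tc_fm (mem_xt _), ← hd', ← h2]
  refine cd_congr_map hUo' e1 (fun s hs => ?_) htU _
  rw [← fderiv_comp_on hUo' (kapDom_open d d') (kap_smooth d d') hγ hm hs]
  rw [fderiv_congr_on hUo' e1 hs]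

/-- The acceleration is defined for a fixed point of `M`; here it is recognised as a covariant
derivative along the whole local map on parameters times space, the form in which `Setup.fderiv_lin`
produces it. -/
theorem sloc_acc (hΦ : IsFamily m n Φ) {t a b : T} {x : Euc m} (hx : (t, x) ∈ fdom m n c d Φ) :
    sloc m c d (Φ t) (acc h Φ t a b) x = cd (gam h d) (floc m n c d Φ)
      (fun z => fderiv ℝ (floc m n c d Φ) z (b, 0)) (a, 0) (t, x) := by
  have ho := fdom_open (c := c) (d := d) hΦ
  have hs := floc_smooth (c := c) (d := d) hΦ
  have hUo : IsOpen {s | (s, x) ∈ fdom m n c d Φ} := ho.preimage (Continuous.prodMk_left x)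
  have h1 : tc d (Φ t ((xt m c).symm x)) (acc h Φ t a b ((xt m c).symm x)) = _ :=
    tc_acc h hΦ hx.2 a b
  refine h1.trans ?_
  change cd (gam h d) (fun s => floc m n c d Φ (s, x))
    (fun s => fderiv ℝ (fun s => floc m n c d Φ (s, x)) s b) a t = _
  rw [cd_congr hUo (w' := fun s => fderiv ℝ (floc m n c d Φ) (s, x) (b, 0)) (fun s hsx =>
    fderiv_slice_left_apply (f := floc m n c d Φ) (diffAt_of_smooth ho hs hsx) b) hx]
  rw [cd, cd, ← fderiv_slice_left_apply (diffAt_of_smooth ho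
    (smooth_fderiv_apply ho hs (b, (0 : Euc m))) hx),
    ← fderiv_slice_left_apply (diffAt_of_smooth ho hs hx) a]

theorem acc_smooth (hΦ : IsFamily m n Φ) (t a b : T) : IsSmoothSection m (Φ t) (acc h Φ t a b) :=
  isSmoothSection_congr (hΦ.slice t)
    (fun c d => slice_smooth (cd_smooth (fdom_open hΦ) (gam_smooth h d) (floc_smooth hΦ)
      (fun _ hz => (xt n d).map_source hz.2)
      (smooth_fderiv_apply (fdom_open hΦ) (floc_smooth hΦ) (b, 0)) (a, 0)) t)
    fun _ _ _ hx => sloc_acc h hΦ hx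

/-! ### Variation of the density -/

theorem density_family (hΦ : IsFamily m n Φ) {z : T × Euc m} (hz : z ∈ fdom m n c d Φ) :
    density g h (Φ z.1) ((xt m c).symm z.2) =
      ((chartLoc g c).pull T).dens (metL h d) (gam h d) (floc m n c d Φ) z := by
  rw [density_eq g h (hΦ.slice z.1) (d := d) hz]
  exact ((fsetup g h hΦ c d).dens_slice (t := z.1) (x := z.2) hz).symm

theorem linG_family (hΦ : IsFamily m n Φ) (b : T) {z : T × Euc m} (hz : z ∈ fdom m n c d Φ) :
    linG g h (Φ z.1) (vel n Φ z.1 b) ((xt m c).symm z.2) =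
      ((chartLoc g c).pull T).lin (metL h d) (gam h d) (floc m n c d Φ)
        (fun z => fderiv ℝ (floc m n c d Φ) z (b, 0)) z := by
  obtain ⟨t, x⟩ := z
  have hs := fsetup g h hΦ c d
  rw [linG_eq g h (hΦ.slice t) (vel_smooth hΦ t b) (d := d) hz,
    hs.lin_slice (smooth_fderiv_apply hs.hU hs.hu (b, 0)) hz]
  have he : ∀ y ∈ dom m n c d (Φ t), sloc m c d (Φ t) (vel n Φ t b) y =
      fderiv ℝ (floc m n c d Φ) (t, y) (b, 0) := fun y hy => sloc_vel hΦ hy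
  have hst := setup g h (hΦ.slice t) c d
  rw [Loc.lin, Loc.lin, Loc.jac_congr hst.hU he hz]
  simp only [Loc.cov_congr hst.hU he hz]
  rfl

/-- The first variation of the density. -/
theorem first_variation (hΦ : IsFamily m n Φ) (t a : T) (p : M) :
    fderiv ℝ (fun s => density g h (Φ s) p) t a = 2 * linG g h (Φ t) (vel n Φ t a) p := by
  set d := Φ t p
  have hp := mem_xt (n := m) p
  have hz : (t, xt m p p) ∈ fdom m n p d Φ := mem_dom hp (mem_xt d)
  have hs := fsetup g h hΦ p d
  have e1 : ∀ s ∈ {s | (s, xt m p p) ∈ fdom m n p d Φ}, density g h (Φ s) p =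
      ((chartLoc g p).pull T).dens (metL h d) (gam h d) (floc m n p d Φ) (s, xt m p p) :=
    fun s hsx => by
      rw [← density_family g h hΦ hsx, (xt m p).left_inv hp]
  have e2 := linG_family g h hΦ a hz
  rw [(xt m p).left_inv hp] at e2
  rw [fderiv_congr_on (hs.hU.preimage (Continuous.prodMk_left (xt m p p))) e1 hz,
    fderiv_slice_left_apply (diffAt_of_smooth hs.hU hs.dens_smooth hz),
    hs.fderiv_dens (pull_indep g p Φ a) hz, e2]

/-- The second variation of the density. -/
theorem second_variation (hΦ : IsFamily m n Φ) (t a b : T) (p : M) :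
    fderiv ℝ (fun s => linG g h (Φ s) (vel n Φ s b) p) t a =
      secG g h (Φ t) (vel n Φ t a) (vel n Φ t b) p + linG g h (Φ t) (acc h Φ t a b) p := by
  set d := Φ t p
  have hp := mem_xt (n := m) p
  have hz : (t, xt m p p) ∈ fdom m n p d Φ := mem_dom hp (mem_xt d)
  have hs := fsetup g h hΦ p d
  have hst := setup g h (hΦ.slice t) p d
  have hb := smooth_fderiv_apply hs.hU hs.hu (b, (0 : Euc m))
  have ha := smooth_fderiv_apply hs.hU hs.hu (a, (0 : Euc m))
  have e1 : ∀ s ∈ {s | (s, xt m p p) ∈ fdom m n p d Φ}, linG g h (Φ s) (vel n Φ s b) p =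
      ((chartLoc g p).pull T).lin (metL h d) (gam h d) (floc m n p d Φ)
        (fun z => fderiv ℝ (floc m n p d Φ) z (b, 0)) (s, xt m p p) :=
    fun s hsx => by
      rw [← linG_family g h hΦ b hsx, (xt m p).left_inv hp]
  have e2 := linG_eq g h (hΦ.slice t) (acc_smooth h hΦ t a b) (d := d) hz
  have e3 := secG_eq g h (hΦ.slice t) (vel_smooth hΦ t a) (vel_smooth hΦ t b) (d := d) hz
  rw [(xt m p).left_inv hp] at e2 e3
  have hv : ∀ (b : T), ∀ y ∈ dom m n p d (Φ t), sloc m p d (Φ t) (vel n Φ t b) y =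
      fderiv ℝ (floc m n p d Φ) (t, y) (b, 0) := fun b y hy => sloc_vel hΦ hy
  have hac : ∀ y ∈ dom m n p d (Φ t), sloc m p d (Φ t) (acc h Φ t a b) y = _ :=
    fun y hy => sloc_acc h hΦ hy
  rw [fderiv_congr_on (hs.hU.preimage (Continuous.prodMk_left (xt m p p))) e1 hz,
    fderiv_slice_left_apply (diffAt_of_smooth hs.hU (hs.lin_smooth hb) hz),
    hs.fderiv_lin (pull_indep g p Φ a) hb hz, e2, e3, hs.sec_slice hb ha hz,
    hs.lin_slice (hs.cd_smooth hb (a, 0)) hz, Loc.lin, Loc.lin, Loc.sec, Loc.sec, Loc.comm,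
    Loc.comm, Loc.jac_congr hst.hU hac hz, Loc.jac_congr hst.hU (hv a) hz,
    Loc.jac_congr hst.hU (hv b) hz, hv a _ hz, hv b _ hz]
  simp only [Loc.cov_congr hst.hU hac hz, Loc.cov_congr hst.hU (hv a) hz,
    Loc.cov_congr hst.hU (hv b) hz]
  rfl

end Families

end CBiharmonic

end

/-! ### Differentiation under the integral; first and second variation of the energy. -/

noncomputable section

set_option linter.unusedSectionVars false
set_option synthInstance.maxHeartbeats 200000

namespace CBiharmonic


/-! ### Integrals depending smoothly on parameters -/

section Parameters

variable {m n : ℕ} {M : Type*} [TopologicalSpace M] [ChartedSpace (Euc m) M] [IsManifold (𝓡 m) ∞ M]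
  {T X : Type} [NormedAddCommGroup T] [NormedSpace ℝ T] [NormedAddCommGroup X] [NormedSpace ℝ X]
  {D : T → M → X}

/-- Functions which depend smoothly on a parameter and on the point of a manifold. -/
def SmoothFam (m : ℕ) {M : Type*} [TopologicalSpace M] [ChartedSpace (Euc m) M]
    {T X : Type} [NormedAddCommGroup T] [NormedSpace ℝ T] [NormedAddCommGroup X] [NormedSpace ℝ X]
    (D : T → M → X) : Prop :=
  ∀ c : M, ContDiffOn ℝ ∞ (fun z : T × Euc m => D z.1 ((xt m c).symm z.2))
    {z | z.2 ∈ (xt m c).target}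

theorem SmoothFam.fderiv_eq (hD : SmoothFam m D) {c : M} {z : T × Euc m}
    (hz : z.2 ∈ (xt m c).target) :
    fderiv ℝ (fun t => D t ((xt m c).symm z.2)) z.1 =
      (fderiv ℝ (fun z : T × Euc m => D z.1 ((xt m c).symm z.2)) z).comp
        (ContinuousLinearMap.inl ℝ T (Euc m)) :=
  fderiv_slice_left (f := fun z : T × Euc m => D z.1 ((xt m c).symm z.2))
    (diffAt_of_smooth (param_target_open T c) (hD c) hz)

theorem SmoothFam.fderiv (hD : SmoothFam m D) :
    SmoothFam m fun t p => fderiv ℝ (fun t => D t p) t := fun c =>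
  ((smooth_fderiv (param_target_open T c) (hD c)).clm_comp contDiffOn_const).congr
    fun _ hz => hD.fderiv_eq hz

theorem SmoothFam.differentiableAt (hD : SmoothFam m D) (t : T) (p : M) :
    DifferentiableAt ℝ (fun t => D t p) t := by
  have hp := mem_xt (n := m) p
  have h1 := diffAt_of_smooth (param_target_open T p) (hD p) (z := (t, xt m p p))
    ((xt m p).map_source hp)
  have h2 := (HasFDerivAt.comp (f := fun s : T => (s, xt m p p)) t h1.hasFDerivAt
    (hasFDerivAt_prodMk_left t (xt m p p))).differentiableAt
  simpa only [Function.comp_def, (xt m p).left_inv hp] using h2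

theorem SmoothFam.continuous (hD : SmoothFam m D) : Continuous fun z : T × M => D z.1 z.2 := by
  rw [continuous_iff_continuousAt]
  rintro ⟨t, p⟩
  have hp := mem_xt (n := m) p
  have h1 : ContinuousAt (fun z : T × Euc m => D z.1 ((xt m p).symm z.2)) (t, xt m p p) :=
    (hD p).continuousOn.continuousAt ((param_target_open T p).mem_nhds ((xt m p).map_source hp))
  have h2 : ContinuousAt (fun z : T × M => (z.1, xt m p z.2)) (t, p) :=
    continuousAt_fst.prodMk
      (ContinuousAt.comp (f := Prod.snd) (x := (t, p)) (continuousAt_extChartAt p) continuousAt_snd)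
  refine (ContinuousAt.comp (f := fun z : T × M => (z.1, xt m p z.2)) h1 h2).congr ?_
  filter_upwards [((xt_source_open (n := m) p).preimage continuous_snd).mem_nhds
    (show (t, p) ∈ Prod.snd ⁻¹' _ from hp)] with z hz
  simp only [Function.comp, (xt m p).left_inv hz]

variable [T2Space M] [CompactSpace M] [MeasurableSpace M] [BorelSpace M] (g : Metric m M)

theorem finite_vol : IsFiniteMeasure (vol g) :=
  ((integrable_const_iff (μ := vol g) (c := (1 : ℝ))).mp
    (integrable_vol g continuous_const)).resolve_left one_ne_zero

theorem integrable_vol_vec [FiniteDimensional ℝ X] {f : M → X} (hf : Continuous f) :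
    Integrable f (vol g) := by
  have := finite_vol g
  have := FiniteDimensional.proper_real X
  exact hf.integrable_of_hasCompactSupport (HasCompactSupport.of_compactSpace f)

/-- The derivative is continuous, hence bounded on the compact product of a closed ball of
parameters with `M`; a constant bound is integrable as the volume is finite. -/
theorem SmoothFam.hasFDerivAt_integral [FiniteDimensional ℝ T] [FiniteDimensional ℝ X]
    (hD : SmoothFam m D) (t : T) :
    HasFDerivAt (fun t => ∫ p, D t p ∂(vol g))
      (∫ p, _root_.fderiv ℝ (fun t => D t p) t ∂(vol g)) t := by
  have := finite_vol g
  have := FiniteDimensional.proper_real T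
  have hi : ∀ t, Integrable (D t) (vol g) := fun t =>
    integrable_vol_vec g (hD.continuous.comp (Continuous.prodMk_right t))
  have hi' : Integrable (fun p => _root_.fderiv ℝ (fun t => D t p) t) (vol g) :=
    integrable_vol_vec g (hD.fderiv.continuous.comp (Continuous.prodMk_right t))
  obtain ⟨C, hC⟩ := ((isCompact_closedBall t 1).prod (isCompact_univ (X := M))).exists_bound_of_continuousOn
    hD.fderiv.continuous.continuousOn
  exact hasFDerivAt_integral_of_dominated_of_fderiv_le (bound := fun _ => C)
    (Metric.closedBall_mem_nhds t one_pos) (Filter.Eventually.of_forall fun t => (hi t).1) (hi t)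
    hi'.1 (Filter.Eventually.of_forall fun p s hs => hC (s, p) ⟨hs, trivial⟩) (integrable_const C)
    (Filter.Eventually.of_forall fun p s _ => (hD.differentiableAt s p).hasFDerivAt)

/-- Induction on `k`. Differentiation replaces `X` by `T →L[ℝ] X`, so `X` is quantified inside the
induction, with all spaces in one universe. -/
theorem SmoothFam.contDiff_integral [FiniteDimensional ℝ T] (k : ℕ) :
    ∀ {X : Type} [NormedAddCommGroup X] [NormedSpace ℝ X] [FiniteDimensional ℝ X] {D : T → M → X},
      SmoothFam m D → ContDiff ℝ k fun t => ∫ p, D t p ∂(vol g) := by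
  induction k with
  | zero =>
    intro X _ _ _ D hD
    exact contDiff_zero.mpr (continuous_iff_continuousAt.mpr fun t =>
      (hD.hasFDerivAt_integral g t).continuousAt)
  | succ k ih =>
    intro X _ _ _ D hD
    exact contDiff_succ_iff_hasFDerivAt.mpr ⟨_, ih hD.fderiv, hD.hasFDerivAt_integral g⟩

theorem SmoothFam.fderiv_integral_apply [FiniteDimensional ℝ T] [FiniteDimensional ℝ X]
    (hD : SmoothFam m D) (t a : T) :
    _root_.fderiv ℝ (fun t => ∫ p, D t p ∂(vol g)) t a =
      ∫ p, _root_.fderiv ℝ (fun t => D t p) t a ∂(vol g) := by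
  have hi : Integrable (fun p => _root_.fderiv ℝ (fun t => D t p) t) (vol g) :=
    integrable_vol_vec g (hD.fderiv.continuous.comp (Continuous.prodMk_right t))
  rw [(hD.hasFDerivAt_integral g t).fderiv, ContinuousLinearMap.integral_apply hi]

variable {N : Type*} [TopologicalSpace N] [ChartedSpace (Euc n) N] [IsManifold (𝓡 n) ∞ N]
  {Φ : T → M → N} (h : Metric n N)

omit [T2Space M] [CompactSpace M] [MeasurableSpace M] [BorelSpace M] in
-- Smoothness is local, and near a given point the target chart may be taken at the value of the
-- family there.
theorem smoothFam_of_fdom (hΦ : IsFamily m n Φ) {F : M → N → T × Euc m → X}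
    (hF : ∀ c d, ContDiffOn ℝ ∞ (F c d) (fdom m n c d Φ))
    (hD : ∀ c d, ∀ z ∈ fdom m n c d Φ, D z.1 ((xt m c).symm z.2) = F c d z) : SmoothFam m D :=
  fun c z hz => (((hF c (Φ z.1 ((xt m c).symm z.2))).congr (hD c _)).contDiffAt
    ((fdom_open hΦ).mem_nhds ⟨hz, mem_xt _⟩)).contDiffWithinAt

omit [T2Space M] [CompactSpace M] [MeasurableSpace M] [BorelSpace M] in
theorem density_smoothFam (hΦ : IsFamily m n Φ) : SmoothFam m fun t => density g h (Φ t) :=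
  smoothFam_of_fdom hΦ (fun c d => (fsetup g h hΦ c d).dens_smooth)
    fun _ _ _ hz => density_family g h hΦ hz

omit [T2Space M] [CompactSpace M] [MeasurableSpace M] [BorelSpace M] in
theorem linG_smoothFam (hΦ : IsFamily m n Φ) (b : T) :
    SmoothFam m fun t => linG g h (Φ t) (vel n Φ t b) :=
  smoothFam_of_fdom hΦ (fun c d => (fsetup g h hΦ c d).lin_smooth
      (smooth_fderiv_apply (fdom_open hΦ) (floc_smooth hΦ) (b, 0)))
    fun _ _ _ hz => linG_family g h hΦ b hz

variable [FiniteDimensional ℝ T]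

theorem energy_contDiff (hΦ : IsFamily m n Φ) (k : ℕ) :
    ContDiff ℝ k fun t => energy2c g h (Φ t) :=
  contDiff_const.mul ((density_smoothFam g h hΦ).contDiff_integral g k)

/-- The first variation of the energy. -/
theorem fderiv_energy (hΦ : IsFamily m n Φ) (t a : T) :
    fderiv ℝ (fun t => energy2c g h (Φ t)) t a =
      ∫ p, linG g h (Φ t) (vel n Φ t a) p ∂(vol g) := by
  have hD := density_smoothFam g h hΦ
  change fderiv ℝ (fun t => (1 / 2 : ℝ) * ∫ p, density g h (Φ t) p ∂(vol g)) t a = _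
  rw [fderiv_const_mul (hD.hasFDerivAt_integral g t).differentiableAt, smul_apply,
    hD.fderiv_integral_apply g t a]
  simp only [first_variation g h hΦ, integral_const_mul, smul_eq_mul]
  ring

/-- The second variation of the energy. -/
theorem fderiv_fderiv_energy (hΦ : IsFamily m n Φ) (t a b : T) :
    fderiv ℝ (fun t => fderiv ℝ (fun t => energy2c g h (Φ t)) t b) t a =
      ∫ p, secG g h (Φ t) (vel n Φ t a) (vel n Φ t b) p ∂(vol g)
        + ∫ p, linG g h (Φ t) (acc h Φ t a b) p ∂(vol g) := by
  simp only [fderiv_energy g h hΦ]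
  rw [(linG_smoothFam g h hΦ b).fderiv_integral_apply g t a]
  simp only [second_variation g h hΦ]
  exact integral_add
    (integrable_vol g (secG_continuous g h (hΦ.slice t) (vel_smooth hΦ t a) (vel_smooth hΦ t b)))
    (integrable_vol g (linG_continuous g h (hΦ.slice t) (acc_smooth h hΦ t a b)))

end Parameters

end CBiharmonic

end

/-! ### Vanishing of the first variation at a critical map. -/

noncomputable section

set_option linter.unusedSectionVars false
set_option synthInstance.maxHeartbeats 200000

namespace CBiharmonic


/-! ### Critical points -/

section Critical

variable {m n : ℕ}
  {M : Type*} [TopologicalSpace M] [ChartedSpace (Euc m) M] [IsManifold (𝓡 m) ∞ M]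
  {N : Type*} [TopologicalSpace N] [ChartedSpace (Euc n) N] [IsManifold (𝓡 n) ∞ N]
  {φ : M → N} {c : M} {d : N} (g : Metric m M) (h : Metric n N)
  {X : ∀ q : M, TangentSpace (𝓡 n) (φ q)} {χ : M → ℝ}

theorem section_eq {V W : ∀ q : M, TangentSpace (𝓡 n) (φ q)}
    (hVW : ∀ p, ∃ d, φ p ∈ (xt n d).source ∧ tc d (φ p) (V p) = tc d (φ p) (W p)) : V = W := by
  funext p
  obtain ⟨d, hd, he⟩ := hVW p
  exact tc_inj hd he

/-- Sections along `ψ` and `φ` have different types although the maps are equal, so they are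
compared through components in a chart. -/
theorem linG_congr {ψ : M → N} (e : ψ = φ) {V : ∀ q : M, TangentSpace (𝓡 n) (ψ q)}
    (hVX : ∀ p, ∃ d, φ p ∈ (xt n d).source ∧ tc d (ψ p) (V p) = tc d (φ p) (X p)) (p : M) :
    linG g h ψ V p = linG g h φ X p := by
  subst e
  rw [section_eq hVX]

theorem tc_section_contMDiffAt (hX : IsSmoothSection m φ X) (hφ : Continuous φ) {p : M}
    (hd : φ p ∈ (xt n d).source) :
    ContMDiffAt (𝓡 m) 𝓘(ℝ, Euc n) ∞ (fun q => tc d (φ q) (X q)) p := by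
  have hp := mem_xt (n := m) p
  have h1 : ContDiffAt ℝ ∞ (sloc m p d φ X) (xt m p p) :=
    (sloc_smooth hX).contDiffAt ((dom_open hφ).mem_nhds (mem_dom hp hd))
  have h2 := h1.contMDiffAt.comp p (contMDiffAt_extChartAt (I := 𝓡 m) (n := ∞) (x := p))
  refine h2.congr_of_eventuallyEq ?_
  filter_upwards [(xt_source_open (n := m) p).mem_nhds hp] with q hq
  exact (sloc_xt hq X).symm

/-- The variation of a map in a chart of the target. -/
def bump (φ : M → N) (d : N) (w : M → Euc n) (σ : ℝ → ℝ) (s : ℝ) (p : M) : N :=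
  open Classical in
  if φ p ∈ (xt n d).source then (xt n d).symm (xt n d (φ p) + σ s • w p) else φ p

/-- Near `K` the family is a composition of smooth maps in the chart at `d`; on the open complement
of `K` the field vanishes and the family is constantly `φ`. The two open regions cover. -/
theorem bump_isFamily (hφ : ContMDiff (𝓡 m) (𝓡 n) ∞ φ) {w : M → Euc n} {σ : ℝ → ℝ}
    (hσ : ContDiff ℝ ∞ σ) (hw : ∀ p, φ p ∈ (xt n d).source → ContMDiffAt (𝓡 m) 𝓘(ℝ, Euc n) ∞ w p)
    {K : Set M} (hK : IsClosed K) (hKd : K ⊆ φ ⁻¹' (xt n d).source) (hwK : ∀ p ∉ K, w p = 0)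
    (ht : ∀ s p, φ p ∈ (xt n d).source → xt n d (φ p) + σ s • w p ∈ (xt n d).target) :
    IsFamily m n (bump φ d w σ) := by
  rintro ⟨s, p⟩
  by_cases hp : p ∈ K
  · have hd : φ p ∈ (xt n d).source := hKd hp
    have h1 : ContMDiffAt (𝓘(ℝ, ℝ).prod (𝓡 m)) 𝓘(ℝ, Euc n) ∞
        (fun z : ℝ × M => xt n d (φ z.2) + σ z.1 • w z.2) (s, p) := by
      have a1 : ContMDiffAt (𝓘(ℝ, ℝ).prod (𝓡 m)) (𝓡 n) ∞ (fun z : ℝ × M => φ z.2) (s, p) :=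
        (hφ.comp contMDiff_snd).contMDiffAt
      have a2 : ContMDiffAt (𝓘(ℝ, ℝ).prod (𝓡 m)) 𝓘(ℝ, Euc n) ∞
          (fun z : ℝ × M => xt n d (φ z.2)) (s, p) :=
        ContMDiffAt.comp (s, p) (contMDiffAt_extChartAt' (I := 𝓡 n) (n := ∞)
          (mem_chart_of_xt hd)) a1
      have a3 : ContMDiffAt (𝓘(ℝ, ℝ).prod (𝓡 m)) 𝓘(ℝ, ℝ) ∞ (fun z : ℝ × M => σ z.1) (s, p) :=
        (hσ.contMDiff.comp contMDiff_fst).contMDiffAt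
      have a4 : ContMDiffAt (𝓘(ℝ, ℝ).prod (𝓡 m)) 𝓘(ℝ, Euc n) ∞ (fun z : ℝ × M => w z.2) (s, p) :=
        ContMDiffAt.comp (s, p) (hw p hd) contMDiffAt_snd
      exact a2.add (a3.smul a4)
    have h2 : ContMDiffAt 𝓘(ℝ, Euc n) (𝓡 n) ∞ (xt n d).symm (xt n d (φ p) + σ s • w p) :=
      (contMDiffOn_extChartAt_symm d).contMDiffAt ((xt_target_open d).mem_nhds (ht s p hd))
    refine (ContMDiffAt.comp (s, p) h2 h1).congr_of_eventuallyEq ?_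
    filter_upwards [((xt_source_open d).preimage (hφ.continuous.comp continuous_snd)).mem_nhds
      (show (s, p) ∈ (fun z : ℝ × M => φ z.2) ⁻¹' _ from hd)] with z hz
    exact if_pos hz
  · refine ((hφ.comp contMDiff_snd).contMDiffAt (x := (s, p))).congr_of_eventuallyEq ?_
    filter_upwards [(hK.isOpen_compl.preimage continuous_snd).mem_nhds
      (show (s, p) ∈ Prod.snd ⁻¹' Kᶜ from hp)] with z hz
    rw [bump, hwK z.2 hz, smul_zero, add_zero]
    split_ifs with hd
    · exact (xt n d).left_inv hd
    · rfl

theorem bump_zero {w : M → Euc n} {σ : ℝ → ℝ} (hσ : σ 0 = 0) : bump φ d w σ 0 = φ := by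
  funext p
  rw [bump, hσ, zero_smul, add_zero]
  split_ifs with hd
  · exact (xt n d).left_inv hd
  · rfl

variable [CompactSpace M]

/-- Small multiples of a field with support in a chart keep the map in this chart. -/
theorem exists_small (hφ : Continuous φ) {w : M → Euc n} {K : Set M} (hK : IsClosed K)
    (hKd : K ⊆ φ ⁻¹' (xt n d).source) (hwK : ∀ p ∉ K, w p = 0) (hw : ContinuousOn w K) :
    ∃ ε > 0, ∀ r : ℝ, |r| ≤ ε → ∀ p, φ p ∈ (xt n d).source →
      xt n d (φ p) + r • w p ∈ (xt n d).target := by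
  have hcont : ContinuousOn (fun p => xt n d (φ p)) K :=
    (continuousOn_extChartAt d).comp hφ.continuousOn hKd
  obtain ⟨δ, hδ, hsub⟩ := (hK.isCompact.image_of_continuousOn hcont).exists_cthickening_subset_open
    (xt_target_open d) (Set.image_subset_iff.mpr fun p hp => (xt n d).map_source (hKd hp))
  obtain ⟨C, hC⟩ := hK.isCompact.exists_bound_of_continuousOn hw
  refine ⟨δ / (|C| + 1), by positivity, fun r hr p hd => ?_⟩
  by_cases hp : p ∈ K
  · refine hsub (Metric.mem_cthickening_of_dist_le _ _ _ _ (Set.mem_image_of_mem _ hp) ?_)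
    rw [dist_eq_norm, add_sub_cancel_left, norm_smul, Real.norm_eq_abs]
    have h1 : ‖w p‖ ≤ |C| + 1 := (hC p hp).trans ((le_abs_self C).trans (by linarith))
    calc |r| * ‖w p‖ ≤ δ / (|C| + 1) * (|C| + 1) := by gcongr
      _ = δ := by field_simp
  · rw [hwK p hp, smul_zero, add_zero]
    exact (xt n d).map_source hd

variable [T2Space M] [MeasurableSpace M] [BorelSpace M]

/-- A field supported over one chart of `N` is the velocity of the variation which moves `φ` along
straight lines of that chart, and criticality applies to this variation. -/
theorem integral_linG_cutoff (hφ : IsCBiharmonic g h φ) (hχ : ContMDiff (𝓡 m) 𝓘(ℝ, ℝ) ∞ χ)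
    (hs : tsupport χ ⊆ φ ⁻¹' (xt n d).source) (hX : IsSmoothSection m φ X) :
    ∫ p, linG g h φ (fun q => χ q • X q) p ∂(vol g) = 0 := by
  have hφs := hφ.smooth
  set w : M → Euc n := fun q => χ q • tc d (φ q) (X q) with hw
  have hws : ∀ p, φ p ∈ (xt n d).source → ContMDiffAt (𝓡 m) 𝓘(ℝ, Euc n) ∞ w p := fun p hp =>
    (hχ.contMDiffAt).smul (tc_section_contMDiffAt hX hφs.continuous hp)
  have hw0 : ∀ p ∉ tsupport χ, w p = 0 := fun p hp => by
    simp only [hw, image_eq_zero_of_notMem_tsupport hp, zero_smul]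
  obtain ⟨ε, hε, ht⟩ := exists_small hφs.continuous (isClosed_tsupport χ) hs hw0
    fun p hp => (hws p (hs hp)).continuousAt.continuousWithinAt
  -- A variation must be defined for every real `s`. This reparametrisation stays within `[-ε, ε]`,
  -- so the map never leaves the chart, and has derivative `1` at `0`.
  set σ : ℝ → ℝ := fun s => ε * Real.sin (s / ε) with hσdef
  have hσ : ContDiff ℝ ∞ σ := contDiff_const.mul (Real.contDiff_sin.comp (contDiff_id.div_const ε))
  have hσ0 : σ 0 = 0 := by simp [hσdef]
  have hσd : HasDerivAt σ 1 0 := by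
    have h1 := ((hasDerivAt_id (0 : ℝ)).div_const ε).sin.const_mul ε
    have e1 : ε * (Real.cos (id (0 : ℝ) / ε) * (1 / ε)) = 1 := by
      rw [id, zero_div, Real.cos_zero, one_mul, mul_one_div_cancel hε.ne']
    rw [e1] at h1
    exact h1
  have hσb : ∀ s, |σ s| ≤ ε := fun s => by
    rw [hσdef, abs_mul, abs_of_pos hε]
    exact mul_le_of_le_one_right hε.le (Real.abs_sin_le_one _)
  have hfam : IsFamily m n (bump φ d w σ) :=
    bump_isFamily hφs hσ hws (isClosed_tsupport χ) hs hw0 fun s => ht _ (hσb s)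
  have h0 : bump φ d w σ 0 = φ := bump_zero hσ0
  have hv : ∀ p, ∃ d', φ p ∈ (xt n d').source ∧
      tc d' (bump φ d w σ 0 p) (vel n (bump φ d w σ) 0 1 p) = tc d' (φ p) (χ p • X p) := by
    intro p
    by_cases hp : φ p ∈ (xt n d).source
    · refine ⟨d, hp, ?_⟩
      rw [tc_vel hfam (by rwa [h0]), map_smul]
      have e1 : (fun s => xt n d (bump φ d w σ s p)) = fun s => xt n d (φ p) + σ s • w p := by
        funext s
        rw [bump, if_pos hp, (xt n d).right_inv (ht _ (hσb s) p hp)]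
      rw [e1, fderiv_apply_one_eq_deriv, ((hσd.smul_const (w p)).const_add _).deriv, one_smul]
    -- Away from the chart at `d` the variation is constant in `s` and the cut-off vanishes, so both
    -- fields are zero.
    · refine ⟨φ p, mem_xt _, ?_⟩
      rw [tc_vel hfam (by rw [h0]; exact mem_xt _), map_smul,
        image_eq_zero_of_notMem_tsupport fun hpk => hp (hs hpk), zero_smul]
      have e1 : (fun s => xt n (φ p) (bump φ d w σ s p)) = fun _ => xt n (φ p) (φ p) := by
        funext s
        rw [bump, if_neg hp]
      rw [e1]
      simp
  have h1 := fderiv_energy g h hfam 0 1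
  rw [fderiv_apply_one_eq_deriv,
    (hφ.critical (fun z => bump φ d w σ z.1 z.2) hfam fun p => congrFun h0 p).deriv] at h1
  rw [h1]
  exact integral_congr_ae (Filter.Eventually.of_forall fun p => (linG_congr g h h0 hv p).symm)

/-- The first variation vanishes at critical points. -/
theorem integral_linG_eq_zero (hφ : IsCBiharmonic g h φ) (hX : IsSmoothSection m φ X) :
    ∫ p, linG g h φ X p ∂(vol g) = 0 := by
  have hφs := hφ.smooth
  -- The partition is subordinate to preimages of charts of `N`, because the variations are
  -- constructed in the target.
  obtain ⟨ρ, hρ⟩ := SmoothPartitionOfUnity.exists_isSubordinate (𝓡 m) (isClosed_univ (X := M))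
    (fun d : N => φ ⁻¹' (xt n d).source) (fun d => (xt_source_open d).preimage hφs.continuous)
    fun p _ => Set.mem_iUnion.mpr ⟨φ p, mem_xt _⟩
  have hfin : {d : N | (Function.support (ρ d)).Nonempty}.Finite :=
    ρ.locallyFinite.finite_nonempty_of_compact
  have hsum : ∀ p, ∑ d ∈ hfin.toFinset, ρ d p = 1 := fun p => by
    rw [← ρ.sum_eq_one (Set.mem_univ p)]
    refine (finsum_eq_sum_of_support_subset _ fun d hd => ?_).symm
    exact hfin.mem_toFinset.mpr ⟨p, hd⟩
  have hXs : X = fun p => ∑ d ∈ hfin.toFinset, ρ d p • X p := by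
    funext p
    rw [← Finset.sum_smul, hsum p, one_smul]
  have hs : ∀ d : N, IsSmoothSection m φ fun p => ρ d p • X p := fun d =>
    section_smul hφs (ρ d).contMDiff hX
  rw [hXs]
  simp only [linG_sum g h hφs _ hs]
  rw [integral_finsetSum _ fun d _ => integrable_vol g (linG_continuous g h hφs (hs d))]
  exact Finset.sum_eq_zero fun d _ => integral_linG_cutoff g h hφ (ρ d).contMDiff (hρ d) hX

end Critical

end CBiharmonic

end

/-! ### The Hessian along a two-parameter variation of a critical map. -/

noncomputable section

set_option linter.unusedSectionVars false
set_option synthInstance.maxHeartbeats 200000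

namespace CBiharmonic


/-! ### The Hessian -/

section Hessian

variable {m n : ℕ}
  {M : Type*} [TopologicalSpace M] [ChartedSpace (Euc m) M] [IsManifold (𝓡 m) ∞ M]
  {N : Type*} [TopologicalSpace N] [ChartedSpace (Euc n) N] [IsManifold (𝓡 n) ∞ N]
  (g : Metric m M) (h : Metric n N)

theorem IsFamily.comp {S T : Type*} [NormedAddCommGroup S] [NormedSpace ℝ S] [NormedAddCommGroup T]
    [NormedSpace ℝ T] {Φ : T → M → N} (hΦ : IsFamily m n Φ) {e : S → T} (he : ContDiff ℝ ∞ e) :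
    IsFamily m n fun s => Φ (e s) :=
  ContMDiff.comp (I' := 𝓘(ℝ, T).prod (𝓡 m)) (f := fun z : S × M => (e z.1, z.2)) hΦ
    ((he.contMDiff.comp contMDiff_fst).prodMk contMDiff_snd)

theorem vel_comp {S T : Type*} [NormedAddCommGroup S] [NormedSpace ℝ S] [NormedAddCommGroup T]
    [NormedSpace ℝ T] {Φ : T → M → N} (hΦ : IsFamily m n Φ) {e : S → T} (he : ContDiff ℝ ∞ e)
    (s a : S) (p : M) :
    vel n (fun s => Φ (e s)) s a p = vel n Φ (e s) (fderiv ℝ e s a) p := by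
  have hd := mem_xt (n := n) (Φ (e s) p)
  refine tc_inj hd ?_
  rw [tc_vel hΦ hd, tc_vel (hΦ.comp he) hd]
  have ho : IsOpen {t | Φ t p ∈ (xt n (Φ (e s) p)).source} :=
    (xt_source_open _).preimage (hΦ.curve p).continuous
  have h1 := fderiv_comp s (diffAt_of_smooth ho (curve_smooth hΦ (Φ (e s) p) p) hd)
    (he.differentiable (by simp) s)
  exact congrArg (fun L => L a) h1

theorem deriv_deriv_eq {E : ℝ × ℝ → ℝ} (hE : ContDiff ℝ 2 E) :
    deriv (fun s => deriv (fun t => E (s, t)) 0) 0 =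
      fderiv ℝ (fun z => fderiv ℝ E z (0, 1)) (0, 0) (1, 0) := by
  have h1 : ∀ s, deriv (fun t => E (s, t)) 0 = fderiv ℝ E (s, 0) (0, 1) := fun s => by
    rw [← fderiv_apply_one_eq_deriv, fderiv_slice_right (hE.differentiable (by simp) _)]
  have h2 : Differentiable ℝ fun z => fderiv ℝ E z ((0 : ℝ), (1 : ℝ)) :=
    ((hE.fderiv_right (m := 1) (by norm_num)).clm_apply contDiff_const).differentiable (by simp)
  simp only [h1]
  rw [← fderiv_apply_one_eq_deriv,
    fderiv_slice_left_apply (f := fun z => fderiv ℝ E z ((0 : ℝ), (1 : ℝ))) (h2 _)]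

variable {φ : M → N} {Φ : ℝ × ℝ × M → N} {V W : ∀ p : M, TangentSpace (𝓡 n) (φ p)}

theorem IsVariation.isFamily (hΦ : IsVariation m φ Φ V W) :
    IsFamily m n fun (z : ℝ × ℝ) p => Φ (z.1, z.2, p) :=
  ContMDiff.comp (I' := 𝓘(ℝ, ℝ).prod (𝓘(ℝ, ℝ).prod (𝓡 m)))
    (f := fun z : (ℝ × ℝ) × M => (z.1.1, z.1.2, z.2)) hΦ.smooth
    ((contDiff_fst.contMDiff.comp contMDiff_fst).prodMk
      ((contDiff_snd.contMDiff.comp contMDiff_fst).prodMk contMDiff_snd))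

variable [T2Space M] [CompactSpace M] [MeasurableSpace M] [BorelSpace M]

/-- The mixed derivative is the integral of `secG` plus the first variation in the direction of the
mixed acceleration. The latter vanishes at a critical map, so only `V` and `W` matter. They are
smooth sections because they are velocities of a smooth family. -/
theorem IsVariation.hessian (hφ : IsCBiharmonic g h φ) (hΦ : IsVariation m φ Φ V W) :
    ContDiff ℝ 2 (fun z : ℝ × ℝ => energy2c g h (fun p => Φ (z.1, z.2, p))) ∧
    IsSmoothSection m φ V ∧ IsSmoothSection m φ W ∧
    deriv (fun s : ℝ => deriv (fun t : ℝ => energy2c g h (fun p => Φ (s, t, p))) 0) 0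
      = ∫ p, hessIntegrand g h φ V W p ∂(vol g) := by
  have hf := hΦ.isFamily
  set Ψ : ℝ × ℝ → M → N := fun z p => Φ (z.1, z.2, p) with hΨ
  have hE : ContDiff ℝ 2 (fun z : ℝ × ℝ => energy2c g h (Ψ z)) := energy_contDiff g h hf 2
  -- Substitution makes `V` and `W` sections along the central map of the family, so that they can
  -- be compared with velocities.
  obtain rfl : (fun p => Φ (0, 0, p)) = φ := funext hΦ.base
  have hV : vel n Ψ (0, 0) (1, 0) = V := by
    funext p
    have h1 := vel_comp hf (e := fun s : ℝ => (s, (0 : ℝ))) (by fun_prop) 0 1 p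
    rw [(hasFDerivAt_prodMk_left (𝕜 := ℝ) (0 : ℝ) (0 : ℝ)).fderiv] at h1
    exact h1.symm.trans (TotalSpace.mk_inj.mp (hΦ.fieldV p))
  have hW : vel n Ψ (0, 0) (0, 1) = W := by
    funext p
    have h1 := vel_comp hf (e := fun t : ℝ => ((0 : ℝ), t)) (by fun_prop) 0 1 p
    rw [(hasFDerivAt_prodMk_right (𝕜 := ℝ) (0 : ℝ) (0 : ℝ)).fderiv] at h1
    exact h1.symm.trans (TotalSpace.mk_inj.mp (hΦ.fieldW p))
  have hVs : IsSmoothSection m (Ψ (0, 0)) V := hV ▸ vel_smooth hf (0, 0) (1, 0)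
  have hWs : IsSmoothSection m (Ψ (0, 0)) W := hW ▸ vel_smooth hf (0, 0) (0, 1)
  refine ⟨hE, hVs, hWs, ?_⟩
  have h1 := fderiv_fderiv_energy g h hf (0, 0) (1, 0) (0, 1)
  have h2 := integral_linG_eq_zero g h hφ (acc_smooth h hf (0, 0) (1, 0) (0, 1))
  have h3 := integral_secG g h hφ.smooth hVs hWs
  rw [hV, hW] at h1
  exact (deriv_deriv_eq hE).trans (h1.trans (by
    rw [← h3]
    exact (congrArg (_ + ·) h2).trans (add_zero _)))

end Hessian

end CBiharmonic

end

/-! ### The theorem. -/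

open CBiharmonic in
theorem mainTheorem4 {m n : ℕ}
    {M : Type*} [TopologicalSpace M] [ChartedSpace (Euc m) M] [IsManifold (𝓡 m) ∞ M]
    [T2Space M] [CompactSpace M] [ConnectedSpace M] [MeasurableSpace M] [BorelSpace M]
    {N : Type*} [TopologicalSpace N] [ChartedSpace (Euc n) N] [IsManifold (𝓡 n) ∞ N]
    [T2Space N] [SecondCountableTopology N] [ConnectedSpace N]
    (g : Metric m M) (h : Metric n N) (φ : M → N) (hφ : IsCBiharmonic g h φ) :
    -- the Hessian, for every two-parameter variation
    (∀ (Φ : ℝ × ℝ × M → N) (V W : ∀ p : M, TangentSpace (𝓡 n) (φ p)), IsVariation m φ Φ V W →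
      ContDiff ℝ 2 (fun z : ℝ × ℝ => energy2c g h (fun p => Φ (z.1, z.2, p))) ∧
      deriv (fun s : ℝ => deriv (fun t : ℝ => energy2c g h (fun p => Φ (s, t, p))) 0) 0
        = ∫ p, h.inner (φ p) (jacobi2c g h φ W p) (V p) ∂(vol g) ∧
      deriv (fun s : ℝ => deriv (fun t : ℝ => energy2c g h (fun p => Φ (s, t, p))) 0) 0
        = ∫ p, hessIntegrand g h φ V W p ∂(vol g)) ∧
    -- the integral expressions, as symmetric forms on all smooth sections
    (∀ V W : ∀ p : M, TangentSpace (𝓡 n) (φ p), IsSmoothSection m φ V → IsSmoothSection m φ W →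
      Integrable (fun p => h.inner (φ p) (jacobi2c g h φ W p) (V p)) (vol g) ∧
      Integrable (hessIntegrand g h φ V W) (vol g) ∧
      ∫ p, h.inner (φ p) (jacobi2c g h φ W p) (V p) ∂(vol g)
        = ∫ p, hessIntegrand g h φ V W p ∂(vol g) ∧
      ∫ p, hessIntegrand g h φ V W p ∂(vol g) = ∫ p, hessIntegrand g h φ W V p ∂(vol g) ∧
      ∫ p, h.inner (φ p) (jacobi2c g h φ W p) (V p) ∂(vol g)
        = ∫ p, h.inner (φ p) (W p) (jacobi2c g h φ V p) ∂(vol g)) ∧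
    -- a linear differential operator of order four
    IsDiffOp m φ 4 (jacobi2c g h φ) ∧
    (0 < m → 0 < n → ¬ IsDiffOp m φ 3 (jacobi2c g h φ)) ∧
    -- elliptic
    IsElliptic m φ 4 (jacobi2c g h φ) ∧
    -- with leading term the square of the rough Laplacian
    IsDiffOp m φ 3 (fun W p =>
      jacobi2c g h φ W p - roughLaplacian g h φ (roughLaplacian g h φ W) p) := by
  have hφs := hφ.smooth
  refine ⟨fun Φ V W hΦ => ?_, fun V W hV hW => ⟨?_, ?_, ?_, ?_, ?_⟩, isDiffOp_jacobi2c g h hφs,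
    not_isDiffOp_jacobi2c g h hφs, isElliptic_jacobi2c g h hφs, isDiffOp_jacobi2c_sub g h hφs⟩
  · obtain ⟨hE, hV, hW, hH⟩ := hΦ.hessian g h hφ
    exact ⟨hE, hH.trans (integral_jacobi2c g h hφs hV hW).symm, hH⟩
  · exact integrable_vol g (inner_continuous h hφs (jacobi2c_smooth g h hφs hW) hV)
  · exact integrable_vol g (hessIntegrand_continuous g h hφs hV hW)
  · exact integral_jacobi2c g h hφs hV hW
  · exact integral_hessIntegrand_symm g h hφs hV hW
  · exact integral_jacobi2c_symm g h hφs hV hW
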